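/- **Setting.** Let $s\in\{0,1\}$, $K,L\ge 0$, integers $m_1,\dots,m_K\ge 1$ and $m_0$, with $m_0=0$ if $s=0$, and $m_0\ge 1$ or $m_0=-1$ if $s=1$; assume $n:=L-\sum_{j=0}^K m_j\ge 1$. Let $$\mathcal A_M=\Big\{\lambda(p)=\frac{\prod_{i=1}^L(p-a_i)}{p^{m_0}\prod_{j=1}^K(p-v_j)^{m_j}}\Big\},\qquad \sum_i a_i=\sum_j m_jv_j\ \text{ if } s=0,$$ where the $a_i\in\mathbb C$ are distinct, the $v_j\in\mathbb C$ are distinct, $a_i\ne v_j$, and $a_i,v_j\neq 0$ if $s=1$. The numbers $a_i,v_j$ are the coordinates on this complex manifold of dimension $N=K+L+s-1$, and a tangent vector is identified with the corresponding derivative of $\lambda$, so that $T_\lambda\subset\mathbb C(p)$. Write $\lambda_p=d\lambda/dp$, $v_0=0$, and let $\Gamma=\{\infty\}\cup\{v_k: 1-s\le k\le K\}$. For $\nu\in\Gamma$ put $\operatorname{tr}_\nu f=\epsilon\operatorname{res}_{p=\nu}(p^{-s}f)$ with $\epsilon=-1$ for $\nu=\infty$ and $\epsilon=1$ otherwise.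 For $f\in\mathbb C(p)$ let $[f]^\infty_{\ge0}$ be the sum of the terms $c_ip^i$ with $i\ge0$ of its expansion at $\infty$, and for finite $\nu$ let $[f]^\nu_{\ge 0}$ be $f$ minus its principal part at $\nu$. Put $\ell_\nu(f)=p^s[p^{-s}f]^\nu_{\ge0}-\frac12 f$ and $$\alpha\circ_\nu\beta=\ell_\nu(p^s\lambda_p\alpha)\,\beta+\alpha\,\ell_\nu(p^s\lambda_p\beta),\qquad \alpha,\beta\in\mathcal A=\mathbb C[p,p^{-1},(p-a_i)^{-1},(p-v_j)^{-1}].$$ A *Frobenius manifold* of weight $d$ is a complex manifold with a holomorphic nondegenerate symmetric metric $\eta$ and a holomorphic commutative associative unital multiplication $*$ of tangent vectors with $\eta(X,Y*Z)=\eta(X*Y,Z)$, such that, $\nabla$ being the Levi-Civita connection: $\eta$ is flat; $\nabla c$ is symmetric in its four arguments, where $c(X,Y,Z)=\eta(X*Y,Z)$; the unit field $e$ is flat, $\nabla e=0$; and there is a vector field $E$ with $\nabla\nabla E=0$, $\mathcal L_E*=*$ and $\mathcal L_E\eta=(2-d)\eta$. **Theorem.** Let $d=1+(s-1)\frac2n$.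 There are a metric $\eta$, a multiplication $*$ and vector fields $e,E$ on $\mathcal A_M$ with the following properties. 1. They are induced from every $\nu\in\Gamma$: at each $\lambda\in\mathcal A_M$, the pairing $\langle\alpha,X\rangle=\operatorname{tr}_\nu(X\alpha)$ identifies $T^*_\lambda\mathcal A_M$ with $\mathcal A/(T_\lambda)^\perp$; $(T_\lambda)^\perp$ is an ideal for $\circ_\nu$, and $\operatorname{tr}_\nu(\alpha\circ_\nu\beta)=0$ for $\alpha\in (T_\lambda)^\perp$, $\beta\in\mathcal A$; and under the isomorphism $X\mapsto\eta(X,\cdot)$ of $T_\lambda$ with $T_\lambda^*$, $*$ corresponds to $\circ_\nu$ and $\eta$ to $\eta^*(\alpha,\beta)=\operatorname{tr}_\nu(\alpha\circ_\nu\beta)$. 2. As functions of $p$, $E=\lambda-\frac1n p\lambda_p$, and the unit $e$ is $1-\lambda_p$ if $s=0$ and $n=1$; $1-\frac1{u_1}\lambda_p$ with $u_1=\lambda_p(0)$ if $s=1$ and $m_0=-1$; and $1$ otherwise. 3. Unless $s=1$ and $m_0=-1$, $(\mathcal A_M,\eta,*,e,E)$ is a Frobenius manifold of weight $d$. If $s=1$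 and $m_0=-1$, it satisfies all the axioms of a Frobenius manifold of weight $d$ except for the flatness of $e$, and if moreover $N\ge1$ then $e$ is not flat. 4. Let $m_k$ be the order of the pole of $\lambda$ at $v_k$. Near every point of $\mathcal A_M$ there are continuous branches of the logarithms of the coefficients of $(p-v_k)^{-m_k}$ in the expansions of $\lambda$ at $v_k$, and of the logarithms of $v_j-v_k$ ($j\ne k$; $1-s\le j,k\le K$). On any open set where such branches are chosen, use them to define $\lambda^{r/m_k}$ and $\log[(p-v_k)^{m_k}\lambda]$ near $v_k$ and $\log(p-v_k)$ near $v_j$; near $\infty$ let $\lambda^{1/n}=p+\dots$ and $\log[(p-v_k)^{-n}\lambda]\to0$ as $p\to\infty$. For $f=1$ and $f=\lambda$ let $\operatorname{tr}_{v_k}(f\log\lambda)+\frac{m_k}{n}\operatorname{tr}_\infty(f\log\lambda)$ denote the regularised value $$\operatorname{tr}_{v_k}\!\big(f\log[(p-v_k)^{m_k}\lambda]\big)+\tfrac{m_k}{n}\operatorname{tr}_\infty\!\big(f\log[(p-v_k)^{-n}\lambda]\big)+m_k\!\!\sum_{1-s\le j\le K,\ j\ne k}\!\!\operatorname{tr}_{v_j}\!\big(f\log(p-v_k)\big).$$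 Then the functions $$t^i_\infty=\tfrac{1}{1-i/n}\operatorname{tr}_\infty\lambda^{1-\frac in}\ (1\le i\le n-1),\qquad t^j_{v_k}=\tfrac1{1-j/m_k}\operatorname{tr}_{v_k}\lambda^{1-\frac j{m_k}}\ (0\le j<m_k),\qquad t^{m_k}_{v_k}=\operatorname{tr}_{v_k}\log\lambda+\tfrac{m_k}n\operatorname{tr}_\infty\log\lambda$$ ($1-s\le k\le K$, and no $t_{v_0}$ if $m_0=-1$) are flat local coordinates for $\eta$: their differentials form a basis of the cotangent space at every point and are $\nabla$-parallel. With $E^i_\nu=\langle dt^i_\nu,E\rangle$ and $$\mathcal H^{\infty,i}_{(1)}=\tfrac1{1-i/n}\tfrac1{2-i/n}\operatorname{tr}_\infty\lambda^{2-\frac in},\qquad \mathcal H^{v_k,j}_{(1)}=\tfrac1{1-j/m_k}\tfrac1{2-j/m_k}\operatorname{tr}_{v_k}\lambda^{2-\frac j{m_k}}\ (0\le j<m_k),$$ $$\mathcal H^{v_k,m_k}_{(1)}=\operatorname{tr}_{v_k}(\lambda\log\lambda-\lambda)+\tfrac{m_k}n\operatorname{tr}_\infty(\lambda\log\lambda-\lambda),$$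 the function $$\mathcal F=\frac1{3-d}\Big(\frac1n\sum_{i=1}^{n-1}E^i_\infty\mathcal H^{\infty,n-i}_{(1)}+\sum_{k=1-s}^K\frac1{m_k}\sum_{j=0}^{m_k}E^j_{v_k}\mathcal H^{v_k,m_k-j}_{(1)}\Big)$$ is a prepotential: $c\big(\tfrac{\partial}{\partial t^A},\tfrac{\partial}{\partial t^B},\tfrac{\partial}{\partial t^C}\big)=\dfrac{\partial^3\mathcal F}{\partial t^A\partial t^B\partial t^C}$ for any three $t^A,t^B,t^C$ of these flat coordinates. -/

import Mathlib

noncomputable section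

namespace MeroFrob

/-! ### Frobenius manifolds: holomorphic structures on an open set of a complex vector space -/

/-- Tensor fields on a vector space `V` (of interest on an open subset): a metric `η`, a
multiplication `mul` of tangent vectors, vector fields `e`, `E`, and the bilinear form
`Γ` of an affine connection `∇_X Y = D_X Y + Γ(X, Y)`. All laws are imposed below. -/
structure FrobeniusData (V : Type*) [NormedAddCommGroup V] [NormedSpace ℂ V] where
  η : V → V →L[ℂ] V →L[ℂ] ℂ
  mul : V → V →L[ℂ] V →L[ℂ] V
  e : V → V
  E : V → V
  Γ : V → V →L[ℂ] V →L[ℂ] V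

namespace FrobeniusData

variable {V : Type*} [NormedAddCommGroup V] [NormedSpace ℂ V] (D : FrobeniusData V)

/-- `c(X, Y, Z) = η(X * Y, Z)`. -/
def c (x X Y Z : V) : ℂ := D.η x (D.mul x X Y) Z

/-- `∇_X A` at the point `x`, for a vector field `A`. -/
def nablaVec (A : V → V) (x X : V) : V := fderiv ℂ A x X + D.Γ x X (A x)

/-- The endomorphism `Y ↦ ∇_Y A` of the tangent space at `x`. -/
def nablaEnd (A : V → V) (x : V) : V →L[ℂ] V := fderiv ℂ A x + (D.Γ x).flip (A x)

/-- The second covariant derivative `(∇∇A)(X, Y) = (∇_X (∇A))(Y)` of a vector field. -/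
def nablaNablaVec (A : V → V) (x X Y : V) : V :=
  fderiv ℂ (D.nablaEnd A) x X Y + D.Γ x X (D.nablaEnd A x Y) - D.nablaEnd A x (D.Γ x X Y)

/-- The four-tensor `∇c`, that is `(∇_{w 0} c)(w 1, w 2, w 3)`. -/
def nablaC (x : V) (w : Fin 4 → V) : ℂ :=
  fderiv ℂ (fun y => D.c y (w 1) (w 2) (w 3)) x (w 0)
    - D.c x (D.Γ x (w 0) (w 1)) (w 2) (w 3)
    - D.c x (w 1) (D.Γ x (w 0) (w 2)) (w 3)
    - D.c x (w 1) (w 2) (D.Γ x (w 0) (w 3))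

/-- The curvature `R(X, Y) Z` of the connection. -/
def curvature (x X Y Z : V) : V :=
  fderiv ℂ (fun y => D.Γ y Y Z) x X - fderiv ℂ (fun y => D.Γ y X Z) x Y
    + D.Γ x X (D.Γ x Y Z) - D.Γ x Y (D.Γ x X Z)

/-- The covariant derivative `(∇_X df)(Y)` of the differential of a function. -/
def hessian (f : V → ℂ) (x X Y : V) : ℂ :=
  fderiv ℂ (fun y => fderiv ℂ f y) x X Y - fderiv ℂ f x (D.Γ x X Y)

/-- The Lie derivative `(𝓛_E *)(X, Y)` of the multiplication. -/
def lieMul (x X Y : V) : V :=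
  fderiv ℂ (fun y => D.mul y X Y) x (D.E x) - fderiv ℂ D.E x (D.mul x X Y)
    + D.mul x (fderiv ℂ D.E x X) Y + D.mul x X (fderiv ℂ D.E x Y)

/-- The Lie derivative `(𝓛_E η)(X, Y)` of the metric. -/
def lieMetric (x X Y : V) : ℂ :=
  fderiv ℂ (fun y => D.η y X Y) x (D.E x)
    + D.η x (fderiv ℂ D.E x X) Y + D.η x X (fderiv ℂ D.E x Y)

/-- All the axioms of a Frobenius manifold of weight `d` on the open set `U`, except for the
flatness of the unit vector field. -/
structure IsFrobeniusUpToUnit (U : Set V) (d : ℂ) : Prop where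
  isOpen : IsOpen U
  smooth_η : ContDiffOn ℂ (⊤ : ℕ∞) D.η U
  smooth_mul : ContDiffOn ℂ (⊤ : ℕ∞) D.mul U
  smooth_e : ContDiffOn ℂ (⊤ : ℕ∞) D.e U
  smooth_E : ContDiffOn ℂ (⊤ : ℕ∞) D.E U
  smooth_Γ : ContDiffOn ℂ (⊤ : ℕ∞) D.Γ U
  -- the metric
  η_symm : ∀ x ∈ U, ∀ X Y, D.η x X Y = D.η x Y X
  η_nondegenerate : ∀ x ∈ U, ∀ X, (∀ Y, D.η x X Y = 0) → X = 0
  -- the Frobenius algebra on each tangent space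
  mul_comm : ∀ x ∈ U, ∀ X Y, D.mul x X Y = D.mul x Y X
  mul_assoc : ∀ x ∈ U, ∀ X Y Z, D.mul x (D.mul x X Y) Z = D.mul x X (D.mul x Y Z)
  unit_mul : ∀ x ∈ U, ∀ X, D.mul x (D.e x) X = X
  invariant : ∀ x ∈ U, ∀ X Y Z, D.η x X (D.mul x Y Z) = D.η x (D.mul x X Y) Z
  -- `∇` is the Levi-Civita connection of `η`
  torsion_free : ∀ x ∈ U, ∀ X Y, D.Γ x X Y = D.Γ x Y X
  metric_compatible : ∀ x ∈ U, ∀ X Y Z,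
    fderiv ℂ (fun y => D.η y Y Z) x X = D.η x (D.Γ x X Y) Z + D.η x Y (D.Γ x X Z)
  -- the metric is flat
  flat : ∀ x ∈ U, ∀ X Y Z, D.curvature x X Y Z = 0
  -- `∇c` is symmetric in all four arguments
  nablaC_symm : ∀ x ∈ U, ∀ (w : Fin 4 → V) (σ : Equiv.Perm (Fin 4)),
    D.nablaC x (w ∘ σ) = D.nablaC x w
  -- `E` is an Euler vector field
  euler_affine : ∀ x ∈ U, ∀ X Y, D.nablaNablaVec D.E x X Y = 0
  euler_mul : ∀ x ∈ U, ∀ X Y, D.lieMul x X Y = D.mul x X Y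
  euler_metric : ∀ x ∈ U, ∀ X Y, D.lieMetric x X Y = (2 - d) * D.η x X Y

/-- The unit vector field is flat on `U`. -/
def UnitFlat (U : Set V) : Prop := ∀ x ∈ U, ∀ X, D.nablaVec D.e x X = 0

/-- Frobenius manifold of weight `d` on the open set `U`. -/
structure IsFrobenius (U : Set V) (d : ℂ) : Prop extends D.IsFrobeniusUpToUnit U d where
  unit_flat : D.UnitFlat U

/-- The functions `t i` are flat local coordinates on `W`: their differentials are everywhere a
basis of the cotangent space, and are annihilated by `∇`. -/
structure IsFlatCoordinates {I : Type*} (W : Set V) (t : I → V → ℂ) : Prop where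
  smooth : ∀ i, ContDiffOn ℂ (⊤ : ℕ∞) (t i) W
  linearIndependent : ∀ x ∈ W, LinearIndependent ℂ fun i => fderiv ℂ (t i) x
  span : ∀ x ∈ W, Submodule.span ℂ (Set.range fun i => fderiv ℂ (t i) x) = ⊤
  flat : ∀ x ∈ W, ∀ i X Y, D.hessian (t i) x X Y = 0

/-- Derivative of the function `f` along the vector field `X`. -/
def along (X : V → V) (f : V → ℂ) (x : V) : ℂ := fderiv ℂ f x (X x)

open Classical in
/-- `F` is a prepotential on `W` with respect to the coordinates `t i`: with `∂ i` the coordinate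
vector fields, `c(∂ i, ∂ j, ∂ k) = ∂ i ∂ j ∂ k F`. -/
def IsPrepotential {I : Type*} (W : Set V) (t : I → V → ℂ) (F : V → ℂ) : Prop :=
  ContDiffOn ℂ (⊤ : ℕ∞) F W ∧
  ∃ b : I → V → V, (∀ i, ContDiffOn ℂ (⊤ : ℕ∞) (b i) W) ∧
    (∀ x ∈ W, ∀ i j, fderiv ℂ (t i) x (b j x) = if i = j then 1 else 0) ∧
    ∀ x ∈ W, ∀ i j k,
      D.c x (b i x) (b j x) (b k x) = along (b i) (along (b j) (along (b k) F)) x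

end FrobeniusData

/-! ### Rational functions and their Laurent expansions on the Riemann sphere -/

open scoped OnePoint

/-- The variable `p` as a Laurent series in the local parameter at `ν`, which is `p - ν` for
finite `ν` and `p⁻¹` for `ν = ∞`. -/
def locVar : OnePoint ℂ → LaurentSeries ℂ
  | ∞ => HahnSeries.single (-1) 1
  | (ν : ℂ) => HahnSeries.C ν + HahnSeries.single 1 1

/-- The Laurent expansion at `ν`, in the local parameter at `ν`. -/
def expand (ν : OnePoint ℂ) (f : RatFunc ℂ) : LaurentSeries ℂ :=
  RatFunc.eval (HahnSeries.C : ℂ →+* LaurentSeries ℂ) (locVar ν) f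

/-- The trace form `ε res_{p = ν} (p^{-s} F)`, with `ε = -1` at `ν = ∞` and `ε = 1` otherwise, of
a Laurent series `F` at `ν`. At `∞` it is the coefficient of `p⁻¹` in `p^{-s} F`, that is of the
first power of the local parameter. -/
def trSeries (s : ℕ) : OnePoint ℂ → LaurentSeries ℂ → ℂ
  | ∞, F => ((locVar ∞)⁻¹ ^ s * F).coeff 1
  | (ν : ℂ), F => ((locVar (ν : OnePoint ℂ))⁻¹ ^ s * F).coeff (-1)

/-- The trace form at `ν` of a rational function. -/
def tr (s : ℕ) (ν : OnePoint ℂ) (f : RatFunc ℂ) : ℂ := trSeries s ν (expand ν f)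

/-- The projection `[f]^ν_{≥ 0}`: at `∞` the sum of the terms `a_i p^i` with `i ≥ 0` of the
expansion; at a finite `ν` the difference of `f` and the sum `[f]^ν_{< 0}` of the terms
`a_i (p - ν)^i` with `i < 0`. -/
def nonnegPart : OnePoint ℂ → RatFunc ℂ → RatFunc ℂ
  | ∞, f => ∑ᶠ i : ℕ, RatFunc.C ((expand ∞ f).coeff (-(i : ℤ))) * RatFunc.X ^ i
  | (ν : ℂ), f => f - ∑ᶠ i : ℕ, RatFunc.C ((expand (ν : OnePoint ℂ) f).coeff (-((i : ℤ) + 1))) *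
      (RatFunc.X - RatFunc.C ν) ^ (-((i : ℤ) + 1))

/-- The derivative `f_p` of a rational function `f` of `p`. -/
def derivP (f : RatFunc ℂ) : RatFunc ℂ :=
  algebraMap (Polynomial ℂ) (RatFunc ℂ)
      (Polynomial.derivative f.num * f.denom - f.num * Polynomial.derivative f.denom) /
    algebraMap (Polynomial ℂ) (RatFunc ℂ) (f.denom ^ 2)

/-- `ℓ(f) = p^s [p^{-s} f]^ν_{≥ 0} - f / 2`. -/
def ell (s : ℕ) (ν : OnePoint ℂ) (f : RatFunc ℂ) : RatFunc ℂ :=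
  RatFunc.X ^ s * nonnegPart ν (RatFunc.X⁻¹ ^ s * f) - RatFunc.C (1 / 2) * f

/-- The multiplication `α ∘ β = ℓ(λ' α) β + α ℓ(λ' β)`, where `λ' = p^s λ_p`. -/
def circ (s : ℕ) (ν : OnePoint ℂ) (lam α β : RatFunc ℂ) : RatFunc ℂ :=
  ell s ν (RatFunc.X ^ s * derivP lam * α) * β + α * ell s ν (RatFunc.X ^ s * derivP lam * β)

/-! ### Logarithms and fractional powers of Laurent series -/

/-- `log (1 + u)` for a power series `u` without constant term. -/
def logOneAdd (u : PowerSeries ℂ) : PowerSeries ℂ :=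
  PowerSeries.mk fun d => ∑ k ∈ Finset.Icc 1 d, (-1) ^ (k + 1) / (k : ℂ) * PowerSeries.coeff d (u ^ k)

/-- `(1 + u) ^ r` for a power series `u` without constant term. -/
def powOneAdd (r : ℂ) (u : PowerSeries ℂ) : PowerSeries ℂ :=
  PowerSeries.mk fun d => ∑ k ∈ Finset.range (d + 1),
    (∏ i ∈ Finset.range k, (r - i)) / (Nat.factorial k : ℂ) * PowerSeries.coeff d (u ^ k)

/-- For a Laurent series `F = x^{-m} g` with `g` a power series with constant term `exp lc`, the
power series `u` without constant term such that `g = exp lc * (1 + u)`. -/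
def unitPart (lc : ℂ) (m : ℤ) (F : LaurentSeries ℂ) : PowerSeries ℂ :=
  PowerSeries.C (Complex.exp (-lc)) * PowerSeries.mk (fun d => F.coeff ((d : ℤ) - m)) - 1

/-- The Laurent series `F ^ (q / m)` for `F = x^{-m} g`, where `m ≠ 0` and `g` is a power series
with constant term `exp lc`; the branch is fixed by the leading term
`exp ((q / m) * lc) * x^{-q}`. -/
def fracPow (lc : ℂ) (m q : ℤ) (F : LaurentSeries ℂ) : LaurentSeries ℂ :=
  HahnSeries.single (-q) (Complex.exp ((q : ℂ) / m * lc)) *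
    HahnSeries.ofPowerSeries ℤ ℂ (powOneAdd ((q : ℂ) / m) (unitPart lc m F))

/-- The power series `log (x^m F) = log g` for `F = x^{-m} g`, where `g` has constant term
`exp lc`; the branch is fixed by the constant term `lc`. -/
def logReg (lc : ℂ) (m : ℤ) (F : LaurentSeries ℂ) : LaurentSeries ℂ :=
  HahnSeries.C lc + HahnSeries.ofPowerSeries ℤ ℂ (logOneAdd (unitPart lc m F))

/-! ### The spaces of meromorphic functions -/

/-- The discrete data of the space of functions
`λ(p) = ∏_{i ≤ L} (p - a_i) / (p^{m₀} ∏_{j ≤ K} (p - v_j)^{m_j})`. -/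
structure MeroType where
  s : ℕ
  L : ℕ
  K : ℕ
  m₀ : ℤ
  m : Fin K → ℕ
  s_cases : (s = 0 ∧ m₀ = 0) ∨ (s = 1 ∧ (1 ≤ m₀ ∨ m₀ = -1))
  m_pos : ∀ j, 1 ≤ m j
  n_pos : 1 ≤ (L : ℤ) - m₀ - ∑ j, (m j : ℤ)

namespace MeroType

variable (τ : MeroType)

/-- The order of the pole at `∞`. -/
def n : ℤ := (τ.L : ℤ) - τ.m₀ - ∑ j, (τ.m j : ℤ)

/-- The dimension `N = K + L + s - 1`. -/
def N : ℤ := (τ.K : ℤ) + τ.L + τ.s - 1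

/-- The weight `d = 1 + (s - 1) 2 / n`. -/
def d : ℂ := 1 + ((τ.s : ℂ) - 1) * (2 / (τ.n : ℂ))

/-- The case in which the unit vector field is not flat. -/
def Exceptional : Prop := τ.s = 1 ∧ τ.m₀ = -1

/-- The vector space of the coordinates `(a, v)`, subject to `∑ a_i = ∑ m_j v_j` if `s = 0`. -/
def coordSpace : Submodule ℂ ((Fin τ.L → ℂ) × (Fin τ.K → ℂ)) where
  carrier := {q | τ.s = 0 → ∑ i, q.1 i = ∑ j, (τ.m j : ℂ) * q.2 j}
  add_mem' := by
    intro q r hq hr hs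
    simp only [Prod.fst_add, Prod.snd_add, Pi.add_apply, mul_add, Finset.sum_add_distrib,
      hq hs, hr hs]
  zero_mem' := by intro _; simp
  smul_mem' := by
    intro z q hq hs
    simp only [Prod.smul_fst, Prod.smul_snd, Pi.smul_apply, smul_eq_mul, ← Finset.mul_sum, hq hs]
    rw [Finset.mul_sum]
    exact Finset.sum_congr rfl fun j _ => by ring

/-- The coordinate space as a finite-dimensional complex normed space. -/
abbrev V : Type := τ.coordSpace

variable {τ}

/-- The zero `a_i`. -/
def a (x : τ.V) (i : Fin τ.L) : ℂ := x.1.1 i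

/-- The pole `v_j`. -/
def v (x : τ.V) (j : Fin τ.K) : ℂ := x.1.2 j

variable (τ)

/-- The underlying manifold: the zeros `a_i` are simple, the poles `v_j` are distinct, no `a_i` is a
`v_j`, and for `s = 1` none of them is the fixed point `0`, so that the orders of `λ` at its zeros
and poles are the prescribed ones. -/
def domain : Set τ.V :=
  {x | Function.Injective (a x) ∧ Function.Injective (v x) ∧ (∀ i j, a x i ≠ v x j) ∧
    (τ.s = 1 → (∀ i, a x i ≠ 0) ∧ ∀ j, v x j ≠ 0)}

variable {τ}

/-- The function `λ` with coordinates `x = (a, v)`. -/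
def lam (x : τ.V) : RatFunc ℂ :=
  (∏ i, (RatFunc.X - RatFunc.C (a x i))) /
    (RatFunc.X ^ τ.m₀ * ∏ j, (RatFunc.X - RatFunc.C (v x j)) ^ τ.m j)

/-- The derivative of `λ` in the direction `ξ`, which is
`∑ i, ξ(a_i) ∂λ/∂a_i + ∑ j, ξ(v_j) ∂λ/∂v_j` with `∂λ/∂a_i = -λ / (p - a_i)` and
`∂λ/∂v_j = m_j λ / (p - v_j)`. It identifies the vector `ξ` with an element of
`T_λ ⊆ ℂ(p)`. -/
def tangent (x ξ : τ.V) : RatFunc ℂ :=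
  (∑ i, RatFunc.C (a ξ i) * (-lam x / (RatFunc.X - RatFunc.C (a x i)))) +
    ∑ j, RatFunc.C (v ξ j) * (RatFunc.C (τ.m j : ℂ) * lam x / (RatFunc.X - RatFunc.C (v x j)))

/-- The algebra `𝒜 = ℂ[p, p⁻¹, (p - a_i)⁻¹, (p - v_j)⁻¹]`. -/
def algA (x : τ.V) : Subalgebra ℂ (RatFunc ℂ) :=
  Algebra.adjoin ℂ ({RatFunc.X, RatFunc.X⁻¹} ∪
    Set.range (fun i => (RatFunc.X - RatFunc.C (a x i))⁻¹) ∪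
    Set.range (fun j => (RatFunc.X - RatFunc.C (v x j))⁻¹))

variable (τ)

/-- Labels of the finite marked points: `some j` stands for `v_j`, and `none` for `v_0 = 0`, which
is a marked point only if `s = 1`. -/
def marked : Finset (Option (Fin τ.K)) := Finset.univ.filter fun k => k = none → τ.s = 1

/-- The order `m_k` of the pole of `λ` at the marked point with label `k`. -/
def ord : Option (Fin τ.K) → ℤ
  | none => τ.m₀
  | some j => (τ.m j : ℤ)

variable {τ}

/-- The marked point with label `k`. -/
def pt (x : τ.V) : Option (Fin τ.K) → ℂ
  | none => 0
  | some j => v x j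

/-- The set `{∞, 0 (if s = 1), v_1, …, v_K}` of all the marked points. -/
def markedSet (x : τ.V) : Set (OnePoint ℂ) :=
  {ν | ν = ∞ ∨ ∃ k ∈ τ.marked, ν = (pt x k : OnePoint ℂ)}

/-- The duality pairing `⟨α, ξ⟩ = tr_ν (ξ α)` of `α ∈ 𝒜` with a tangent vector. -/
def pairing (ν : OnePoint ℂ) (x : τ.V) (α : RatFunc ℂ) (ξ : τ.V) : ℂ :=
  tr τ.s ν (tangent x ξ * α)

/-- The metric and the multiplication of `D` at the point `x` are those obtained from the trace form
and the multiplication `∘` at the marked point `ν`: the cotangent space is the quotient of `𝒜` by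
the orthogonal complement of the tangent space, both `∘` and `η*(α, β) = tr_ν (α ∘ β)` descend to
this quotient, and they correspond to `D.mul` and `D.η` under the isomorphism
`X ↦ η(X, ·)` of tangent and cotangent vectors. -/
structure IsInducedAt (D : FrobeniusData τ.V) (x : τ.V) (ν : OnePoint ℂ) : Prop where
  cotangent : ∀ θ : τ.V →ₗ[ℂ] ℂ, ∃ α ∈ algA x, ∀ ξ, pairing ν x α ξ = θ ξ
  perp_ideal : ∀ α ∈ algA x, ∀ β ∈ algA x, (∀ ξ, pairing ν x α ξ = 0) →
    ∀ ξ, pairing ν x (circ τ.s ν (lam x) α β) ξ = 0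
  perp_metric : ∀ α ∈ algA x, ∀ β ∈ algA x, (∀ ξ, pairing ν x α ξ = 0) →
    tr τ.s ν (circ τ.s ν (lam x) α β) = 0
  metric : ∀ α ∈ algA x, ∀ β ∈ algA x, ∀ X Y : τ.V,
    (∀ ξ, D.η x X ξ = pairing ν x α ξ) → (∀ ξ, D.η x Y ξ = pairing ν x β ξ) →
      D.η x X Y = tr τ.s ν (circ τ.s ν (lam x) α β)
  product : ∀ α ∈ algA x, ∀ β ∈ algA x, ∀ X Y : τ.V,
    (∀ ξ, D.η x X ξ = pairing ν x α ξ) → (∀ ξ, D.η x Y ξ = pairing ν x β ξ) →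
      ∀ ξ, D.η x (D.mul x X Y) ξ = pairing ν x (circ τ.s ν (lam x) α β) ξ

open Classical in
/-- The unit vector field as a rational function of `p`; `u₁` is the first Taylor coefficient of `λ`
at `p = 0`. -/
def unitFun (x : τ.V) : RatFunc ℂ :=
  if τ.s = 0 ∧ τ.n = 1 then 1 - derivP (lam x)
  else if τ.Exceptional then
    1 - RatFunc.C ((expand ((0 : ℂ) : OnePoint ℂ) (lam x)).coeff 1)⁻¹ * derivP (lam x)
  else 1

/-- The Euler vector field `λ - (1 / n) p λ_p` as a rational function of `p`. -/
def eulerFun (x : τ.V) : RatFunc ℂ :=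
  lam x - RatFunc.C (1 / (τ.n : ℂ)) * RatFunc.X * derivP (lam x)

/-! ### Flat coordinates and prepotential -/

/-- The coefficient of `(p - v_k)^{-m_k}` in the expansion of `λ` at the marked point `v_k`. -/
def lead (x : τ.V) (k : Option (Fin τ.K)) : ℂ :=
  (expand (pt x k : OnePoint ℂ) (lam x)).coeff (-(τ.ord k))

/-- A choice, continuous on `W`, of branches of the logarithms of the leading coefficients of `λ` at
the finite marked points, and of the differences of these points. -/
structure Branch (τ : MeroType) (W : Set τ.V) where
  logLead : Option (Fin τ.K) → τ.V → ℂ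
  logDiff : Option (Fin τ.K) → Option (Fin τ.K) → τ.V → ℂ
  continuous_logLead : ∀ k ∈ τ.marked, ContinuousOn (logLead k) W
  exp_logLead : ∀ k ∈ τ.marked, ∀ x ∈ W, Complex.exp (logLead k x) = lead x k
  continuous_logDiff : ∀ j ∈ τ.marked, ∀ k ∈ τ.marked, j ≠ k → ContinuousOn (logDiff j k) W
  exp_logDiff : ∀ j ∈ τ.marked, ∀ k ∈ τ.marked, j ≠ k → ∀ x ∈ W,
    Complex.exp (logDiff j k x) = pt x j - pt x k

/-- `tr_∞ λ^{q / n}`, with the branch `λ^{1 / n} = p + …`. -/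
def trInfPow (q : ℤ) (x : τ.V) : ℂ :=
  trSeries τ.s ∞ (fracPow 0 τ.n q (expand ∞ (lam x)))

/-- `t_∞^i = (1 - i / n)⁻¹ tr_∞ λ^{1 - i / n}`. -/
def tInf (i : ℤ) (x : τ.V) : ℂ :=
  1 / (1 - (i : ℂ) / τ.n) * trInfPow (τ.n - i) x

/-- `H_{(1)}^{∞, i} = (1 - i / n)⁻¹ (2 - i / n)⁻¹ tr_∞ λ^{2 - i / n}`. -/
def hInf (i : ℤ) (x : τ.V) : ℂ :=
  1 / (1 - (i : ℂ) / τ.n) * (1 / (2 - (i : ℂ) / τ.n)) * trInfPow (2 * τ.n - i) x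

variable {W : Set τ.V} (b : Branch τ W)

/-- `tr_{v_k} λ^{q / m_k}`. -/
def trFinPow (k : Option (Fin τ.K)) (q : ℤ) (x : τ.V) : ℂ :=
  trSeries τ.s (pt x k : OnePoint ℂ)
    (fracPow (b.logLead k x) (τ.ord k) q (expand (pt x k : OnePoint ℂ) (lam x)))

/-- The regularised value of `tr_{v_k} (f log λ) + (m_k / n) tr_∞ (f log λ)`, for `f = 1` or
`f = λ`, which is
`tr_{v_k} (f log [(p - v_k)^{m_k} λ]) + (m_k / n) tr_∞ (f log [(p - v_k)^{-n} λ])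
  + m_k ∑_{j ≠ k} tr_{v_j} (f log (p - v_k))`,
the sum being over the finite marked points `v_j` other than `v_k`. -/
def regTrLog (k : Option (Fin τ.K)) (f : RatFunc ℂ) (x : τ.V) : ℂ :=
  trSeries τ.s (pt x k : OnePoint ℂ) (expand (pt x k : OnePoint ℂ) f *
      logReg (b.logLead k x) (τ.ord k) (expand (pt x k : OnePoint ℂ) (lam x)))
  + (τ.ord k : ℂ) / τ.n * trSeries τ.s ∞ (expand ∞ f *
      logReg 0 0 (expand ∞ ((RatFunc.X - RatFunc.C (pt x k)) ^ (-τ.n) * lam x)))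
  + (τ.ord k : ℂ) * ∑ j ∈ τ.marked.erase k,
      trSeries τ.s (pt x j : OnePoint ℂ) (expand (pt x j : OnePoint ℂ) f *
        logReg (b.logDiff j k x) 0
          (expand (pt x j : OnePoint ℂ) (RatFunc.X - RatFunc.C (pt x k))))

/-- `t_{v_k}^j`: equal to `(1 - j / m_k)⁻¹ tr_{v_k} λ^{1 - j / m_k}` for `j < m_k`, and to
`tr_{v_k} log λ + (m_k / n) tr_∞ log λ` for `j = m_k`. -/
def tFin (k : Option (Fin τ.K)) (j : ℤ) (x : τ.V) : ℂ :=
  if j = τ.ord k then regTrLog b k 1 x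
  else 1 / (1 - (j : ℂ) / τ.ord k) * trFinPow b k (τ.ord k - j) x

/-- `H_{(1)}^{v_k, j}`: equal to `(1 - j / m_k)⁻¹ (2 - j / m_k)⁻¹ tr_{v_k} λ^{2 - j / m_k}` for
`j < m_k`, and to `tr_{v_k} (λ log λ - λ) + (m_k / n) tr_∞ (λ log λ - λ)` for `j = m_k`. -/
def hFin (k : Option (Fin τ.K)) (j : ℤ) (x : τ.V) : ℂ :=
  if j = τ.ord k then
    regTrLog b k (lam x) x - tr τ.s (pt x k : OnePoint ℂ) (lam x)
      - (τ.ord k : ℂ) / τ.n * tr τ.s ∞ (lam x)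
  else 1 / (1 - (j : ℂ) / τ.ord k) * (1 / (2 - (j : ℂ) / τ.ord k)) *
    trFinPow b k (2 * τ.ord k - j) x

variable (τ) in
/-- The indices of the flat coordinates: `t_∞^i` with `1 ≤ i ≤ n - 1`, and `t_{v_k}^j` with `v_k` a
finite marked point and `0 ≤ j ≤ m_k`. -/
abbrev FlatIdx : Type :=
  {i : ℤ // 1 ≤ i ∧ i ≤ τ.n - 1} ⊕
    {q : Option (Fin τ.K) × ℤ // q.1 ∈ τ.marked ∧ 0 ≤ q.2 ∧ q.2 ≤ τ.ord q.1}

/-- The flat coordinates. -/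
def flatCoord : τ.FlatIdx → τ.V → ℂ
  | Sum.inl i => tInf i.1
  | Sum.inr q => tFin b q.1.1 q.1.2

/-- `(3 - d)⁻¹ (n⁻¹ ∑_i E_∞^i H_{(1)}^{∞, n - i} + ∑_k m_k⁻¹ ∑_j E_{v_k}^j H_{(1)}^{v_k, m_k - j})`,
where `E_ν^i = ⟨dt_ν^i, E⟩`. -/
def prepotential (E : τ.V → τ.V) (x : τ.V) : ℂ :=
  1 / (3 - τ.d) *
    (1 / (τ.n : ℂ) * ∑ i ∈ Finset.Icc 1 (τ.n - 1),
        fderiv ℂ (tInf i) x (E x) * hInf (τ.n - i) x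
      + ∑ k ∈ τ.marked, 1 / (τ.ord k : ℂ) * ∑ j ∈ Finset.Icc 0 (τ.ord k),
        fderiv ℂ (tFin b k j) x (E x) * hFin b k (τ.ord k - j) x)

end MeroType

end MeroFrob

end

/-! The structure is of Landau–Ginzburg type. Let R be the ring of rational functions regular away
from the marked points (`InR`). After division by p^s the tangent space becomes a space cut out by
pole bounds (`InT`, with `inT_xt` and `exists_xt_eq`): f is regular off the marked points, and f/λ_p
is regular at each finite marked point and vanishes at ∞. A rational function without poles that
vanishes at ∞ is zero, and every rational function is the sum of its principal parts. Hence R is the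
direct sum of p^(-s) T_λ and λ_p R (`exists_xt_add`, `eq_zero_of_inT_of_eq_mul`). The multiplication
of tangent vectors is multiplication modulo λ_p R. The functional φ(f) = -∑ res f/λ_p over all
marked points kills λ_p R by the residue theorem, so η(X, Y) = φ(p^(-2s) X Y) is an invariant form.
Neither object depends on a chosen marked point.

For a marked point ν and a Laurent series α there, `lift` produces the tangent vector built from λ_p
α_- - (λ_p α)_-. The identity η(lift α, X) = ⟨α, X⟩_ν (`phi_lift_mul`) says that it represents the
covector of α, and the analogous identity with two lifts (`phi_lift_mul_lift_mul`) identifies ∘_ν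
with the product. This gives nondegeneracy and the claim that every ν induces the same structure.

The connection comes from the second derivative of λ at fixed p. If X_ξ X_ζ = X_{ξ*ζ} + p^s λ_p K,
then ∂_ξ∂_ζ λ - p^s ∂_p K is again tangent (`inT_conn`), and it is taken to be X_{Γ(ξ,ζ)}. Suppose
now that dF(X) is a sum of residues of p^(-s) g(λ) X. Differentiating once more and integrating the
term p^s ∂_p K by parts gives the key formula (`Pot.hess`): ∇dF(ξ, ζ) is the same sum of residues
with g'(λ) X_{ξ*ζ}. For g(λ) = λ^(-j/m) with j in the range of flat coordinates these last residues
vanish, so the functions t are flat. For a primitive of that g one obtains functions H with ∇dH =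
dt(· * ·). In the logarithmic case the regularised logarithms at the various places satisfy the
required derivative rules up to one and the same multiple of 1/(p - v_k); being a single rational
function it contributes nothing to a sum over all marked points (`Pot.sum_res`, `pot_logG`).

In the covectors dt the metric is antidiagonal: two exponents at different places are orthogonal,
and at one place the Gram entry is -res λ^(-(j+j')/m) λ_p, which is m if j + j' = m and otherwise
the residue of an exact differential (`IsExp.res_pw_mul_derivP`). The dt separate tangent vectors
(`eq_zero_of_cov`), so they are a frame in which η has constant coefficients.

The remaining axioms are formal consequences of this information, collected in `FlatData`. Flatness
and the symmetry of ∇c are symmetry of third derivatives of t and of H; the Euler axioms and the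
formula for the prepotential are Euler's identity, because E is the radial field x/n and t, H are
homogeneous up to flat terms.

The unit is the representative of 1 in the tangent space, that is 1 - uλ_p, with u ≠ 0 only where 1
itself violates a pole bound. Outside the exceptional case the numbers dt(e) are constant. In the
exceptional case a flat e would have only components of degree 1, which would make the pole of uλ_p
at some marked point too small (`not_unitFlat`). -/

noncomputable section

/-! ### Laurent expansions, principal parts and residues on the Riemann sphere. -/

namespace MeroFrob

open scoped OnePoint

/-! ### Laurent series -/

/-- `F` has order at least `k`. -/
def LOrd (k : ℤ) (F : LaurentSeries ℂ) : Prop := (k : WithTop ℤ) ≤ F.orderTop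

/-- `F` has order exactly `k`. -/
def LExact (k : ℤ) (F : LaurentSeries ℂ) : Prop := F.orderTop = (k : WithTop ℤ)

theorem lOrd_iff {k : ℤ} {F : LaurentSeries ℂ} : LOrd k F ↔ ∀ d < k, F.coeff d = 0 := by
  rw [LOrd, HahnSeries.le_orderTop_iff_forall]
  simp

theorem LOrd.coeff {k : ℤ} {F : LaurentSeries ℂ} (h : LOrd k F) {d : ℤ} (hd : d < k) :
    F.coeff d = 0 := lOrd_iff.1 h d hd

theorem LOrd.mono {k l : ℤ} {F : LaurentSeries ℂ} (h : LOrd k F) (hl : l ≤ k) : LOrd l F :=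
  le_trans (by exact_mod_cast hl) h

theorem lOrd_zero (k : ℤ) : LOrd k 0 := by simp [LOrd]

theorem LOrd.add {k : ℤ} {F G : LaurentSeries ℂ} (h : LOrd k F) (h' : LOrd k G) :
    LOrd k (F + G) := by
  rw [lOrd_iff] at *; intro d hd; simp [h d hd, h' d hd]

theorem LOrd.neg {k : ℤ} {F : LaurentSeries ℂ} (h : LOrd k F) : LOrd k (-F) := by
  rw [lOrd_iff] at *; intro d hd; simp [h d hd]

theorem LOrd.sub {k : ℤ} {F G : LaurentSeries ℂ} (h : LOrd k F) (h' : LOrd k G) :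
    LOrd k (F - G) := by
  rw [sub_eq_add_neg]; exact h.add h'.neg

theorem LOrd.sum {k : ℤ} {ι : Type*} {s : Finset ι} {F : ι → LaurentSeries ℂ}
    (h : ∀ i ∈ s, LOrd k (F i)) : LOrd k (∑ i ∈ s, F i) := by
  rw [lOrd_iff]; intro d hd
  rw [HahnSeries.coeff_sum]
  exact Finset.sum_eq_zero fun i hi => (h i hi).coeff hd

theorem LOrd.mul {k l : ℤ} {F G : LaurentSeries ℂ} (h : LOrd k F) (h' : LOrd l G) :
    LOrd (k + l) (F * G) := by
  rw [LOrd, HahnSeries.orderTop_mul]; push_cast; exact add_le_add h h'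

theorem LOrd.mul_le {k l r : ℤ} {F G : LaurentSeries ℂ} (h : LOrd k F) (h' : LOrd l G)
    (hr : r ≤ k + l) : LOrd r (F * G) := (h.mul h').mono hr

theorem lOrd_C (c : ℂ) : LOrd 0 (HahnSeries.C c) := by
  rw [lOrd_iff]; intro d hd; simp [hd.ne]

theorem lOrd_one : LOrd 0 1 := by simpa using lOrd_C 1

theorem lOrd_single (k : ℤ) (c : ℂ) : LOrd k (HahnSeries.single k c) := by
  rw [lOrd_iff]; intro d hd; simp [hd.ne]

theorem lOrd_ofPowerSeries (f : PowerSeries ℂ) : LOrd 0 (HahnSeries.ofPowerSeries ℤ ℂ f) := by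
  rw [lOrd_iff]; intro d hd
  rw [PowerSeries.coeff_coe, if_pos hd]

theorem LOrd.pow {F : LaurentSeries ℂ} {k : ℤ} (h : LOrd k F) (j : ℕ) : LOrd (j * k) (F ^ j) := by
  induction j with
  | zero => simpa using lOrd_one
  | succ j ih => rw [pow_succ]; exact ih.mul_le h (by push_cast; linarith)

theorem exists_lOrd (F : LaurentSeries ℂ) : ∃ k, LOrd k F := by
  by_cases h : F = 0
  · exact ⟨0, h ▸ lOrd_zero 0⟩
  · exact ⟨F.order, (HahnSeries.order_eq_orderTop_of_ne_zero h).le⟩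

theorem LExact.lOrd {k : ℤ} {F : LaurentSeries ℂ} (h : LExact k F) : LOrd k F := h.ge

theorem LExact.ne_zero {k : ℤ} {F : LaurentSeries ℂ} (h : LExact k F) : F ≠ 0 := by
  rintro rfl; simp [LExact] at h

theorem LExact.coeff_ne_zero {k : ℤ} {F : LaurentSeries ℂ} (h : LExact k F) : F.coeff k ≠ 0 :=
  HahnSeries.coeff_orderTop_ne h

theorem lExact_of {k : ℤ} {F : LaurentSeries ℂ} (h : LOrd k F) (h' : F.coeff k ≠ 0) :
    LExact k F :=
  le_antisymm (HahnSeries.orderTop_le_of_coeff_ne_zero h') h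

theorem exists_lExact {F : LaurentSeries ℂ} (h : F ≠ 0) : ∃ k, LExact k F :=
  ⟨F.order, (HahnSeries.order_eq_orderTop_of_ne_zero h).symm⟩

theorem LExact.mul {k l : ℤ} {F G : LaurentSeries ℂ} (h : LExact k F) (h' : LExact l G) :
    LExact (k + l) (F * G) := by
  rw [LExact, HahnSeries.orderTop_mul, h, h']; rfl

theorem LExact.unique {k l : ℤ} {F : LaurentSeries ℂ} (h : LExact k F) (h' : LExact l F) :
    k = l := by
  have := h.symm.trans h'; exact_mod_cast this

theorem lExact_single (k : ℤ) {c : ℂ} (hc : c ≠ 0) : LExact k (HahnSeries.single k c) :=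
  HahnSeries.orderTop_single hc

theorem lExact_one : LExact 0 1 := by
  simpa using lExact_single 0 (one_ne_zero (α := ℂ))

theorem LExact.inv {k : ℤ} {F : LaurentSeries ℂ} (h : LExact k F) : LExact (-k) F⁻¹ := by
  obtain ⟨l, hl⟩ := exists_lExact (inv_ne_zero h.ne_zero)
  have h1 := h.mul hl
  rw [mul_inv_cancel₀ h.ne_zero] at h1
  have := h1.unique lExact_one
  rwa [show -k = l by omega]

theorem LExact.pow {k : ℤ} {F : LaurentSeries ℂ} (h : LExact k F) (j : ℕ) :
    LExact (j * k) (F ^ j) := by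
  induction j with
  | zero => simpa using lExact_one
  | succ j ih =>
    rw [pow_succ, show ((j + 1 : ℕ) : ℤ) * k = j * k + k by push_cast; ring]; exact ih.mul h

theorem LExact.zpow {k : ℤ} {F : LaurentSeries ℂ} (h : LExact k F) (j : ℤ) :
    LExact (j * k) (F ^ j) := by
  obtain ⟨m, rfl | rfl⟩ := j.eq_nat_or_neg
  · simpa using h.pow m
  · rw [zpow_neg, zpow_natCast, neg_mul]; exact (h.pow m).inv

theorem LExact.prod {ι : Type*} {s : Finset ι} {k : ι → ℤ} {F : ι → LaurentSeries ℂ}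
    (h : ∀ i ∈ s, LExact (k i) (F i)) : LExact (∑ i ∈ s, k i) (∏ i ∈ s, F i) := by
  classical
  induction s using Finset.induction_on with
  | empty => simpa using lExact_one
  | insert i s hi ih =>
    rw [Finset.sum_insert hi, Finset.prod_insert hi]
    exact (h i (by simp)).mul (ih fun j hj => h j (by simp [hj]))

/-- The convolution is rewritten over an interval that depends only on the order bounds and not on
the supports. With bounds uniform in a parameter, products of families can then be differentiated
term by term. -/
theorem coeff_mul_of_lOrd {a b : ℤ} {F G : LaurentSeries ℂ} (hF : LOrd a F) (hG : LOrd b G)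
    (d : ℤ) : (F * G).coeff d = ∑ i ∈ Finset.Icc a (d - b), F.coeff i * G.coeff (d - i) := by
  rw [HahnSeries.coeff_mul]
  refine Finset.sum_bij_ne_zero (fun p _ _ => p.1) ?_ ?_ ?_ ?_
  · rintro ⟨i, j⟩ h _
    simp only [Finset.mem_antidiagonal, HahnSeries.mem_support] at h
    rw [Finset.mem_Icc]
    refine ⟨?_, ?_⟩
    · by_contra hlt; exact h.1 (hF.coeff (not_le.1 hlt))
    · by_contra hlt; exact h.2.1 (hG.coeff (by simp only at hlt h; omega))
  · rintro ⟨i, j⟩ h _ ⟨i', j'⟩ h' _ heq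
    simp only [Finset.mem_antidiagonal] at h h'
    simp only at heq
    ext <;> simp <;> omega
  · intro i hi hne
    refine ⟨(i, d - i), ?_, hne, rfl⟩
    simp only [Finset.mem_antidiagonal, HahnSeries.mem_support]
    exact ⟨left_ne_zero_of_mul hne, right_ne_zero_of_mul hne, by ring⟩
  · rintro ⟨i, j⟩ h _
    simp only [Finset.mem_antidiagonal] at h
    simp [← h.2.2]

theorem LOrd.coeff_mul_add {a b : ℤ} {F G : LaurentSeries ℂ} (hF : LOrd a F) (hG : LOrd b G) :
    (F * G).coeff (a + b) = F.coeff a * G.coeff b := by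
  rw [coeff_mul_of_lOrd hF hG]; simp

/-- The operator `z d/dz`. -/
def theta (F : LaurentSeries ℂ) : LaurentSeries ℂ where
  coeff d := d * F.coeff d
  isPWO_support' := F.isPWO_support.mono fun d hd => by
    simp only [Function.mem_support] at hd
    exact right_ne_zero_of_mul hd

@[simp] theorem theta_coeff (F : LaurentSeries ℂ) (d : ℤ) : (theta F).coeff d = d * F.coeff d := rfl

theorem LOrd.theta {k : ℤ} {F : LaurentSeries ℂ} (h : LOrd k F) : LOrd k (theta F) := by
  rw [lOrd_iff] at *; intro d hd; simp [h d hd]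

theorem theta_add (F G : LaurentSeries ℂ) : theta (F + G) = theta F + theta G := by
  ext d; simp [mul_add]

theorem theta_mul (F G : LaurentSeries ℂ) : theta (F * G) = theta F * G + F * theta G := by
  obtain ⟨a, ha⟩ := exists_lOrd F
  obtain ⟨b, hb⟩ := exists_lOrd G
  ext d
  rw [theta_coeff, HahnSeries.coeff_add, coeff_mul_of_lOrd ha hb, coeff_mul_of_lOrd ha.theta hb,
    coeff_mul_of_lOrd ha hb.theta, Finset.mul_sum, ← Finset.sum_add_distrib]
  refine Finset.sum_congr rfl fun i _ => ?_
  simp; ring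

/-- The derivative `d/dp` in the local parameter at `ν`. -/
def der : OnePoint ℂ → LaurentSeries ℂ → LaurentSeries ℂ
  | ∞, F => -(HahnSeries.single 1 1 * theta F)
  | (_ : ℂ), F => HahnSeries.single (-1) 1 * theta F

theorem der_coe (ν : ℂ) (F : LaurentSeries ℂ) :
    der (ν : OnePoint ℂ) F = HahnSeries.single (-1) 1 * theta F := rfl

theorem der_infty (F : LaurentSeries ℂ) : der ∞ F = -(HahnSeries.single 1 1 * theta F) := rfl

theorem coeff_single_mul' (k : ℤ) (c : ℂ) (F : LaurentSeries ℂ) (d : ℤ) :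
    (HahnSeries.single k c * F).coeff d = c * F.coeff (d - k) := by
  rw [HahnSeries.coeff_single_mul]

theorem der_coe_coeff (ν : ℂ) (F : LaurentSeries ℂ) (d : ℤ) :
    (der (ν : OnePoint ℂ) F).coeff d = ((d : ℂ) + 1) * F.coeff (d + 1) := by
  rw [der_coe, coeff_single_mul']; simp

theorem der_infty_coeff (F : LaurentSeries ℂ) (d : ℤ) :
    (der ∞ F).coeff d = -(((d : ℂ) - 1) * F.coeff (d - 1)) := by
  rw [der_infty, HahnSeries.coeff_neg, coeff_single_mul']; simp

theorem der_add (ν : OnePoint ℂ) (F G : LaurentSeries ℂ) : der ν (F + G) = der ν F + der ν G := by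
  induction ν using OnePoint.rec
  · simp only [der_infty, theta_add]; ring
  · simp only [der_coe, theta_add]; ring

theorem der_mul (ν : OnePoint ℂ) (F G : LaurentSeries ℂ) :
    der ν (F * G) = der ν F * G + F * der ν G := by
  induction ν using OnePoint.rec
  · simp only [der_infty, theta_mul]; ring
  · simp only [der_coe, theta_mul]; ring

theorem der_C (ν : OnePoint ℂ) (c : ℂ) : der ν (HahnSeries.C c) = 0 := by
  have : theta (HahnSeries.C c) = 0 := by
    ext d; by_cases h : d = 0 <;> simp [h]
  induction ν using OnePoint.rec
  · rw [der_infty, this]; simp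
  · rw [der_coe, this]; simp

theorem der_zero (ν : OnePoint ℂ) : der ν 0 = 0 := by simpa using der_C ν 0

theorem der_one (ν : OnePoint ℂ) : der ν 1 = 0 := by simpa using der_C ν 1

theorem der_neg (ν : OnePoint ℂ) (F : LaurentSeries ℂ) : der ν (-F) = -der ν F := by
  have := der_add ν F (-F)
  rw [add_neg_cancel, der_zero] at this
  linear_combination -this

theorem der_sub (ν : OnePoint ℂ) (F G : LaurentSeries ℂ) : der ν (F - G) = der ν F - der ν G := by
  rw [sub_eq_add_neg, der_add, der_neg, ← sub_eq_add_neg]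

theorem der_C_mul (ν : OnePoint ℂ) (c : ℂ) (F : LaurentSeries ℂ) :
    der ν (HahnSeries.C c * F) = HahnSeries.C c * der ν F := by
  rw [der_mul, der_C, zero_mul, zero_add]

theorem der_div (ν : OnePoint ℂ) (F : LaurentSeries ℂ) {G : LaurentSeries ℂ} (hG : G ≠ 0) :
    der ν (F / G) = (der ν F * G - F * der ν G) / G ^ 2 := by
  have h := der_mul ν (F / G) G
  rw [div_mul_cancel₀ _ hG] at h
  rw [eq_div_iff (pow_ne_zero 2 hG), h]
  field_simp
  ring

theorem der_eval₂ (ν : OnePoint ℂ) (a : LaurentSeries ℂ) (q : Polynomial ℂ) :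
    der ν (Polynomial.eval₂ HahnSeries.C a q) =
      Polynomial.eval₂ HahnSeries.C a (Polynomial.derivative q) * der ν a := by
  have hpow (k : ℕ) : der ν (a ^ (k + 1)) = HahnSeries.C ((k : ℂ) + 1) * a ^ k * der ν a := by
    induction k with
    | zero => simp
    | succ k ih =>
      rw [pow_succ, der_mul, ih]; push_cast; simp only [map_add, map_one]; ring
  induction q using Polynomial.induction_on' with
  | add p q hp hq => simp only [Polynomial.eval₂_add, der_add, hp, hq, Polynomial.derivative_add]; ring
  | monomial k c =>
    rcases k with _ | k
    · rw [Polynomial.monomial_zero_left, Polynomial.eval₂_C, der_C, Polynomial.derivative_C]; simp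
    · rw [Polynomial.eval₂_monomial, der_C_mul, hpow, Polynomial.derivative_monomial,
        Polynomial.eval₂_monomial]
      simp only [map_mul, Nat.cast_add, Nat.cast_one, Nat.add_sub_cancel]; ring

/-- `1` at `∞`, and `0` elsewhere. -/
def cut : OnePoint ℂ → ℤ
  | ∞ => 1
  | (_ : ℂ) => 0

/-- `-1` at `∞`, and `1` elsewhere. -/
def sgn : OnePoint ℂ → ℂ
  | ∞ => -1
  | (_ : ℂ) => 1

@[simp] theorem cut_infty : cut ∞ = 1 := rfl
@[simp] theorem cut_coe (ν : ℂ) : cut (ν : OnePoint ℂ) = 0 := rfl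
@[simp] theorem sgn_infty : sgn ∞ = -1 := rfl
@[simp] theorem sgn_coe (ν : ℂ) : sgn (ν : OnePoint ℂ) = 1 := rfl

theorem cut_nonneg (ν : OnePoint ℂ) : 0 ≤ cut ν := by
  induction ν using OnePoint.rec <;> simp

theorem sgn_mul_self (ν : OnePoint ℂ) : sgn ν * sgn ν = 1 := by
  induction ν using OnePoint.rec <;> simp

/-- The residue at `ν` of `F dp`. -/
def res (ν : OnePoint ℂ) : LaurentSeries ℂ →ₗ[ℂ] ℂ where
  -- At ∞ the parameter is z = 1/p and dp = -z^(-2) dz, so the residue is minus the coefficient of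
  -- z. At a finite point it is the coefficient of z^(-1). The index `2 * cut ν - 1` covers both.
  toFun F := sgn ν * F.coeff (2 * cut ν - 1)
  map_add' F G := by simp [mul_add]
  map_smul' c F := by simp; ring

theorem res_infty (F : LaurentSeries ℂ) : res ∞ F = -F.coeff 1 := by simp [res]

theorem res_coe (ν : ℂ) (F : LaurentSeries ℂ) : res (ν : OnePoint ℂ) F = F.coeff (-1) := by
  simp [res]

theorem res_der (ν : OnePoint ℂ) (F : LaurentSeries ℂ) : res ν (der ν F) = 0 := by
  induction ν using OnePoint.rec
  · simp [res_infty, der_infty_coeff]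
  · simp [res_coe, der_coe_coeff]

theorem res_eq_zero {ν : OnePoint ℂ} {F : LaurentSeries ℂ} (h : LOrd (2 * cut ν) F) :
    res ν F = 0 := by
  simp [res, h.coeff (show 2 * cut ν - 1 < 2 * cut ν by omega)]

theorem res_C_mul (ν : OnePoint ℂ) (c : ℂ) (F : LaurentSeries ℂ) :
    res ν (HahnSeries.C c * F) = c * res ν F := by
  rw [show HahnSeries.C c * F = c • F by ext d; simp]; simp

theorem LOrd.der {ν : OnePoint ℂ} {k : ℤ} {F : LaurentSeries ℂ} (h : LOrd k F) :
    LOrd (k - 1 + 2 * cut ν) (der ν F) := by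
  induction ν using OnePoint.rec
  · exact ((lOrd_single 1 1).mul_le h.theta (by simp; omega)).neg
  · exact (lOrd_single (-1) 1).mul_le h.theta (by rw [cut_coe]; omega)

/-- At a finite point the general bound loses one order, but the constant term is killed by
differentiation, so regular series stay regular. -/
theorem LOrd.der_zero {ν : OnePoint ℂ} {F : LaurentSeries ℂ} (h : LOrd 0 F) :
    LOrd 0 (MeroFrob.der ν F) := by
  induction ν using OnePoint.rec
  · exact h.der.mono (by simp)
  · rw [lOrd_iff]; intro d hd
    rw [der_coe_coeff]
    by_cases h1 : d = -1
    · simp [h1]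
    · rw [h.coeff (by omega)]; simp

/-! ### The expansion homomorphism -/

theorem locVar_ne_C (ν : OnePoint ℂ) (c : ℂ) : locVar ν ≠ HahnSeries.C c := by
  intro h
  induction ν using OnePoint.rec with
  | infty => simpa [locVar] using congrArg (fun F : LaurentSeries ℂ => F.coeff (-1)) h
  | coe ν => simpa [locVar] using congrArg (fun F : LaurentSeries ℂ => F.coeff 1) h

/-- The polynomial splits over ℂ and no linear factor vanishes, since the local variable is not a
constant series. This is what makes the expansion a ring homomorphism on rational functions. -/
theorem eval₂_locVar_ne_zero (ν : OnePoint ℂ) {q : Polynomial ℂ} (hq : q ≠ 0) :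
    Polynomial.eval₂ (HahnSeries.C : ℂ →+* LaurentSeries ℂ) (locVar ν) q ≠ 0 := by
  have h := (IsAlgClosed.splits q).eq_prod_roots
  rw [h, Polynomial.eval₂_mul, Polynomial.eval₂_C, Polynomial.eval₂_multiset_prod]
  refine mul_ne_zero ?_ (Multiset.prod_ne_zero ?_)
  · simpa using hq
  · simp only [Multiset.mem_map]
    rintro ⟨_, ⟨r, _, rfl⟩, h0⟩
    rw [Polynomial.eval₂_sub, Polynomial.eval₂_X, Polynomial.eval₂_C, sub_eq_zero] at h0
    exact locVar_ne_C ν r h0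

/-- The Laurent expansion at `ν` as a ring homomorphism. -/
def expandHom (ν : OnePoint ℂ) : RatFunc ℂ →+* LaurentSeries ℂ :=
  RatFunc.liftRingHom (Polynomial.eval₂RingHom (HahnSeries.C : ℂ →+* LaurentSeries ℂ) (locVar ν))
    fun q hq => by
      rw [Submonoid.mem_comap, mem_nonZeroDivisors_iff_ne_zero]
      exact eval₂_locVar_ne_zero ν (nonZeroDivisors.ne_zero hq)

theorem expandHom_apply (ν : OnePoint ℂ) (f : RatFunc ℂ) : expandHom ν f = expand ν f := by
  rw [expandHom, RatFunc.liftRingHom_apply]; rfl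

theorem expand_add (ν : OnePoint ℂ) (f g : RatFunc ℂ) :
    expand ν (f + g) = expand ν f + expand ν g := by simp only [← expandHom_apply, map_add]

theorem expand_sub (ν : OnePoint ℂ) (f g : RatFunc ℂ) :
    expand ν (f - g) = expand ν f - expand ν g := by simp only [← expandHom_apply, map_sub]

theorem expand_neg (ν : OnePoint ℂ) (f : RatFunc ℂ) :
    expand ν (-f) = -expand ν f := by simp only [← expandHom_apply, map_neg]

theorem expand_mul (ν : OnePoint ℂ) (f g : RatFunc ℂ) :
    expand ν (f * g) = expand ν f * expand ν g := by simp only [← expandHom_apply, map_mul]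

theorem expand_div (ν : OnePoint ℂ) (f g : RatFunc ℂ) :
    expand ν (f / g) = expand ν f / expand ν g := by simp only [← expandHom_apply, map_div₀]

theorem expand_inv (ν : OnePoint ℂ) (f : RatFunc ℂ) :
    expand ν f⁻¹ = (expand ν f)⁻¹ := by simp only [← expandHom_apply, map_inv₀]

theorem expand_pow (ν : OnePoint ℂ) (f : RatFunc ℂ) (k : ℕ) :
    expand ν (f ^ k) = expand ν f ^ k := by simp only [← expandHom_apply, map_pow]

theorem expand_zpow (ν : OnePoint ℂ) (f : RatFunc ℂ) (k : ℤ) :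
    expand ν (f ^ k) = expand ν f ^ k := by simp only [← expandHom_apply, map_zpow₀]

theorem expand_sum (ν : OnePoint ℂ) {ι : Type*} (s : Finset ι) (f : ι → RatFunc ℂ) :
    expand ν (∑ i ∈ s, f i) = ∑ i ∈ s, expand ν (f i) := by simp only [← expandHom_apply, map_sum]

theorem expand_prod (ν : OnePoint ℂ) {ι : Type*} (s : Finset ι) (f : ι → RatFunc ℂ) :
    expand ν (∏ i ∈ s, f i) = ∏ i ∈ s, expand ν (f i) := by simp only [← expandHom_apply, map_prod]

theorem expand_zero (ν : OnePoint ℂ) : expand ν 0 = 0 := by simp only [← expandHom_apply, map_zero]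

theorem expand_one (ν : OnePoint ℂ) : expand ν 1 = 1 := by simp only [← expandHom_apply, map_one]

theorem expand_C (ν : OnePoint ℂ) (c : ℂ) : expand ν (RatFunc.C c) = HahnSeries.C c := by
  simp [expand]

theorem expand_X (ν : OnePoint ℂ) : expand ν RatFunc.X = locVar ν := by simp [expand]

theorem expand_injective (ν : OnePoint ℂ) : Function.Injective (expand ν) := by
  intro f g h
  rw [← expandHom_apply, ← expandHom_apply] at h
  exact (expandHom ν).injective h

theorem expand_ne_zero (ν : OnePoint ℂ) {f : RatFunc ℂ} (h : f ≠ 0) : expand ν f ≠ 0 := by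
  rw [← expandHom_apply]; exact (map_ne_zero _).2 h

theorem expand_algebraMap (ν : OnePoint ℂ) (q : Polynomial ℂ) :
    expand ν (algebraMap (Polynomial ℂ) (RatFunc ℂ) q) =
      Polynomial.eval₂ HahnSeries.C (locVar ν) q := by
  simp [expand]

theorem der_locVar (ν : OnePoint ℂ) : der ν (locVar ν) = 1 := by
  induction ν using OnePoint.rec with
  | infty =>
    ext d
    simp only [der_infty_coeff, locVar, HahnSeries.coeff_one, HahnSeries.coeff_single]
    by_cases h : d = 0
    · simp [h]
    · rw [if_neg (by omega), if_neg h]; simp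
  | coe ν =>
    change der (ν : OnePoint ℂ) (HahnSeries.C ν + HahnSeries.single 1 1) = 1
    rw [der_add, der_C, zero_add]
    ext d
    simp only [der_coe_coeff, HahnSeries.coeff_one, HahnSeries.coeff_single]
    by_cases h : d = 0
    · simp [h]
    · rw [if_neg (by omega), if_neg h]; simp

theorem expand_derivP (ν : OnePoint ℂ) (f : RatFunc ℂ) :
    expand ν (derivP f) = der ν (expand ν f) := by
  have h : expand ν f = Polynomial.eval₂ HahnSeries.C (locVar ν) f.num /
      Polynomial.eval₂ HahnSeries.C (locVar ν) f.denom := rfl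
  rw [h, der_div _ _ (eval₂_locVar_ne_zero ν f.denom_ne_zero), der_eval₂, der_eval₂, der_locVar,
    derivP, expand_div, expand_algebraMap, expand_algebraMap]
  simp only [Polynomial.eval₂_mul, Polynomial.eval₂_sub, Polynomial.eval₂_pow, mul_one]

/-- The rules of differentiation are awkward for a definition through numerator and denominator;
they are pulled back from Laurent series at ∞, where expansion is injective and intertwines the two
derivatives. -/
theorem derivP_add (f g : RatFunc ℂ) : derivP (f + g) = derivP f + derivP g :=
  expand_injective ∞ (by simp only [expand_derivP, expand_add, der_add])

theorem derivP_sub (f g : RatFunc ℂ) : derivP (f - g) = derivP f - derivP g :=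
  expand_injective ∞ (by simp only [expand_derivP, expand_sub, der_sub])

theorem derivP_mul (f g : RatFunc ℂ) : derivP (f * g) = derivP f * g + f * derivP g :=
  expand_injective ∞ (by simp only [expand_derivP, expand_mul, expand_add, der_mul])

theorem derivP_div (f : RatFunc ℂ) {g : RatFunc ℂ} (hg : g ≠ 0) :
    derivP (f / g) = (derivP f * g - f * derivP g) / g ^ 2 :=
  expand_injective ∞ (by
    simp only [expand_derivP, expand_mul, expand_sub, expand_div, expand_pow,
      der_div _ _ (expand_ne_zero ∞ hg)])

theorem derivP_C (c : ℂ) : derivP (RatFunc.C c) = 0 :=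
  expand_injective ∞ (by simp only [expand_derivP, expand_C, expand_zero, der_C])

theorem derivP_X : derivP RatFunc.X = 1 :=
  expand_injective ∞ (by simp only [expand_derivP, expand_X, expand_one, der_locVar])

theorem derivP_zero : derivP 0 = 0 := by simpa using derivP_C 0

theorem derivP_one : derivP 1 = 0 := by simpa using derivP_C 1

theorem derivP_C_mul (c : ℂ) (f : RatFunc ℂ) : derivP (RatFunc.C c * f) = RatFunc.C c * derivP f := by
  rw [derivP_mul, derivP_C, zero_mul, zero_add]

theorem derivP_sum {ι : Type*} (s : Finset ι) (f : ι → RatFunc ℂ) :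
    derivP (∑ i ∈ s, f i) = ∑ i ∈ s, derivP (f i) := by
  classical
  induction s using Finset.induction_on with
  | empty => simp [derivP_zero]
  | insert i s hi ih => simp only [Finset.sum_insert hi, derivP_add, ih]

theorem derivP_inv {f : RatFunc ℂ} (hf : f ≠ 0) : derivP f⁻¹ = -derivP f / f ^ 2 := by
  have := derivP_div 1 hf
  rw [derivP_one] at this
  simpa using this

/-- The logarithmic derivative of an integral power. -/
theorem derivP_zpow {f : RatFunc ℂ} (hf : f ≠ 0) (e : ℤ) :
    derivP (f ^ e) = f ^ e * (RatFunc.C (e : ℂ) * (derivP f / f)) := by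
  have hn (k : ℕ) : derivP (f ^ k) = f ^ k * (RatFunc.C (k : ℂ) * (derivP f / f)) := by
    induction k with
    | zero => simp [derivP_one]
    | succ k ih =>
      rw [pow_succ, derivP_mul, ih]; push_cast; simp only [map_add, map_one]
      field_simp
  obtain ⟨k, rfl | rfl⟩ := e.eq_nat_or_neg
  · simpa using hn k
  · rw [zpow_neg, zpow_natCast, derivP_inv (pow_ne_zero k hf), hn]
    have := pow_ne_zero k hf
    push_cast; simp only [map_neg]
    field_simp

theorem derivP_prod {ι : Type*} (s : Finset ι) (f : ι → RatFunc ℂ) (hf : ∀ i ∈ s, f i ≠ 0) :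
    derivP (∏ i ∈ s, f i) = (∏ i ∈ s, f i) * ∑ i ∈ s, derivP (f i) / f i := by
  classical
  induction s using Finset.induction_on with
  | empty => simp [derivP_one]
  | insert i s hi ih =>
    have h1 := hf i (by simp)
    rw [Finset.prod_insert hi, Finset.sum_insert hi, derivP_mul, ih fun j hj => hf j (by simp [hj])]
    field_simp

/-! ### Orders of linear factors -/

/-- The linear factor `p - c`. -/
def lin (c : ℂ) : RatFunc ℂ := RatFunc.X - RatFunc.C c

theorem lin_ne_zero (c : ℂ) : lin c ≠ 0 := by
  intro h
  have h1 := congrArg (expand ∞) h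
  rw [lin, expand_sub, expand_X, expand_C, expand_zero, sub_eq_zero] at h1
  exact locVar_ne_C ∞ c h1

theorem lin_zero : lin 0 = RatFunc.X := by simp [lin]

theorem derivP_lin (c : ℂ) : derivP (lin c) = 1 := by
  rw [lin, derivP_sub, derivP_X, derivP_C, sub_zero]

theorem expand_lin_infty (c : ℂ) :
    expand ∞ (lin c) = HahnSeries.single (-1) 1 - HahnSeries.C c := by
  rw [lin, expand_sub, expand_X, expand_C]; rfl

theorem expand_lin_coe (μ c : ℂ) :
    expand (μ : OnePoint ℂ) (lin c) = HahnSeries.C (μ - c) + HahnSeries.single 1 1 := by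
  rw [lin, expand_sub, expand_X, expand_C, map_sub]
  change HahnSeries.C μ + HahnSeries.single 1 1 - HahnSeries.C c = _
  ring

theorem expand_lin_self (c : ℂ) :
    expand (c : OnePoint ℂ) (lin c) = HahnSeries.single 1 1 := by
  rw [expand_lin_coe]; simp

open Classical in
/-- The order at `μ` of `p - c`. -/
def linOrd (c : ℂ) (μ : OnePoint ℂ) : ℤ :=
  if μ = ∞ then -1 else if μ = (c : OnePoint ℂ) then 1 else 0

@[simp] theorem linOrd_infty (c : ℂ) : linOrd c ∞ = -1 := by simp [linOrd]

@[simp] theorem linOrd_self (c : ℂ) : linOrd c (c : OnePoint ℂ) = 1 := by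
  simp [linOrd, OnePoint.coe_ne_infty]

theorem linOrd_of_ne {c μ : ℂ} (h : μ ≠ c) : linOrd c (μ : OnePoint ℂ) = 0 := by
  simp [linOrd, OnePoint.coe_ne_infty, h]

theorem lExact_lin (c : ℂ) (μ : OnePoint ℂ) : LExact (linOrd c μ) (expand μ (lin c)) := by
  induction μ using OnePoint.rec with
  | infty =>
    rw [linOrd_infty, expand_lin_infty]
    refine lExact_of ((lOrd_single _ _).sub ((lOrd_C c).mono (by omega))) ?_
    simp
  | coe μ =>
    by_cases h : μ = c
    · subst h
      rw [linOrd_self, expand_lin_self]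
      exact lExact_single 1 one_ne_zero
    · rw [linOrd_of_ne h, expand_lin_coe]
      refine lExact_of ((lOrd_C _).add ((lOrd_single 1 1).mono (by omega))) ?_
      simpa [sub_eq_zero] using h

theorem lExact_lin_zpow (c : ℂ) (μ : OnePoint ℂ) (e : ℤ) :
    LExact (e * linOrd c μ) (expand μ (lin c ^ e)) := by
  rw [expand_zpow]; exact (lExact_lin c μ).zpow e

/-! ### Rational functions without poles -/

theorem eval₂_locVar_coe (c : ℂ) (q : Polynomial ℂ) :
    LOrd 0 (Polynomial.eval₂ HahnSeries.C (locVar (c : OnePoint ℂ)) q) ∧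
      (Polynomial.eval₂ HahnSeries.C (locVar (c : OnePoint ℂ)) q).coeff 0 = q.eval c := by
  have hx : LOrd 0 (locVar (c : OnePoint ℂ)) :=
    (lOrd_C c).add ((lOrd_single 1 1).mono (by omega))
  have hx0 : (locVar (c : OnePoint ℂ)).coeff 0 = c := by simp [locVar]
  have hpow (k : ℕ) : LOrd 0 (locVar (c : OnePoint ℂ) ^ k) ∧
      (locVar (c : OnePoint ℂ) ^ k).coeff 0 = c ^ k := by
    induction k with
    | zero => exact ⟨by simpa using lOrd_one, by simp⟩
    | succ k ih =>
      refine ⟨by simpa using hx.pow (k + 1), ?_⟩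
      have := ih.1.coeff_mul_add hx
      rw [add_zero] at this
      rw [pow_succ, this, ih.2, hx0, pow_succ]
  induction q using Polynomial.induction_on' with
  | add p q hp hq =>
    rw [Polynomial.eval₂_add]
    exact ⟨hp.1.add hq.1, by rw [HahnSeries.coeff_add, hp.2, hq.2, Polynomial.eval_add]⟩
  | monomial k a =>
    rw [Polynomial.eval₂_monomial]
    refine ⟨(lOrd_C a).mul_le (hpow k).1 (by simp), ?_⟩
    have := (lOrd_C a).coeff_mul_add (hpow k).1
    rw [add_zero] at this
    rw [this, (hpow k).2]; simp

theorem eval₂_locVar_infty (q : Polynomial ℂ) (k : ℕ) :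
    (Polynomial.eval₂ HahnSeries.C (locVar ∞) q).coeff (-(k : ℤ)) = q.coeff k := by
  induction q using Polynomial.induction_on' with
  | add p q hp hq => rw [Polynomial.eval₂_add, HahnSeries.coeff_add, hp, hq, Polynomial.coeff_add]
  | monomial j a =>
    rw [Polynomial.eval₂_monomial, Polynomial.coeff_monomial]
    have : locVar ∞ ^ j = HahnSeries.single (-(j : ℤ)) 1 := by
      simp [locVar, HahnSeries.single_pow]
    rw [this, HahnSeries.C_apply, HahnSeries.single_mul_single, HahnSeries.coeff_single]
    by_cases h : j = k
    · simp [h]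
    · rw [if_neg h, if_neg (by omega)]

/-- A rational function without poles, vanishing at `∞`, is zero. -/
theorem eq_zero_of_forall_lOrd {f : RatFunc ℂ} (h : ∀ μ, LOrd (cut μ) (expand μ f)) : f = 0 := by
  -- At a root of the denominator, regularity would force the numerator to vanish as well, against
  -- coprimality. So the denominator is 1, and vanishing at ∞ then kills every coefficient of the
  -- numerator.
  have hroot (c : ℂ) : f.denom.eval c ≠ 0 := by
    intro hc
    have h1 : expand (c : OnePoint ℂ) f * Polynomial.eval₂ HahnSeries.C (locVar c) f.denom =
        Polynomial.eval₂ HahnSeries.C (locVar c) f.num :=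
      div_mul_cancel₀ _ (eval₂_locVar_ne_zero _ f.denom_ne_zero)
    have h2 := (h c).coeff_mul_add (eval₂_locVar_coe c f.denom).1
    rw [h1, cut_coe, add_zero, (eval₂_locVar_coe c f.denom).2, hc, mul_zero,
      (eval₂_locVar_coe c f.num).2] at h2
    obtain ⟨u, w, huw⟩ := f.isCoprime_num_denom
    have := congrArg (Polynomial.eval c) huw
    simp [h2, hc] at this
  have hden : f.denom = 1 := by
    refine f.monic_denom.natDegree_eq_zero.1 ?_
    by_contra hd
    obtain ⟨c, hc⟩ := IsAlgClosed.exists_root f.denom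
      (fun h0 => hd (Polynomial.natDegree_eq_of_degree_eq_some h0))
    exact hroot c hc
  have hf : expand ∞ f = Polynomial.eval₂ HahnSeries.C (locVar ∞) f.num := by
    change _ / Polynomial.eval₂ HahnSeries.C (locVar ∞) f.denom = _
    rw [hden]; simp
  have hnum : f.num = 0 := by
    ext k
    rw [← eval₂_locVar_infty, ← hf, (h ∞).coeff (by simp; omega)]; simp
  exact RatFunc.num_eq_zero_iff.1 hnum

/-! ### Principal parts -/

/-- The principal part at `ν` (the polynomial part if `ν = ∞`) of a Laurent series at `ν`. -/
def ppart : OnePoint ℂ → LaurentSeries ℂ → RatFunc ℂ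
  | ∞, F => ∑ᶠ i : ℕ, RatFunc.C (F.coeff (-(i : ℤ))) * RatFunc.X ^ i
  | (ν : ℂ), F => ∑ᶠ i : ℕ, RatFunc.C (F.coeff (-((i : ℤ) + 1))) *
      (RatFunc.X - RatFunc.C ν) ^ (-((i : ℤ) + 1))

theorem exists_ppart_infty (F : LaurentSeries ℂ) : ∃ s : Finset ℕ,
    (∀ i : ℕ, i ∉ s → F.coeff (-(i : ℤ)) = 0) ∧
    ppart ∞ F = ∑ i ∈ s, RatFunc.C (F.coeff (-(i : ℤ))) * lin 0 ^ (i : ℤ) := by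
  obtain ⟨k, hk⟩ := exists_lOrd F
  have hz (i : ℕ) (hi : i ∉ Finset.range (k.natAbs + 1)) : F.coeff (-(i : ℤ)) = 0 := by
    rw [Finset.mem_range] at hi; exact hk.coeff (by omega)
  refine ⟨_, hz, ?_⟩
  change ∑ᶠ i : ℕ, _ = _
  rw [finsum_eq_sum_of_support_subset (s := Finset.range (k.natAbs + 1))]
  · simp [lin_zero]
  · intro i hi
    by_contra h
    exact hi (by simp only [hz i h, map_zero, zero_mul])

theorem exists_ppart_coe (ν : ℂ) (F : LaurentSeries ℂ) : ∃ s : Finset ℕ,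
    (∀ i : ℕ, i ∉ s → F.coeff (-((i : ℤ) + 1)) = 0) ∧
    ppart (ν : OnePoint ℂ) F =
      ∑ i ∈ s, RatFunc.C (F.coeff (-((i : ℤ) + 1))) * lin ν ^ (-((i : ℤ) + 1)) := by
  obtain ⟨k, hk⟩ := exists_lOrd F
  have hz (i : ℕ) (hi : i ∉ Finset.range (k.natAbs + 1)) : F.coeff (-((i : ℤ) + 1)) = 0 := by
    rw [Finset.mem_range] at hi; exact hk.coeff (by omega)
  refine ⟨_, hz, ?_⟩
  change ∑ᶠ i : ℕ, _ = _
  rw [finsum_eq_sum_of_support_subset (s := Finset.range (k.natAbs + 1))]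
  · rfl
  · intro i hi
    by_contra h
    exact hi (by simp only [hz i h, map_zero, zero_mul])

theorem expand_lin_zpow_self (c : ℂ) (e : ℤ) :
    expand (c : OnePoint ℂ) (lin c ^ e) = HahnSeries.single e 1 := by
  rw [expand_zpow, expand_lin_self, ← RatFunc.single_zpow]

theorem expand_lin_zero_zpow_infty (e : ℤ) :
    expand ∞ (lin 0 ^ e) = HahnSeries.single (-e) 1 := by
  rw [expand_zpow, expand_lin_infty, map_zero, sub_zero, RatFunc.single_zpow, ← zpow_mul,
    RatFunc.single_zpow (-e)]
  simp

/-- The part at ∞ includes the constant term, so the remainder has order at least 1 there, but only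
order at least 0 at finite points. This asymmetry is the reason for `cut`: constants are assigned to
∞, and the decomposition into principal parts is unique. -/
theorem lOrd_sub_ppart (ν : OnePoint ℂ) (F : LaurentSeries ℂ) :
    LOrd (cut ν) (F - expand ν (ppart ν F)) := by
  induction ν using OnePoint.rec with
  | infty =>
    obtain ⟨s, hs, h⟩ := exists_ppart_infty F
    rw [h, expand_sum, lOrd_iff]
    intro d hd
    obtain ⟨j, rfl⟩ : ∃ j : ℕ, d = -(j : ℤ) := ⟨(-d).toNat, by rw [cut_infty] at hd; omega⟩
    rw [HahnSeries.coeff_sub, HahnSeries.coeff_sum, sub_eq_zero]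
    have : ∀ i ∈ s, (expand ∞ (RatFunc.C (F.coeff (-(i : ℤ))) * lin 0 ^ (i : ℤ))).coeff (-(j : ℤ)) =
        if i = j then F.coeff (-(j : ℤ)) else 0 := by
      intro i _
      rw [expand_mul, expand_C, expand_lin_zero_zpow_infty, HahnSeries.C_apply,
        HahnSeries.single_mul_single, HahnSeries.coeff_single]
      by_cases hij : i = j
      · simp [hij]
      · rw [if_neg hij, if_neg (by omega)]
    rw [Finset.sum_congr rfl this, Finset.sum_ite_eq' s j]
    split_ifs with hj
    · rfl
    · exact hs j hj
  | coe ν =>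
    obtain ⟨s, hs, h⟩ := exists_ppart_coe ν F
    rw [h, expand_sum, lOrd_iff]
    intro d hd
    obtain ⟨j, rfl⟩ : ∃ j : ℕ, d = -((j : ℤ) + 1) :=
      ⟨(-d - 1).toNat, by rw [cut_coe] at hd; omega⟩
    rw [HahnSeries.coeff_sub, HahnSeries.coeff_sum, sub_eq_zero]
    have : ∀ i ∈ s, (expand (ν : OnePoint ℂ) (RatFunc.C (F.coeff (-((i : ℤ) + 1))) *
        lin ν ^ (-((i : ℤ) + 1)))).coeff (-((j : ℤ) + 1)) =
        if i = j then F.coeff (-((j : ℤ) + 1)) else 0 := by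
      intro i _
      rw [expand_mul, expand_C, expand_lin_zpow_self, HahnSeries.C_apply,
        HahnSeries.single_mul_single, HahnSeries.coeff_single]
      by_cases hij : i = j
      · simp [hij]
      · rw [if_neg hij, if_neg (by omega)]
    rw [Finset.sum_congr rfl this, Finset.sum_ite_eq' s j]
    split_ifs with hj
    · rfl
    · exact hs j hj

theorem lOrd_ppart {μ ν : OnePoint ℂ} (h : μ ≠ ν) (F : LaurentSeries ℂ) :
    LOrd (cut μ) (expand μ (ppart ν F)) := by
  induction ν using OnePoint.rec with
  | infty =>
    obtain ⟨s, -, hs⟩ := exists_ppart_infty F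
    rw [hs, expand_sum]
    refine LOrd.sum fun i _ => ?_
    rw [expand_mul, expand_C]
    refine (lOrd_C _).mul_le (lExact_lin_zpow _ _ _).lOrd ?_
    induction μ using OnePoint.rec with
    | infty => exact absurd rfl h
    | coe μ =>
      by_cases h0 : μ = 0
      · subst h0; simp
      · simp [linOrd_of_ne h0]
  | coe ν =>
    obtain ⟨s, -, hs⟩ := exists_ppart_coe ν F
    rw [hs, expand_sum]
    refine LOrd.sum fun i _ => ?_
    rw [expand_mul, expand_C]
    refine (lOrd_C _).mul_le (lExact_lin_zpow _ _ _).lOrd ?_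
    induction μ using OnePoint.rec with
    | infty => simp
    | coe μ =>
      have h' : μ ≠ ν := fun h' => h (congrArg _ h')
      simp [linOrd_of_ne h']

/-- The principal part then satisfies the bound at ν as well as at all other points, so it has no
poles and vanishes at ∞. -/
theorem ppart_eq_zero {ν : OnePoint ℂ} {F : LaurentSeries ℂ} (h : LOrd (cut ν) F) :
    ppart ν F = 0 := by
  refine eq_zero_of_forall_lOrd fun μ => ?_
  by_cases hμ : μ = ν
  · subst hμ
    have := h.sub (lOrd_sub_ppart μ F)
    rwa [sub_sub_cancel] at this
  · exact lOrd_ppart hμ F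

theorem res_derivP (μ : OnePoint ℂ) (f : RatFunc ℂ) : res μ (expand μ (derivP f)) = 0 := by
  rw [expand_derivP, res_der]

theorem res_C_mul_expand (μ : OnePoint ℂ) (c : ℂ) (f : RatFunc ℂ) :
    res μ (expand μ (RatFunc.C c * f)) = c * res μ (expand μ f) := by
  rw [expand_mul, expand_C, res_C_mul]

theorem res_mul_eq_zero {μ : OnePoint ℂ} {F G : LaurentSeries ℂ} (hF : LOrd (cut μ) F)
    (hG : LOrd (cut μ) G) : res μ (F * G) = 0 :=
  res_eq_zero (hF.mul_le hG (by omega))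

/-- Every power other than the inverse has a rational primitive. -/
theorem res_lin_zpow (μ : OnePoint ℂ) (c : ℂ) {e : ℤ} (he : e ≠ -1) :
    res μ (expand μ (lin c ^ e)) = 0 := by
  have he' : (e : ℂ) + 1 ≠ 0 := by
    intro h; apply he; have : ((e + 1 : ℤ) : ℂ) = 0 := by push_cast; exact h
    have : e + 1 = 0 := by exact_mod_cast this
    omega
  have h : lin c ^ e = derivP (RatFunc.C (((e : ℂ) + 1)⁻¹) * lin c ^ (e + 1)) := by
    rw [derivP_C_mul, derivP_zpow (lin_ne_zero c), derivP_lin, zpow_add_one₀ (lin_ne_zero c)]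
    have h2 : RatFunc.C (((e : ℂ) + 1)⁻¹) * RatFunc.C ((e : ℂ) + 1) = 1 := by
      rw [← map_mul, inv_mul_cancel₀ he', map_one]
    have h3 := lin_ne_zero c
    push_cast
    rw [div_eq_mul_inv, one_mul]
    push_cast
    rw [map_add] at h2 ⊢
    linear_combination (norm := skip) (-(lin c) ^ e) * h2
    field_simp
    ring
  rw [h, res_derivP]

/-- The only nonzero residues are 1 at c and -1 at ∞. Together with the vanishing for the other
powers this is the residue theorem for principal parts. -/
theorem sum_res_lin_inv (c : ℂ) {S : Finset (OnePoint ℂ)} (hS : ∞ ∈ S) (hc : (c : OnePoint ℂ) ∈ S) :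
    ∑ μ ∈ S, res μ (expand μ (lin c ^ (-1 : ℤ))) = 0 := by
  classical
  have hne : (∞ : OnePoint ℂ) ≠ (c : OnePoint ℂ) := OnePoint.infty_ne_coe c
  rw [← Finset.add_sum_erase S _ hS, ← Finset.add_sum_erase (S.erase ∞) _
    (Finset.mem_erase.2 ⟨hne.symm, hc⟩), Finset.sum_eq_zero, add_zero]
  · rw [expand_lin_zpow_self, res_coe, res_infty]
    have h1 : LOrd 1 (expand ∞ (lin c ^ (-1 : ℤ))) := by
      simpa using (lExact_lin_zpow c ∞ (-1)).lOrd
    have h2 : LOrd (-1) (expand ∞ (lin c)) := by simpa using (lExact_lin c ∞).lOrd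
    have h3 := h1.coeff_mul_add h2
    rw [← expand_mul, ← zpow_add_one₀ (lin_ne_zero c), expand_lin_infty] at h3
    simp [expand_one] at h3
    simp [h3]
  · intro μ hμ
    simp only [Finset.mem_erase] at hμ
    induction μ using OnePoint.rec with
    | infty => exact absurd rfl hμ.2.1
    | coe μ =>
      refine res_eq_zero ((lExact_lin_zpow c μ (-1)).lOrd.mono ?_)
      rw [linOrd_of_ne (fun h => hμ.1 (by rw [h]))]; simp

theorem sum_res_ppart {S : Finset (OnePoint ℂ)} (hS : ∞ ∈ S) {ν : OnePoint ℂ} (hν : ν ∈ S)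
    (F : LaurentSeries ℂ) : ∑ μ ∈ S, res μ (expand μ (ppart ν F)) = 0 := by
  induction ν using OnePoint.rec with
  | infty =>
    obtain ⟨s, -, h⟩ := exists_ppart_infty F
    refine Finset.sum_eq_zero fun μ _ => ?_
    rw [h, expand_sum, map_sum]
    refine Finset.sum_eq_zero fun i _ => ?_
    rw [res_C_mul_expand, res_lin_zpow μ 0 (by omega), mul_zero]
  | coe ν =>
    obtain ⟨s, -, h⟩ := exists_ppart_coe ν F
    simp only [h, expand_sum, map_sum]
    rw [Finset.sum_comm]
    refine Finset.sum_eq_zero fun i _ => ?_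
    simp only [res_C_mul_expand]
    rw [← Finset.mul_sum]
    by_cases hi : i = 0
    · subst hi
      have := sum_res_lin_inv ν hS hν
      simp only [Nat.cast_zero, zero_add]
      rw [this, mul_zero]
    · rw [Finset.sum_eq_zero, mul_zero]
      intro μ _
      exact res_lin_zpow μ ν (by omega)

/-- A rational function is the sum of its principal parts. -/
theorem eq_sum_ppart {S : Finset (OnePoint ℂ)} {f : RatFunc ℂ}
    (hf : ∀ μ ∉ S, LOrd (cut μ) (expand μ f)) : f = ∑ ν ∈ S, ppart ν (expand ν f) := by
  classical
  rw [← sub_eq_zero]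
  refine eq_zero_of_forall_lOrd fun μ => ?_
  rw [expand_sub, expand_sum]
  by_cases hμ : μ ∈ S
  · rw [← Finset.add_sum_erase S _ hμ, ← sub_sub]
    refine (lOrd_sub_ppart μ _).sub (LOrd.sum fun ν hν => lOrd_ppart ?_ _)
    exact (Finset.ne_of_mem_erase hν).symm
  · exact (hf μ hμ).sub (LOrd.sum fun ν hν => lOrd_ppart (fun h => hμ (by rw [h]; exact hν)) _)

/-- The residue theorem on the Riemann sphere. -/
theorem sum_res_eq_zero {S : Finset (OnePoint ℂ)} (hS : ∞ ∈ S) {f : RatFunc ℂ}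
    (hf : ∀ μ ∉ S, LOrd (cut μ) (expand μ f)) : ∑ μ ∈ S, res μ (expand μ f) = 0 := by
  conv_lhs => rw [eq_sum_ppart hf]
  simp only [expand_sum, map_sum]
  rw [Finset.sum_comm]
  exact Finset.sum_eq_zero fun ν hν => sum_res_ppart hS hν _

/-! ### Tangent space, metric, multiplication and connection for the functions λ. -/

namespace MeroType

variable {τ : MeroType}

/-! ### The divisor of `λ` -/

variable (τ) in
/-- Labels of the zeros and of the finite marked points. -/
abbrev Lab : Type := Fin τ.L ⊕ Option (Fin τ.K)

variable (τ) in
/-- The zeros and the finite marked points. -/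
def sidx : Finset τ.Lab := Finset.univ.disjSum τ.marked

/-- The special point with label `c`. -/
def spt (x : τ.V) : τ.Lab → ℂ := Sum.elim (a x) (pt x)

variable (τ) in
/-- Minus the order of `λ` at the special point with label `c`. -/
def mult : τ.Lab → ℤ := Sum.elim (fun _ => -1) τ.ord

theorem inl_mem_sidx (i : Fin τ.L) : (Sum.inl i : τ.Lab) ∈ τ.sidx := by simp [sidx]

theorem inr_mem_sidx {k : Option (Fin τ.K)} : (Sum.inr k : τ.Lab) ∈ τ.sidx ↔ k ∈ τ.marked := by
  simp [sidx]

theorem some_mem_marked (j : Fin τ.K) : some j ∈ τ.marked := by simp [marked]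

theorem none_mem_marked : (none : Option (Fin τ.K)) ∈ τ.marked ↔ τ.s = 1 := by simp [marked]

theorem m₀_eq_zero (h : τ.s ≠ 1) : τ.m₀ = 0 := by
  rcases τ.s_cases with h' | h'
  · exact h'.2
  · exact absurd h'.1 h

theorem s_eq (τ : MeroType) : τ.s = 0 ∨ τ.s = 1 := by
  rcases τ.s_cases with h | h
  · exact Or.inl h.1
  · exact Or.inr h.1

theorem sum_marked {M : Type*} [AddCommMonoid M] (f : Option (Fin τ.K) → M)
    (h : τ.s ≠ 1 → f none = 0) : ∑ k ∈ τ.marked, f k = f none + ∑ j, f (some j) := by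
  rw [marked, Finset.sum_filter, Fintype.sum_option]
  congr 1
  · by_cases hs : τ.s = 1
    · simp [hs]
    · simp [hs, h hs]

theorem prod_marked {M : Type*} [CommMonoid M] (f : Option (Fin τ.K) → M)
    (h : τ.s ≠ 1 → f none = 1) : ∏ k ∈ τ.marked, f k = f none * ∏ j, f (some j) := by
  rw [marked, Finset.prod_filter, Fintype.prod_option]
  congr 1
  · by_cases hs : τ.s = 1
    · simp [hs]
    · simp [hs, h hs]

/-- Zeros and poles are treated uniformly as special points with integral multiplicities. For s = 0
the label of the point 0 is not marked, and its factor is trivial because m₀ = 0. -/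
theorem lam_eq (x : τ.V) : lam x = ∏ c ∈ τ.sidx, lin (spt x c) ^ (-τ.mult c) := by
  rw [sidx, Finset.prod_disjSum, lam]
  simp only [spt, mult, Sum.elim_inl, Sum.elim_inr, neg_neg, zpow_one]
  rw [prod_marked (fun k => lin (pt x k) ^ (-τ.ord k))
    (fun h => by simp [ord, m₀_eq_zero h])]
  simp only [pt, ord, lin_zero, zpow_neg, zpow_natCast, Finset.prod_inv_distrib, ← mul_inv,
    div_eq_mul_inv]
  rfl

theorem sum_mult : ∑ c ∈ τ.sidx, τ.mult c = -τ.n := by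
  rw [sidx, Finset.sum_disjSum]
  simp only [mult, Sum.elim_inl, Sum.elim_inr]
  rw [sum_marked _ (fun h => by simp [ord, m₀_eq_zero h])]
  simp [ord, n]; ring

theorem n_pos' (τ : MeroType) : 1 ≤ τ.n := τ.n_pos

theorem spt_inr_none (x : τ.V) : spt x (Sum.inr none) = 0 := rfl

theorem spt_injOn {x : τ.V} (hx : x ∈ τ.domain) : Set.InjOn (spt x) (τ.sidx : Set τ.Lab) := by
  obtain ⟨ha, hv, hav, h0⟩ := hx
  rintro (i | k) hc (i' | k') hc' h
  · rw [ha h]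
  · exfalso
    rcases k' with _ | j
    · exact (h0 (none_mem_marked.1 (inr_mem_sidx.1 hc'))).1 i h
    · exact hav i j h
  · exfalso
    rcases k with _ | j
    · exact (h0 (none_mem_marked.1 (inr_mem_sidx.1 hc))).1 i' h.symm
    · exact hav i' j h.symm
  · rcases k with _ | j <;> rcases k' with _ | j'
    · rfl
    · exact absurd h.symm ((h0 (none_mem_marked.1 (inr_mem_sidx.1 hc))).2 j')
    · exact absurd h ((h0 (none_mem_marked.1 (inr_mem_sidx.1 hc'))).2 j)
    · rw [hv h]

/-- The sum `∑ c, w c / (p - c) ^ k` over the special points. -/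
def psum (k : ℕ) (x : τ.V) (w : τ.Lab → ℂ) : RatFunc ℂ :=
  ∑ c ∈ τ.sidx, RatFunc.C (w c) * lin (spt x c) ^ (-(k : ℤ))

theorem psum_add (k : ℕ) (x : τ.V) (w w' : τ.Lab → ℂ) :
    psum k x (fun c => w c + w' c) = psum k x w + psum k x w' := by
  simp only [psum, map_add, add_mul, Finset.sum_add_distrib]

theorem psum_C_mul (k : ℕ) (x : τ.V) (z : ℂ) (w : τ.Lab → ℂ) :
    psum k x (fun c => z * w c) = RatFunc.C z * psum k x w := by
  simp only [psum, map_mul, Finset.mul_sum, mul_assoc]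

theorem psum_congr (k : ℕ) (x : τ.V) {w w' : τ.Lab → ℂ} (h : ∀ c ∈ τ.sidx, w c = w' c) :
    psum k x w = psum k x w' :=
  Finset.sum_congr rfl fun c hc => by rw [h c hc]

theorem lOrd_psum_of (k : ℕ) (x : τ.V) (w : τ.Lab → ℂ) {μ : ℂ}
    (h : ∀ c ∈ τ.sidx, spt x c = μ → w c = 0) : LOrd 0 (expand (μ : OnePoint ℂ) (psum k x w)) := by
  rw [psum, expand_sum]
  refine LOrd.sum fun c hc => ?_
  by_cases hμ : spt x c = μ
  · rw [h c hc hμ]; simp [expand_zero, lOrd_zero]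
  · rw [expand_mul, expand_C]
    refine (lOrd_C _).mul_le (lExact_lin_zpow _ _ _).lOrd ?_
    rw [linOrd_of_ne (Ne.symm hμ)]; simp

theorem lOrd_psum_infty (k : ℕ) (x : τ.V) (w : τ.Lab → ℂ) :
    LOrd k (expand ∞ (psum k x w)) := by
  rw [psum, expand_sum]
  refine LOrd.sum fun c _ => ?_
  rw [expand_mul, expand_C]
  exact (lOrd_C _).mul_le (lExact_lin_zpow _ _ _).lOrd (by simp)

theorem lOrd_psum_one (x : τ.V) (w : τ.Lab → ℂ) (μ : ℂ) :
    LOrd (-1) (expand (μ : OnePoint ℂ) (psum 1 x w)) := by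
  rw [psum, expand_sum]
  refine LOrd.sum fun c _ => ?_
  rw [expand_mul, expand_C]
  refine (lOrd_C _).mul_le (lExact_lin_zpow _ _ _).lOrd ?_
  by_cases h : μ = spt x c
  · rw [h, linOrd_self]; simp
  · rw [linOrd_of_ne h]; simp

theorem coeff_lin_inv_infty (c : ℂ) : (expand ∞ (lin c ^ (-1 : ℤ))).coeff 1 = 1 := by
  have h1 : LOrd 1 (expand ∞ (lin c ^ (-1 : ℤ))) := by
    simpa using (lExact_lin_zpow c ∞ (-1)).lOrd
  have h2 : LOrd (-1) (expand ∞ (lin c)) := by simpa using (lExact_lin c ∞).lOrd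
  have h3 := h1.coeff_mul_add h2
  rw [← expand_mul, ← zpow_add_one₀ (lin_ne_zero c), expand_lin_infty] at h3
  simp only [neg_add_cancel, zpow_zero, expand_one, add_neg_cancel, HahnSeries.coeff_one, if_true,
    HahnSeries.coeff_sub, HahnSeries.coeff_single_same, HahnSeries.C_apply] at h3
  simpa using h3.symm

theorem coeff_psum_infty (x : τ.V) (w : τ.Lab → ℂ) :
    (expand ∞ (psum 1 x w)).coeff 1 = ∑ c ∈ τ.sidx, w c := by
  rw [psum, expand_sum, HahnSeries.coeff_sum]
  refine Finset.sum_congr rfl fun c _ => ?_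
  rw [expand_mul, expand_C, HahnSeries.C_mul_eq_smul, HahnSeries.coeff_smul]
  simp only [Nat.cast_one]
  rw [coeff_lin_inv_infty]; simp

/-- The special points are distinct on the domain, so only one summand has a pole there. -/
theorem coeff_psum_self {x : τ.V} (hx : x ∈ τ.domain) (w : τ.Lab → ℂ) {c : τ.Lab}
    (hc : c ∈ τ.sidx) : (expand (spt x c : OnePoint ℂ) (psum 1 x w)).coeff (-1) = w c := by
  classical
  have h0 : LOrd 0 (expand (spt x c : OnePoint ℂ)
      (∑ c' ∈ τ.sidx.erase c, RatFunc.C (w c') * lin (spt x c') ^ (-((1 : ℕ) : ℤ)))) := by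
    rw [expand_sum]
    refine LOrd.sum fun c' hc' => ?_
    rw [Finset.mem_erase] at hc'
    rw [expand_mul, expand_C]
    refine (lOrd_C _).mul_le (lExact_lin_zpow _ _ _).lOrd ?_
    rw [linOrd_of_ne fun h => hc'.1 (spt_injOn hx hc'.2 hc h.symm)]; simp
  rw [psum, ← Finset.add_sum_erase _ _ hc, expand_add, HahnSeries.coeff_add,
    h0.coeff (by omega), add_zero, expand_mul, expand_C, Nat.cast_one, expand_lin_zpow_self]
  simp

theorem psum_eq_zero {x : τ.V} (hx : x ∈ τ.domain) {w : τ.Lab → ℂ} (h : psum 1 x w = 0)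
    {c : τ.Lab} (hc : c ∈ τ.sidx) : w c = 0 := by
  rw [← coeff_psum_self hx w hc, h, expand_zero]; rfl

theorem derivP_psum (k : ℕ) (x : τ.V) (w : τ.Lab → ℂ) :
    derivP (psum k x w) = psum (k + 1) x (fun c => -(k : ℂ) * w c) := by
  rw [psum, psum, derivP_sum]
  refine Finset.sum_congr rfl fun c _ => ?_
  rw [derivP_C_mul, derivP_zpow (lin_ne_zero _), derivP_lin]
  have h := lin_ne_zero (spt x c)
  rw [show (-((k + 1 : ℕ) : ℤ)) = -(k : ℤ) + -1 by push_cast; ring, zpow_add₀ h, map_mul]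
  push_cast
  rw [zpow_neg_one, one_div]; ring

/-- The order of `λ` at `μ`. -/
def lamOrd (x : τ.V) (μ : OnePoint ℂ) : ℤ := ∑ c ∈ τ.sidx, -τ.mult c * linOrd (spt x c) μ

theorem lExact_lam (x : τ.V) (μ : OnePoint ℂ) : LExact (lamOrd x μ) (expand μ (lam x)) := by
  rw [lam_eq, expand_prod]
  exact LExact.prod fun c _ => lExact_lin_zpow _ _ _

theorem lam_ne_zero (x : τ.V) : lam x ≠ 0 := by
  intro h
  exact (lExact_lam x ∞).ne_zero (by rw [h, expand_zero])

theorem lamOrd_infty (x : τ.V) : lamOrd x ∞ = -τ.n := by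
  simp [lamOrd, ← sum_mult]

theorem lamOrd_spt {x : τ.V} (hx : x ∈ τ.domain) {c : τ.Lab} (hc : c ∈ τ.sidx) :
    lamOrd x (spt x c) = -τ.mult c := by
  rw [lamOrd, Finset.sum_eq_single_of_mem c hc]
  · simp
  · intro c' hc' hne
    rw [linOrd_of_ne fun h => hne (spt_injOn hx hc' hc h.symm)]; simp

theorem lamOrd_of_ne (x : τ.V) {μ : ℂ} (h : ∀ c ∈ τ.sidx, spt x c ≠ μ) : lamOrd x μ = 0 :=
  Finset.sum_eq_zero fun c hc => by rw [linOrd_of_ne (h c hc).symm]; simp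

/-- The logarithmic derivative `λ_p / λ`. -/
def rho (x : τ.V) : RatFunc ℂ := psum 1 x fun c => -(τ.mult c : ℂ)

theorem derivP_lam (x : τ.V) : derivP (lam x) = lam x * rho x := by
  rw [lam_eq, derivP_prod _ _ fun c _ => zpow_ne_zero _ (lin_ne_zero _), ← lam_eq, rho, psum]
  congr 1
  refine Finset.sum_congr rfl fun c _ => ?_
  rw [derivP_zpow (lin_ne_zero _), derivP_lin,
    mul_div_cancel_left₀ _ (zpow_ne_zero _ (lin_ne_zero _))]
  simp

/-- The logarithmic derivative of `λ` in the direction `ξ`. -/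
def yy (x ξ : τ.V) : RatFunc ℂ := psum 1 x fun c => (τ.mult c : ℂ) * spt ξ c

theorem tangent_eq (x ξ : τ.V) : tangent x ξ = lam x * yy x ξ := by
  rw [yy, psum, sidx, Finset.sum_disjSum]
  rw [sum_marked _ (fun h => by simp [mult, ord, m₀_eq_zero h])]
  simp only [spt, mult, pt, Sum.elim_inl, Sum.elim_inr, tangent, ord, Nat.cast_one, zpow_neg_one]
  simp only [mul_zero, map_zero, zero_mul, zero_add, mul_add, Finset.mul_sum]
  congr 1
  · refine Finset.sum_congr rfl fun i _ => ?_
    change _ = lam x * (_ * (RatFunc.X - RatFunc.C (a x i))⁻¹)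
    rw [div_eq_mul_inv]; push_cast; simp only [neg_mul, one_mul, map_neg]; ring
  · refine Finset.sum_congr rfl fun j _ => ?_
    change _ = lam x * (_ * (RatFunc.X - RatFunc.C (v x j))⁻¹)
    rw [div_eq_mul_inv]; push_cast; simp only [map_mul]; ring

/-- The finite set of marked points. -/
def gam (x : τ.V) : Finset (OnePoint ℂ) := by
  classical exact insert ∞ (τ.marked.image fun k => (pt x k : OnePoint ℂ))

theorem infty_mem_gam (x : τ.V) : ∞ ∈ gam x := by simp [gam]

theorem pt_mem_gam (x : τ.V) {k : Option (Fin τ.K)} (hk : k ∈ τ.marked) :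
    (pt x k : OnePoint ℂ) ∈ gam x := by
  simp only [gam, Finset.mem_insert, Finset.mem_image]
  exact Or.inr ⟨k, hk, rfl⟩

theorem mem_gam {x : τ.V} {μ : OnePoint ℂ} :
    μ ∈ gam x ↔ μ = ∞ ∨ ∃ k ∈ τ.marked, μ = (pt x k : OnePoint ℂ) := by
  simp only [gam, Finset.mem_insert, Finset.mem_image, eq_comm]

theorem pt_injOn {x : τ.V} (hx : x ∈ τ.domain) : Set.InjOn (pt x) (τ.marked : Set _) := by
  intro k hk l hl h
  have := spt_injOn hx (inr_mem_sidx.2 hk) (inr_mem_sidx.2 hl) h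
  simpa using this

theorem sum_gam {x : τ.V} (hx : x ∈ τ.domain) {M : Type*} [AddCommMonoid M]
    (f : OnePoint ℂ → M) : ∑ μ ∈ gam x, f μ = f ∞ + ∑ k ∈ τ.marked, f (pt x k) := by
  classical
  rw [gam, Finset.sum_insert, Finset.sum_image]
  · intro k hk l hl h
    exact pt_injOn hx hk hl (OnePoint.coe_injective h)
  · simp [OnePoint.coe_ne_infty]

/-- A finite point is a marked point, a zero of `λ`, or a point where `λ` is a unit. -/
theorem point_cases {x : τ.V} (hx : x ∈ τ.domain) (μ : ℂ) :
    (∃ k ∈ τ.marked, μ = pt x k ∧ lamOrd x μ = -τ.ord k) ∨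
    (∃ i, μ = a x i ∧ lamOrd x μ = 1 ∧ (μ : OnePoint ℂ) ∉ gam x) ∨
    ((∀ c ∈ τ.sidx, spt x c ≠ μ) ∧ lamOrd x μ = 0 ∧ (μ : OnePoint ℂ) ∉ gam x) := by
  by_cases h : ∃ c ∈ τ.sidx, spt x c = μ
  · obtain ⟨c, hc, rfl⟩ := h
    have h1 := lamOrd_spt hx hc
    rcases c with i | k
    · refine Or.inr (Or.inl ⟨i, rfl, by simpa [mult] using h1, fun hmem => ?_⟩)
      rcases mem_gam.1 hmem with h | ⟨k, hk, h⟩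
      · exact OnePoint.coe_ne_infty _ h
      · have := spt_injOn hx hc (inr_mem_sidx.2 hk) (OnePoint.coe_injective h)
        simp at this
    · exact Or.inl ⟨k, inr_mem_sidx.1 hc, rfl, by simpa [mult] using h1⟩
  · push Not at h
    refine Or.inr (Or.inr ⟨h, lamOrd_of_ne x h, fun hmem => ?_⟩)
    rcases mem_gam.1 hmem with h' | ⟨k, hk, h'⟩
    · exact OnePoint.coe_ne_infty _ h'
    · exact h _ (inr_mem_sidx.2 hk) (OnePoint.coe_injective h').symm

open Classical in
/-- The order of `λ_p` at the marked points, and zero elsewhere. -/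
def lb (x : τ.V) (μ : OnePoint ℂ) : ℤ := if μ ∈ gam x then lamOrd x μ - 1 + 2 * cut μ else 0

theorem lb_infty (x : τ.V) : lb x ∞ = 1 - τ.n := by
  rw [lb, if_pos (infty_mem_gam x), lamOrd_infty, cut_infty]; ring

theorem lb_pt {x : τ.V} (hx : x ∈ τ.domain) {k : Option (Fin τ.K)} (hk : k ∈ τ.marked) :
    lb x (pt x k) = -τ.ord k - 1 := by
  rw [lb, if_pos (pt_mem_gam x hk), cut_coe]
  have := lamOrd_spt hx (inr_mem_sidx.2 hk)
  simp only [spt, mult, Sum.elim_inr] at this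
  rw [this]; ring

theorem lb_of_notMem {x : τ.V} {μ : OnePoint ℂ} (h : μ ∉ gam x) : lb x μ = 0 := if_neg h

theorem neg_one_le_ord (k : Option (Fin τ.K)) : -1 ≤ τ.ord k := by
  rcases k with _ | j
  · rcases τ.s_cases with h | h
    · simp [ord, h.2]
    · simp only [ord]; omega
  · simp only [ord]; omega

theorem ord_ne_zero {k : Option (Fin τ.K)} (hk : k ∈ τ.marked) : τ.ord k ≠ 0 := by
  rcases k with _ | j
  · have := none_mem_marked.1 hk
    rcases τ.s_cases with h | h
    · omega
    · simp only [ord]; omega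
  · have := τ.m_pos j; simp only [ord]; omega

theorem mult_ne_zero {c : τ.Lab} (hc : c ∈ τ.sidx) : τ.mult c ≠ 0 := by
  rcases c with i | k
  · simp [mult]
  · exact ord_ne_zero (inr_mem_sidx.1 hc)

/-- This is where n ≥ 1 and m_k ≥ -1 enter: a zero of λ at the marked point 0 is harmless as long as
it is simple, since then λ_p is a unit there. -/
theorem lb_nonpos {x : τ.V} (hx : x ∈ τ.domain) (μ : OnePoint ℂ) : lb x μ ≤ 0 := by
  by_cases h : μ ∈ gam x
  · rcases mem_gam.1 h with rfl | ⟨k, hk, rfl⟩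
    · rw [lb_infty]; have := τ.n_pos'; omega
    · rw [lb_pt hx hk]; have := neg_one_le_ord k; omega
  · rw [lb_of_notMem h]

theorem lExact_rho_infty (x : τ.V) : LExact 1 (expand ∞ (rho x)) := by
  refine lExact_of (lOrd_psum_infty 1 x _) ?_
  rw [rho, coeff_psum_infty, Finset.sum_neg_distrib, ← Int.cast_sum, sum_mult]
  have := τ.n_pos'
  simp; omega

theorem coeff_rho_infty (x : τ.V) : (expand ∞ (rho x)).coeff 1 = τ.n := by
  rw [rho, coeff_psum_infty, Finset.sum_neg_distrib, ← Int.cast_sum, sum_mult]; simp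

theorem coeff_rho_pt {x : τ.V} (hx : x ∈ τ.domain) {k : Option (Fin τ.K)} (hk : k ∈ τ.marked) :
    (expand (pt x k : OnePoint ℂ) (rho x)).coeff (-1) = -(τ.ord k : ℂ) := by
  have h := coeff_psum_self hx (fun c => -(τ.mult c : ℂ)) (inr_mem_sidx.2 hk)
  exact h

theorem lExact_rho_pt {x : τ.V} (hx : x ∈ τ.domain) {k : Option (Fin τ.K)} (hk : k ∈ τ.marked) :
    LExact (-1) (expand (pt x k : OnePoint ℂ) (rho x)) := by
  refine lExact_of (lOrd_psum_one x _ _) ?_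
  rw [coeff_rho_pt hx hk]
  have := ord_ne_zero hk
  simpa using this

/-- At a finite marked point λ has nonzero order, so λ_p/λ has exactly a simple pole; at ∞ it
vanishes to order exactly 1 because n ≠ 0. The exactness allows division by λ_p at the marked
points. -/
theorem lExact_derivP_lam {x : τ.V} (hx : x ∈ τ.domain) {μ : OnePoint ℂ} (h : μ ∈ gam x) :
    LExact (lb x μ) (expand μ (derivP (lam x))) := by
  rw [derivP_lam, expand_mul]
  rcases mem_gam.1 h with rfl | ⟨k, hk, rfl⟩
  · rw [lb_infty, show 1 - τ.n = lamOrd x ∞ + 1 by rw [lamOrd_infty]; ring]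
    exact (lExact_lam x _).mul (lExact_rho_infty x)
  · rw [lb, if_pos h, cut_coe, show lamOrd x (pt x k) - 1 + 2 * 0 = lamOrd x (pt x k) + -1 by ring]
    exact (lExact_lam x _).mul (lExact_rho_pt hx hk)

theorem derivP_lam_ne_zero {x : τ.V} (hx : x ∈ τ.domain) : derivP (lam x) ≠ 0 := by
  intro h
  exact (lExact_derivP_lam hx (infty_mem_gam x)).ne_zero (by rw [h, expand_zero])

/-! ### Rational functions with poles at the marked points only -/

/-- `f` is regular away from the marked points. -/
def InR (x : τ.V) (f : RatFunc ℂ) : Prop := ∀ μ ∉ gam x, LOrd 0 (expand μ f)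

theorem InR.add {x : τ.V} {f g : RatFunc ℂ} (hf : InR x f) (hg : InR x g) : InR x (f + g) :=
  fun μ h => by rw [expand_add]; exact (hf μ h).add (hg μ h)

theorem InR.sub {x : τ.V} {f g : RatFunc ℂ} (hf : InR x f) (hg : InR x g) : InR x (f - g) :=
  fun μ h => by rw [expand_sub]; exact (hf μ h).sub (hg μ h)

theorem InR.mul {x : τ.V} {f g : RatFunc ℂ} (hf : InR x f) (hg : InR x g) : InR x (f * g) :=
  fun μ h => by rw [expand_mul]; exact (hf μ h).mul_le (hg μ h) (by simp)

theorem InR.pow {x : τ.V} {f : RatFunc ℂ} (hf : InR x f) (k : ℕ) : InR x (f ^ k) :=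
  fun μ h => by rw [expand_pow]; simpa using (hf μ h).pow k

theorem InR.sum {x : τ.V} {ι : Type*} {s : Finset ι} {f : ι → RatFunc ℂ}
    (hf : ∀ i ∈ s, InR x (f i)) : InR x (∑ i ∈ s, f i) :=
  fun μ h => by rw [expand_sum]; exact LOrd.sum fun i hi => hf i hi μ h

theorem InR.derivP {x : τ.V} {f : RatFunc ℂ} (hf : InR x f) : InR x (derivP f) :=
  fun μ h => by rw [expand_derivP]; exact (hf μ h).der_zero

theorem inR_C (x : τ.V) (c : ℂ) : InR x (RatFunc.C c) := fun μ _ => by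
  rw [expand_C]; exact lOrd_C c

theorem inR_one (x : τ.V) : InR x 1 := by simpa using inR_C x 1

theorem inR_zero (x : τ.V) : InR x 0 := by simpa using inR_C x 0

theorem inR_X (x : τ.V) : InR x RatFunc.X := fun μ h => by
  induction μ using OnePoint.rec with
  | infty => exact absurd (infty_mem_gam x) h
  | coe μ =>
    rw [← lin_zero]
    refine (lExact_lin 0 μ).lOrd.mono ?_
    by_cases h0 : μ = 0
    · subst h0; simp
    · rw [linOrd_of_ne h0]

theorem InR.lOrd_cut {x : τ.V} {f : RatFunc ℂ} (hf : InR x f) {μ : OnePoint ℂ} (h : μ ∉ gam x) :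
    LOrd (cut μ) (expand μ f) := by
  have : cut μ = 0 := by
    induction μ using OnePoint.rec with
    | infty => exact absurd (infty_mem_gam x) h
    | coe μ => rfl
  rw [this]; exact hf μ h

theorem InR.sum_res {x : τ.V} {f : RatFunc ℂ} (hf : InR x f) :
    ∑ μ ∈ gam x, res μ (expand μ f) = 0 :=
  sum_res_eq_zero (infty_mem_gam x) fun _ h => hf.lOrd_cut h

theorem inR_ppart {x : τ.V} {ν : OnePoint ℂ} (hν : ν ∈ gam x) (F : LaurentSeries ℂ) :
    InR x (ppart ν F) := fun μ h =>
  (lOrd_ppart (fun h' => h (by rw [h']; exact hν)) F).mono (cut_nonneg μ)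

/-- The factor `p ^ (-s)`. -/
def ps (τ : MeroType) : RatFunc ℂ := RatFunc.X⁻¹ ^ τ.s

theorem ps_eq (τ : MeroType) : ps τ = lin 0 ^ (-(τ.s : ℤ)) := by
  rw [ps, lin_zero, zpow_neg, zpow_natCast, inv_pow]

theorem ps_ne_zero : ps τ ≠ 0 := by rw [ps_eq]; exact zpow_ne_zero _ (lin_ne_zero 0)

theorem ps_mul_X_pow : ps τ * RatFunc.X ^ τ.s = 1 := by
  rw [ps, ← mul_pow, inv_mul_cancel₀, one_pow]
  rw [← lin_zero]; exact lin_ne_zero 0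

theorem lOrd_ps_infty : LOrd (τ.s : ℤ) (expand ∞ (ps τ)) := by
  rw [ps_eq]; simpa using (lExact_lin_zpow 0 ∞ (-(τ.s : ℤ))).lOrd

theorem lOrd_ps_coe {μ : ℂ} (h : τ.s = 1 → μ ≠ 0) : LOrd 0 (expand (μ : OnePoint ℂ) (ps τ)) := by
  rw [ps_eq]
  refine (lExact_lin_zpow 0 μ (-(τ.s : ℤ))).lOrd.mono ?_
  rcases τ.s_eq with hs | hs
  · simp [hs]
  · rw [linOrd_of_ne (h hs)]; simp

theorem lOrd_ps_zero : LOrd (-(τ.s : ℤ)) (expand ((0 : ℂ) : OnePoint ℂ) (ps τ)) := by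
  rw [ps_eq]; simpa using (lExact_lin_zpow 0 ((0 : ℂ) : OnePoint ℂ) (-(τ.s : ℤ))).lOrd

theorem ne_zero_of_notMem {x : τ.V} {μ : ℂ} (h : (μ : OnePoint ℂ) ∉ gam x) (hs : τ.s = 1) :
    μ ≠ 0 := by
  rintro rfl
  exact h (pt_mem_gam x (none_mem_marked.2 hs))

theorem inR_ps (x : τ.V) : InR x (ps τ) := fun μ h => by
  induction μ using OnePoint.rec with
  | infty => exact absurd (infty_mem_gam x) h
  | coe μ => exact lOrd_ps_coe (ne_zero_of_notMem h)

/-! ### The tangent space -/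

/-- `p ^ (-s)` times the function of `p` that is identified with the tangent vector `ξ`. -/
def xt (x ξ : τ.V) : RatFunc ℂ := ps τ * tangent x ξ

theorem tangent_eq_xt (x ξ : τ.V) : tangent x ξ = RatFunc.X ^ τ.s * xt x ξ := by
  rw [xt, ← mul_assoc, mul_comm (RatFunc.X ^ τ.s), ps_mul_X_pow, one_mul]

/-- The pole bounds that characterize `p ^ (-s) T_λ`. -/
def InT (x : τ.V) (f : RatFunc ℂ) : Prop := ∀ μ, LOrd (lb x μ + cut μ) (expand μ f)

theorem InT.inR {x : τ.V} {f : RatFunc ℂ} (h : InT x f) : InR x f := fun μ hμ => by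
  refine (h μ).mono ?_
  rw [lb_of_notMem hμ]; have := cut_nonneg μ; omega

theorem sum_mult_spt (hs : τ.s = 0) (ξ : τ.V) : ∑ c ∈ τ.sidx, (τ.mult c : ℂ) * spt ξ c = 0 := by
  rw [sidx, Finset.sum_disjSum]
  rw [sum_marked _ (fun h => by simp [mult, ord, m₀_eq_zero h])]
  have := ξ.2 hs
  simp only [mult, spt, Sum.elim_inl, Sum.elim_inr, pt, ord, mul_zero, zero_add]
  push_cast
  simp only [neg_mul, one_mul, Finset.sum_neg_distrib, a, v]
  rw [this]; ring

/-- A tangent vector is λ times a sum of simple fractions. The simple poles are cancelled at the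
zeros of λ and raise the pole order by one at the v_k. At the fixed point 0 the velocity is zero,
which makes room for the factor 1/p. At ∞ with s = 0 the normalisation of the coordinates removes
the leading term of the sum. -/
theorem inT_xt {x : τ.V} (hx : x ∈ τ.domain) (ξ : τ.V) : InT x (xt x ξ) := by
  intro μ
  rw [xt, tangent_eq, expand_mul, expand_mul]
  induction μ using OnePoint.rec with
  | infty =>
    have hy : LOrd (2 - τ.s) (expand ∞ (yy x ξ)) := by
      have h1 := lOrd_psum_infty 1 x fun c => (τ.mult c : ℂ) * spt ξ c
      rcases τ.s_eq with hs | hs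
      · rw [lOrd_iff, hs]
        intro d hd
        by_cases hd1 : d = 1
        · subst hd1; rw [yy, coeff_psum_infty, sum_mult_spt hs]
        · exact h1.coeff (by push_cast at hd ⊢; omega)
      · exact h1.mono (by simp [hs])
    refine (lOrd_ps_infty (τ := τ)).mul_le ((lExact_lam x ∞).lOrd.mul hy) ?_
    rw [lb_infty, lamOrd_infty, cut_infty]; omega
  | coe μ =>
    rw [cut_coe, add_zero]
    rcases point_cases hx μ with ⟨k, hk, rfl, hl⟩ | ⟨i, rfl, hl, hg⟩ | ⟨hne, hl, hg⟩
    · rw [lb_pt hx hk]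
      by_cases hk0 : τ.s = 1 ∧ k = none
      · obtain ⟨hs, rfl⟩ := hk0
        have hy : LOrd 0 (expand ((pt x none : ℂ) : OnePoint ℂ) (yy x ξ)) := by
          refine lOrd_psum_of 1 x _ fun c hc h => ?_
          rw [spt_injOn hx hc (inr_mem_sidx.2 hk) h, spt_inr_none, mul_zero]
        refine (lOrd_ps_zero (τ := τ)).mul_le ((lExact_lam x (pt x none)).lOrd.mul hy) ?_
        rw [hl, hs]; push_cast; omega
      · refine (lOrd_ps_coe fun hs h0 => hk0 ⟨hs, ?_⟩).mul_le
          ((lExact_lam x (pt x k)).lOrd.mul (lOrd_psum_one x _ _)) ?_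
        · exact pt_injOn hx hk (none_mem_marked.2 hs) h0
        · rw [hl]; omega
    · rw [lb_of_notMem hg]
      refine (lOrd_ps_coe (ne_zero_of_notMem hg)).mul_le
          ((lExact_lam x (a x i)).lOrd.mul (lOrd_psum_one x _ _)) ?_
      rw [hl]; omega
    · rw [lb_of_notMem hg]
      refine (lOrd_ps_coe (ne_zero_of_notMem hg)).mul_le
          ((lExact_lam x μ).lOrd.mul (lOrd_psum_of 1 x _ fun c hc h => absurd h (hne c hc))) ?_
      rw [hl]; omega

theorem xt_add (x ξ ζ : τ.V) : xt x (ξ + ζ) = xt x ξ + xt x ζ := by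
  have : yy x (ξ + ζ) = yy x ξ + yy x ζ := by
    rw [yy, yy, yy, ← psum_add]
    refine psum_congr 1 x fun c _ => ?_
    rcases c with i | _ | j <;> simp [spt, a, v, pt] <;> ring
  rw [xt, xt, xt, tangent_eq, tangent_eq, tangent_eq, this]; ring

theorem xt_smul (x : τ.V) (z : ℂ) (ξ : τ.V) : xt x (z • ξ) = RatFunc.C z * xt x ξ := by
  have : yy x (z • ξ) = RatFunc.C z * yy x ξ := by
    rw [yy, yy, ← psum_C_mul]
    refine psum_congr 1 x fun c _ => ?_
    rcases c with i | _ | j <;> simp [spt, a, v, pt] <;> ring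
  rw [xt, xt, tangent_eq, tangent_eq, this]; ring

theorem eq_zero_of_xt_eq_zero {x : τ.V} (hx : x ∈ τ.domain) {ξ : τ.V} (h : xt x ξ = 0) :
    ξ = 0 := by
  rw [xt, tangent_eq] at h
  have hy : yy x ξ = 0 := by
    simpa [ps_ne_zero, lam_ne_zero] using h
  have hw (c : τ.Lab) (hc : c ∈ τ.sidx) : spt ξ c = 0 := by
    have := psum_eq_zero hx hy hc
    have h2 : (τ.mult c : ℂ) ≠ 0 := by exact_mod_cast mult_ne_zero hc
    simpa [h2] using this
  refine Subtype.ext (Prod.ext (funext fun i => ?_) (funext fun j => ?_))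
  · exact hw (Sum.inl i) (inl_mem_sidx i)
  · exact hw (Sum.inr (some j)) (inr_mem_sidx.2 (some_mem_marked j))

/-- Converse of `inT_xt`: p^s f/λ has at most simple poles, only at special points, and vanishes at
∞. It is therefore a sum of simple fractions, and the velocities are read off from its residues. -/
theorem exists_xt_eq {x : τ.V} (hx : x ∈ τ.domain) {f : RatFunc ℂ} (hf : InT x f) :
    ∃ ξ : τ.V, xt x ξ = f := by
  set g := RatFunc.X ^ τ.s * f / lam x with hg
  have hgexp (μ : OnePoint ℂ) : expand μ g =
      expand μ (lin 0 ^ (τ.s : ℤ)) * (expand μ f * (expand μ (lam x))⁻¹) := by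
    rw [hg, expand_div, expand_mul, div_eq_mul_inv, lin_zero, zpow_natCast]; ring
  have hg0 : LOrd (2 - (τ.s : ℤ)) (expand ∞ g) := by
    rw [hgexp]
    refine (lExact_lin_zpow 0 ∞ τ.s).lOrd.mul_le ((hf ∞).mul (lExact_lam x ∞).inv.lOrd) ?_
    rw [lb_infty, lamOrd_infty, cut_infty, linOrd_infty]; omega
  have hs1 : (τ.s : ℤ) ≤ 1 := by rcases τ.s_eq with h | h <;> rw [h] <;> norm_num
  have hX (μ : ℂ) : LOrd 0 (expand (μ : OnePoint ℂ) (lin 0 ^ (τ.s : ℤ))) := by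
    refine (lExact_lin_zpow 0 μ τ.s).lOrd.mono ?_
    by_cases h0 : μ = 0
    · subst h0; simp
    · rw [linOrd_of_ne h0]; simp
  have hgμ (μ : ℂ) : LOrd (-1) (expand (μ : OnePoint ℂ) g) ∧
      ((τ.s = 1 ∧ μ = 0 ∨ ∀ c ∈ τ.sidx, spt x c ≠ μ) → LOrd 0 (expand (μ : OnePoint ℂ) g)) := by
    rw [hgexp]
    have hfμ := hf μ
    have hl := (lExact_lam x μ).inv.lOrd
    rw [cut_coe, add_zero] at hfμ
    rcases point_cases hx μ with ⟨k, hk, rfl, hl'⟩ | ⟨i, rfl, hl', hg'⟩ | ⟨hne, hl', hg'⟩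
    · rw [lb_pt hx hk] at hfμ
      refine ⟨(hX _).mul_le (hfμ.mul hl) (by rw [hl']; omega), ?_⟩
      rintro (⟨hs, h0⟩ | h)
      · refine LOrd.mul_le (k := 1) ?_ (hfμ.mul hl) (by rw [hl']; omega)
        rw [h0, hs]
        simpa using (lExact_lin_zpow 0 ((0 : ℂ) : OnePoint ℂ) 1).lOrd
      · exact absurd rfl (h _ (inr_mem_sidx.2 hk))
    · rw [lb_of_notMem hg'] at hfμ
      refine ⟨(hX _).mul_le (hfμ.mul hl) (by rw [hl']; omega), ?_⟩
      rintro (⟨hs, h0⟩ | h)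
      · exact absurd h0 (ne_zero_of_notMem hg' hs)
      · exact absurd rfl (h _ (inl_mem_sidx i))
    · rw [lb_of_notMem hg'] at hfμ
      exact ⟨(hX _).mul_le (hfμ.mul hl) (by rw [hl']; omega),
        fun _ => (hX _).mul_le (hfμ.mul hl) (by rw [hl']; omega)⟩
  set w : τ.Lab → ℂ := fun c => (expand (spt x c : OnePoint ℂ) g).coeff (-1) with hw
  have hgw : g = psum 1 x w := by
    rw [← sub_eq_zero]
    refine eq_zero_of_forall_lOrd fun μ => ?_
    rw [expand_sub]
    induction μ using OnePoint.rec with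
    | infty => exact (hg0.mono (by rw [cut_infty]; omega)).sub (lOrd_psum_infty 1 x w)
    | coe μ =>
      rw [cut_coe]
      by_cases h : ∃ c ∈ τ.sidx, spt x c = μ
      · obtain ⟨c, hc, rfl⟩ := h
        have h1 := (hgμ (spt x c)).1.sub (lOrd_psum_one x w (spt x c))
        rw [lOrd_iff] at h1 ⊢
        intro d hd
        by_cases hd1 : d = -1
        · subst hd1
          rw [HahnSeries.coeff_sub, coeff_psum_self hx w hc, sub_self]
        · exact h1 d (by omega)
      · push Not at h
        exact ((hgμ μ).2 (Or.inr h)).sub (lOrd_psum_of 1 x w fun c hc h' => absurd h' (h c hc))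
  -- The two constraints on a tangent vector are recovered from the bounds: no motion of the point 0
  -- for s = 1, and for s = 0 the linear relation, which is the vanishing of the coefficient of 1/p
  -- at ∞.
  have hw0 : τ.s = 1 → w (Sum.inr none) = 0 := fun hs =>
    ((hgμ 0).2 (Or.inl ⟨hs, rfl⟩)).coeff (by norm_num)
  have hwsum : τ.s = 0 → ∑ c ∈ τ.sidx, w c = 0 := fun hs => by
    rw [← coeff_psum_infty x w, ← hgw]
    exact hg0.coeff (by rw [hs]; norm_num)
  have hm (j : Fin τ.K) : ((τ.m j : ℕ) : ℂ) ≠ 0 := by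
    have := τ.m_pos j; exact_mod_cast (by omega : τ.m j ≠ 0)
  -- The weight of a simple fraction is the multiplicity times the velocity, and the multiplicity of
  -- a zero is -1.
  let ξ0 : (Fin τ.L → ℂ) × (Fin τ.K → ℂ) :=
    (fun i => -w (Sum.inl i), fun j => w (Sum.inr (some j)) / τ.m j)
  have hξ0 : ξ0 ∈ τ.coordSpace := by
    intro hs
    have h := hwsum hs
    have hnm : none ∉ τ.marked := fun h' => by rw [none_mem_marked] at h'; omega
    have hmk : τ.marked = Finset.univ.map Function.Embedding.some := by
      ext k; rcases k with _ | j
      · simp [hnm]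
      · simp [some_mem_marked]
    rw [sidx, Finset.sum_disjSum, hmk, Finset.sum_map] at h
    simp only [ξ0, Finset.sum_neg_distrib]
    rw [Finset.sum_congr rfl fun j _ => mul_div_cancel₀ (w (Sum.inr (some j))) (hm j)]
    simp only [Function.Embedding.some_apply] at h
    linear_combination -h
  refine ⟨⟨ξ0, hξ0⟩, ?_⟩
  have hy : yy x ⟨ξ0, hξ0⟩ = g := by
    rw [hgw, yy]
    refine psum_congr 1 x fun c hc => ?_
    rcases c with i | _ | j
    · simp [mult, spt, a, ξ0]
    · have hs := none_mem_marked.1 (inr_mem_sidx.1 hc)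
      rw [hw0 hs, spt_inr_none, mul_zero]
    · simp only [mult, spt, pt, v, ξ0, Sum.elim_inr, ord, Int.cast_natCast]
      exact mul_div_cancel₀ _ (hm j)
  rw [xt, tangent_eq, hy, hg, mul_div_cancel₀ _ (lam_ne_zero x), ← mul_assoc, ps_mul_X_pow,
    one_mul]

theorem C_sgn_mul_self (ν : OnePoint ℂ) : RatFunc.C (sgn ν) * RatFunc.C (sgn ν) = 1 := by
  rw [← map_mul, sgn_mul_self, map_one]

theorem inR_lam {x : τ.V} (hx : x ∈ τ.domain) : InR x (lam x) := fun μ h => by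
  refine (lExact_lam x μ).lOrd.mono ?_
  induction μ using OnePoint.rec with
  | infty => exact absurd (infty_mem_gam x) h
  | coe μ =>
    rcases point_cases hx μ with ⟨k, hk, rfl, hl⟩ | ⟨i, rfl, hl, hg⟩ | ⟨hne, hl, hg⟩
    · exact absurd (pt_mem_gam x hk) h
    · omega
    · omega

theorem inR_xt {x : τ.V} (hx : x ∈ τ.domain) (ξ : τ.V) : InR x (xt x ξ) := (inT_xt hx ξ).inR

theorem inR_tangent {x : τ.V} (hx : x ∈ τ.domain) (ξ : τ.V) : InR x (tangent x ξ) := by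
  rw [tangent_eq_xt]; exact ((inR_X x).pow _).mul (inR_xt hx ξ)

/-- The tangent vector `p ^ s (λ_p α_- - (λ_p α)_-)` attached to a Laurent series `α` at `ν`. -/
def lift (x : τ.V) (ν : OnePoint ℂ) (α : LaurentSeries ℂ) : RatFunc ℂ :=
  RatFunc.C (sgn ν) * (derivP (lam x) * ppart ν α - ppart ν (expand ν (derivP (lam x)) * α))

theorem lOrd_derivP_lam {x : τ.V} (hx : x ∈ τ.domain) (μ : OnePoint ℂ) :
    LOrd (lb x μ) (expand μ (derivP (lam x))) := by
  by_cases h : μ ∈ gam x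
  · exact (lExact_derivP_lam hx h).lOrd
  · rw [lb_of_notMem h]; exact (inR_lam hx).derivP μ h

/-- Away from ν both principal parts are harmless. At ν the difference is rewritten in terms of the
complementary parts, λ_p α minus its principal part and λ_p times (α minus its principal part), and
each of them meets the bound. -/
theorem inT_lift {x : τ.V} (hx : x ∈ τ.domain) (ν : OnePoint ℂ)
    (α : LaurentSeries ℂ) : InT x (lift x ν α) := by
  intro μ
  have hlb := lb_nonpos hx μ
  rw [lift, expand_mul, expand_C, expand_sub, expand_mul]
  refine (lOrd_C _).mul_le ?_ (zero_add _).ge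
  by_cases h : μ = ν
  · subst h
    have h1 : expand μ (derivP (lam x)) * expand μ (ppart μ α) -
        expand μ (ppart μ (expand μ (derivP (lam x)) * α)) =
        (expand μ (derivP (lam x)) * α - expand μ (ppart μ (expand μ (derivP (lam x)) * α))) -
        expand μ (derivP (lam x)) * (α - expand μ (ppart μ α)) := by ring
    rw [h1]
    exact ((lOrd_sub_ppart μ _).mono (by omega)).sub
      ((lOrd_derivP_lam hx μ).mul (lOrd_sub_ppart μ α))
  · exact ((lOrd_derivP_lam hx μ).mul (lOrd_ppart h α)).sub ((lOrd_ppart h _).mono (by omega))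

/-- Dividing by λ_p shows that K is regular at the finite marked points and vanishes at ∞, while it
is regular elsewhere by assumption. So K = 0: the tangent space meets λ_p R only in zero. -/
theorem eq_zero_of_inT_of_eq_mul {x : τ.V} (hx : x ∈ τ.domain) {f K : RatFunc ℂ} (hf : InT x f)
    (hK : InR x K) (h : f = derivP (lam x) * K) : f = 0 := by
  have hK0 : K = 0 := by
    refine eq_zero_of_forall_lOrd fun μ => ?_
    by_cases hμ : μ ∈ gam x
    · have hKf : K = f * (derivP (lam x))⁻¹ := by
        rw [h]; field_simp [derivP_lam_ne_zero hx]
      rw [hKf, expand_mul, expand_inv]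
      exact (hf μ).mul_le (lExact_derivP_lam hx hμ).inv.lOrd (by omega)
    · exact hK.lOrd_cut hμ
  rw [h, hK0, mul_zero]

/-- It suffices to decompose the principal part of f at each marked point. There the lift of f/λ_p
is, up to sign, λ_p (f/λ_p)_- - f_-, which exhibits f_- as a tangent vector plus a multiple of λ_p.
-/
theorem exists_xt_add {x : τ.V} (hx : x ∈ τ.domain) {f : RatFunc ℂ} (hf : InR x f) :
    ∃ (ξ : τ.V) (K : RatFunc ℂ), InR x K ∧ f = xt x ξ + derivP (lam x) * K := by
  have h1 (ν : OnePoint ℂ) (hν : ν ∈ gam x) : ∃ (ξ : τ.V) (K : RatFunc ℂ), InR x K ∧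
      ppart ν (expand ν f) = xt x ξ + derivP (lam x) * K := by
    set α := (expand ν (derivP (lam x)))⁻¹ * expand ν f with hα
    obtain ⟨ξ, hξ⟩ := exists_xt_eq hx (inT_lift hx ν α)
    refine ⟨(-sgn ν) • ξ, ppart ν α, inR_ppart hν _, ?_⟩
    rw [xt_smul, hξ, lift, hα, mul_inv_cancel_left₀ (expand_ne_zero ν (derivP_lam_ne_zero hx)),
      map_neg]
    linear_combination (derivP (lam x) * ppart ν ((expand ν (derivP (lam x)))⁻¹ * expand ν f) -
      ppart ν (expand ν f)) * C_sgn_mul_self ν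
  choose! ξ K hK h using h1
  refine ⟨∑ ν ∈ gam x, ξ ν, ∑ ν ∈ gam x, K ν, InR.sum hK, ?_⟩
  have hsum : xt x (∑ ν ∈ gam x, ξ ν) = ∑ ν ∈ gam x, xt x (ξ ν) := by
    have h0 : xt x 0 = 0 := by simpa using xt_smul x 0 (0 : τ.V)
    exact map_sum (AddMonoidHom.mk' (xt x) (xt_add x)) ξ (gam x)
  rw [hsum, Finset.mul_sum, ← Finset.sum_add_distrib, ← Finset.sum_congr rfl h]
  exact eq_sum_ppart fun μ hμ => hf.lOrd_cut hμ

/-! ### The metric -/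

/-- The functional `f ↦ -∑ res (f / λ_p)`, the sum being over the marked points. -/
def phi (x : τ.V) (f : RatFunc ℂ) : ℂ := -∑ μ ∈ gam x, res μ (expand μ (f / derivP (lam x)))

theorem phi_add (x : τ.V) (f g : RatFunc ℂ) : phi x (f + g) = phi x f + phi x g := by
  simp only [phi, add_div, expand_add, map_add, Finset.sum_add_distrib]; ring

theorem phi_C_mul (x : τ.V) (z : ℂ) (f : RatFunc ℂ) : phi x (RatFunc.C z * f) = z * phi x f := by
  simp only [phi, mul_div_assoc, res_C_mul_expand, ← Finset.mul_sum]; ring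

theorem phi_derivP_lam_mul {x : τ.V} (hx : x ∈ τ.domain) {K : RatFunc ℂ} (hK : InR x K) :
    phi x (derivP (lam x) * K) = 0 := by
  rw [phi, mul_div_cancel_left₀ _ (derivP_lam_ne_zero hx), hK.sum_res, neg_zero]

theorem lOrd_div_derivP_lam {x : τ.V} (hx : x ∈ τ.domain) {f : RatFunc ℂ} (hf : InT x f)
    {μ : OnePoint ℂ} (hμ : μ ∈ gam x) : LOrd (cut μ) (expand μ (f / derivP (lam x))) := by
  rw [div_eq_mul_inv, expand_mul, expand_inv]
  exact (hf μ).mul_le (lExact_derivP_lam hx hμ).inv.lOrd (by omega)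

/-- The summand λ_p α_- of the lift contributes zero by the residue theorem. The summand (λ_p α)_-
has a residue only at ν, and there it may be replaced by λ_p α itself, because the remainder has no
residue against f/λ_p. Thus the lift of α represents the covector of α at ν. -/
theorem phi_lift_mul {x : τ.V} (hx : x ∈ τ.domain) {ν : OnePoint ℂ} (hν : ν ∈ gam x)
    (α : LaurentSeries ℂ) {f : RatFunc ℂ} (hf : InT x f) :
    phi x (lift x ν α * f) = sgn ν * res ν (α * expand ν f) := by
  have hd := derivP_lam_ne_zero hx
  set q := f / derivP (lam x) with hq
  have hfq : f = derivP (lam x) * q := by rw [hq, mul_div_cancel₀ _ hd]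
  set G := expand ν (derivP (lam x)) * α with hG
  have h1 : lift x ν α * f = RatFunc.C (sgn ν) * (derivP (lam x) * (ppart ν α * f)) +
      RatFunc.C (-sgn ν) * (ppart ν G * f) := by
    rw [lift, map_neg]; ring
  have h2 : phi x (ppart ν G * f) = -res ν (α * expand ν f) := by
    rw [phi, mul_div_assoc, ← hq, Finset.sum_eq_single_of_mem ν hν]
    · have h3 : expand ν (ppart ν G * q) = α * expand ν f -
          (G - expand ν (ppart ν G)) * expand ν q := by
        rw [hfq, expand_mul, expand_mul, hG]; ring
      rw [h3, map_sub, res_mul_eq_zero (lOrd_sub_ppart ν G) (lOrd_div_derivP_lam hx hf hν), sub_zero]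
    · intro μ hμ hne
      rw [expand_mul]
      exact res_mul_eq_zero (lOrd_ppart hne G) (lOrd_div_derivP_lam hx hf hμ)
  rw [h1, phi_add, phi_C_mul, phi_C_mul, h2,
    phi_derivP_lam_mul hx ((inR_ppart hν α).mul hf.inR)]
  ring

/-- The bound s ≤ 1 is used here: the pole of p^s at ∞ is no worse than the order gained from one
cut-off. -/
theorem lOrd_X_pow (μ : OnePoint ℂ) : LOrd (-cut μ) (expand μ (RatFunc.X ^ τ.s)) := by
  rw [← lin_zero, ← zpow_natCast]
  refine (lExact_lin_zpow 0 μ τ.s).lOrd.mono ?_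
  induction μ using OnePoint.rec with
  | infty => rcases τ.s_eq with h | h <;> simp [h]
  | coe μ =>
    by_cases h0 : μ = 0
    · subst h0; simp
    · rw [linOrd_of_ne h0]; simp

theorem phi_lift_mul_lift_mul {x : τ.V} (hx : x ∈ τ.domain) {ν : OnePoint ℂ} (hν : ν ∈ gam x)
    (α β : LaurentSeries ℂ) {f : RatFunc ℂ} (hf : InT x f) {d : LaurentSeries ℂ}
    (hd' : d = expand ν (derivP (lam x))) :
    phi x (RatFunc.X ^ τ.s * lift x ν α * lift x ν β * f) =
      res ν (expand ν (RatFunc.X ^ τ.s) * expand ν f * (d * α * β -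
        expand ν (ppart ν (d * α)) * β - α * expand ν (ppart ν (d * β)))) := by
  have hd := derivP_lam_ne_zero hx
  set q := f / derivP (lam x) with hq
  have hfq : f = derivP (lam x) * q := by rw [hq, mul_div_cancel₀ _ hd]
  -- In the product of the two lifts every term except (λ_p α)_- (λ_p β)_- carries a factor λ_p and
  -- is killed by the residue theorem.
  rw [show phi x _ = phi x (derivP (lam x) * (RatFunc.X ^ τ.s * f *
      (derivP (lam x) * ppart ν α * ppart ν β - ppart ν α * ppart ν (d * β) -
        ppart ν β * ppart ν (d * α))) +
      RatFunc.X ^ τ.s * ppart ν (d * α) * ppart ν (d * β) * f) by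
    rw [lift, lift, ← hd']; congr 1
    linear_combination RatFunc.X ^ τ.s * f * (derivP (lam x) * ppart ν α - ppart ν (d * α)) *
      (derivP (lam x) * ppart ν β - ppart ν (d * β)) * C_sgn_mul_self ν]
  have hP (γ : LaurentSeries ℂ) : InR x (ppart ν γ) := inR_ppart hν γ
  rw [phi_add, phi_derivP_lam_mul hx, zero_add]
  · rw [phi, mul_div_assoc, ← hq, Finset.sum_eq_single_of_mem ν hν]
    · rw [← map_neg, ← sub_eq_zero, ← map_sub]
      -- The discrepancy is p^s times the product of the two complementary parts times f/λ_p, which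
      -- is too regular at ν to have a residue.
      have h3 : -expand ν (RatFunc.X ^ τ.s * ppart ν (d * α) * ppart ν (d * β) * q) -
          expand ν (RatFunc.X ^ τ.s) * expand ν f * (d * α * β -
          expand ν (ppart ν (d * α)) * β - α * expand ν (ppart ν (d * β))) =
          (expand ν (RatFunc.X ^ τ.s) * ((d * α - expand ν (ppart ν (d * α))) *
          (d * β - expand ν (ppart ν (d * β))))) * (-expand ν q) := by
        rw [hfq]; simp only [expand_mul, ← hd']; ring
      rw [h3]
      exact res_mul_eq_zero ((lOrd_X_pow ν).mul_le ((lOrd_sub_ppart ν _).mul (lOrd_sub_ppart ν _))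
        (by omega)) (lOrd_div_derivP_lam hx hf hν).neg
    · intro μ hμ hne
      simp only [expand_mul]
      exact res_mul_eq_zero (((lOrd_X_pow μ).mul (lOrd_ppart hne _)).mul_le (lOrd_ppart hne _)
        (by omega)) (lOrd_div_derivP_lam hx hf hμ)
  · exact (((inR_X x).pow _).mul hf.inR).mul
      (((((inR_lam hx).derivP.mul (hP _)).mul (hP _)).sub ((hP _).mul (hP _))).sub
        ((hP _).mul (hP _)))

/-! ### The trace form and the multiplication `∘` -/

theorem trSeries_eq (ν : OnePoint ℂ) (F : LaurentSeries ℂ) :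
    trSeries τ.s ν F = sgn ν * res ν (expand ν (ps τ) * F) := by
  have h : expand ν (ps τ) = (locVar ν)⁻¹ ^ τ.s := by rw [ps, expand_pow, expand_inv, expand_X]
  rw [h]
  induction ν using OnePoint.rec with
  | infty =>
    rw [res_infty, sgn_infty]
    change ((locVar ∞)⁻¹ ^ τ.s * F).coeff 1 = _
    ring
  | coe ν => rw [res_coe, sgn_coe, one_mul]; rfl

theorem tr_eq (ν : OnePoint ℂ) (f : RatFunc ℂ) :
    tr τ.s ν f = sgn ν * res ν (expand ν (ps τ * f)) := by
  rw [tr, trSeries_eq, expand_mul]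

theorem pairing_eq (ν : OnePoint ℂ) (x : τ.V) (α : RatFunc ℂ) (ξ : τ.V) :
    pairing ν x α ξ = sgn ν * res ν (expand ν α * expand ν (xt x ξ)) := by
  rw [pairing, tr_eq, ← mul_assoc, ← xt, expand_mul, mul_comm (expand ν (xt x ξ))]

/-- The truncation keeps the principal part at ∞ but removes it at a finite point. After subtracting
one half of the function the two cases differ only by the sign of the trace form. -/
theorem circ_eq (ν : OnePoint ℂ) (x : τ.V) (α β : RatFunc ℂ) :
    circ τ.s ν (lam x) α β = RatFunc.C (sgn ν) * (RatFunc.X ^ τ.s * (derivP (lam x) * α * β -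
      ppart ν (expand ν (derivP (lam x)) * expand ν α) * β -
      α * ppart ν (expand ν (derivP (lam x)) * expand ν β))) := by
  have h (γ : RatFunc ℂ) : ell τ.s ν (RatFunc.X ^ τ.s * derivP (lam x) * γ) =
      RatFunc.C (sgn ν) * (RatFunc.X ^ τ.s * (RatFunc.C (1 / 2) * (derivP (lam x) * γ) -
        ppart ν (expand ν (derivP (lam x)) * expand ν γ))) := by
    have h1 : RatFunc.X⁻¹ ^ τ.s * (RatFunc.X ^ τ.s * derivP (lam x) * γ) = derivP (lam x) * γ := by
      have := ps_mul_X_pow (τ := τ)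
      rw [ps] at this
      linear_combination derivP (lam x) * γ * this
    have h2 : (RatFunc.C (1 / 2) : RatFunc ℂ) + RatFunc.C (1 / 2) = 1 := by
      rw [← map_add]; norm_num
    rw [ell, h1, ← expand_mul]
    induction ν using OnePoint.rec with
    | infty =>
      rw [sgn_infty, map_neg, map_one]
      change RatFunc.X ^ τ.s * ppart ∞ (expand ∞ (derivP (lam x) * γ)) - _ = _
      ring
    | coe ν =>
      rw [sgn_coe, map_one, one_mul]
      change RatFunc.X ^ τ.s * (_ - ppart (ν : OnePoint ℂ) (expand ν (derivP (lam x) * γ))) - _ = _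
      linear_combination -(RatFunc.X ^ τ.s * derivP (lam x) * γ) * h2
  have h2 : (RatFunc.C (1 / 2) : RatFunc ℂ) + RatFunc.C (1 / 2) = 1 := by
    rw [← map_add]; norm_num
  rw [circ, h, h]
  linear_combination (RatFunc.C (sgn ν) * RatFunc.X ^ τ.s * derivP (lam x) * α * β) * h2

theorem tr_circ {x : τ.V} {ν : OnePoint ℂ} (hν : ν ∈ gam x) (α β : RatFunc ℂ) :
    tr τ.s ν (circ τ.s ν (lam x) α β) =
      sgn ν * res ν (expand ν α * expand ν (lift x ν (expand ν β))) := by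
  set d := derivP (lam x) with hd
  set f := expand ν d * expand ν α with hf
  set g := expand ν d * expand ν β with hg
  have hs : sgn ν * sgn ν = 1 := sgn_mul_self ν
  have h1 : ps τ * circ τ.s ν (lam x) α β = RatFunc.C (sgn ν) * (d * α * β - ppart ν f * β -
      α * ppart ν g) := by
    rw [circ_eq]
    linear_combination RatFunc.C (sgn ν) * (d * α * β - ppart ν f * β - α * ppart ν g) *
      ps_mul_X_pow (τ := τ)
  have h2 : expand ν α * expand ν (lift x ν (expand ν β)) =
      HahnSeries.C (sgn ν) * (expand ν α * (expand ν d * expand ν (ppart ν (expand ν β)) -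
        expand ν (ppart ν g))) := by
    rw [lift, expand_mul, expand_C, expand_sub, expand_mul]; ring
  rw [tr_eq, h1, res_C_mul_expand, h2, res_C_mul, ← mul_assoc, ← mul_assoc, hs, one_mul, one_mul,
    ← sub_eq_zero, ← map_sub]
  -- The discrepancy is a product of two complementary parts, which has no residue at ν, minus a
  -- product of two principal parts. The latter has no residue at ν because the residue theorem
  -- leaves ν as the only possible contribution.
  have h3 : expand ν (d * α * β - ppart ν f * β - α * ppart ν g) -
      expand ν α * (expand ν d * expand ν (ppart ν (expand ν β)) - expand ν (ppart ν g)) =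
      (f - expand ν (ppart ν f)) * (expand ν β - expand ν (ppart ν (expand ν β))) -
      expand ν (ppart ν f * ppart ν (expand ν β)) := by
    simp only [expand_sub, expand_mul, hf]; ring
  rw [h3, map_sub, res_mul_eq_zero (lOrd_sub_ppart ν _) (lOrd_sub_ppart ν _), zero_sub, neg_eq_zero]
  have h4 := ((inR_ppart hν f).mul (inR_ppart hν (expand ν β))).sum_res
  rwa [Finset.sum_eq_single_of_mem ν hν] at h4
  intro μ _ hne
  rw [expand_mul]
  exact res_mul_eq_zero (lOrd_ppart hne _) (lOrd_ppart hne _)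

theorem pairing_circ {x : τ.V} (hx : x ∈ τ.domain) {ν : OnePoint ℂ} (hν : ν ∈ gam x)
    (α β : RatFunc ℂ) (ξ : τ.V) : pairing ν x (circ τ.s ν (lam x) α β) ξ =
      phi x (RatFunc.X ^ τ.s * lift x ν (expand ν α) * lift x ν (expand ν β) * xt x ξ) := by
  rw [phi_lift_mul_lift_mul hx hν _ _ (inT_xt hx ξ) rfl, pairing_eq, ← res_C_mul]
  congr 1
  rw [circ_eq]
  simp only [expand_mul, expand_sub, expand_C]
  have h : (HahnSeries.C (sgn ν) : LaurentSeries ℂ) * HahnSeries.C (sgn ν) = 1 := by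
    rw [← map_mul, sgn_mul_self, map_one]
  linear_combination (expand ν (RatFunc.X ^ τ.s) * expand ν (xt x ξ) *
    (expand ν (derivP (lam x)) * expand ν α * expand ν β -
        expand ν (ppart ν (expand ν (derivP (lam x)) * expand ν α)) * expand ν β -
      expand ν α * expand ν (ppart ν (expand ν (derivP (lam x)) * expand ν β)))) * h

end MeroType

/-- A bilinear map on a finite-dimensional space as a continuous bilinear map. -/
def toCBilin {V F : Type*} [NormedAddCommGroup V] [NormedSpace ℂ V] [FiniteDimensional ℂ V]
    [NormedAddCommGroup F] [NormedSpace ℂ F] (B : V →ₗ[ℂ] V →ₗ[ℂ] F) : V →L[ℂ] V →L[ℂ] F :=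
  LinearMap.toContinuousLinearMap
    ((LinearMap.toContinuousLinearMap (𝕜 := ℂ) (E := V) (F' := F)).toLinearMap ∘ₗ B)

@[simp] theorem toCBilin_apply {V F : Type*} [NormedAddCommGroup V] [NormedSpace ℂ V]
    [FiniteDimensional ℂ V] [NormedAddCommGroup F] [NormedSpace ℂ F]
    (B : V →ₗ[ℂ] V →ₗ[ℂ] F) (x y : V) : toCBilin B x y = B x y := rfl

/-- If `Ψ` is injective modulo `N` and `B` takes values in `range Ψ + N`, then `B` lifts to a
bilinear map modulo `N`. -/
theorem exists_bilin_lift {V M : Type*} [NormedAddCommGroup V] [NormedSpace ℂ V]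
    [FiniteDimensional ℂ V] [AddCommGroup M] [Module ℂ M] (Ψ : V →ₗ[ℂ] M) (N : Submodule ℂ M)
    (B : V →ₗ[ℂ] V →ₗ[ℂ] M) (hinj : ∀ w, Ψ w ∈ N → w = 0) (hB : ∀ x y, ∃ w, B x y - Ψ w ∈ N) :
    ∃ G : V →L[ℂ] V →L[ℂ] V, ∀ x y, B x y - Ψ (G x y) ∈ N := by
  -- Composing `B` with a linear left inverse of `Ψ` modulo `N` makes the chosen representatives
  -- automatically bilinear.
  obtain ⟨g, hg⟩ := LinearMap.exists_leftInverse_of_injective (N.mkQ ∘ₗ Ψ) (by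
    rw [LinearMap.ker_eq_bot']
    intro w hw
    exact hinj w (by simpa using hw))
  refine ⟨toCBilin (B.compr₂ (g ∘ₗ N.mkQ)), fun x y => ?_⟩
  obtain ⟨w, hw⟩ := hB x y
  have h1 : N.mkQ (B x y) = N.mkQ (Ψ w) := by
    exact (Submodule.Quotient.eq N).2 hw
  have h2 : g (N.mkQ (B x y)) = w := by
    rw [h1]; exact LinearMap.congr_fun hg w
  rw [toCBilin_apply, LinearMap.compr₂_apply, LinearMap.comp_apply, h2]
  exact hw

namespace MeroType

variable {τ : MeroType}

theorem smul_eq_C (z : ℂ) (f : RatFunc ℂ) : z • f = RatFunc.C z * f := RatFunc.smul_eq_C_mul z f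

/-- `xt` as a linear map. -/
def xtL (x : τ.V) : τ.V →ₗ[ℂ] RatFunc ℂ where
  toFun := xt x
  map_add' := xt_add x
  map_smul' z ξ := by rw [xt_smul, RingHom.id_apply, smul_eq_C]

@[simp] theorem xtL_apply (x ξ : τ.V) : xtL x ξ = xt x ξ := rfl

/-- The metric, as a bilinear form. -/
def metricL (x : τ.V) : τ.V →ₗ[ℂ] τ.V →ₗ[ℂ] ℂ :=
  LinearMap.mk₂ ℂ (fun ξ ζ => phi x (xt x ξ * xt x ζ))
    (fun ξ ξ' ζ => by rw [xt_add, add_mul, phi_add])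
    (fun z ξ ζ => by rw [xt_smul, mul_assoc, phi_C_mul, smul_eq_mul])
    (fun ξ ζ ζ' => by rw [xt_add, mul_add, phi_add])
    (fun z ξ ζ => by rw [xt_smul, mul_left_comm, phi_C_mul, smul_eq_mul])

/-- The multiples of `λ_p` by functions regular away from the marked points. -/
def idealN (x : τ.V) : Submodule ℂ (RatFunc ℂ) where
  carrier := {f | ∃ K, InR x K ∧ f = derivP (lam x) * K}
  add_mem' := by
    rintro _ _ ⟨K, hK, rfl⟩ ⟨K', hK', rfl⟩
    exact ⟨K + K', hK.add hK', by ring⟩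
  zero_mem' := ⟨0, inR_zero x, by simp⟩
  smul_mem' := by
    rintro z _ ⟨K, hK, rfl⟩
    exact ⟨RatFunc.C z * K, (inR_C x z).mul hK, by rw [smul_eq_C]; ring⟩

/-- `p ^ s X Y` as a bilinear map. -/
def prodL (x : τ.V) : τ.V →ₗ[ℂ] τ.V →ₗ[ℂ] RatFunc ℂ :=
  LinearMap.mk₂ ℂ (fun ξ ζ => RatFunc.X ^ τ.s * xt x ξ * xt x ζ)
    (fun ξ ξ' ζ => by rw [xt_add]; ring)
    (fun z ξ ζ => by rw [xt_smul, smul_eq_C]; ring)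
    (fun ξ ζ ζ' => by rw [xt_add]; ring)
    (fun z ξ ζ => by rw [xt_smul, smul_eq_C]; ring)

theorem exists_mul {x : τ.V} (hx : x ∈ τ.domain) : ∃ G : τ.V →L[ℂ] τ.V →L[ℂ] τ.V,
    ∀ ξ ζ, prodL x ξ ζ - xtL x (G ξ ζ) ∈ idealN x := by
  refine exists_bilin_lift (xtL x) (idealN x) (prodL x) ?_ fun ξ ζ => ?_
  · rintro w ⟨K, hK, h⟩
    exact eq_zero_of_xt_eq_zero hx (eq_zero_of_inT_of_eq_mul hx (inT_xt hx w) hK h)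
  · obtain ⟨w, K, hK, h⟩ := exists_xt_add hx
      ((((inR_X x).pow τ.s).mul (inR_xt hx ξ)).mul (inR_xt hx ζ))
    exact ⟨w, K, hK, by
      rw [sub_eq_iff_eq_add, xtL_apply, add_comm]; exact h⟩

open Classical in
/-- The multiplication of tangent vectors. -/
def mulV (x : τ.V) : τ.V →L[ℂ] τ.V →L[ℂ] τ.V :=
  if hx : x ∈ τ.domain then (exists_mul hx).choose else 0

theorem mulV_spec {x : τ.V} (hx : x ∈ τ.domain) (ξ ζ : τ.V) : ∃ K, InR x K ∧
    RatFunc.X ^ τ.s * xt x ξ * xt x ζ = xt x (mulV x ξ ζ) + derivP (lam x) * K := by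
  obtain ⟨K, hK, h⟩ := (exists_mul hx).choose_spec ξ ζ
  refine ⟨K, hK, ?_⟩
  rw [mulV, dif_pos hx, ← h]
  change _ = _ + (RatFunc.X ^ τ.s * xt x ξ * xt x ζ - xt x _)
  ring

theorem mulV_unique {x : τ.V} (hx : x ∈ τ.domain) {ξ ζ w : τ.V} {K : RatFunc ℂ} (hK : InR x K)
    (h : RatFunc.X ^ τ.s * xt x ξ * xt x ζ = xt x w + derivP (lam x) * K) : mulV x ξ ζ = w := by
  obtain ⟨K', hK', h'⟩ := mulV_spec hx ξ ζ
  rw [← sub_eq_zero]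
  refine eq_zero_of_xt_eq_zero hx (eq_zero_of_inT_of_eq_mul hx (inT_xt hx _) (hK.sub hK') ?_)
  have : xt x (mulV x ξ ζ - w) = xt x (mulV x ξ ζ) - xt x w := map_sub (xtL x) _ _
  rw [this]; linear_combination h - h'

theorem mulV_comm {x : τ.V} (hx : x ∈ τ.domain) (ξ ζ : τ.V) : mulV x ξ ζ = mulV x ζ ξ := by
  obtain ⟨K, hK, h⟩ := mulV_spec hx ζ ξ
  exact mulV_unique hx hK (by rw [← h]; ring)

theorem mulV_assoc {x : τ.V} (hx : x ∈ τ.domain) (ξ ζ ω : τ.V) :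
    mulV x (mulV x ξ ζ) ω = mulV x ξ (mulV x ζ ω) := by
  obtain ⟨K, hK, h⟩ := mulV_spec hx ξ ζ
  obtain ⟨K', hK', h'⟩ := mulV_spec hx ζ ω
  obtain ⟨K'', hK'', h''⟩ := mulV_spec hx ξ (mulV x ζ ω)
  have hX (ξ : τ.V) : InR x (RatFunc.X ^ τ.s * xt x ξ) := ((inR_X x).pow τ.s).mul (inR_xt hx ξ)
  refine mulV_unique hx (K := K'' + RatFunc.X ^ τ.s * xt x ξ * K' - RatFunc.X ^ τ.s * xt x ω * K)
    ((hK''.add ((hX ξ).mul hK')).sub ((hX ω).mul hK)) ?_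
  linear_combination h'' + RatFunc.X ^ τ.s * xt x ξ * h' - RatFunc.X ^ τ.s * xt x ω * h

/-- The metric. -/
def metricV (x : τ.V) : τ.V →L[ℂ] τ.V →L[ℂ] ℂ := toCBilin (metricL x)

theorem metricV_apply (x ξ ζ : τ.V) : metricV x ξ ζ = phi x (xt x ξ * xt x ζ) := rfl

theorem metricV_symm (x ξ ζ : τ.V) : metricV x ξ ζ = metricV x ζ ξ := by
  rw [metricV_apply, metricV_apply, mul_comm]

theorem metricV_mulV {x : τ.V} (hx : x ∈ τ.domain) (ξ ζ ω : τ.V) :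
    metricV x (mulV x ξ ζ) ω = phi x (RatFunc.X ^ τ.s * xt x ξ * xt x ζ * xt x ω) := by
  obtain ⟨K, hK, h⟩ := mulV_spec hx ξ ζ
  rw [metricV_apply, h, add_mul, phi_add, mul_assoc,
    phi_derivP_lam_mul hx (hK.mul (inR_xt hx ω)), add_zero]

/-- Both sides are φ of p^s times the product of the three functions, since φ does not see multiples
of λ_p. -/
theorem metricV_invariant {x : τ.V} (hx : x ∈ τ.domain) (ξ ζ ω : τ.V) :
    metricV x ξ (mulV x ζ ω) = metricV x (mulV x ξ ζ) ω := by
  rw [metricV_symm, metricV_mulV hx, metricV_mulV hx]; congr 1; ring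

theorem metricV_lift {x : τ.V} (hx : x ∈ τ.domain) {ν : OnePoint ℂ} (hν : ν ∈ gam x)
    {α : LaurentSeries ℂ} {ξ : τ.V} (hξ : xt x ξ = lift x ν α) (ζ : τ.V) :
    metricV x ξ ζ = sgn ν * res ν (α * expand ν (xt x ζ)) := by
  rw [metricV_apply, hξ, phi_lift_mul hx hν α (inT_xt hx ζ)]

/-! ### Nondegeneracy and the cotangent space -/

theorem lin_zpow_mem_algA {x : τ.V} {k : Option (Fin τ.K)} (e : ℤ) : lin (pt x k) ^ e ∈ algA x := by
  have hXmem : (RatFunc.X : RatFunc ℂ) ∈ algA x :=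
    Algebra.subset_adjoin (Or.inl (Or.inl (by simp)))
  have hinv : (lin (pt x k))⁻¹ ∈ algA x := by
    rcases k with _ | j
    · exact Algebra.subset_adjoin (Or.inl (Or.inl (by simp [pt, lin_zero])))
    · exact Algebra.subset_adjoin (Or.inr ⟨j, rfl⟩)
  have hlin : lin (pt x k) ∈ algA x :=
    sub_mem hXmem ((algA x).algebraMap_mem (pt x k))
  obtain ⟨m, rfl | rfl⟩ := e.eq_nat_or_neg
  · rw [zpow_natCast]; exact pow_mem hlin m
  · rw [zpow_neg, zpow_natCast, ← inv_pow]; exact pow_mem hinv m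

theorem exists_pairing_ne_zero {x : τ.V} (hx : x ∈ τ.domain) {ν : OnePoint ℂ} (hν : ν ∈ gam x)
    {ξ : τ.V} (hξ : ξ ≠ 0) : ∃ α ∈ algA x, pairing ν x α ξ ≠ 0 := by
  have h0 : xt x ξ ≠ 0 := fun h => hξ (eq_zero_of_xt_eq_zero hx h)
  obtain ⟨d, hd⟩ := exists_lExact (expand_ne_zero ν h0)
  rcases mem_gam.1 hν with rfl | ⟨k, hk, rfl⟩
  -- A power of the local parameter is chosen that moves the leading coefficient of the tangent
  -- vector into the position of the residue. At ∞ powers of p serve, which lie in the algebra even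
  -- if 0 is not marked.
  · refine ⟨lin (pt x none) ^ (d - 1), lin_zpow_mem_algA _, ?_⟩
    rw [pairing_eq, res_infty, sgn_infty]
    change -1 * -(expand ∞ (lin 0 ^ (d - 1)) * expand ∞ (xt x ξ)).coeff 1 ≠ 0
    rw [expand_lin_zero_zpow_infty, HahnSeries.coeff_single_mul]
    simpa using hd.coeff_ne_zero
  · refine ⟨lin (pt x k) ^ (-d - 1), lin_zpow_mem_algA _, ?_⟩
    rw [pairing_eq, res_coe, sgn_coe, expand_lin_zpow_self, HahnSeries.coeff_single_mul,
      show -1 - (-d - 1) = d by ring]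
    simpa using hd.coeff_ne_zero

/-- Pairing with any α is the metric product with its lift, so a vector in the radical is
annihilated by every α at ∞. -/
theorem metricV_nondegenerate {x : τ.V} (hx : x ∈ τ.domain) {ξ : τ.V}
    (h : ∀ ζ, metricV x ξ ζ = 0) : ξ = 0 := by
  by_contra hξ
  obtain ⟨α, -, hα⟩ := exists_pairing_ne_zero hx (infty_mem_gam x) hξ
  obtain ⟨ζ, hζ⟩ := exists_xt_eq hx (inT_lift hx ∞ (expand ∞ α))
  apply hα
  rw [pairing_eq, ← metricV_lift hx (infty_mem_gam x) hζ, metricV_symm, h]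

theorem mem_gam_iff_markedSet {x : τ.V} {ν : OnePoint ℂ} : ν ∈ gam x ↔ ν ∈ markedSet x := mem_gam

/-- The pairing as a linear map. -/
def pairingL (ν : OnePoint ℂ) (x : τ.V) : RatFunc ℂ →ₗ[ℂ] τ.V →ₗ[ℂ] ℂ :=
  LinearMap.mk₂ ℂ (fun α ξ => pairing ν x α ξ)
    (fun α α' ξ => by simp only [pairing_eq, expand_add, add_mul, map_add, mul_add])
    (fun z α ξ => by
      simp only [pairing_eq, smul_eq_C, expand_mul, expand_C, mul_assoc, res_C_mul, smul_eq_mul]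
      ring)
    (fun α ξ ξ' => by simp only [pairing_eq, xt_add, expand_add, mul_add, map_add])
    (fun z α ξ => by
      simp only [pairing_eq, xt_smul, expand_mul, expand_C, mul_left_comm _ (HahnSeries.C z),
        res_C_mul, smul_eq_mul]
      ring)

/-- A proper subspace of the finite-dimensional cotangent space is killed by a nonzero functional,
which is evaluation at some nonzero vector; but every nonzero vector is detected by an element of
the algebra. -/
theorem exists_pairing_eq {x : τ.V} (hx : x ∈ τ.domain) {ν : OnePoint ℂ} (hν : ν ∈ gam x)
    (θ : τ.V →ₗ[ℂ] ℂ) : ∃ α ∈ algA x, ∀ ξ, pairing ν x α ξ = θ ξ := by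
  set P : Submodule ℂ (τ.V →ₗ[ℂ] ℂ) :=
    (Subalgebra.toSubmodule (algA x)).map (pairingL ν x) with hP
  have htop : P = ⊤ := by
    by_contra hne
    obtain ⟨f, hf, hle⟩ := Submodule.exists_le_ker_of_lt_top P (lt_top_iff_ne_top.2 hne)
    set ξ := (Module.evalEquiv ℂ τ.V).symm f with hξ
    have hfe (θ : τ.V →ₗ[ℂ] ℂ) : f θ = θ ξ := by
      have : f = Module.evalEquiv ℂ τ.V ξ := by simp [hξ]
      rw [this]; rfl
    have hξ0 : ξ ≠ 0 := fun h => hf (by ext θ; simp [hfe, h])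
    obtain ⟨α, hα, hne'⟩ := exists_pairing_ne_zero hx hν hξ0
    apply hne'
    have := hle ⟨α, hα, rfl⟩
    rwa [LinearMap.mem_ker, hfe] at this
  have : θ ∈ P := by rw [htop]; trivial
  obtain ⟨α, hα, h⟩ := this
  exact ⟨α, hα, fun ξ => LinearMap.congr_fun h ξ⟩

/-- By nondegeneracy the vector dual to the class of α is the one given by `lift`, and α orthogonal
to the tangent space has lift zero. The assertions about ideal, metric and product are then the
residue identities for lifts. -/
theorem isInducedAt {x : τ.V} (hx : x ∈ τ.domain) {ν : OnePoint ℂ} (hν : ν ∈ gam x)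
    {D : FrobeniusData τ.V} (hη : D.η x = metricV x) (hmul : D.mul x = mulV x) :
    IsInducedAt D x ν := by
  have hl (α : RatFunc ℂ) : ∃ ξ, xt x ξ = lift x ν (expand ν α) :=
    exists_xt_eq hx (inT_lift hx ν _)
  have hη' (α : RatFunc ℂ) {X : τ.V} (hX : xt x X = lift x ν (expand ν α)) (ξ : τ.V) :
      metricV x X ξ = pairing ν x α ξ := by
    rw [pairing_eq, metricV_lift hx hν hX]
  have huniq (α : RatFunc ℂ) {X : τ.V} (hX : ∀ ξ, metricV x X ξ = pairing ν x α ξ) :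
      xt x X = lift x ν (expand ν α) := by
    obtain ⟨Y, hY⟩ := hl α
    rw [← hY, sub_eq_zero.1 (metricV_nondegenerate hx (ξ := X - Y) fun ζ => by
      rw [map_sub, sub_apply, hX, hη' α hY, sub_self])]
  have hzero (α : RatFunc ℂ) (h : ∀ ξ, pairing ν x α ξ = 0) : lift x ν (expand ν α) = 0 := by
    rw [← huniq α (X := 0) fun ξ => by rw [h]; simp]
    exact map_zero (xtL x)
  have hmet (α β : RatFunc ℂ) {Y : τ.V} (hY : xt x Y = lift x ν (expand ν β)) :
      tr τ.s ν (circ τ.s ν (lam x) α β) = pairing ν x α Y := by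
    rw [tr_circ hν, pairing_eq, hY]
  refine ⟨exists_pairing_eq hx hν, fun α _ β _ h ξ => ?_, fun α _ β _ h => ?_,
    fun α _ β _ X Y hX hY => ?_, fun α _ β _ X Y hX hY ξ => ?_⟩
  · rw [pairing_circ hx hν, hzero α h]
    have := phi_C_mul x 0 0
    simpa using this
  · obtain ⟨Y, hY⟩ := hl β
    rw [hmet α β hY, h]
  · rw [hη] at hX hY ⊢
    rw [hmet α β (huniq β hY), hX]
  · rw [hη] at hX hY ⊢
    rw [hmul, pairing_circ hx hν, metricV_mulV hx, huniq α hX, huniq β hY]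

/-! ### The connection -/

/-- The second derivative of `λ` at fixed `p`. -/
def d2 (x ξ ζ : τ.V) : RatFunc ℂ :=
  lam x * (yy x ξ * yy x ζ + psum 2 x fun c => (τ.mult c : ℂ) * spt ξ c * spt ζ c)

/-- The quotient `(X_ξ X_ζ - X_{ξ * ζ}) / (p ^ s λ_p)`. -/
def kk (x ξ ζ : τ.V) : RatFunc ℂ :=
  (RatFunc.X ^ τ.s * xt x ξ * xt x ζ - xt x (mulV x ξ ζ)) / derivP (lam x)

theorem kk_spec {x : τ.V} (hx : x ∈ τ.domain) (ξ ζ : τ.V) :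
    RatFunc.X ^ τ.s * xt x ξ * xt x ζ = xt x (mulV x ξ ζ) + derivP (lam x) * kk x ξ ζ := by
  rw [kk, mul_div_cancel₀ _ (derivP_lam_ne_zero hx)]; ring

theorem inR_kk {x : τ.V} (hx : x ∈ τ.domain) (ξ ζ : τ.V) : InR x (kk x ξ ζ) := by
  obtain ⟨K, hK, h⟩ := mulV_spec hx ξ ζ
  rw [kk, h, add_sub_cancel_left, mul_div_cancel_left₀ _ (derivP_lam_ne_zero hx)]
  exact hK

/-- The logarithmic derivative of `λ` along `ξ`, in the coordinate moving with velocity `u`. -/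
def yyShift (x ξ : τ.V) (u : ℂ) : RatFunc ℂ := psum 1 x fun c => (τ.mult c : ℂ) * (spt ξ c - u)

theorem yyShift_eq (x ξ : τ.V) (u : ℂ) : yyShift x ξ u = yy x ξ + RatFunc.C u * rho x := by
  rw [yyShift, yy, rho, ← psum_C_mul, ← psum_add]
  exact psum_congr 1 x fun c _ => by ring

theorem tangent_shift (x ξ : τ.V) (u : ℂ) :
    tangent x ξ + RatFunc.C u * derivP (lam x) = lam x * yyShift x ξ u := by
  rw [yyShift_eq, tangent_eq, derivP_lam]; ring

/-- The left side is the second derivative of λ along ξ and ζ in a coordinate moving with velocities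
u and v, that is, of (∂_ξ + u∂_p)(∂_ζ + v∂_p). The right side is the formula for the second
derivative with all velocities replaced by relative ones, so the poles at a point moving along with
the coordinate disappear. -/
theorem d2_shift (x ξ ζ : τ.V) (u v : ℂ) :
    d2 x ξ ζ + RatFunc.C u * RatFunc.C v * derivP (derivP (lam x)) +
      RatFunc.C u * derivP (tangent x ζ) + RatFunc.C v * derivP (tangent x ξ) =
    lam x * (yyShift x ξ u * yyShift x ζ v +
      psum 2 x fun c => (τ.mult c : ℂ) * (spt ξ c - u) * (spt ζ c - v)) := by
  have h : psum 2 x (fun c => (τ.mult c : ℂ) * (spt ξ c - u) * (spt ζ c - v)) =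
      psum 2 x (fun c => (τ.mult c : ℂ) * spt ξ c * spt ζ c) +
      RatFunc.C u * RatFunc.C v * derivP (rho x) + RatFunc.C u * derivP (yy x ζ) +
      RatFunc.C v * derivP (yy x ξ) := by
    rw [rho, yy, yy, derivP_psum, derivP_psum, derivP_psum, ← map_mul, ← psum_C_mul, ← psum_C_mul,
      ← psum_C_mul, ← psum_add, ← psum_add, ← psum_add]
    refine psum_congr 2 x fun c _ => ?_
    push_cast; ring
  rw [h, d2, yyShift_eq, yyShift_eq, tangent_eq, tangent_eq, derivP_mul, derivP_mul, derivP_lam,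
    derivP_mul, derivP_lam]
  ring

theorem lOrd_yyShift {x : τ.V} (hx : x ∈ τ.domain) (ξ : τ.V) {c : τ.Lab} (hc : c ∈ τ.sidx) :
    LOrd 0 (expand (spt x c : OnePoint ℂ) (yyShift x ξ (spt ξ c))) :=
  lOrd_psum_of 1 x _ fun c' hc' h => by rw [spt_injOn hx hc' hc h]; simp

theorem lOrd_d2_shift {x : τ.V} (hx : x ∈ τ.domain) (ξ ζ : τ.V) {c : τ.Lab} (hc : c ∈ τ.sidx) :
    LOrd (-τ.mult c) (expand (spt x c : OnePoint ℂ) (d2 x ξ ζ +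
      RatFunc.C (spt ξ c) * RatFunc.C (spt ζ c) * derivP (derivP (lam x)) +
      RatFunc.C (spt ξ c) * derivP (tangent x ζ) + RatFunc.C (spt ζ c) * derivP (tangent x ξ))) := by
  rw [d2_shift, expand_mul, expand_add, expand_mul]
  refine (lExact_lam x _).lOrd.mul_le (LOrd.add (((lOrd_yyShift hx ξ hc).mul_le
    (lOrd_yyShift hx ζ hc) (add_zero 0).ge)) (lOrd_psum_of 2 x _ fun c' hc' h => ?_)) ?_
  · rw [spt_injOn hx hc' hc h]; simp
  · rw [lamOrd_spt hx hc]; omega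

theorem lOrd_C_mul {μ : OnePoint ℂ} {k : ℤ} (z : ℂ) {f : RatFunc ℂ} (h : LOrd k (expand μ f)) :
    LOrd k (expand μ (RatFunc.C z * f)) := by
  rw [expand_mul, expand_C]; exact (lOrd_C z).mul_le h (by omega)

theorem lOrd_derivP_of_coe {μ : ℂ} {k : ℤ} {f : RatFunc ℂ} (h : LOrd k (expand (μ : OnePoint ℂ) f)) :
    LOrd (k - 1) (expand (μ : OnePoint ℂ) (derivP f)) := by
  rw [expand_derivP]; simpa using h.der (ν := (μ : OnePoint ℂ))

/-- Only the zeros of λ need care: in the coordinate that moves with a_i nothing is singular there,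
and returning to fixed p adds derivatives of functions regular at a_i. -/
theorem inR_d2 {x : τ.V} (hx : x ∈ τ.domain) (ξ ζ : τ.V) : InR x (d2 x ξ ζ) := fun μ h => by
  induction μ using OnePoint.rec with
  | infty => exact absurd (infty_mem_gam x) h
  | coe μ =>
    rcases point_cases hx μ with ⟨k, hk, rfl, hl⟩ | ⟨i, rfl, hl, hg⟩ | ⟨hne, hl, hg⟩
    · exact absurd (pt_mem_gam x hk) h
    · have h1 := lOrd_d2_shift hx ξ ζ (inl_mem_sidx i)
      have h2 (u v : ℂ) : InR x (RatFunc.C u * RatFunc.C v * derivP (derivP (lam x)) +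
          RatFunc.C u * derivP (tangent x ζ) + RatFunc.C v * derivP (tangent x ξ)) :=
        ((((inR_C x _).mul (inR_C x _)).mul (inR_lam hx).derivP.derivP).add
          ((inR_C x _).mul (inR_tangent hx ζ).derivP)).add
          ((inR_C x _).mul (inR_tangent hx ξ).derivP)
      have h3 := (h1.mono (show (0 : ℤ) ≤ _ by simp [mult])).sub
        (h2 (spt ξ (Sum.inl i)) (spt ζ (Sum.inl i)) _ hg)
      rw [spt, Sum.elim_inl, ← expand_sub] at h3
      convert h3 using 2
      ring
    · rw [d2, expand_mul, expand_add, expand_mul]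
      exact (lExact_lam x μ).lOrd.mul_le (((lOrd_psum_of 1 x _ fun c hc h => absurd h (hne c hc)).mul
        (lOrd_psum_of 1 x _ fun c hc h => absurd h (hne c hc))).add
        (lOrd_psum_of 2 x _ fun c hc h => absurd h (hne c hc))) (by rw [hl]; omega)

theorem kk_eq_shift {x : τ.V} (hx : x ∈ τ.domain) (ξ ζ : τ.V) (u v : ℂ) :
    kk x ξ ζ = ps τ * ((lam x * yyShift x ξ u) * (lam x * yyShift x ζ v) / derivP (lam x) -
      RatFunc.C u * tangent x ζ - RatFunc.C v * tangent x ξ -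
      RatFunc.C u * RatFunc.C v * derivP (lam x)) - xt x (mulV x ξ ζ) / derivP (lam x) := by
  have hd := derivP_lam_ne_zero hx
  rw [kk, ← tangent_shift, ← tangent_shift]
  have : RatFunc.X ^ τ.s * xt x ξ * xt x ζ = ps τ * tangent x ξ * tangent x ζ := by
    rw [xt, xt]
    linear_combination ps τ * tangent x ξ * tangent x ζ * ps_mul_X_pow (τ := τ)
  rw [this]
  field_simp
  ring

theorem lOrd_conn_infty {x : τ.V} (hx : x ∈ τ.domain) (ξ ζ : τ.V) :
    LOrd (2 - τ.n) (expand ∞ (ps τ * d2 x ξ ζ - derivP (kk x ξ ζ))) := by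
  have hμ := infty_mem_gam x
  have hq := lOrd_div_derivP_lam hx (inT_xt hx (mulV x ξ ζ)) hμ
  rw [expand_sub, expand_mul, expand_derivP]
  refine LOrd.sub ?_ ?_
  · refine (lOrd_ps_infty (τ := τ)).mul_le (l := 2 - τ.n) ?_ (by omega)
    rw [d2, expand_mul, expand_add, expand_mul]
    refine (lExact_lam x ∞).lOrd.mul_le (((lOrd_psum_infty 1 x _).mul_le
      (lOrd_psum_infty 1 x _) le_rfl).add ((lOrd_psum_infty 2 x _).mono ?_)) ?_
    · norm_num
    · rw [lamOrd_infty]; push_cast; omega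
  · have hT (ω : τ.V) := inT_xt hx ω ∞
    rw [lb_infty, cut_infty] at hT
    rw [kk, sub_div, expand_sub, der_sub]
    refine LOrd.sub ?_ (hq.der.mono ?_)
    · have h1 : LOrd (2 - τ.n)
          (expand ∞ (RatFunc.X ^ τ.s * xt x ξ * xt x ζ / derivP (lam x))) := by
        rw [div_eq_mul_inv, expand_mul, expand_inv, expand_mul, expand_mul]
        refine (((lOrd_X_pow (τ := τ) ∞).mul (hT ξ)).mul (hT ζ)).mul_le
          (lExact_derivP_lam hx hμ).inv.lOrd ?_
        rw [cut_infty, lb_infty]; omega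
      exact h1.der.mono (by rw [cut_infty]; omega)
    · have := τ.n_pos'; rw [cut_infty]; omega

/-- Differentiating K in p produces exactly the terms that turn the second derivative at fixed p
into the one in the moving coordinate. What is left over involves the derivative of p^(-s) and a
function regular enough to be ignored. -/
theorem conn_eq_shift {x : τ.V} (hx : x ∈ τ.domain) (ξ ζ : τ.V) (u v : ℂ) {Q S W : RatFunc ℂ}
    (hQ : Q = (lam x * yyShift x ξ u) * (lam x * yyShift x ζ v) / derivP (lam x))
    (hS : S = Q - RatFunc.C u * tangent x ζ - RatFunc.C v * tangent x ξ -
      RatFunc.C u * RatFunc.C v * derivP (lam x))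
    (hW : W = d2 x ξ ζ + RatFunc.C u * RatFunc.C v * derivP (derivP (lam x)) +
      RatFunc.C u * derivP (tangent x ζ) + RatFunc.C v * derivP (tangent x ξ)) :
    ps τ * d2 x ξ ζ - derivP (kk x ξ ζ) = ps τ * W - ps τ * derivP Q -
      derivP (ps τ) * S + derivP (xt x (mulV x ξ ζ) / derivP (lam x)) := by
  rw [kk_eq_shift hx ξ ζ u v, ← hQ, ← hS, derivP_sub, derivP_mul]
  have : derivP S = derivP Q - RatFunc.C u * derivP (tangent x ζ) -
      RatFunc.C v * derivP (tangent x ξ) -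
      RatFunc.C u * RatFunc.C v * derivP (derivP (lam x)) := by
    rw [hS, derivP_sub, derivP_sub, derivP_sub, derivP_C_mul, derivP_C_mul, mul_assoc,
      derivP_C_mul, derivP_C_mul, mul_assoc]
  rw [this, hW]; ring

theorem spt_inr (x : τ.V) (k : Option (Fin τ.K)) : spt x (Sum.inr k) = pt x k := rfl

theorem mult_inr (k : Option (Fin τ.K)) : τ.mult (Sum.inr k) = τ.ord k := rfl

theorem lOrd_lam_pt {x : τ.V} (hx : x ∈ τ.domain) {k : Option (Fin τ.K)} (hk : k ∈ τ.marked) :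
    LExact (-τ.ord k) (expand (pt x k : OnePoint ℂ) (lam x)) := by
  have := lExact_lam x (spt x (Sum.inr k))
  rwa [lamOrd_spt hx (inr_mem_sidx.2 hk), spt_inr, mult_inr] at this

/-- There are two cases. At the point 0 for s = 1 the factor p^(-s) has a pole, but the point does
not move, so S reduces to the better function Q. At the other finite marked points S may be worse by
two orders, but p^(-s) and its derivative are regular. -/
theorem lOrd_conn_of_shift {x : τ.V} (hx : x ∈ τ.domain) (ξ ζ : τ.V) {k : Option (Fin τ.K)}
    (hk : k ∈ τ.marked) {u v : ℂ} (hu : k = none → u = 0 ∧ v = 0) {Q S W : RatFunc ℂ}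
    (hS : S = Q - RatFunc.C u * tangent x ζ - RatFunc.C v * tangent x ξ -
      RatFunc.C u * RatFunc.C v * derivP (lam x))
    (hWo : LOrd (-τ.ord k) (expand (pt x k : OnePoint ℂ) W))
    (hQo : LOrd (1 - τ.ord k) (expand (pt x k : OnePoint ℂ) Q)) :
    LOrd (-τ.ord k - 1) (expand (pt x k : OnePoint ℂ)
      (ps τ * W - ps τ * derivP Q - derivP (ps τ) * S)) := by
  rw [expand_sub, expand_sub, expand_mul, expand_mul, expand_mul]
  have hdQ := lOrd_derivP_of_coe hQo
  by_cases hk0 : τ.s = 1 ∧ k = none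
  · obtain ⟨hs, rfl⟩ := hk0
    have hps : LOrd (-1) (expand (pt x none : OnePoint ℂ) (ps τ)) := by
      have := lOrd_ps_zero (τ := τ)
      rwa [hs] at this
    have hSQ : S = Q := by rw [hS, (hu rfl).1, (hu rfl).2]; simp
    rw [hSQ]
    exact ((hps.mul_le hWo (by omega)).sub (hps.mul_le hdQ (by omega))).sub
      ((lOrd_derivP_of_coe hps).mul_le hQo (by omega))
  · have hps : LOrd 0 (expand (pt x k : OnePoint ℂ) (ps τ)) :=
      lOrd_ps_coe fun hs h0 => hk0 ⟨hs, pt_injOn hx hk (none_mem_marked.2 hs) h0⟩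
    have hX (ω : τ.V) : LOrd (-τ.ord k - 1) (expand (pt x k : OnePoint ℂ) (tangent x ω)) := by
      rw [tangent_eq, expand_mul]; exact (lOrd_lam_pt hx hk).lOrd.mul (lOrd_psum_one x _ _)
    have hlamp : LOrd (-τ.ord k - 1) (expand (pt x k : OnePoint ℂ) (derivP (lam x))) := by
      rw [← lb_pt hx hk]; exact lOrd_derivP_lam hx _
    have hSo : LOrd (-τ.ord k - 1) (expand (pt x k : OnePoint ℂ) S) := by
      rw [hS, expand_sub, expand_sub, expand_sub, mul_assoc]
      exact (((hQo.mono (by omega)).sub (lOrd_C_mul _ (hX ζ))).sub (lOrd_C_mul _ (hX ξ))).sub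
        (lOrd_C_mul _ (lOrd_C_mul _ hlamp))
    have hdps : LOrd 0 (expand (pt x k : OnePoint ℂ) (derivP (ps τ))) := by
      rw [expand_derivP]; exact LOrd.der_zero hps
    exact ((hps.mul_le hWo (by omega)).sub (hps.mul_le hdQ (by omega))).sub
      (hdps.mul_le hSo (by omega))

theorem lOrd_conn_pt {x : τ.V} (hx : x ∈ τ.domain) (ξ ζ : τ.V) {k : Option (Fin τ.K)}
    (hk : k ∈ τ.marked) : LOrd (-τ.ord k - 1)
      (expand (pt x k : OnePoint ℂ) (ps τ * d2 x ξ ζ - derivP (kk x ξ ζ))) := by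
  have hμ := pt_mem_gam x hk
  have hq := lOrd_div_derivP_lam hx (inT_xt hx (mulV x ξ ζ)) hμ
  have hm := neg_one_le_ord (τ := τ) k
  have hlamp : LExact (-τ.ord k - 1) (expand (pt x k : OnePoint ℂ) (derivP (lam x))) := by
    rw [← lb_pt hx hk]; exact lExact_derivP_lam hx hμ
  have hy (ω : τ.V) : LOrd 0 (expand (pt x k : OnePoint ℂ) (yyShift x ω (pt ω k))) := by
    have := lOrd_yyShift hx ω (inr_mem_sidx.2 hk)
    rwa [spt_inr, spt_inr] at this
  have hWo := lOrd_d2_shift hx ξ ζ (inr_mem_sidx.2 hk)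
  rw [spt_inr, spt_inr, spt_inr, mult_inr] at hWo
  have hu : k = none → pt ξ k = 0 ∧ pt ζ k = 0 := by rintro rfl; exact ⟨rfl, rfl⟩
  have hQo : LOrd (1 - τ.ord k) (expand (pt x k : OnePoint ℂ)
      ((lam x * yyShift x ξ (pt ξ k)) * (lam x * yyShift x ζ (pt ζ k)) / derivP (lam x))) := by
    rw [div_eq_mul_inv, expand_mul, expand_inv, expand_mul, expand_mul, expand_mul]
    exact (((lOrd_lam_pt hx hk).lOrd.mul (hy ξ)).mul ((lOrd_lam_pt hx hk).lOrd.mul (hy ζ))).mul_le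
      hlamp.inv.lOrd (by omega)
  rw [conn_eq_shift hx ξ ζ (pt ξ k) (pt ζ k) rfl rfl rfl, expand_add]
  refine (lOrd_conn_of_shift hx ξ ζ hk hu rfl hWo hQo).add ?_
  rw [expand_derivP]
  exact LOrd.mono (LOrd.der_zero hq) (by omega)

theorem inT_conn {x : τ.V} (hx : x ∈ τ.domain) (ξ ζ : τ.V) :
    InT x (ps τ * d2 x ξ ζ - derivP (kk x ξ ζ)) := by
  intro μ
  by_cases hμ : μ ∈ gam x
  · rcases mem_gam.1 hμ with rfl | ⟨k, hk, rfl⟩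
    · rw [lb_infty, cut_infty, show 1 - τ.n + 1 = 2 - τ.n by ring]
      exact lOrd_conn_infty hx ξ ζ
    · rw [lb_pt hx hk, cut_coe, add_zero]
      exact lOrd_conn_pt hx ξ ζ hk
  · rw [lb_of_notMem hμ, zero_add]
    exact (((inR_ps x).mul (inR_d2 hx ξ ζ)).sub (inR_kk hx ξ ζ).derivP).lOrd_cut hμ

theorem d2_symm (x ξ ζ : τ.V) : d2 x ξ ζ = d2 x ζ ξ := by
  rw [d2, d2, mul_comm (yy x ξ)]
  congr 2
  exact psum_congr 2 x fun c _ => by ring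

theorem spt_add (ξ ζ : τ.V) (c : τ.Lab) : spt (ξ + ζ) c = spt ξ c + spt ζ c := by
  rcases c with i | _ | j <;> simp [spt, a, v, pt]

theorem spt_smul (z : ℂ) (ξ : τ.V) (c : τ.Lab) : spt (z • ξ) c = z * spt ξ c := by
  rcases c with i | _ | j <;> simp [spt, a, v, pt]

theorem d2_add (x ξ ξ' ζ : τ.V) : d2 x (ξ + ξ') ζ = d2 x ξ ζ + d2 x ξ' ζ := by
  have h1 : yy x (ξ + ξ') = yy x ξ + yy x ξ' := by
    rw [yy, yy, yy, ← psum_add]; exact psum_congr 1 x fun c _ => by rw [spt_add]; ring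
  have h2 : psum 2 x (fun c => (τ.mult c : ℂ) * spt (ξ + ξ') c * spt ζ c) =
      psum 2 x (fun c => (τ.mult c : ℂ) * spt ξ c * spt ζ c) +
      psum 2 x (fun c => (τ.mult c : ℂ) * spt ξ' c * spt ζ c) := by
    rw [← psum_add]; exact psum_congr 2 x fun c _ => by rw [spt_add]; ring
  rw [d2, d2, d2, h1, h2]; ring

theorem d2_smul (x : τ.V) (z : ℂ) (ξ ζ : τ.V) : d2 x (z • ξ) ζ = RatFunc.C z * d2 x ξ ζ := by
  have h1 : yy x (z • ξ) = RatFunc.C z * yy x ξ := by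
    rw [yy, yy, ← psum_C_mul]; exact psum_congr 1 x fun c _ => by rw [spt_smul]; ring
  have h2 : psum 2 x (fun c => (τ.mult c : ℂ) * spt (z • ξ) c * spt ζ c) =
      RatFunc.C z * psum 2 x (fun c => (τ.mult c : ℂ) * spt ξ c * spt ζ c) := by
    rw [← psum_C_mul]; exact psum_congr 2 x fun c _ => by rw [spt_smul]; ring
  rw [d2, d2, h1, h2]; ring

theorem kk_symm {x : τ.V} (hx : x ∈ τ.domain) (ξ ζ : τ.V) : kk x ξ ζ = kk x ζ ξ := by
  rw [kk, kk, mulV_comm hx ξ ζ]; ring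

theorem kk_add (x ξ ξ' ζ : τ.V) : kk x (ξ + ξ') ζ = kk x ξ ζ + kk x ξ' ζ := by
  rw [kk, kk, kk, map_add, add_apply, xt_add, xt_add]; ring

theorem kk_smul (x : τ.V) (z : ℂ) (ξ ζ : τ.V) : kk x (z • ξ) ζ = RatFunc.C z * kk x ξ ζ := by
  rw [kk, kk, map_smul, smul_apply, xt_smul, xt_smul]; ring

/-- The covariant Hessian of `λ`, times `p ^ (-s)`, as a bilinear map. -/
def connL {x : τ.V} (hx : x ∈ τ.domain) : τ.V →ₗ[ℂ] τ.V →ₗ[ℂ] RatFunc ℂ :=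
  LinearMap.mk₂ ℂ (fun ξ ζ => ps τ * d2 x ξ ζ - derivP (kk x ξ ζ))
    (fun ξ ξ' ζ => by rw [d2_add, kk_add, derivP_add]; ring)
    (fun z ξ ζ => by rw [d2_smul, kk_smul, derivP_C_mul, smul_eq_C]; ring)
    (fun ξ ζ ζ' => by
      rw [d2_symm x ξ (ζ + ζ'), kk_symm hx ξ (ζ + ζ'), d2_add, kk_add, derivP_add, d2_symm x ξ ζ,
        kk_symm hx ξ ζ, d2_symm x ξ ζ', kk_symm hx ξ ζ']; ring)
    (fun z ξ ζ => by
      rw [d2_symm x ξ (z • ζ), kk_symm hx ξ (z • ζ), d2_smul, kk_smul, derivP_C_mul, smul_eq_C,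
        d2_symm x ξ ζ, kk_symm hx ξ ζ]; ring)

theorem exists_conn {x : τ.V} (hx : x ∈ τ.domain) : ∃ G : τ.V →L[ℂ] τ.V →L[ℂ] τ.V,
    ∀ ξ ζ, connL hx ξ ζ - xtL x (G ξ ζ) ∈ (⊥ : Submodule ℂ (RatFunc ℂ)) := by
  refine exists_bilin_lift (xtL x) ⊥ (connL hx) ?_ fun ξ ζ => ?_
  · intro w h
    exact eq_zero_of_xt_eq_zero hx ((Submodule.mem_bot ℂ).1 h)
  · obtain ⟨w, h⟩ := exists_xt_eq hx (inT_conn hx ξ ζ)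
    exact ⟨w, by rw [Submodule.mem_bot, sub_eq_zero]; exact h.symm⟩

open Classical in
/-- The bilinear form of the Levi-Civita connection. -/
def connV (x : τ.V) : τ.V →L[ℂ] τ.V →L[ℂ] τ.V :=
  if hx : x ∈ τ.domain then (exists_conn hx).choose else 0

/-- This is the definition of the connection by its effect on λ. That it preserves the metric is not
visible here; it follows later from the existence of flat coordinates. -/
theorem connV_spec {x : τ.V} (hx : x ∈ τ.domain) (ξ ζ : τ.V) :
    d2 x ξ ζ = tangent x (connV x ξ ζ) + RatFunc.X ^ τ.s * derivP (kk x ξ ζ) := by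
  have h := (exists_conn hx).choose_spec ξ ζ
  rw [Submodule.mem_bot, sub_eq_zero] at h
  have h' : ps τ * d2 x ξ ζ - derivP (kk x ξ ζ) = xt x (connV x ξ ζ) := by
    rw [connV, dif_pos hx]; exact h
  rw [tangent_eq_xt, ← h']
  linear_combination -(d2 x ξ ζ) * ps_mul_X_pow (τ := τ)

theorem connV_symm {x : τ.V} (hx : x ∈ τ.domain) (ξ ζ : τ.V) : connV x ξ ζ = connV x ζ ξ := by
  have h := connV_spec hx ξ ζ
  rw [d2_symm, connV_spec hx ζ ξ, kk_symm hx ζ ξ] at h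
  have h2 := add_right_cancel h
  rw [← sub_eq_zero]
  refine eq_zero_of_xt_eq_zero hx ?_
  have : xt x (connV x ξ ζ - connV x ζ ξ) = xt x (connV x ξ ζ) - xt x (connV x ζ ξ) :=
    map_sub (xtL x) _ _
  rw [this, xt, xt, h2, sub_self]

theorem tangent_mul_tangent {x : τ.V} (hx : x ∈ τ.domain) (ξ ζ : τ.V) :
    tangent x ξ * tangent x ζ =
      tangent x (mulV x ξ ζ) + RatFunc.X ^ τ.s * derivP (lam x) * kk x ξ ζ := by
  rw [tangent_eq_xt, tangent_eq_xt x ζ, tangent_eq_xt x (mulV x ξ ζ)]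
  linear_combination RatFunc.X ^ τ.s * kk_spec hx ξ ζ

end MeroType

end MeroFrob
end

/-! ### Frobenius structures from flat coordinates and their first deformations. -/

noncomputable section

set_option linter.unusedSectionVars false

namespace MeroFrob

open scoped ContDiff

/-! ### Calculus -/

section Calculus

variable {V : Type*} [NormedAddCommGroup V] [NormedSpace ℂ V] {W : Set V}

/-- The second derivative. -/
def dd (f : V → ℂ) (x X Y : V) : ℂ := fderiv ℂ (fun y => fderiv ℂ f y) x X Y

theorem smooth_at {F : Type*} [NormedAddCommGroup F] [NormedSpace ℂ F] {f : V → F}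
    (hW : IsOpen W) (hf : ContDiffOn ℂ (⊤ : ℕ∞) f W) {x : V} (hx : x ∈ W) :
    ContDiffAt ℂ (⊤ : ℕ∞) f x := hf.contDiffAt (hW.mem_nhds hx)

theorem smooth_diff {F : Type*} [NormedAddCommGroup F] [NormedSpace ℂ F] {f : V → F}
    (hW : IsOpen W) (hf : ContDiffOn ℂ (⊤ : ℕ∞) f W) {x : V} (hx : x ∈ W) :
    DifferentiableAt ℂ f x := (smooth_at hW hf hx).differentiableAt (by simp)

theorem smooth_fderiv {F : Type*} [NormedAddCommGroup F] [NormedSpace ℂ F] {f : V → F}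
    (hW : IsOpen W) (hf : ContDiffOn ℂ (⊤ : ℕ∞) f W) :
    ContDiffOn ℂ (⊤ : ℕ∞) (fun y => fderiv ℂ f y) W :=
  hf.fderiv_of_isOpen hW (by simp)

theorem smooth_fderiv_apply {f : V → ℂ} (hW : IsOpen W) (hf : ContDiffOn ℂ (⊤ : ℕ∞) f W)
    {A : V → V} (hA : ContDiffOn ℂ (⊤ : ℕ∞) A W) :
    ContDiffOn ℂ (⊤ : ℕ∞) (fun y => fderiv ℂ f y (A y)) W :=
  (smooth_fderiv hW hf).clm_apply hA

theorem smooth_dd {f : V → ℂ} (hW : IsOpen W) (hf : ContDiffOn ℂ (⊤ : ℕ∞) f W) (X Y : V) :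
    ContDiffOn ℂ (⊤ : ℕ∞) (fun y => dd f y X Y) W :=
  ((smooth_fderiv hW (smooth_fderiv hW hf)).clm_apply contDiffOn_const).clm_apply contDiffOn_const

theorem fderiv_fderiv_apply {f : V → ℂ} (hW : IsOpen W) (hf : ContDiffOn ℂ (⊤ : ℕ∞) f W)
    {A : V → V} {x : V} (hx : x ∈ W) (hA : DifferentiableAt ℂ A x) (X : V) :
    fderiv ℂ (fun y => fderiv ℂ f y (A y)) x X = dd f x X (A x) + fderiv ℂ f x (fderiv ℂ A x X) := by
  rw [fderiv_clm_apply (smooth_diff hW (smooth_fderiv hW hf) hx) hA]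
  simp [dd, add_comm]

theorem fderiv_fderiv_const {f : V → ℂ} (hW : IsOpen W) (hf : ContDiffOn ℂ (⊤ : ℕ∞) f W)
    {x : V} (hx : x ∈ W) (X Y : V) : fderiv ℂ (fun y => fderiv ℂ f y Y) x X = dd f x X Y := by
  rw [fderiv_fderiv_apply hW hf hx (differentiableAt_const Y)]; simp

theorem dd_symm {f : V → ℂ} (hW : IsOpen W) (hf : ContDiffOn ℂ (⊤ : ℕ∞) f W)
    {x : V} (hx : x ∈ W) (X Y : V) : dd f x X Y = dd f x Y X :=
  (smooth_at hW hf hx).isSymmSndFDerivAt (by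
    simp only [minSmoothness_of_isRCLikeNormedField]; exact WithTop.coe_le_coe.2 le_top) X Y

theorem fderiv_congr_on {F : Type*} [NormedAddCommGroup F] [NormedSpace ℂ F] {f g : V → F}
    (hW : IsOpen W) (h : ∀ y ∈ W, f y = g y) {x : V} (hx : x ∈ W) :
    fderiv ℂ f x = fderiv ℂ g x :=
  Filter.EventuallyEq.fderiv_eq (Filter.eventually_of_mem (hW.mem_nhds hx) h)

theorem fderiv_dd_symm {f : V → ℂ} (hW : IsOpen W) (hf : ContDiffOn ℂ (⊤ : ℕ∞) f W)
    {x : V} (hx : x ∈ W) (X Y Z : V) :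
    fderiv ℂ (fun y => dd f y Y Z) x X = fderiv ℂ (fun y => dd f y X Z) x Y := by
  have h (Y : V) : ∀ y ∈ W, dd f y Y Z = fderiv ℂ (fun y => fderiv ℂ f y Z) y Y :=
    fun y hy => (fderiv_fderiv_const hW hf hy Y Z).symm
  have hg : ContDiffOn ℂ (⊤ : ℕ∞) (fun y => fderiv ℂ f y Z) W :=
    smooth_fderiv_apply hW hf contDiffOn_const
  rw [fderiv_congr_on hW (h Y) hx, fderiv_congr_on hW (h X) hx, fderiv_fderiv_const hW hg hx,
    fderiv_fderiv_const hW hg hx, dd_symm hW hg hx]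

end Calculus

/-! ### Frobenius structures from flat coordinates and their deformations -/

/-- Flat coordinates `t i` and functions `H i` with `∇ dH i = dt i (· * ·)`, quasi-homogeneous for
the Euler field `E = κ x`. -/
structure FlatData {V : Type*} [NormedAddCommGroup V] [NormedSpace ℂ V] (D : FrobeniusData V)
    (W : Set V) (d κ : ℂ) {I : Type*} [Fintype I] (t H : I → V → ℂ) (w dg : I → ℂ)
    (star : I → I) : Prop where
  isOpen : IsOpen W
  smooth_t : ∀ i, ContDiffOn ℂ (⊤ : ℕ∞) (t i) W
  smooth_H : ∀ i, ContDiffOn ℂ (⊤ : ℕ∞) (H i) W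
  star_star : ∀ i, star (star i) = i
  w_star : ∀ i, w (star i) = w i
  exists_frame : ∀ x ∈ W, ∀ i, ∃ v, fderiv ℂ (t i) x v = 1 ∧ ∀ j, j ≠ i → fderiv ℂ (t j) x v = 0
  separates : ∀ x ∈ W, ∀ X, (∀ i, fderiv ℂ (t i) x X = 0) → X = 0
  metric : ∀ x ∈ W, ∀ X Y,
    D.η x X Y = ∑ i, (w i)⁻¹ * fderiv ℂ (t i) x X * fderiv ℂ (t (star i)) x Y
  Γ_symm : ∀ x ∈ W, ∀ X Y, D.Γ x X Y = D.Γ x Y X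
  hess_t : ∀ x ∈ W, ∀ i X Y, dd (t i) x X Y = fderiv ℂ (t i) x (D.Γ x X Y)
  hess_H : ∀ x ∈ W, ∀ i X Y,
    dd (H i) x X Y = fderiv ℂ (H i) x (D.Γ x X Y) + fderiv ℂ (t i) x (D.mul x X Y)
  mul_comm : ∀ x ∈ W, ∀ X Y, D.mul x X Y = D.mul x Y X
  invariant : ∀ x ∈ W, ∀ X Y Z, D.η x X (D.mul x Y Z) = D.η x (D.mul x X Y) Z
  euler : D.E = fun x => κ • x
  euler_t : ∀ i, ∃ r, ∀ x ∈ W, fderiv ℂ (t i) x (D.E x) = dg i * t i x + r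
  euler_H : ∀ i, ∃ g : V → ℂ, ContDiffOn ℂ (⊤ : ℕ∞) g W ∧
    (∀ x ∈ W, ∀ X Y, dd g x X Y = fderiv ℂ g x (D.Γ x X Y)) ∧
    ∀ x ∈ W, fderiv ℂ (H i) x (D.E x) = (dg i + 1) * H i x + g x
  dg_star : ∀ i, dg i + dg (star i) = 2 - d

namespace FlatData

variable {V : Type*} [NormedAddCommGroup V] [NormedSpace ℂ V]
  {D : FrobeniusData V} {W : Set V} {d κ : ℂ} {I : Type*} [Fintype I] {t H : I → V → ℂ}
  {w dg : I → ℂ} {star : I → I}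

theorem ext (h : FlatData D W d κ t H w dg star) {x : V} (hx : x ∈ W) {X Y : V}
    (hXY : ∀ i, fderiv ℂ (t i) x X = fderiv ℂ (t i) x Y) : X = Y := by
  rw [← sub_eq_zero]
  exact h.separates x hx _ fun i => by rw [map_sub, hXY, sub_self]

theorem c_eq (h : FlatData D W d κ t H w dg star) {x : V} (hx : x ∈ W) (X Y Z : V) :
    D.c x X Y Z = ∑ i, (w i)⁻¹ * fderiv ℂ (t i) x (D.mul x X Y) * fderiv ℂ (t (star i)) x Z :=
  h.metric x hx _ _

theorem c_swap (h : FlatData D W d κ t H w dg star) {x : V} (hx : x ∈ W) (X Y Z : V) :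
    D.c x X Y Z = D.c x Y X Z := by
  rw [FrobeniusData.c, h.mul_comm x hx, FrobeniusData.c]

theorem c_swap' (h : FlatData D W d κ t H w dg star) {x : V} (hx : x ∈ W) (X Y Z : V) :
    D.c x X Y Z = D.c x X Z Y := by
  rw [FrobeniusData.c, ← h.invariant x hx, h.mul_comm x hx, h.invariant x hx, FrobeniusData.c]

/-- The differential of all the flat coordinates. -/
def dt (t : I → V → ℂ) (x : V) : V →L[ℂ] I → ℂ := ContinuousLinearMap.pi fun i => fderiv ℂ (t i) x

open Classical in
/-- The coordinate vector fields. -/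
def frame (t : I → V → ℂ) (j : I) (x : V) : V := (dt t x).inverse (Pi.single j 1)

variable [FiniteDimensional ℂ V]

/-- Separation gives injectivity and the vectors dual to the covectors give surjectivity, so the
differential of all the coordinates is an isomorphism at each point. -/
theorem exists_equiv (h : FlatData D W d κ t H w dg star) {x : V} (hx : x ∈ W) :
    ∃ e : V ≃L[ℂ] I → ℂ, (e : V →L[ℂ] I → ℂ) = dt t x := by
  classical
  choose v hv hv' using h.exists_frame x hx
  have hb : Function.Bijective (dt t x : V →ₗ[ℂ] I → ℂ) := by
    refine ⟨fun X Y hXY => h.ext hx fun i => congrFun hXY i, fun f => ⟨∑ i, f i • v i, ?_⟩⟩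
    funext j
    change fderiv ℂ (t j) x (∑ i, f i • v i) = f j
    rw [map_sum, Finset.sum_eq_single j]
    · simp [hv]
    · intro i _ hij; rw [map_smul, hv' i j hij.symm, smul_zero]
    · simp
  exact ⟨(LinearEquiv.ofBijective _ hb).toContinuousLinearEquiv, by ext; rfl⟩

open Classical in
theorem fderiv_frame (h : FlatData D W d κ t H w dg star) {x : V} (hx : x ∈ W) (i j : I) :
    fderiv ℂ (t i) x (frame t j x) = if i = j then 1 else 0 := by
  obtain ⟨e, he⟩ := h.exists_equiv hx
  have : dt t x (frame t j x) = Pi.single j 1 := by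
    rw [frame, ← he, ContinuousLinearMap.inverse_equiv]
    exact e.apply_symm_apply _
  have := congrFun this i
  rw [Pi.single_apply] at this
  exact this

theorem smooth_frame (h : FlatData D W d κ t H w dg star) (j : I) :
    ContDiffOn ℂ (⊤ : ℕ∞) (frame t j) W := by
  intro x hx
  obtain ⟨e, he⟩ := h.exists_equiv hx
  have h1 : ContDiffAt ℂ (⊤ : ℕ∞) (dt t) x := by
    have : ContDiffOn ℂ (⊤ : ℕ∞) (dt t) W :=
      contDiffOn_clm_apply.2 fun X => contDiffOn_pi.2 fun i =>
        smooth_fderiv_apply h.isOpen (h.smooth_t i) contDiffOn_const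
    exact smooth_at h.isOpen this hx
  have h2 : ContDiffAt ℂ (⊤ : ℕ∞) ContinuousLinearMap.inverse (dt t x) := by
    rw [← he]; exact contDiffAt_map_inverse e
  exact ((h2.comp x h1).clm_apply contDiffAt_const).contDiffWithinAt

theorem eq_sum_frame (h : FlatData D W d κ t H w dg star) {x : V} (hx : x ∈ W) (X : V) :
    X = ∑ i, fderiv ℂ (t i) x X • frame t i x := by
  refine h.ext hx fun i => ?_
  rw [map_sum, Finset.sum_eq_single i]
  · simp [h.fderiv_frame hx]
  · intro j _ hij; simp [h.fderiv_frame hx, hij.symm]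
  · simp

/-- Smoothness can be tested on the components along the dt, because the dual frame is smooth. This
is how Γ and the product, which are known only pointwise, are shown to be smooth: their components
are second derivatives of t and of H. -/
theorem smooth_vec (h : FlatData D W d κ t H w dg star) {A : V → V}
    (hA : ∀ i, ContDiffOn ℂ (⊤ : ℕ∞) (fun x => fderiv ℂ (t i) x (A x)) W) :
    ContDiffOn ℂ (⊤ : ℕ∞) A W := by
  have : ContDiffOn ℂ (⊤ : ℕ∞) (fun x => ∑ i, fderiv ℂ (t i) x (A x) • frame t i x) W :=
    ContDiffOn.sum fun i _ => (hA i).smul (h.smooth_frame i)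
  exact this.congr fun x hx => h.eq_sum_frame hx _

theorem smooth_Γ (h : FlatData D W d κ t H w dg star) : ContDiffOn ℂ (⊤ : ℕ∞) D.Γ W := by
  refine contDiffOn_clm_apply.2 fun X => contDiffOn_clm_apply.2 fun Y => h.smooth_vec fun i => ?_
  exact (smooth_dd h.isOpen (h.smooth_t i) X Y).congr fun x hx => (h.hess_t x hx i X Y).symm

theorem smooth_Γ_apply (h : FlatData D W d κ t H w dg star) (X Y : V) :
    ContDiffOn ℂ (⊤ : ℕ∞) (fun y => D.Γ y X Y) W :=
  (h.smooth_Γ.clm_apply contDiffOn_const).clm_apply contDiffOn_const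

theorem smooth_mul (h : FlatData D W d κ t H w dg star) : ContDiffOn ℂ (⊤ : ℕ∞) D.mul W := by
  refine contDiffOn_clm_apply.2 fun X => contDiffOn_clm_apply.2 fun Y => h.smooth_vec fun i => ?_
  refine ((smooth_dd h.isOpen (h.smooth_H i) X Y).sub
    (smooth_fderiv_apply h.isOpen (h.smooth_H i) (h.smooth_Γ_apply X Y))).congr fun x hx => ?_
  rw [h.hess_H x hx]; ring

theorem smooth_mul_apply (h : FlatData D W d κ t H w dg star) (X Y : V) :
    ContDiffOn ℂ (⊤ : ℕ∞) (fun y => D.mul y X Y) W :=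
  (h.smooth_mul.clm_apply contDiffOn_const).clm_apply contDiffOn_const

theorem smooth_η (h : FlatData D W d κ t H w dg star) : ContDiffOn ℂ (⊤ : ℕ∞) D.η W := by
  refine contDiffOn_clm_apply.2 fun X => contDiffOn_clm_apply.2 fun Y => ?_
  refine (ContDiffOn.sum (s := Finset.univ) fun i _ => ?_).congr fun x hx => h.metric x hx X Y
  exact (contDiffOn_const.mul
    (smooth_fderiv_apply h.isOpen (h.smooth_t i) contDiffOn_const)).mul
      (smooth_fderiv_apply h.isOpen (h.smooth_t _) contDiffOn_const)

/-- The metric has constant coefficients in the covectors dt, and the dt are parallel. -/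
theorem metric_compatible (h : FlatData D W d κ t H w dg star) {x : V} (hx : x ∈ W) (X Y Z : V) :
    fderiv ℂ (fun y => D.η y Y Z) x X = D.η x (D.Γ x X Y) Z + D.η x Y (D.Γ x X Z) := by
  have hd (i : I) (Y : V) : DifferentiableAt ℂ (fun y => fderiv ℂ (t i) y Y) x :=
    smooth_diff h.isOpen (smooth_fderiv_apply h.isOpen (h.smooth_t i) contDiffOn_const) hx
  rw [fderiv_congr_on h.isOpen (fun y hy => h.metric y hy Y Z) hx,
    fderiv_fun_sum (fun i _ => ((hd i Y).const_mul _).fun_mul (hd _ Z)), sum_apply,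
    h.metric x hx, h.metric x hx, ← Finset.sum_add_distrib]
  refine Finset.sum_congr rfl fun i _ => ?_
  rw [fderiv_fun_mul ((hd i Y).const_mul _) (hd _ Z), fderiv_const_mul (hd i Y)]
  simp only [add_apply, smul_apply, smul_eq_mul, fderiv_fderiv_const h.isOpen (h.smooth_t _) hx,
    h.hess_t x hx]
  ring

theorem fderiv_Γ (h : FlatData D W d κ t H w dg star) {x : V} (hx : x ∈ W) (i : I) (X Y Z : V) :
    fderiv ℂ (t i) x (fderiv ℂ (fun y => D.Γ y Y Z) x X) =
      fderiv ℂ (fun y => dd (t i) y Y Z) x X - fderiv ℂ (t i) x (D.Γ x X (D.Γ x Y Z)) := by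
  rw [fderiv_congr_on h.isOpen (fun y hy => h.hess_t y hy i Y Z) hx,
    fderiv_fderiv_apply h.isOpen (h.smooth_t i) hx
      (smooth_diff h.isOpen (h.smooth_Γ_apply Y Z) hx), h.hess_t x hx]
  ring

/-- Applying dt to the curvature gives an antisymmetrised third derivative of t. -/
theorem flat (h : FlatData D W d κ t H w dg star) {x : V} (hx : x ∈ W) (X Y Z : V) :
    D.curvature x X Y Z = 0 := by
  refine h.separates x hx _ fun i => ?_
  rw [FrobeniusData.curvature, map_sub, map_add, map_sub, h.fderiv_Γ hx, h.fderiv_Γ hx,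
    fderiv_dd_symm h.isOpen (h.smooth_t i) hx X Y]
  ring

theorem fderiv_mul (h : FlatData D W d κ t H w dg star) {x : V} (hx : x ∈ W) (i : I) (X Y Z : V) :
    fderiv ℂ (fun y => fderiv ℂ (t i) y (D.mul y Y Z)) x X =
      fderiv ℂ (fun y => dd (H i) y Y Z) x X - dd (H i) x X (D.Γ x Y Z)
        - fderiv ℂ (H i) x (fderiv ℂ (fun y => D.Γ y Y Z) x X) := by
  have h1 : ∀ y ∈ W, fderiv ℂ (t i) y (D.mul y Y Z) =
      dd (H i) y Y Z - fderiv ℂ (H i) y (D.Γ y Y Z) := fun y hy => by rw [h.hess_H y hy]; ring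
  rw [fderiv_congr_on h.isOpen h1 hx, fderiv_fun_sub
    (smooth_diff h.isOpen (smooth_dd h.isOpen (h.smooth_H i) Y Z) hx)
    (smooth_diff h.isOpen (smooth_fderiv_apply h.isOpen (h.smooth_H i) (h.smooth_Γ_apply Y Z)) hx),
    sub_apply, fderiv_fderiv_apply h.isOpen (h.smooth_H i) hx
      (smooth_diff h.isOpen (h.smooth_Γ_apply Y Z) hx)]
  ring

/-- Since dt(Y * Z) is the covariant Hessian of H, its covariant derivative is a third covariant
derivative of H, which is symmetric in the first two arguments because the connection is flat. This
is the only nontrivial symmetry of ∇c. -/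
theorem fderiv_mul_symm (h : FlatData D W d κ t H w dg star) {x : V} (hx : x ∈ W) (i : I)
    (X Y Z : V) :
    fderiv ℂ (fun y => fderiv ℂ (t i) y (D.mul y Y Z)) x X
        - fderiv ℂ (t i) x (D.mul x Y (D.Γ x X Z)) =
      fderiv ℂ (fun y => fderiv ℂ (t i) y (D.mul y X Z)) x Y
        - fderiv ℂ (t i) x (D.mul x X (D.Γ x Y Z)) := by
  have h1 := congrArg (fderiv ℂ (H i) x) (h.flat hx X Y Z)
  rw [FrobeniusData.curvature, map_sub, map_add, map_sub, map_zero] at h1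
  rw [h.fderiv_mul hx, h.fderiv_mul hx, fderiv_dd_symm h.isOpen (h.smooth_H i) hx X Y,
    h.hess_H x hx i X, h.hess_H x hx i Y]
  linear_combination -h1

theorem fderiv_c (h : FlatData D W d κ t H w dg star) {x : V} (hx : x ∈ W) (X Y Z T : V) :
    fderiv ℂ (fun y => D.c y Y Z T) x X = ∑ i, (w i)⁻¹ *
      (fderiv ℂ (fun y => fderiv ℂ (t i) y (D.mul y Y Z)) x X * fderiv ℂ (t (star i)) x T +
        fderiv ℂ (t i) x (D.mul x Y Z) * fderiv ℂ (t (star i)) x (D.Γ x X T)) := by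
  have hd (i : I) : DifferentiableAt ℂ (fun y => fderiv ℂ (t i) y (D.mul y Y Z)) x :=
    smooth_diff h.isOpen (smooth_fderiv_apply h.isOpen (h.smooth_t i) (h.smooth_mul_apply Y Z)) hx
  have hd' (i : I) : DifferentiableAt ℂ (fun y => fderiv ℂ (t i) y T) x :=
    smooth_diff h.isOpen (smooth_fderiv_apply h.isOpen (h.smooth_t i) contDiffOn_const) hx
  rw [fderiv_congr_on h.isOpen (fun y hy => h.c_eq hy Y Z T) hx,
    fderiv_fun_sum (fun i _ => ((hd i).const_mul _).fun_mul (hd' _)), sum_apply]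
  refine Finset.sum_congr rfl fun i _ => ?_
  rw [fderiv_fun_mul ((hd i).const_mul _) (hd' _), fderiv_const_mul (hd i)]
  simp only [add_apply, smul_apply, smul_eq_mul, fderiv_fderiv_const h.isOpen (h.smooth_t _) hx,
    h.hess_t x hx]
  ring

/-- Adjacent transpositions generate all permutations. The first one is the symmetry coming from the
potentials H; the other two are commutativity of the product and invariance of the metric. -/
theorem nablaC_symm (h : FlatData D W d κ t H w dg star) {x : V} (hx : x ∈ W) (u : Fin 4 → V)
    (σ : Equiv.Perm (Fin 4)) : D.nablaC x (u ∘ σ) = D.nablaC x u := by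
  have hσ : σ ∈ Submonoid.closure (Set.range fun i : Fin 3 => Equiv.swap i.castSucc i.succ) := by
    rw [Equiv.Perm.mclosure_swap_castSucc_succ]; trivial
  induction hσ using Submonoid.closure_induction generalizing u with
  | one => rfl
  | mul σ ρ _ _ h1 h2 =>
    rw [Equiv.Perm.coe_mul, ← Function.comp_assoc, h2, h1]
  | mem σ hσ =>
    obtain ⟨i, rfl⟩ := hσ
    fin_cases i
    · have e : (u ∘ Equiv.swap (0 : Fin 4) 1) = ![u 1, u 0, u 2, u 3] := by
        funext j; fin_cases j <;> rfl
      change D.nablaC x (u ∘ Equiv.swap (0 : Fin 4) 1) = _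
      rw [e]
      simp only [FrobeniusData.nablaC, Matrix.cons_val, h.fderiv_c hx, h.c_eq hx,
        ← Finset.sum_sub_distrib]
      refine Finset.sum_congr rfl fun i _ => ?_
      rw [h.Γ_symm x hx (u 1) (u 0)]
      linear_combination (-(w i)⁻¹ * fderiv ℂ (t (star i)) x (u 3)) *
        h.fderiv_mul_symm hx i (u 0) (u 1) (u 2)
    · have e : (u ∘ Equiv.swap (1 : Fin 4) 2) = ![u 0, u 2, u 1, u 3] := by
        funext j; fin_cases j <;> rfl
      change D.nablaC x (u ∘ Equiv.swap (1 : Fin 4) 2) = _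
      rw [e]
      simp only [FrobeniusData.nablaC, Matrix.cons_val]
      rw [fderiv_congr_on h.isOpen (fun y hy => h.c_swap hy (u 2) (u 1) (u 3)) hx,
        h.c_swap hx _ (u 1) (u 3), h.c_swap hx (u 2) _ (u 3), h.c_swap hx (u 2)]
      ring
    · have e : (u ∘ Equiv.swap (2 : Fin 4) 3) = ![u 0, u 1, u 3, u 2] := by
        funext j; fin_cases j <;> rfl
      change D.nablaC x (u ∘ Equiv.swap (2 : Fin 4) 3) = _
      rw [e]
      simp only [FrobeniusData.nablaC, Matrix.cons_val]
      rw [fderiv_congr_on h.isOpen (fun y hy => h.c_swap' hy (u 1) (u 3) (u 2)) hx,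
        h.c_swap' hx _ (u 3) (u 2), h.c_swap' hx _ _ (u 2), h.c_swap' hx _ (u 3)]
      ring

/-! #### The Euler field -/

theorem fderiv_smul_id (κ : ℂ) (x X : V) : fderiv ℂ (fun y : V => κ • y) x X = κ • X := by
  rw [fderiv_fun_const_smul differentiableAt_fun_id]; simp

/-- Obtained by differentiating Euler's relation for f along X; the radial field κx has derivative κ
times the identity. -/
theorem fderiv_homogeneous {f g : V → ℂ} {c : ℂ} (hW : IsOpen W)
    (hf : ContDiffOn ℂ (⊤ : ℕ∞) f W) (hg : ContDiffOn ℂ (⊤ : ℕ∞) g W)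
    (hE : ∀ x ∈ W, fderiv ℂ f x (κ • x) = c * f x + g x) {x : V} (hx : x ∈ W) (X : V) :
    dd f x (κ • x) X = (c - κ) * fderiv ℂ f x X + fderiv ℂ g x X := by
  have h1 := fderiv_congr_on hW hE hx
  have h2 := DFunLike.congr_fun h1 X
  have hA : DifferentiableAt ℂ (fun y : V => κ • y) x := differentiableAt_id.const_smul κ
  rw [fderiv_fderiv_apply hW hf hx hA, fderiv_fun_add ((smooth_diff hW hf hx).const_mul c)
    (smooth_diff hW hg hx), fderiv_const_mul (smooth_diff hW hf hx), fderiv_smul_id] at h2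
  rw [dd_symm hW hf hx]
  simp only [add_apply, smul_apply, smul_eq_mul, map_smul] at h2
  linear_combination h2

theorem dd_homogeneous {f g : V → ℂ} {c : ℂ} (hW : IsOpen W)
    (hf : ContDiffOn ℂ (⊤ : ℕ∞) f W) (hg : ContDiffOn ℂ (⊤ : ℕ∞) g W)
    (hE : ∀ x ∈ W, fderiv ℂ f x (κ • x) = c * f x + g x) {x : V} (hx : x ∈ W) (X Y : V) :
    fderiv ℂ (fun y => dd f y X Y) x (κ • x) = (c - 2 * κ) * dd f x X Y + dd g x X Y := by
  have hfY : ContDiffOn ℂ (⊤ : ℕ∞) (fun y => fderiv ℂ f y Y) W :=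
    smooth_fderiv_apply hW hf contDiffOn_const
  rw [fderiv_congr_on hW (fun y hy => (fderiv_fderiv_const hW hf hy X Y).symm) hx,
    fderiv_fderiv_const hW hfY hx, fderiv_homogeneous (c := c - κ) hW hfY
      (smooth_fderiv_apply hW hg contDiffOn_const) (fun y hy => ?_) hx X,
    fderiv_fderiv_const hW hf hx, fderiv_fderiv_const hW hg hx]
  · ring
  · rw [fderiv_fderiv_const hW hf hy, fderiv_homogeneous hW hf hg hE hy]

theorem fderiv_E (h : FlatData D W d κ t H w dg star) (x X : V) : fderiv ℂ D.E x X = κ • X := by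
  rw [h.euler, fderiv_smul_id]

theorem E_apply (h : FlatData D W d κ t H w dg star) (x : V) : D.E x = κ • x := by rw [h.euler]

theorem dd_t_E (h : FlatData D W d κ t H w dg star) {x : V} (hx : x ∈ W) (i : I) (X : V) :
    dd (t i) x (κ • x) X = (dg i - κ) * fderiv ℂ (t i) x X := by
  obtain ⟨r, hr⟩ := h.euler_t i
  rw [fderiv_homogeneous h.isOpen (h.smooth_t i) contDiffOn_const
    (fun y hy => by rw [← h.E_apply, hr y hy]) hx]
  simp

theorem fderiv_Γ_E (h : FlatData D W d κ t H w dg star) {x : V} (hx : x ∈ W) (X Y : V) :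
    fderiv ℂ (fun y => D.Γ y X Y) x (κ • x) = -κ • D.Γ x X Y := by
  refine h.ext hx fun i => ?_
  obtain ⟨r, hr⟩ := h.euler_t i
  rw [h.fderiv_Γ hx, ← h.hess_t x hx i (κ • x), h.dd_t_E hx, dd_homogeneous h.isOpen (h.smooth_t i)
    (contDiffOn_const (c := r)) (fun y hy => by rw [← h.E_apply, hr y hy]) hx, h.hess_t x hx]
  simp [dd]
  ring

/-- The endomorphism ∇E is diagonal in the frame of the dt with the constant eigenvalues `dg i`,
hence parallel. -/
theorem euler_affine (h : FlatData D W d κ t H w dg star) {x : V} (hx : x ∈ W) (X Y : V) :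
    D.nablaNablaVec D.E x X Y = 0 := by
  have hA (y : V) (Y : V) : D.nablaEnd D.E y Y = κ • Y + D.Γ y Y (κ • y) := by
    simp only [FrobeniusData.nablaEnd, add_apply, ContinuousLinearMap.flip_apply, h.fderiv_E,
      h.E_apply]
  have hA' (i : I) (Y : V) : ∀ y ∈ W, fderiv ℂ (t i) y (D.nablaEnd D.E y Y) =
      dg i * fderiv ℂ (t i) y Y := fun y hy => by
    rw [hA, map_add, ← h.hess_t y hy, dd_symm h.isOpen (h.smooth_t i) hy, h.dd_t_E hy, map_smul,
      smul_eq_mul]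
    ring
  have hs : ContDiffOn ℂ (⊤ : ℕ∞) (fun y => D.nablaEnd D.E y) W := by
    refine contDiffOn_clm_apply.2 fun Y => ?_
    simp only [hA]
    exact contDiffOn_const.add
      ((h.smooth_Γ.clm_apply contDiffOn_const).clm_apply (contDiff_id.const_smul κ).contDiffOn)
  have hs' : DifferentiableAt ℂ (fun y => D.nablaEnd D.E y Y) x :=
    smooth_diff h.isOpen (hs.clm_apply contDiffOn_const) hx
  have e : fderiv ℂ (fun y => D.nablaEnd D.E y Y) x X =
      fderiv ℂ (fun y => D.nablaEnd D.E y) x X Y := by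
    rw [fderiv_clm_apply (smooth_diff h.isOpen hs hx) (differentiableAt_const Y)]; simp
  refine h.separates x hx _ fun i => ?_
  have h1 := DFunLike.congr_fun (fderiv_congr_on h.isOpen (hA' i Y) hx) X
  rw [fderiv_fderiv_apply h.isOpen (h.smooth_t i) hx hs', e, fderiv_const_mul
    (smooth_diff h.isOpen (smooth_fderiv_apply h.isOpen (h.smooth_t i) contDiffOn_const) hx),
    smul_apply, fderiv_fderiv_const h.isOpen (h.smooth_t i) hx, h.hess_t x hx, h.hess_t x hx,
    smul_eq_mul] at h1
  rw [FrobeniusData.nablaNablaVec, map_sub, map_add, hA' i _ x hx]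
  change fderiv ℂ (t i) x (fderiv ℂ (fun y => D.nablaEnd D.E y) x X Y) + _ - _ = _
  linear_combination h1

/-- Componentwise, dt(X * Y) is the covariant Hessian of H. The degree of H exceeds that of t by
one, and its inhomogeneous term has zero covariant Hessian, so the Lie derivative of the product has
weight one. -/
theorem euler_mul (h : FlatData D W d κ t H w dg star) {x : V} (hx : x ∈ W) (X Y : V) :
    D.lieMul x X Y = D.mul x X Y := by
  refine h.ext hx fun i => ?_
  obtain ⟨g, hs, haff, hq⟩ := h.euler_H i
  have hE : ∀ x ∈ W, fderiv ℂ (H i) x (κ • x) = (dg i + 1) * H i x + g x := fun x hx => by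
    rw [← h.E_apply, hq x hx]
  have h1 := h.fderiv_mul hx i (κ • x) X Y
  rw [fderiv_fderiv_apply h.isOpen (h.smooth_t i) hx
    (smooth_diff h.isOpen (h.smooth_mul_apply X Y) hx), h.dd_t_E hx,
    dd_homogeneous h.isOpen (h.smooth_H i) hs hE hx,
    fderiv_homogeneous h.isOpen (h.smooth_H i) hs hE hx, h.fderiv_Γ_E hx, haff x hx,
    h.hess_H x hx] at h1
  simp only [FrobeniusData.lieMul, h.fderiv_E, h.E_apply, map_add, map_sub, map_smul, smul_apply,
    smul_eq_mul]
  simp only [map_smul, smul_eq_mul] at h1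
  linear_combination h1

/-- Each term of the metric pairs two covectors whose degrees add up to 2 - d. -/
theorem euler_metric (h : FlatData D W d κ t H w dg star) {x : V} (hx : x ∈ W) (X Y : V) :
    D.lieMetric x X Y = (2 - d) * D.η x X Y := by
  have hd (i : I) (Y : V) : DifferentiableAt ℂ (fun y => fderiv ℂ (t i) y Y) x :=
    smooth_diff h.isOpen (smooth_fderiv_apply h.isOpen (h.smooth_t i) contDiffOn_const) hx
  rw [FrobeniusData.lieMetric, h.fderiv_E, h.fderiv_E, h.E_apply, (D.η x).map_smul,
    (D.η x X).map_smul, smul_apply, smul_eq_mul,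
    fderiv_congr_on h.isOpen (fun y hy => h.metric y hy X Y) hx,
    fderiv_fun_sum (fun i _ => ((hd i X).const_mul _).fun_mul (hd _ Y)), sum_apply,
    h.metric x hx, Finset.mul_sum, Finset.mul_sum, ← Finset.sum_add_distrib,
    ← Finset.sum_add_distrib]
  refine Finset.sum_congr rfl fun i _ => ?_
  rw [fderiv_fun_mul ((hd i X).const_mul _) (hd _ Y), fderiv_const_mul (hd i X)]
  simp only [add_apply, smul_apply, smul_eq_mul, fderiv_fderiv_const h.isOpen (h.smooth_t _) hx,
    h.dd_t_E hx, ← h.dg_star i]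
  ring

/-! #### Flat coordinates and prepotential -/

theorem isFlatCoordinates (h : FlatData D W d κ t H w dg star) : D.IsFlatCoordinates W t where
  smooth := h.smooth_t
  linearIndependent x hx := by
    classical
    rw [Fintype.linearIndependent_iff]
    intro g hg i
    have := DFunLike.congr_fun hg (frame t i x)
    simpa [sum_apply, h.fderiv_frame hx] using this
  span x hx := by
    rw [eq_top_iff]
    rintro f -
    have : f = ∑ i, f (frame t i x) • fderiv ℂ (t i) x := by
      ext X
      conv_lhs => rw [h.eq_sum_frame hx X]
      rw [map_sum, sum_apply]
      exact Finset.sum_congr rfl fun i _ => by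
        rw [map_smul, smul_apply, smul_eq_mul, smul_eq_mul, _root_.mul_comm]
    rw [this]
    exact Submodule.sum_mem _ fun i _ => Submodule.smul_mem _ _ (Submodule.subset_span ⟨i, rfl⟩)
  flat x hx i X Y := by
    rw [FrobeniusData.hessian, ← h.hess_t x hx]; exact sub_self _

open FrobeniusData (along)

theorem smooth_along (h : FlatData D W d κ t H w dg star) {f : V → ℂ}
    (hf : ContDiffOn ℂ (⊤ : ℕ∞) f W) (j : I) :
    ContDiffOn ℂ (⊤ : ℕ∞) (along (frame t j) f) W :=
  smooth_fderiv_apply h.isOpen hf (h.smooth_frame j)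

/-- The coordinate fields are parallel, being dual to parallel covectors. -/
theorem fderiv_frame_vec (h : FlatData D W d κ t H w dg star) {x : V} (hx : x ∈ W) (j : I)
    (X : V) : fderiv ℂ (frame t j) x X = -D.Γ x X (frame t j x) := by
  classical
  refine h.ext hx fun i => ?_
  have h1 := DFunLike.congr_fun
    (fderiv_congr_on h.isOpen (fun y hy => h.fderiv_frame hy i j) hx) X
  rw [fderiv_fderiv_apply h.isOpen (h.smooth_t i) hx (smooth_diff h.isOpen (h.smooth_frame j) hx),
    h.hess_t x hx] at h1
  rw [map_neg]
  simp only [fderiv_fun_const, Pi.zero_apply, zero_apply] at h1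
  linear_combination h1

theorem fderiv_along (h : FlatData D W d κ t H w dg star) {f : V → ℂ}
    (hf : ContDiffOn ℂ (⊤ : ℕ∞) f W) {x : V} (hx : x ∈ W) (j : I) (X : V) :
    fderiv ℂ (along (frame t j) f) x X =
      dd f x X (frame t j x) - fderiv ℂ f x (D.Γ x X (frame t j x)) := by
  change fderiv ℂ (fun y => fderiv ℂ f y (frame t j y)) x X = _
  rw [fderiv_fderiv_apply h.isOpen hf hx (smooth_diff h.isOpen (h.smooth_frame j) hx),
    h.fderiv_frame_vec hx, map_neg, sub_eq_add_neg]

theorem along_comm (h : FlatData D W d κ t H w dg star) {f : V → ℂ}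
    (hf : ContDiffOn ℂ (⊤ : ℕ∞) f W) {x : V} (hx : x ∈ W) (i j : I) :
    along (frame t i) (along (frame t j) f) x = along (frame t j) (along (frame t i) f) x := by
  rw [along, h.fderiv_along hf hx, along, h.fderiv_along hf hx, dd_symm h.isOpen hf hx,
    h.Γ_symm x hx]

theorem along_congr (h : FlatData D W d κ t H w dg star) {f g : V → ℂ}
    (hfg : ∀ x ∈ W, f x = g x) {x : V} (hx : x ∈ W) (i : I) :
    along (frame t i) f x = along (frame t i) g x := by
  rw [along, along, fderiv_congr_on h.isOpen hfg hx]

theorem along_affine (h : FlatData D W d κ t H w dg star) {f g : V → ℂ}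
    (hf : ContDiffOn ℂ (⊤ : ℕ∞) f W) (c : ℂ) (hs : ContDiffOn ℂ (⊤ : ℕ∞) g W)
    (haff : ∀ x ∈ W, ∀ X Y, dd g x X Y = fderiv ℂ g x (D.Γ x X Y)) {x : V} (hx : x ∈ W) (i j : I) :
    along (frame t i) (along (frame t j) fun x => c * f x + g x) x =
      c * along (frame t i) (along (frame t j) f) x := by
  have h1 : ∀ y ∈ W, along (frame t j) (fun x => c * f x + g x) y =
      c * along (frame t j) f y + along (frame t j) g y :=
    fun y hy => by
      have hd := smooth_diff h.isOpen hf hy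
      rw [along, fderiv_fun_add (hd.const_mul c) (smooth_diff h.isOpen hs hy), fderiv_const_mul hd]
      rfl
  have hd := smooth_diff h.isOpen (h.smooth_along hf j) hx
  rw [h.along_congr h1 hx, along, fderiv_fun_add (hd.const_mul c)
    (smooth_diff h.isOpen (h.smooth_along hs j) hx), fderiv_const_mul hd, add_apply,
    h.fderiv_along hs hx, haff x hx, sub_self, add_zero]
  rfl

theorem along_E (h : FlatData D W d κ t H w dg star) (f : V → ℂ) {x : V} (hx : x ∈ W) :
    along D.E f x = ∑ l, fderiv ℂ (t l) x (D.E x) * along (frame t l) f x := by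
  rw [along]
  conv_lhs => rw [h.eq_sum_frame hx (D.E x)]
  rw [map_sum]
  exact Finset.sum_congr rfl fun l _ => by rw [map_smul, smul_eq_mul, along]

/-- This is the commutator [E, ∂_i] = -`dg i` ∂_i, which holds because E is affine and diagonal in
the flat coordinates. -/
theorem along_E_along (h : FlatData D W d κ t H w dg star) {f : V → ℂ}
    (hf : ContDiffOn ℂ (⊤ : ℕ∞) f W) {x : V} (hx : x ∈ W) (i : I) :
    along D.E (along (frame t i) f) x =
      along (frame t i) (along D.E f) x - dg i * along (frame t i) f x := by
  classical
  have h1 : D.Γ x (κ • x) (frame t i x) = (dg i - κ) • frame t i x := by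
    refine h.ext hx fun j => ?_
    rw [← h.hess_t x hx, h.dd_t_E hx, map_smul, h.fderiv_frame hx, smul_eq_mul]
    split_ifs with hij <;> simp [*]
  have h2 : along (frame t i) (along D.E f) x =
      dd f x (frame t i x) (κ • x) + κ * fderiv ℂ f x (frame t i x) := by
    change fderiv ℂ (fun y => fderiv ℂ f y (D.E y)) x _ = _
    rw [fderiv_fderiv_apply h.isOpen hf hx (by
      rw [h.euler]; exact differentiableAt_id.const_smul κ), h.fderiv_E, h.E_apply, map_smul,
      smul_eq_mul]
  rw [h2, along, h.fderiv_along hf hx, h.E_apply, h1, dd_symm h.isOpen hf hx, map_smul, along,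
    smul_eq_mul]
  ring

/-- In flat coordinates second derivatives are covariant Hessians, so those of H are components of
the product; lowering an index only exchanges k with its dual and divides by the weight. -/
theorem c_frame (h : FlatData D W d κ t H w dg star) {x : V} (hx : x ∈ W) (i j k : I) :
    D.c x (frame t i x) (frame t j x) (frame t k x) =
      (w k)⁻¹ * along (frame t i) (along (frame t j) (H (star k))) x := by
  classical
  rw [along, h.fderiv_along (h.smooth_H _) hx, h.hess_H x hx, h.c_eq hx,
    Finset.sum_eq_single (star k)]
  · rw [h.star_star, h.fderiv_frame hx, h.w_star]; simp
  · intro l _ hl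
    rw [h.fderiv_frame hx, if_neg, mul_zero]
    rintro rfl; exact hl (h.star_star l).symm
  · simp

theorem along_sum_E (h : FlatData D W d κ t H w dg star) {G : I → V → ℂ}
    (hG : ∀ i, ContDiffOn ℂ (⊤ : ℕ∞) (G i) W) {x : V} (hx : x ∈ W) (k : I) :
    along (frame t k) (fun x => ∑ i, (w i)⁻¹ * (fderiv ℂ (t i) x (D.E x) * G i x)) x =
      (w k)⁻¹ * dg k * G k x +
        ∑ i, (w i)⁻¹ * (fderiv ℂ (t i) x (D.E x) * along (frame t k) (G i) x) := by
  classical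
  choose r hr using h.euler_t
  have h1 : ∀ x ∈ W, ∑ i, (w i)⁻¹ * (fderiv ℂ (t i) x (D.E x) * G i x) =
      ∑ i, (w i)⁻¹ * ((dg i * t i x + r i) * G i x) := fun x hx =>
    Finset.sum_congr rfl fun i _ => by rw [hr i x hx]
  have hd (i : I) : DifferentiableAt ℂ (fun x => dg i * t i x + r i) x :=
    ((smooth_diff h.isOpen (h.smooth_t i) hx).const_mul _).add_const _
  have hd' (i : I) := smooth_diff h.isOpen (hG i) hx
  have h2 : (w k)⁻¹ * dg k * G k x =
      ∑ i, (w i)⁻¹ * (dg i * fderiv ℂ (t i) x (frame t k x) * G i x) := by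
    rw [Finset.sum_eq_single k]
    · rw [h.fderiv_frame hx]; simp [mul_assoc]
    · intro i _ hi; rw [h.fderiv_frame hx]; simp [hi]
    · simp
  rw [h.along_congr h1 hx, along, fderiv_fun_sum fun i _ => ((hd i).fun_mul (hd' i)).const_mul _,
    sum_apply, h2, ← Finset.sum_add_distrib]
  refine Finset.sum_congr rfl fun i _ => ?_
  rw [fderiv_const_mul ((hd i).fun_mul (hd' i)), fderiv_fun_mul (hd i) (hd' i), fderiv_add_const,
    fderiv_const_mul (smooth_diff h.isOpen (h.smooth_t i) hx), hr i x hx]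
  simp only [add_apply, smul_apply, smul_eq_mul, along]
  ring

/-- Commuting E past two coordinate fields lowers the degree by `dg i` and `dg j`; the inhomogeneous
term of H is affine in the flat coordinates and drops out after two derivatives. -/
theorem along_along_E_H (h : FlatData D W d κ t H w dg star) {x : V} (hx : x ∈ W) (i j k : I) :
    along D.E (along (frame t i) (along (frame t j) (H (star k)))) x =
      (3 - d - dg i - dg j - dg k) * along (frame t i) (along (frame t j) (H (star k))) x := by
  have hH := h.smooth_H (star k)
  obtain ⟨g, hs, haff, hq⟩ := h.euler_H (star k)
  have h1 : ∀ y ∈ W, along D.E (H (star k)) y = (dg (star k) + 1) * H (star k) y + g y :=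
    fun y hy => by rw [along, hq y hy]
  have hE : ContDiffOn ℂ (⊤ : ℕ∞) (along D.E (H (star k))) W :=
    smooth_fderiv_apply h.isOpen hH (by rw [h.euler]; exact (contDiff_id.const_smul κ).contDiffOn)
  have h2 : along (frame t i) (fun y => along (frame t j) (along D.E (H (star k))) y -
        dg j * along (frame t j) (H (star k)) y) x =
      along (frame t i) (along (frame t j) (along D.E (H (star k)))) x -
        dg j * along (frame t i) (along (frame t j) (H (star k))) x := by
    have hd := smooth_diff h.isOpen (h.smooth_along hH j) hx
    rw [along, fderiv_fun_sub (smooth_diff h.isOpen (h.smooth_along hE j) hx) (hd.const_mul _),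
      fderiv_const_mul hd]
    rfl
  rw [h.along_E_along (h.smooth_along hH j) hx,
    h.along_congr (fun y hy => h.along_E_along hH hy j) hx, h2,
    h.along_congr (fun y hy => h.along_congr h1 hy j) hx, h.along_affine hH _ hs haff hx]
  linear_combination (along (frame t i) (along (frame t j) (H (star k))) x) * h.dg_star k

theorem along_const_mul (h : FlatData D W d κ t H w dg star) {f : V → ℂ}
    (hf : ContDiffOn ℂ (⊤ : ℕ∞) f W) (c : ℂ) {x : V} (hx : x ∈ W) (i : I) :
    along (frame t i) (fun y => c * f y) x = c * along (frame t i) f x := by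
  rw [along, fderiv_const_mul (smooth_diff h.isOpen hf hx)]; rfl

theorem along_add (h : FlatData D W d κ t H w dg star) {f g : V → ℂ}
    (hf : ContDiffOn ℂ (⊤ : ℕ∞) f W) (hg : ContDiffOn ℂ (⊤ : ℕ∞) g W) {x : V} (hx : x ∈ W)
    (i : I) :
    along (frame t i) (fun y => f y + g y) x = along (frame t i) f x + along (frame t i) g x := by
  rw [along, fderiv_fun_add (smooth_diff h.isOpen hf hx) (smooth_diff h.isOpen hg hx)]; rfl

/-- The components of E are affine in the flat coordinates. Three derivatives of the sum therefore
give (`dg i` + `dg j` + `dg k`) c plus the sum of the components of E against third derivatives of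
H. The latter is the derivative of c along E, equal to (3 - d - `dg i` - `dg j` - `dg k`) c, so the
degrees cancel. -/
theorem isPrepotential (h : FlatData D W d κ t H w dg star) (hd : 3 - d ≠ 0) {F : V → ℂ}
    (hF : ∀ x ∈ W, F x =
      1 / (3 - d) * ∑ i, (w i)⁻¹ * (fderiv ℂ (t i) x (D.E x) * H (star i) x)) :
    D.IsPrepotential W t F := by
  classical
  have hE (i : I) : ContDiffOn ℂ (⊤ : ℕ∞) (fun x => fderiv ℂ (t i) x (D.E x)) W :=
    smooth_fderiv_apply h.isOpen (h.smooth_t i)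
      (by rw [h.euler]; exact (contDiff_id.const_smul κ).contDiffOn)
  have hS {G : I → V → ℂ} (hG : ∀ i, ContDiffOn ℂ (⊤ : ℕ∞) (G i) W) :
      ContDiffOn ℂ (⊤ : ℕ∞) (fun x => ∑ i, (w i)⁻¹ * (fderiv ℂ (t i) x (D.E x) * G i x)) W :=
    ContDiffOn.sum fun i _ => contDiffOn_const.mul ((hE i).mul (hG i))
  have hH (i : I) := h.smooth_H (star i)
  have hc (i : I) (c : ℂ) {f : V → ℂ} (hf : ContDiffOn ℂ (⊤ : ℕ∞) f W) :
      ContDiffOn ℂ (⊤ : ℕ∞) (fun x => c * f x) W := contDiffOn_const.mul hf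
  refine ⟨(contDiffOn_const.mul (hS hH)).congr hF, frame t, h.smooth_frame,
    fun x hx i j => ?_, fun x hx i j k => ?_⟩
  · rw [h.fderiv_frame hx]
  have s1 := fun i l => h.smooth_along (hH l) i
  have s2 := fun i j l => h.smooth_along (s1 j l) i
  have e1 : ∀ y ∈ W, along (frame t k) F y = 1 / (3 - d) * ((w k)⁻¹ * dg k * H (star k) y +
        ∑ i, (w i)⁻¹ * (fderiv ℂ (t i) y (D.E y) * along (frame t k) (H (star i)) y)) :=
    fun y hy => by
      rw [h.along_congr hF hy, h.along_const_mul (hS hH) _ hy, h.along_sum_E hH hy]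
  have e2 : ∀ y ∈ W, along (frame t j) (along (frame t k) F) y = 1 / (3 - d) *
      ((w k)⁻¹ * dg k * along (frame t j) (H (star k)) y +
        ((w j)⁻¹ * dg j * along (frame t k) (H (star j)) y + ∑ i, (w i)⁻¹ *
          (fderiv ℂ (t i) y (D.E y) * along (frame t j) (along (frame t k) (H (star i))) y))) :=
    fun y hy => by
      rw [h.along_congr e1 hy, h.along_const_mul ((hc k _ (hH k)).add (hS (s1 k))) _ hy,
        h.along_add (hc k _ (hH k)) (hS (s1 k)) hy, h.along_const_mul (hH k) _ hy,
        h.along_sum_E (s1 k) hy]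
  rw [h.along_congr e2 hx, h.along_const_mul ((hc k _ (s1 j k)).add
      ((hc j _ (s1 k j)).add (hS (s2 j k)))) _ hx, h.along_add (hc k _ (s1 j k))
      ((hc j _ (s1 k j)).add (hS (s2 j k))) hx, h.along_add (hc j _ (s1 k j)) (hS (s2 j k)) hx,
    h.along_const_mul (s1 j k) _ hx, h.along_const_mul (s1 k j) _ hx, h.along_sum_E (s2 j k) hx]
  have c1 := h.c_frame hx i j k
  have c2 : D.c x (frame t i x) (frame t j x) (frame t k x) =
      (w j)⁻¹ * along (frame t i) (along (frame t k) (H (star j))) x := by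
    rw [h.c_swap' hx, h.c_frame hx]
  have c3 : D.c x (frame t i x) (frame t j x) (frame t k x) =
      (w i)⁻¹ * along (frame t j) (along (frame t k) (H (star i))) x := by
    rw [h.c_swap hx, h.c_swap' hx, h.c_frame hx]
  -- Symmetry of c exchanges the derivatives of the potential dual to l with those of the potential
  -- dual to k, and the sum over l becomes a derivative along E.
  have c4 : ∑ l, (w l)⁻¹ * (fderiv ℂ (t l) x (D.E x) *
      along (frame t i) (along (frame t j) (along (frame t k) (H (star l)))) x) =
      (w k)⁻¹ * along D.E (along (frame t i) (along (frame t j) (H (star k)))) x := by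
    rw [h.along_E _ hx, Finset.mul_sum]
    refine Finset.sum_congr rfl fun l _ => ?_
    have : ∀ y ∈ W, (w l)⁻¹ * along (frame t j) (along (frame t k) (H (star l))) y =
        (w k)⁻¹ * along (frame t l) (along (frame t j) (H (star k))) y := fun y hy => by
      rw [h.along_comm (hH k) hy, ← h.c_frame hy, h.c_swap' hy, h.c_frame hy]
    have := h.along_congr this hx i
    rw [h.along_const_mul (s2 j k l) _ hx, h.along_const_mul (s2 l j k) _ hx,
      h.along_comm (s1 j k) hx] at this
    linear_combination (fderiv ℂ (t l) x (D.E x)) * this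
  rw [c4, h.along_along_E_H hx]
  field_simp
  linear_combination (3 - d) * c1 + dg j * (c2 - c1) + dg i * (c3 - c1)

end FlatData

end MeroFrob
end

/-! ### Formal powers and logarithms of series with a prescribed leading coefficient. -/

noncomputable section

namespace MeroFrob

open scoped OnePoint
open PowerSeries (constantCoeff)

/-! ### Powers and logarithms of power series -/

theorem coeff_pow_of_constantCoeff {u : PowerSeries ℂ} (hu : constantCoeff u = 0) {d k : ℕ}
    (h : d < k) : PowerSeries.coeff d (u ^ k) = 0 :=
  PowerSeries.coeff_of_lt_order _ (lt_of_lt_of_le (by exact_mod_cast h)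
    (PowerSeries.le_order_pow_of_constantCoeff_eq_zero k hu))

theorem coeff_subst_eq_sum {u : PowerSeries ℂ} (hu : constantCoeff u = 0) (f : PowerSeries ℂ)
    {d N : ℕ} (h : d < N) : PowerSeries.coeff d (f.subst u) =
      ∑ k ∈ Finset.range N, PowerSeries.coeff k f * PowerSeries.coeff d (u ^ k) := by
  rw [PowerSeries.coeff_subst' (PowerSeries.HasSubst.of_constantCoeff_zero' hu),
    finsum_eq_sum_of_support_subset]
  · rfl
  · intro k hk
    rw [Finset.coe_range, Set.mem_Iio]
    by_contra hk'
    exact hk (by simp only [smul_eq_mul, coeff_pow_of_constantCoeff hu (by omega : d < k), mul_zero])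

/-- The termwise derivative of f(u) and the chain rule have to agree coefficient by coefficient.
Since v has no constant term, only powers of u below d contribute to the coefficient of index d, and
the two finite sums match after a shift. -/
theorem coeff_subst_mul {u v : PowerSeries ℂ} (hu : constantCoeff u = 0) (hv : constantCoeff v = 0)
    (f : PowerSeries ℂ) (d : ℕ) :
    PowerSeries.coeff d ((PowerSeries.derivative ℂ f).subst u * v) =
      ∑ k ∈ Finset.range (d + 1), PowerSeries.coeff k f *
        ((k : ℂ) * PowerSeries.coeff d (u ^ (k - 1) * v)) := by
  rw [Finset.sum_range_succ', PowerSeries.coeff_mul]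
  have h (p) (hp : p ∈ Finset.HasAntidiagonal.antidiagonal d) :
      PowerSeries.coeff p.1 ((PowerSeries.derivative ℂ f).subst u) * PowerSeries.coeff p.2 v =
        ∑ k ∈ Finset.range d, PowerSeries.coeff (k + 1) f * ((k + 1 : ℂ) *
          (PowerSeries.coeff p.1 (u ^ k) * PowerSeries.coeff p.2 v)) := by
    rw [Finset.HasAntidiagonal.mem_antidiagonal] at hp
    rcases Nat.eq_zero_or_pos p.2 with h0 | h0
    · have : PowerSeries.coeff p.2 v = 0 := by
        rw [h0, PowerSeries.coeff_zero_eq_constantCoeff_apply, hv]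
      simp [this]
    · rw [coeff_subst_eq_sum hu _ (by omega : p.1 < d), Finset.sum_mul]
      refine Finset.sum_congr rfl fun k _ => ?_
      rw [PowerSeries.coeff_derivative]; ring
  rw [Finset.sum_congr rfl h, Finset.sum_comm]
  simp only [Nat.cast_zero, zero_mul, mul_zero, add_zero]
  refine Finset.sum_congr rfl fun k _ => ?_
  rw [Nat.add_sub_cancel, PowerSeries.coeff_mul, Finset.mul_sum, Finset.mul_sum]
  push_cast; rfl

/-- The power series of `(1 + X) ^ r`. -/
def binom (r : ℂ) : PowerSeries ℂ :=
  PowerSeries.mk fun k => (∏ i ∈ Finset.range k, (r - i)) / (Nat.factorial k : ℂ)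

theorem powOneAdd_eq {u : PowerSeries ℂ} (hu : constantCoeff u = 0) (r : ℂ) :
    powOneAdd r u = (binom r).subst u := by
  ext d
  rw [coeff_subst_eq_sum hu _ d.lt_succ_self, powOneAdd, PowerSeries.coeff_mk]
  simp [binom]

theorem derivative_binom (r : ℂ) :
    PowerSeries.derivative ℂ (binom r) = PowerSeries.C r * binom (r - 1) := by
  ext k
  rw [PowerSeries.coeff_derivative, PowerSeries.coeff_C_mul, binom, binom, PowerSeries.coeff_mk,
    PowerSeries.coeff_mk, Finset.prod_range_succ', Nat.factorial_succ]
  have h1 : (k + 1 : ℂ) ≠ 0 := by exact_mod_cast k.succ_ne_zero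
  have h2 : (Nat.factorial k : ℂ) ≠ 0 := by exact_mod_cast k.factorial_ne_zero
  have h3 : ∏ i ∈ Finset.range k, (r - ((i + 1 : ℕ) : ℂ)) = ∏ i ∈ Finset.range k, (r - 1 - i) :=
    Finset.prod_congr rfl fun i _ => by push_cast; ring
  rw [h3]
  push_cast
  field_simp
  ring

theorem binom_ode (r : ℂ) :
    (1 + PowerSeries.X) * PowerSeries.derivative ℂ (binom r) = PowerSeries.C r * binom r := by
  ext k
  rw [add_mul, one_mul, map_add, PowerSeries.coeff_C_mul]
  cases k with
  | zero =>
    rw [PowerSeries.coeff_derivative, PowerSeries.coeff_zero_X_mul]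
    simp [binom]
  | succ k =>
    rw [PowerSeries.coeff_succ_X_mul, PowerSeries.coeff_derivative, PowerSeries.coeff_derivative]
    simp only [binom, PowerSeries.coeff_mk]
    rw [Finset.prod_range_succ _ (k + 1), Nat.factorial_succ (k + 1)]
    have h1 : (k + 1 + 1 : ℂ) ≠ 0 := by exact_mod_cast (k + 1).succ_ne_zero
    have h2 : (Nat.factorial (k + 1) : ℂ) ≠ 0 := by exact_mod_cast (k + 1).factorial_ne_zero
    push_cast
    field_simp
    ring

/-- The differential equation determines each coefficient from the preceding one. This uniqueness
yields the law of exponents and the derivative of the logarithm without identities for binomial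
coefficients. -/
theorem eq_binom {f : PowerSeries ℂ} {r : ℂ} (h0 : constantCoeff f = 1)
    (h : (1 + PowerSeries.X) * PowerSeries.derivative ℂ f = PowerSeries.C r * f) : f = binom r := by
  have key : ∀ g : PowerSeries ℂ,
      (1 + PowerSeries.X) * PowerSeries.derivative ℂ g = PowerSeries.C r * g →
      constantCoeff g = 0 → g = 0 := by
    intro g hg hg0
    ext k
    rw [map_zero]
    induction k with
    | zero => simpa using hg0
    | succ k ih =>
      have h1 := congrArg (PowerSeries.coeff k) hg
      have h2 : PowerSeries.coeff k (PowerSeries.X * PowerSeries.derivative ℂ g) = 0 := by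
        cases k with
        | zero => simp
        | succ k => rw [PowerSeries.coeff_succ_X_mul, PowerSeries.coeff_derivative, ih, zero_mul]
      rw [add_mul, one_mul, map_add, h2, PowerSeries.coeff_C_mul, ih, mul_zero, add_zero,
        PowerSeries.coeff_derivative] at h1
      exact (mul_eq_zero.1 h1).resolve_right (by exact_mod_cast k.succ_ne_zero)
  rw [← sub_eq_zero]
  refine key _ ?_ ?_
  · rw [map_sub, mul_sub, h, binom_ode, mul_sub]
  · rw [map_sub, h0, binom, ← PowerSeries.coeff_zero_eq_constantCoeff_apply, PowerSeries.coeff_mk]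
    simp

theorem constantCoeff_binom (r : ℂ) : constantCoeff (binom r) = 1 := by
  rw [binom, ← PowerSeries.coeff_zero_eq_constantCoeff_apply, PowerSeries.coeff_mk]; simp

theorem binom_add (r s : ℂ) : binom (r + s) = binom r * binom s := by
  refine (eq_binom (by simp [constantCoeff_binom]) ?_).symm
  rw [Derivation.leibniz, smul_eq_mul, smul_eq_mul, map_add]
  linear_combination (binom s) * binom_ode r + (binom r) * binom_ode s

theorem binom_zero : binom 0 = 1 := (eq_binom (by simp) (by simp)).symm

theorem binom_one : binom 1 = 1 + PowerSeries.X := (eq_binom (by simp) (by simp)).symm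

/-- Substitution of u into a product formula for binomial series. -/
theorem powOneAdd_add {u : PowerSeries ℂ} (hu : constantCoeff u = 0) (r s : ℂ) :
    powOneAdd (r + s) u = powOneAdd r u * powOneAdd s u := by
  rw [powOneAdd_eq hu, powOneAdd_eq hu, powOneAdd_eq hu, binom_add,
    PowerSeries.subst_mul (PowerSeries.HasSubst.of_constantCoeff_zero' hu)]

theorem powOneAdd_zero {u : PowerSeries ℂ} (hu : constantCoeff u = 0) : powOneAdd 0 u = 1 := by
  rw [powOneAdd_eq hu, binom_zero, ← PowerSeries.coe_substAlgHom
    (PowerSeries.HasSubst.of_constantCoeff_zero' hu), map_one]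

theorem powOneAdd_one {u : PowerSeries ℂ} (hu : constantCoeff u = 0) : powOneAdd 1 u = 1 + u := by
  have h := PowerSeries.HasSubst.of_constantCoeff_zero' hu
  rw [powOneAdd_eq hu, binom_one, ← PowerSeries.coe_substAlgHom h, map_add, map_one,
    PowerSeries.coe_substAlgHom h, PowerSeries.subst_X h]

theorem logOneAdd_eq {u : PowerSeries ℂ} (hu : constantCoeff u = 0) :
    logOneAdd u = (PowerSeries.log ℂ).subst u := by
  ext d
  rw [coeff_subst_eq_sum hu _ d.lt_succ_self, logOneAdd, PowerSeries.coeff_mk,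
    Finset.range_eq_Ico, Finset.sum_eq_sum_Ico_succ_bot d.succ_pos]
  simp only [PowerSeries.coeff_log, if_true, zero_mul, zero_add]
  refine Finset.sum_congr (by ext; simp) fun k hk => ?_
  rw [if_neg (by simp at hk; omega)]
  simp

theorem derivative_log : PowerSeries.derivative ℂ (PowerSeries.log ℂ) = binom (-1) := by
  refine eq_binom ?_ ?_
  · rw [PowerSeries.deriv_log, ← PowerSeries.coeff_zero_eq_constantCoeff_apply,
      PowerSeries.coeff_mk]
    simp
  · rw [PowerSeries.deriv_log]
    ext k
    rw [add_mul, one_mul, map_add, PowerSeries.coeff_C_mul]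
    cases k with
    | zero =>
      rw [PowerSeries.coeff_zero_X_mul, PowerSeries.coeff_derivative, PowerSeries.coeff_mk,
        PowerSeries.coeff_mk]
      simp
    | succ k =>
      rw [PowerSeries.coeff_succ_X_mul, PowerSeries.coeff_derivative, PowerSeries.coeff_derivative,
        PowerSeries.coeff_mk, PowerSeries.coeff_mk]
      simp only [map_pow, map_neg, map_one]
      push_cast
      ring

theorem constantCoeff_powOneAdd (r : ℂ) (u : PowerSeries ℂ) : constantCoeff (powOneAdd r u) = 1 := by
  rw [powOneAdd, ← PowerSeries.coeff_zero_eq_constantCoeff_apply, PowerSeries.coeff_mk]; simp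

theorem derivative_powOneAdd {u : PowerSeries ℂ} (hu : constantCoeff u = 0) (r : ℂ) :
    PowerSeries.derivative ℂ (powOneAdd r u) =
      PowerSeries.C r * powOneAdd (r - 1) u * PowerSeries.derivative ℂ u := by
  have h := PowerSeries.HasSubst.of_constantCoeff_zero' hu
  rw [powOneAdd_eq hu, powOneAdd_eq hu, PowerSeries.derivative_subst h, derivative_binom,
    PowerSeries.subst_mul h, PowerSeries.subst_C]
  rfl

theorem derivative_logOneAdd {u : PowerSeries ℂ} (hu : constantCoeff u = 0) :
    PowerSeries.derivative ℂ (logOneAdd u) = powOneAdd (-1) u * PowerSeries.derivative ℂ u := by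
  have h := PowerSeries.HasSubst.of_constantCoeff_zero' hu
  rw [logOneAdd_eq hu, powOneAdd_eq hu, PowerSeries.derivative_subst h, derivative_log]

theorem theta_ofPowerSeries (f : PowerSeries ℂ) : theta (HahnSeries.ofPowerSeries ℤ ℂ f) =
    HahnSeries.ofPowerSeries ℤ ℂ (PowerSeries.X * PowerSeries.derivative ℂ f) := by
  ext d
  rw [theta_coeff, PowerSeries.coeff_coe, PowerSeries.coeff_coe]
  split_ifs with h
  · simp
  · obtain ⟨k, rfl⟩ := Int.eq_ofNat_of_zero_le (not_lt.1 h)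
    rw [Int.natAbs_natCast]
    cases k with
    | zero => simp
    | succ k =>
      rw [PowerSeries.coeff_succ_X_mul, PowerSeries.coeff_derivative, mul_comm]; push_cast; rfl

theorem theta_single (k : ℤ) (c : ℂ) :
    theta (HahnSeries.single k c) = HahnSeries.C (k : ℂ) * HahnSeries.single k c := by
  ext d
  rw [theta_coeff, HahnSeries.C_mul_eq_smul, HahnSeries.coeff_smul, smul_eq_mul]
  by_cases h : d = k
  · rw [h]
  · rw [HahnSeries.coeff_single_of_ne h, mul_zero, mul_zero]

theorem C_mul_single (c : ℂ) (k : ℤ) (x : ℂ) :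
    HahnSeries.C c * HahnSeries.single k x = HahnSeries.single k (c * x) := by
  rw [HahnSeries.C_apply, HahnSeries.single_mul_single, zero_add]

section UnitPart

variable {lc : ℂ} {m : ℤ} {F : LaurentSeries ℂ}

theorem constantCoeff_unitPart (hl : Complex.exp lc = F.coeff (-m)) :
    constantCoeff (unitPart lc m F) = 0 := by
  rw [unitPart, map_sub, map_mul, ← PowerSeries.coeff_zero_eq_constantCoeff_apply (PowerSeries.mk _),
    PowerSeries.coeff_mk, PowerSeries.constantCoeff_C, map_one, Nat.cast_zero, zero_sub, ← hl,
    ← Complex.exp_add]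
  simp

theorem eq_single_mul {c : ℂ} (hF : LOrd (-m) F) : F = HahnSeries.single (-m) c *
    HahnSeries.ofPowerSeries ℤ ℂ (PowerSeries.C c⁻¹ * PowerSeries.mk fun d => F.coeff ((d : ℤ) - m)) ∨
    c = 0 := by
  by_cases hc : c = 0
  · exact Or.inr hc
  left
  ext d
  rw [coeff_single_mul', PowerSeries.coeff_coe, PowerSeries.coeff_C_mul, PowerSeries.coeff_mk]
  split_ifs with h
  · rw [hF.coeff (by omega)]; simp
  · rw [show (((d - -m).natAbs : ℤ) - m) = d by omega]; field_simp

theorem unitPart_spec (hF : LOrd (-m) F) : F = HahnSeries.single (-m) (Complex.exp lc) *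
    HahnSeries.ofPowerSeries ℤ ℂ (1 + unitPart lc m F) := by
  have := (eq_single_mul (c := Complex.exp lc) hF).resolve_right (Complex.exp_ne_zero _)
  rw [unitPart, add_sub_cancel, Complex.exp_neg]
  exact this

theorem fracPow_add (hl : Complex.exp lc = F.coeff (-m)) (q r : ℤ) :
    fracPow lc m (q + r) F = fracPow lc m q F * fracPow lc m r F := by
  have h : ((q + r : ℤ) : ℂ) / m = (q : ℂ) / m + (r : ℂ) / m := by push_cast; rw [add_div]
  rw [fracPow, h, powOneAdd_add (constantCoeff_unitPart hl), add_mul, Complex.exp_add, neg_add,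
    ← HahnSeries.single_mul_single, map_mul, fracPow, fracPow]
  ring

theorem fracPow_zero (hl : Complex.exp lc = F.coeff (-m)) : fracPow lc m 0 F = 1 := by
  rw [fracPow, Int.cast_zero, zero_div, powOneAdd_zero (constantCoeff_unitPart hl)]; simp

theorem fracPow_self (hm : m ≠ 0) (hF : LOrd (-m) F) (hl : Complex.exp lc = F.coeff (-m)) :
    fracPow lc m m F = F := by
  have h : (m : ℂ) ≠ 0 := by exact_mod_cast hm
  conv_rhs => rw [unitPart_spec (lc := lc) hF]
  rw [fracPow, div_self h, powOneAdd_one (constantCoeff_unitPart hl), one_mul]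

theorem lExact_fracPow (lc : ℂ) (m q : ℤ) (F : LaurentSeries ℂ) :
    LExact (-q) (fracPow lc m q F) := by
  have h := (lOrd_single (-q) (Complex.exp ((q : ℂ) / m * lc))).coeff_mul_add
    (lOrd_ofPowerSeries (powOneAdd ((q : ℂ) / m) (unitPart lc m F)))
  rw [add_zero, PowerSeries.coeff_coe, if_neg (lt_irrefl 0), Int.natAbs_zero,
    PowerSeries.coeff_zero_eq_constantCoeff_apply, constantCoeff_powOneAdd, mul_one,
    HahnSeries.coeff_single_same] at h
  refine lExact_of ?_ ?_
  · exact (lOrd_single _ _).mul_le (lOrd_ofPowerSeries _) (by simp)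
  · rw [fracPow, h]; exact Complex.exp_ne_zero _

/-- The chain rule for fractional powers, for any derivation. -/
theorem fracPow_chain (hm : m ≠ 0) (hF : LOrd (-m) F) (hl : Complex.exp lc = F.coeff (-m))
    (q : ℤ) (c : ℂ) (v : PowerSeries ℂ) :
    HahnSeries.C ((q : ℂ) / m * c) * fracPow lc m q F +
      HahnSeries.single (-q) (Complex.exp ((q : ℂ) / m * lc)) * HahnSeries.ofPowerSeries ℤ ℂ
        (PowerSeries.C ((q : ℂ) / m) * powOneAdd ((q : ℂ) / m - 1) (unitPart lc m F) * v) =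
    HahnSeries.C ((q : ℂ) / m) * fracPow lc m (q - m) F * (HahnSeries.C c * F +
      HahnSeries.single (-m) (Complex.exp lc) * HahnSeries.ofPowerSeries ℤ ℂ v) := by
  have hm' : (m : ℂ) ≠ 0 := by exact_mod_cast hm
  have h1 : fracPow lc m q F = fracPow lc m (q - m) F * F := by
    have := fracPow_add (q := q - m) (r := m) hl
    rwa [fracPow_self hm hF hl, sub_add_cancel] at this
  have h2 : ((q - m : ℤ) : ℂ) / m = (q : ℂ) / m - 1 := by push_cast; field_simp
  have h3 : HahnSeries.single (-q) (Complex.exp ((q : ℂ) / m * lc)) =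
      HahnSeries.single (-(q - m)) (Complex.exp (((q : ℂ) / m - 1) * lc)) *
        HahnSeries.single (-m) (Complex.exp lc) := by
    rw [HahnSeries.single_mul_single, ← Complex.exp_add]
    congr 1
    · congr 1; ring
    · congr 1; ring
  have h4 : HahnSeries.ofPowerSeries ℤ ℂ (PowerSeries.C ((q : ℂ) / m)) =
      HahnSeries.C ((q : ℂ) / m) := HahnSeries.ofPowerSeries_C _
  have h5 : fracPow lc m (q - m) F =
      HahnSeries.single (-(q - m)) (Complex.exp (((q : ℂ) / m - 1) * lc)) *
        HahnSeries.ofPowerSeries ℤ ℂ (powOneAdd ((q : ℂ) / m - 1) (unitPart lc m F)) := by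
    rw [fracPow, h2]
  rw [h1, h3, map_mul HahnSeries.C, map_mul, map_mul, h4]
  linear_combination (-(HahnSeries.C ((q : ℂ) / m)) * HahnSeries.single (-m) (Complex.exp lc) *
    HahnSeries.ofPowerSeries ℤ ℂ v) * h5

theorem theta_eq (hF : LOrd (-m) F) : theta F = HahnSeries.C (-(m : ℂ)) * F +
    HahnSeries.single (-m) (Complex.exp lc) * HahnSeries.ofPowerSeries ℤ ℂ
      (PowerSeries.X * PowerSeries.derivative ℂ (unitPart lc m F)) := by
  have h := unitPart_spec (lc := lc) hF
  have h1 : PowerSeries.derivative ℂ (1 + unitPart lc m F) =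
      PowerSeries.derivative ℂ (unitPart lc m F) := by simp
  conv_lhs => rw [h]
  rw [theta_mul, theta_single, theta_ofPowerSeries, mul_assoc, ← h, h1]
  push_cast; rfl

theorem theta_fracPow (hm : m ≠ 0) (hF : LOrd (-m) F) (hl : Complex.exp lc = F.coeff (-m))
    (q : ℤ) : theta (fracPow lc m q F) =
      HahnSeries.C ((q : ℂ) / m) * fracPow lc m (q - m) F * theta F := by
  have hm' : (m : ℂ) ≠ 0 := by exact_mod_cast hm
  conv_rhs => rw [theta_eq (lc := lc) hF]
  rw [← fracPow_chain hm hF hl]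
  conv_lhs => rw [fracPow, theta_mul, theta_single, theta_ofPowerSeries,
    derivative_powOneAdd (constantCoeff_unitPart hl), mul_assoc, ← fracPow]
  congr 2
  · congr 1; push_cast; field_simp
  · congr 1; ring

/-- The chain rule for logarithms, for any derivation. -/
theorem logReg_chain (hF : LOrd (-m) F) (hl : Complex.exp lc = F.coeff (-m)) (c : ℂ)
    (v : PowerSeries ℂ) :
    HahnSeries.C c + HahnSeries.ofPowerSeries ℤ ℂ (powOneAdd (-1) (unitPart lc m F) * v) =
      (HahnSeries.C c * F +
        HahnSeries.single (-m) (Complex.exp lc) * HahnSeries.ofPowerSeries ℤ ℂ v) / F := by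
  have h := unitPart_spec (lc := lc) hF
  have hu := constantCoeff_unitPart hl
  have h1 : HahnSeries.ofPowerSeries ℤ ℂ (powOneAdd (-1) (unitPart lc m F)) *
      HahnSeries.ofPowerSeries ℤ ℂ (1 + unitPart lc m F) = 1 := by
    rw [← map_mul, ← powOneAdd_one hu, ← powOneAdd_add hu]; simp [powOneAdd_zero hu]
  have hF0 : F ≠ 0 := by
    rintro rfl; rw [HahnSeries.coeff_zero] at hl; exact Complex.exp_ne_zero _ hl
  rw [eq_div_iff hF0, add_mul]
  conv_lhs => enter [2, 2]; rw [h]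
  rw [map_mul]
  linear_combination (HahnSeries.single (-m) (Complex.exp lc) *
    HahnSeries.ofPowerSeries ℤ ℂ v) * h1

/-- The extra constant m appears because the logarithm is that of x^m F and not of F. -/
theorem theta_logReg (hF : LOrd (-m) F) (hl : Complex.exp lc = F.coeff (-m)) :
    theta (logReg lc m F) = theta F / F + HahnSeries.C (m : ℂ) := by
  have h := logReg_chain hF hl (-(m : ℂ)) (PowerSeries.X * PowerSeries.derivative ℂ (unitPart lc m F))
  rw [← theta_eq hF] at h
  have h0 : theta (HahnSeries.C lc : LaurentSeries ℂ) = 0 := by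
    rw [HahnSeries.C_apply, theta_single]; simp
  rw [← h, logReg, theta_add, h0, theta_ofPowerSeries,
    derivative_logOneAdd (constantCoeff_unitPart hl), map_neg, mul_left_comm]
  ring

end UnitPart

end MeroFrob
end

/-! ### Differentiation of Laurent series that depend on parameters. -/

noncomputable section

namespace MeroFrob

open scoped OnePoint ContDiff
open PowerSeries (constantCoeff)

/-! ### Smooth families of Laurent series -/

section Families

variable {V : Type*} [NormedAddCommGroup V] [NormedSpace ℂ V] {W : Set V}

/-- A family of Laurent series with coefficients smooth on `W`, and its coefficientwise
derivative. -/
structure FamZ (W : Set V) (G : V → LaurentSeries ℂ) (G' : V → V → LaurentSeries ℂ) : Prop where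
  lb : ∃ N, ∀ x ∈ W, LOrd N (G x)
  smooth : ∀ d, ContDiffOn ℂ (⊤ : ℕ∞) (fun x => (G x).coeff d) W
  deriv : ∀ x ∈ W, ∀ ξ d, fderiv ℂ (fun y => (G y).coeff d) x ξ = (G' x ξ).coeff d

namespace FamZ

variable {G F : V → LaurentSeries ℂ} {G' F' : V → V → LaurentSeries ℂ}

theorem congr (hW : IsOpen W) (h : FamZ W G G') (hF : ∀ x ∈ W, F x = G x)
    (hF' : ∀ x ∈ W, ∀ ξ, F' x ξ = G' x ξ) : FamZ W F F' where
  lb := by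
    obtain ⟨N, hN⟩ := h.lb
    exact ⟨N, fun x hx => by rw [hF x hx]; exact hN x hx⟩
  smooth d := (h.smooth d).congr fun x hx => by rw [hF x hx]
  deriv x hx ξ d := by
    rw [fderiv_congr_on hW (fun y hy => by rw [hF y hy]) hx, h.deriv x hx, hF' x hx]

theorem deriv_unique (hW : IsOpen W) (h : FamZ W G G') (h' : FamZ W F F')
    (hF : ∀ x ∈ W, F x = G x) {x : V} (hx : x ∈ W) (ξ : V) : F' x ξ = G' x ξ := by
  ext d
  rw [← h.deriv x hx, ← h'.deriv x hx, fderiv_congr_on hW (fun y hy => by rw [hF y hy]) hx]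

theorem lOrd_deriv (hW : IsOpen W) (h : FamZ W G G') {N : ℤ} (hN : ∀ x ∈ W, LOrd N (G x)) {x : V}
    (hx : x ∈ W) (ξ : V) : LOrd N (G' x ξ) := by
  rw [lOrd_iff]
  intro d hd
  rw [← h.deriv x hx, fderiv_congr_on hW (g := fun _ => 0) (fun y hy => (hN y hy).coeff hd) hx]
  simp

theorem const (c : LaurentSeries ℂ) : FamZ W (fun _ => c) fun _ _ => 0 where
  lb := by
    obtain ⟨N, hN⟩ := exists_lOrd c
    exact ⟨N, fun _ _ => hN⟩
  smooth d := contDiffOn_const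
  deriv x hx ξ d := by simp

theorem single (k : ℤ) {φ : V → ℂ} (hφ : ContDiffOn ℂ (⊤ : ℕ∞) φ W) :
    FamZ W (fun x => HahnSeries.single k (φ x)) fun x ξ => HahnSeries.single k (fderiv ℂ φ x ξ) where
  lb := ⟨k, fun x _ => lOrd_single k _⟩
  smooth d := by
    by_cases h : d = k
    · subst h; simpa using hφ
    · simpa [HahnSeries.coeff_single_of_ne h] using contDiffOn_const
  deriv x hx ξ d := by
    by_cases h : d = k
    · subst h; simp
    · simp [HahnSeries.coeff_single_of_ne h]

theorem C {φ : V → ℂ} (hφ : ContDiffOn ℂ (⊤ : ℕ∞) φ W) :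
    FamZ W (fun x => HahnSeries.C (φ x)) fun x ξ => HahnSeries.C (fderiv ℂ φ x ξ) :=
  single 0 hφ

theorem add (hW : IsOpen W) (h : FamZ W G G') (h' : FamZ W F F') :
    FamZ W (fun x => G x + F x) fun x ξ => G' x ξ + F' x ξ where
  lb := by
    obtain ⟨N, hN⟩ := h.lb
    obtain ⟨M, hM⟩ := h'.lb
    exact ⟨min N M, fun x hx => ((hN x hx).mono (min_le_left _ _)).add
      ((hM x hx).mono (min_le_right _ _))⟩
  smooth d := (h.smooth d).add (h'.smooth d)
  deriv x hx ξ d := by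
    simp only [HahnSeries.coeff_add]
    rw [fderiv_fun_add (smooth_diff hW (h.smooth d) hx) (smooth_diff hW (h'.smooth d) hx),
      add_apply, h.deriv x hx, h'.deriv x hx]

theorem mul (hW : IsOpen W) (h : FamZ W G G') (h' : FamZ W F F') :
    FamZ W (fun x => G x * F x) fun x ξ => G' x ξ * F x + G x * F' x ξ := by
  obtain ⟨N, hN⟩ := h.lb
  obtain ⟨M, hM⟩ := h'.lb
  have e (d : ℤ) : ∀ x ∈ W, (G x * F x).coeff d =
      ∑ i ∈ Finset.Icc N (d - M), (G x).coeff i * (F x).coeff (d - i) := fun x hx =>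
    coeff_mul_of_lOrd (hN x hx) (hM x hx) d
  refine ⟨⟨N + M, fun x hx => (hN x hx).mul (hM x hx)⟩, fun d => ?_, fun x hx ξ d => ?_⟩
  · exact (ContDiffOn.sum fun i _ => (h.smooth i).mul (h'.smooth (d - i))).congr (e d)
  · have d1 (i : ℤ) := smooth_diff hW (h.smooth i) hx
    have d2 (i : ℤ) := smooth_diff hW (h'.smooth i) hx
    rw [fderiv_congr_on hW (e d) hx, fderiv_fun_sum fun i _ => (d1 i).fun_mul (d2 _), sum_apply,
      HahnSeries.coeff_add, coeff_mul_of_lOrd (h.lOrd_deriv hW hN hx ξ) (hM x hx),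
      coeff_mul_of_lOrd (hN x hx) (h'.lOrd_deriv hW hM hx ξ), ← Finset.sum_add_distrib]
    refine Finset.sum_congr rfl fun i _ => ?_
    rw [fderiv_fun_mul (d1 i) (d2 _)]
    simp only [add_apply, smul_apply, smul_eq_mul, h.deriv x hx, h'.deriv x hx]
    ring

theorem pow (hW : IsOpen W) (h : FamZ W G G') (k : ℕ) :
    FamZ W (fun x => G x ^ k) fun x ξ => (k : LaurentSeries ℂ) * (G x ^ (k - 1) * G' x ξ) := by
  induction k with
  | zero => exact (const 1).congr hW (fun x _ => pow_zero _) fun x _ ξ => by simp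
  | succ k ih =>
    refine (ih.mul hW h).congr hW (fun x _ => pow_succ _ _) fun x _ ξ => ?_
    rcases k with _ | k
    · simp
    · simp only [Nat.add_sub_cancel]; push_cast; ring

/-- The uniform lower bound on the orders is inherited by the derivatives of the coefficients, so
these form a Laurent series again. -/
theorem exists_deriv (hlb : ∃ N, ∀ x ∈ W, LOrd N (G x)) (hW : IsOpen W)
    (hs : ∀ d, ContDiffOn ℂ (⊤ : ℕ∞) (fun x => (G x).coeff d) W) : ∃ G', FamZ W G G' := by
  have hN := hlb
  obtain ⟨N, hN⟩ := hN
  have hb : ∀ x ∈ W, ∀ ξ, ∀ d < N, fderiv ℂ (fun y => (G y).coeff d) x ξ = 0 :=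
    fun x hx ξ d hd => by
      rw [fderiv_congr_on hW (g := fun _ => 0) (fun y hy => (hN y hy).coeff hd) hx]; simp
  have : ∀ x ξ, ∃ Z : LaurentSeries ℂ, x ∈ W → ∀ d,
      fderiv ℂ (fun y => (G y).coeff d) x ξ = Z.coeff d := fun x ξ => by
    by_cases hx : x ∈ W
    · refine ⟨HahnSeries.ofSuppBddBelow (fun d => fderiv ℂ (fun y => (G y).coeff d) x ξ)
        ⟨N, fun d hd => ?_⟩, fun _ d => rfl⟩
      by_contra hlt
      exact hd (hb x hx ξ d (not_le.1 hlt))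
    · exact ⟨0, fun h => absurd h hx⟩
  choose G' hG' using this
  exact ⟨G', hlb, hs, fun x hx ξ d => hG' x ξ hx d⟩

theorem inv (hW : IsOpen W) (h : FamZ W G G') {e : ℤ} (he : ∀ x ∈ W, LExact e (G x)) :
    FamZ W (fun x => (G x)⁻¹) fun x ξ => -G' x ξ / G x ^ 2 := by
  have hs (k : ℕ) : ContDiffOn ℂ (⊤ : ℕ∞) (fun x => ((G x)⁻¹).coeff (k - e)) W := by
    induction k using Nat.strong_induction_on with
    | _ k ih =>
      -- Comparing coefficients in G · G⁻¹ = 1 and isolating the leading coefficient of G expresses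
      -- each coefficient of the inverse through earlier ones. The constant exact order ensures that
      -- the divisor never vanishes.
      have e1 : ∀ x ∈ W, ((G x)⁻¹).coeff (k - e) = ((1 : LaurentSeries ℂ).coeff k -
          ∑ i ∈ Finset.Icc (e + 1) (k + e), (G x).coeff i * ((G x)⁻¹).coeff (k - i)) /
            (G x).coeff e := fun x hx => by
        rw [eq_div_iff (he x hx).coeff_ne_zero, ← mul_inv_cancel₀ (he x hx).ne_zero,
          coeff_mul_of_lOrd (he x hx).lOrd (he x hx).inv.lOrd, sub_neg_eq_add,
          ← Finset.sum_erase_add _ _ (show e ∈ Finset.Icc e (k + e) by simp)]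
        have : (Finset.Icc e (k + e)).erase e = Finset.Icc (e + 1) (k + e) := by
          ext i; simp
        rw [this]; ring
      refine ContDiffOn.congr ?_ e1
      refine (contDiffOn_const.sub (ContDiffOn.sum fun i hi => (h.smooth i).mul ?_)).div
        (h.smooth e) fun x hx => (he x hx).coeff_ne_zero
      rw [Finset.mem_Icc] at hi
      have := ih (k + e - i).toNat (by omega)
      rwa [show (((k + e - i).toNat : ℤ) - e) = k - i by omega] at this
  have hs' (d : ℤ) : ContDiffOn ℂ (⊤ : ℕ∞) (fun x => ((G x)⁻¹).coeff d) W := by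
    by_cases hd : d < -e
    · exact contDiffOn_const.congr fun x hx => (he x hx).inv.lOrd.coeff hd
    · have := hs (d + e).toNat
      rwa [show (((d + e).toNat : ℤ) - e) = d by omega] at this
  obtain ⟨Z, hZ⟩ := exists_deriv ⟨-e, fun x hx => (he x hx).inv.lOrd⟩ hW hs'
  refine hZ.congr hW (fun _ _ => rfl) fun x hx ξ => ?_
  have h0 := (he x hx).ne_zero
  have := (const (W := W) 1).deriv_unique hW (h.mul hW hZ)
    (fun x hx => mul_inv_cancel₀ (he x hx).ne_zero) hx ξ
  field_simp at this ⊢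
  linear_combination -this

/-- Each coefficient of f(u) is a finite sum of coefficients of powers of u, of a length independent
of the parameter. -/
theorem subst (hW : IsOpen W) {u : V → PowerSeries ℂ} {v : V → V → PowerSeries ℂ}
    (h : FamZ W (fun x => HahnSeries.ofPowerSeries ℤ ℂ (u x))
      fun x ξ => HahnSeries.ofPowerSeries ℤ ℂ (v x ξ))
    (hu : ∀ x ∈ W, constantCoeff (u x) = 0) (f : PowerSeries ℂ) :
    FamZ W (fun x => HahnSeries.ofPowerSeries ℤ ℂ (f.subst (u x))) fun x ξ =>
      HahnSeries.ofPowerSeries ℤ ℂ ((PowerSeries.derivative ℂ f).subst (u x) * v x ξ) := by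
  have hc (g : PowerSeries ℂ) (d : ℕ) :
      (HahnSeries.ofPowerSeries ℤ ℂ g).coeff (d : ℤ) = PowerSeries.coeff d g := by
    rw [PowerSeries.coeff_coe, if_neg (by omega), Int.natAbs_natCast]
  have hv : ∀ x ∈ W, ∀ ξ, constantCoeff (v x ξ) = 0 := fun x hx ξ => by
    rw [← PowerSeries.coeff_zero_eq_constantCoeff_apply, ← hc, ← h.deriv x hx,
      fderiv_congr_on hW (g := fun _ => 0) (fun y hy => ?_) hx]
    · simp
    · rw [hc, PowerSeries.coeff_zero_eq_constantCoeff_apply, hu y hy]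
  have e (d : ℕ) : ∀ x ∈ W, (HahnSeries.ofPowerSeries ℤ ℂ (f.subst (u x))).coeff (d : ℤ) =
      ∑ k ∈ Finset.range (d + 1), PowerSeries.coeff k f *
        (HahnSeries.ofPowerSeries ℤ ℂ (u x) ^ k).coeff (d : ℤ) := fun x hx => by
    rw [hc, coeff_subst_eq_sum (hu x hx) f d.lt_succ_self]
    exact Finset.sum_congr rfl fun k _ => by rw [← map_pow, hc]
  refine ⟨⟨0, fun x _ => lOrd_ofPowerSeries _⟩, fun d => ?_, fun x hx ξ d => ?_⟩
  · rcases lt_or_ge d 0 with hd | hd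
    · exact contDiffOn_const.congr fun x _ => (lOrd_ofPowerSeries _).coeff hd
    · obtain ⟨k, rfl⟩ := Int.eq_ofNat_of_zero_le hd
      exact (ContDiffOn.sum fun i _ => contDiffOn_const.mul ((h.pow hW i).smooth k)).congr (e k)
  · rcases lt_or_ge d 0 with hd | hd
    · rw [(lOrd_ofPowerSeries _).coeff hd, fderiv_congr_on hW (g := fun _ => 0)
        (fun y _ => (lOrd_ofPowerSeries _).coeff hd) hx]
      simp
    · obtain ⟨k, rfl⟩ := Int.eq_ofNat_of_zero_le hd
      have hd (i : ℕ) := smooth_diff hW ((h.pow hW i).smooth k) hx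
      rw [fderiv_congr_on hW (e k) hx, fderiv_fun_sum fun i _ => (hd i).const_mul _, sum_apply, hc,
        coeff_subst_mul (hu x hx) (hv x hx ξ)]
      refine Finset.sum_congr rfl fun i _ => ?_
      rw [fderiv_const_mul (hd i), smul_apply, (h.pow hW i).deriv x hx, smul_eq_mul]
      congr 1
      rw [← map_pow, ← map_mul, ← map_natCast (HahnSeries.C : ℂ →+* LaurentSeries ℂ),
        HahnSeries.C_mul_eq_smul, HahnSeries.coeff_smul, hc, smul_eq_mul]

end FamZ

theorem ofPowerSeries_mk {m : ℤ} {F : LaurentSeries ℂ} (hF : LOrd (-m) F) (c : ℂ) :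
    HahnSeries.ofPowerSeries ℤ ℂ (PowerSeries.C c * PowerSeries.mk fun d => F.coeff ((d : ℤ) - m)) =
      HahnSeries.single m c * F := by
  ext d
  rw [coeff_single_mul', PowerSeries.coeff_coe, PowerSeries.coeff_C_mul, PowerSeries.coeff_mk]
  split_ifs with h
  · rw [hF.coeff (by omega)]; simp
  · rw [show (((d.natAbs : ℕ) : ℤ) - m) = d - m by omega]

/-- A continuous branch of the logarithm of a smooth function is smooth. -/
theorem smooth_of_exp (hW : IsOpen W) {l g : V → ℂ} (hl : ContinuousOn l W)
    (hg : ContDiffOn ℂ (⊤ : ℕ∞) g W) (h : ∀ x ∈ W, Complex.exp (l x) = g x) :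
    ContDiffOn ℂ (⊤ : ℕ∞) l W := by
  intro x hx
  have hg0 : g x ≠ 0 := by rw [← h x hx]; exact Complex.exp_ne_zero _
  have hc : ContinuousAt (fun y => l y - l x) x :=
    (hl.continuousAt (hW.mem_nhds hx)).sub continuousAt_const
  have h1 : ∀ᶠ y in nhds x, |(l y - l x).im| < Real.pi := by
    have : ContinuousAt (fun y => |(l y - l x).im|) x :=
      (Complex.continuous_im.continuousAt.comp hc).abs
    refine this.eventually_lt continuousAt_const ?_
    simpa using Real.pi_pos
  have h2 : l =ᶠ[nhds x] fun y => l x + Complex.log (g y / g x) := by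
    filter_upwards [h1, hW.mem_nhds hx] with y hy hyW
    rw [← h y hyW, ← h x hx, ← Complex.exp_sub,
      Complex.log_exp (abs_lt.1 hy).1 (abs_lt.1 hy).2.le]
    ring
  have h3 : ContDiffAt ℂ (⊤ : ℕ∞) (fun y => l x + Complex.log (g y / g x)) x := by
    have h4 : ContDiffAt ℂ (⊤ : ℕ∞) (fun y => g y / g x) x :=
      (smooth_at hW hg hx).div contDiffAt_const hg0
    refine contDiffAt_const.add (ContDiffAt.comp x (Complex.contDiffAt_log ?_) h4)
    rw [div_self hg0]; exact Complex.one_mem_slitPlane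
  exact (h3.congr_of_eventuallyEq h2).contDiffWithinAt

section UnitPart

variable {m : ℤ} {lc : V → ℂ} {F : V → LaurentSeries ℂ} {F' : V → V → LaurentSeries ℂ}

/-- The coefficientwise derivative of `unitPart`. -/
def unitPart' (lc : V → ℂ) (m : ℤ) (F : V → LaurentSeries ℂ) (F' : V → V → LaurentSeries ℂ)
    (x ξ : V) : PowerSeries ℂ :=
  PowerSeries.C (Complex.exp (-lc x)) * PowerSeries.mk (fun d => (F' x ξ).coeff ((d : ℤ) - m)) -
    PowerSeries.C (fderiv ℂ lc x ξ) * (1 + unitPart (lc x) m (F x))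

theorem famZ_unitPart (hW : IsOpen W) (hl : ContDiffOn ℂ (⊤ : ℕ∞) lc W) (h : FamZ W F F')
    (hF : ∀ x ∈ W, LOrd (-m) (F x)) :
    FamZ W (fun x => HahnSeries.ofPowerSeries ℤ ℂ (unitPart (lc x) m (F x))) fun x ξ =>
      HahnSeries.ofPowerSeries ℤ ℂ (unitPart' lc m F F' x ξ) := by
  have hexp : ContDiffOn ℂ (⊤ : ℕ∞) (fun x => Complex.exp (-lc x)) W := hl.neg.cexp
  refine (((FamZ.single m hexp).mul hW h).add hW (FamZ.const (-1))).congr hW (fun x hx => ?_)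
    fun x hx ξ => ?_
  · rw [unitPart, map_sub, ofPowerSeries_mk (hF x hx), map_one, sub_eq_add_neg]
  · have hd := smooth_diff hW hl hx
    have e : fderiv ℂ (fun x => Complex.exp (-lc x)) x ξ =
        -fderiv ℂ lc x ξ * Complex.exp (-lc x) := by
      rw [(hd.hasFDerivAt.fun_neg.cexp).fderiv]
      simp; ring
    have e2 : HahnSeries.ofPowerSeries ℤ ℂ (PowerSeries.C (fderiv ℂ lc x ξ)) =
      HahnSeries.C (fderiv ℂ lc x ξ) := HahnSeries.ofPowerSeries_C _
    rw [unitPart', map_sub, ofPowerSeries_mk (h.lOrd_deriv hW hF hx ξ), unitPart, add_sub_cancel,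
      map_mul, ofPowerSeries_mk (hF x hx), e, add_zero, e2, ← mul_assoc, C_mul_single, neg_mul,
      HahnSeries.single_neg]
    ring

/-- The derivative of F is split into the change of its leading coefficient and that of its unit
part, in the shape to which the chain rules for powers and logarithms apply. -/
theorem deriv_eq (hW : IsOpen W) (h : FamZ W F F') (hF : ∀ x ∈ W, LOrd (-m) (F x)) {x : V}
    (hx : x ∈ W) (ξ : V) :
    F' x ξ = HahnSeries.C (fderiv ℂ lc x ξ) * F x + HahnSeries.single (-m) (Complex.exp (lc x)) *
      HahnSeries.ofPowerSeries ℤ ℂ (unitPart' lc m F F' x ξ) := by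
  have e2 : HahnSeries.ofPowerSeries ℤ ℂ (PowerSeries.C (fderiv ℂ lc x ξ)) =
      HahnSeries.C (fderiv ℂ lc x ξ) := HahnSeries.ofPowerSeries_C _
  have e3 : HahnSeries.single (-m) (Complex.exp (lc x)) *
      HahnSeries.single m (Complex.exp (-lc x)) = (1 : LaurentSeries ℂ) := by
    rw [HahnSeries.single_mul_single, ← Complex.exp_add]; simp
  rw [unitPart', map_sub, ofPowerSeries_mk (h.lOrd_deriv hW hF hx ξ), unitPart, add_sub_cancel,
    map_mul, ofPowerSeries_mk (hF x hx), e2]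
  linear_combination (HahnSeries.C (fderiv ℂ lc x ξ) * F x - F' x ξ) * e3

theorem famZ_fracPow (hW : IsOpen W) (hm : m ≠ 0) (hl : ContDiffOn ℂ (⊤ : ℕ∞) lc W)
    (h : FamZ W F F') (hF : ∀ x ∈ W, LOrd (-m) (F x))
    (he : ∀ x ∈ W, Complex.exp (lc x) = (F x).coeff (-m)) (q : ℤ) :
    FamZ W (fun x => fracPow (lc x) m q (F x)) fun x ξ =>
      HahnSeries.C ((q : ℂ) / m) * fracPow (lc x) m (q - m) (F x) * F' x ξ := by
  have hu := fun x hx => constantCoeff_unitPart (m := m) (he x hx)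
  have hexp : ContDiffOn ℂ (⊤ : ℕ∞) (fun x => Complex.exp ((q : ℂ) / m * lc x)) W :=
    (contDiffOn_const.mul hl).cexp
  refine ((FamZ.single (-q) hexp).mul hW ((famZ_unitPart hW hl h hF).subst hW hu
    (binom ((q : ℂ) / m)))).congr hW (fun x hx => ?_) fun x hx ξ => ?_
  · rw [fracPow, powOneAdd_eq (hu x hx)]
  · have hd := smooth_diff hW hl hx
    have e : fderiv ℂ (fun x => Complex.exp ((q : ℂ) / m * lc x)) x ξ =
        (q : ℂ) / m * fderiv ℂ lc x ξ * Complex.exp ((q : ℂ) / m * lc x) := by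
      rw [((hd.hasFDerivAt.const_mul _).cexp).fderiv]
      simp; ring
    have hs := PowerSeries.HasSubst.of_constantCoeff_zero' (hu x hx)
    have hs' : PowerSeries.subst (unitPart (lc x) m (F x)) (PowerSeries.C ((q : ℂ) / m)) =
        (PowerSeries.C ((q : ℂ) / m) : PowerSeries ℂ) := PowerSeries.subst_C _
    conv_lhs => rw [deriv_eq (lc := lc) hW h hF hx ξ]
    rw [← fracPow_chain hm (hF x hx) (he x hx), e, derivative_binom, PowerSeries.subst_mul hs,
      hs', fracPow, powOneAdd_eq (hu x hx), powOneAdd_eq (hu x hx), ← C_mul_single]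
    ring

theorem famZ_logReg (hW : IsOpen W) (hl : ContDiffOn ℂ (⊤ : ℕ∞) lc W)
    (h : FamZ W F F') (hF : ∀ x ∈ W, LOrd (-m) (F x))
    (he : ∀ x ∈ W, Complex.exp (lc x) = (F x).coeff (-m)) :
    FamZ W (fun x => logReg (lc x) m (F x)) fun x ξ => F' x ξ / F x := by
  have hu := fun x hx => constantCoeff_unitPart (m := m) (he x hx)
  refine ((FamZ.C hl).add hW ((famZ_unitPart hW hl h hF).subst hW hu
    (PowerSeries.log ℂ))).congr hW (fun x hx => ?_) fun x hx ξ => ?_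
  · rw [logReg, logOneAdd_eq (hu x hx)]
  · conv_lhs => rw [deriv_eq (lc := lc) hW h hF hx ξ]
    rw [← logReg_chain (hF x hx) (he x hx), derivative_log, powOneAdd_eq (hu x hx)]

end UnitPart

end Families

end MeroFrob
end

/-! ### Residue functionals at moving points, their Hessians, and the flat coordinates. -/

noncomputable section

namespace MeroFrob

open scoped OnePoint

theorem der_eq (ν : OnePoint ℂ) :
    ∃ D : LaurentSeries ℂ, ∀ F, der ν F = D * theta F := by
  induction ν using OnePoint.rec with
  | infty => exact ⟨-HahnSeries.single 1 1, fun F => by rw [der_infty]; ring⟩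
  | coe ν => exact ⟨HahnSeries.single (-1) 1, fun F => der_coe ν F⟩

namespace MeroType

variable {τ : MeroType} {W : Set τ.V}

/-! ### The marked points as moving places -/

variable (τ) in
/-- Labels of all the marked points, `none` standing for `∞`. -/
def places : Finset (Option (Option (Fin τ.K))) := Finset.insertNone τ.marked

/-- The marked point with label `κ`. -/
def place (x : τ.V) (κ : Option (Option (Fin τ.K))) : OnePoint ℂ :=
  κ.elim ∞ fun k => (pt x k : OnePoint ℂ)

/-- The velocity of the marked point with label `κ`. -/
def vel (ξ : τ.V) (κ : Option (Option (Fin τ.K))) : ℂ := κ.elim 0 (pt ξ)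

theorem place_none (x : τ.V) : place x none = ∞ := rfl

theorem place_some (x : τ.V) (k : Option (Fin τ.K)) : place x (some k) = (pt x k : OnePoint ℂ) := rfl

theorem place_mem_gam (x : τ.V) {κ : Option (Option (Fin τ.K))} (h : κ ∈ τ.places) :
    place x κ ∈ gam x := by
  cases κ with
  | none => exact infty_mem_gam x
  | some k => exact pt_mem_gam x (Finset.some_mem_insertNone.1 h)

theorem sum_places {x : τ.V} (hx : x ∈ τ.domain) {M : Type*} [AddCommMonoid M]
    (f : OnePoint ℂ → M) : ∑ κ ∈ τ.places, f (place x κ) = ∑ μ ∈ gam x, f μ := by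
  rw [sum_gam hx, places, Finset.sum_insertNone]; rfl

/-- `spt` as a continuous linear form. -/
def sptL (c : τ.Lab) : τ.V →L[ℂ] ℂ :=
  LinearMap.toContinuousLinearMap
    { toFun := fun ξ => spt ξ c
      map_add' := fun ξ ζ => spt_add ξ ζ c
      map_smul' := fun z ξ => spt_smul z ξ c }

theorem smooth_spt (c : τ.Lab) : ContDiffOn ℂ (⊤ : ℕ∞) (fun x : τ.V => spt x c) W :=
  (sptL c).contDiff.contDiffOn

theorem fderiv_spt (c : τ.Lab) (x ξ : τ.V) : fderiv ℂ (fun x : τ.V => spt x c) x ξ = spt ξ c := by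
  change fderiv ℂ (sptL c) x ξ = _
  rw [ContinuousLinearMap.fderiv]; rfl

/-! ### Families of Laurent series at moving places -/

/-- A smooth family of Laurent series at the place `κ`, and its derivative at fixed `p`. -/
def Fam (W : Set τ.V) (κ : Option (Option (Fin τ.K))) (G : τ.V → LaurentSeries ℂ)
    (G' : τ.V → τ.V → LaurentSeries ℂ) : Prop :=
  FamZ W G fun x ξ => G' x ξ + HahnSeries.C (vel ξ κ) * der (place x κ) (G x)

namespace Fam

variable {κ : Option (Option (Fin τ.K))} {G F : τ.V → LaurentSeries ℂ}
  {G' F' : τ.V → τ.V → LaurentSeries ℂ}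

theorem congr (hW : IsOpen W) (h : Fam W κ G G') (hF : ∀ x ∈ W, F x = G x)
    (hF' : ∀ x ∈ W, ∀ ξ, F' x ξ = G' x ξ) : Fam W κ F F' :=
  FamZ.congr hW h hF fun x hx ξ => by rw [hF x hx, hF' x hx]

theorem C (c : ℂ) : Fam W κ (fun _ => HahnSeries.C c) fun _ _ => 0 := by
  have h := FamZ.const (W := W) (HahnSeries.C c : LaurentSeries ℂ)
  simpa only [Fam, der_C, mul_zero, add_zero] using h

theorem add (hW : IsOpen W) (h : Fam W κ G G') (h' : Fam W κ F F') :
    Fam W κ (fun x => G x + F x) fun x ξ => G' x ξ + F' x ξ :=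
  (FamZ.add hW h h').congr hW (fun _ _ => rfl) fun x _ ξ => by rw [der_add]; ring

theorem mul (hW : IsOpen W) (h : Fam W κ G G') (h' : Fam W κ F F') :
    Fam W κ (fun x => G x * F x) fun x ξ => G' x ξ * F x + G x * F' x ξ :=
  (FamZ.mul hW h h').congr hW (fun _ _ => rfl) fun x _ ξ => by rw [der_mul]; ring

theorem C_mul (hW : IsOpen W) (c : ℂ) (h : Fam W κ G G') :
    Fam W κ (fun x => HahnSeries.C c * G x) fun x ξ => HahnSeries.C c * G' x ξ :=
  ((C c).mul hW h).congr hW (fun _ _ => rfl) fun x _ ξ => by ring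

theorem inv (hW : IsOpen W) (h : Fam W κ G G') {e : ℤ} (he : ∀ x ∈ W, LExact e (G x)) :
    Fam W κ (fun x => (G x)⁻¹) fun x ξ => -G' x ξ / G x ^ 2 :=
  (FamZ.inv hW h he).congr hW (fun _ _ => rfl) fun x hx ξ => by
    have h0 := (he x hx).ne_zero
    have := der_div (place x κ) 1 h0
    rw [one_div] at this
    rw [this, der_one]
    field_simp
    ring

/-- The motion of the point adds a multiple of a p-derivative, which has no residue. So residues at
moving points are differentiated as if p were fixed. -/
theorem res (h : Fam W κ G G') :
    ContDiffOn ℂ (⊤ : ℕ∞) (fun x => res (place x κ) (G x)) W ∧ ∀ x ∈ W, ∀ ξ,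
      fderiv ℂ (fun x => MeroFrob.res (place x κ) (G x)) x ξ = MeroFrob.res (place x κ) (G' x ξ) := by
  have key : ∀ x ξ, MeroFrob.res (place x κ) (G' x ξ) = MeroFrob.res (place x κ)
      (G' x ξ + HahnSeries.C (vel ξ κ) * der (place x κ) (G x)) := fun x ξ => by
    rw [map_add, res_C_mul, res_der, mul_zero, add_zero]
  cases κ with
  | none =>
    simp only [place_none, res_infty] at key ⊢
    refine ⟨(h.smooth 1).neg, fun x hx ξ => ?_⟩
    rw [fderiv_fun_neg, neg_apply, h.deriv x hx, key]; rfl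
  | some k =>
    simp only [place_some, res_coe] at key ⊢
    exact ⟨h.smooth (-1), fun x hx ξ => by rw [key]; exact h.deriv x hx ξ (-1)⟩

theorem fracPow (hW : IsOpen W) (h : Fam W κ F F') {m : ℤ} (hm : m ≠ 0) {lc : τ.V → ℂ}
    (hl : ContDiffOn ℂ (⊤ : ℕ∞) lc W) (hF : ∀ x ∈ W, LOrd (-m) (F x))
    (he : ∀ x ∈ W, Complex.exp (lc x) = (F x).coeff (-m)) (q : ℤ) :
    Fam W κ (fun x => fracPow (lc x) m q (F x)) fun x ξ =>
      HahnSeries.C ((q : ℂ) / m) * MeroFrob.fracPow (lc x) m (q - m) (F x) * F' x ξ :=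
  (famZ_fracPow hW hm hl h hF he q).congr hW (fun _ _ => rfl) fun x hx ξ => by
    obtain ⟨D, hD⟩ := der_eq (place x κ)
    rw [hD, hD, theta_fracPow hm (hF x hx) (he x hx)]
    ring

/-- The regularised logarithm contains the logarithm of the local parameter, whose derivative at
fixed p is minus the velocity divided by that parameter. At ∞ the parameter does not move; the
condition m = 0 excludes a correction of a different form there. -/
theorem logReg (hW : IsOpen W) (h : Fam W κ F F') {m : ℤ} {lc : τ.V → ℂ}
    (hl : ContDiffOn ℂ (⊤ : ℕ∞) lc W) (hF : ∀ x ∈ W, LOrd (-m) (F x))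
    (he : ∀ x ∈ W, Complex.exp (lc x) = (F x).coeff (-m))
    (hκ : κ = none → m = 0) :
    Fam W κ (fun x => logReg (lc x) m (F x)) fun x ξ =>
      F' x ξ / F x - HahnSeries.single (-1) (vel ξ κ * m) :=
  (famZ_logReg hW hl h hF he).congr hW (fun _ _ => rfl) fun x hx ξ => by
    have h0 : F x ≠ 0 := by
      intro h0
      have := he x hx
      rw [h0, HahnSeries.coeff_zero] at this
      exact Complex.exp_ne_zero _ this
    cases κ with
    | none => simp [vel]
    | some k =>
      rw [place_some, der_coe, der_coe, theta_logReg (hF x hx) (he x hx)]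
      have : HahnSeries.single (-1) (vel ξ (some k) * (m : ℂ)) = HahnSeries.C (vel ξ (some k)) *
          (HahnSeries.single (-1) 1 * HahnSeries.C (m : ℂ)) := by
        rw [mul_comm (HahnSeries.single (-1) (1 : ℂ)), C_mul_single, C_mul_single, mul_one]
      simp only [this]
      field_simp
      ring

end Fam

/-! ### Families of rational functions -/

/-- A smooth family of rational functions and its derivative at fixed `p`. -/
def RatFam (W : Set τ.V) (f : τ.V → RatFunc ℂ) (f' : τ.V → τ.V → RatFunc ℂ) : Prop :=
  ∀ κ ∈ τ.places, Fam W κ (fun x => expand (place x κ) (f x)) fun x ξ => expand (place x κ) (f' x ξ)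

/-- A smooth family of rational functions whose orders at the marked points do not vary, and its
logarithmic derivative at fixed `p`. -/
structure RatUnit (W : Set τ.V) (f : τ.V → RatFunc ℂ) (y : τ.V → τ.V → RatFunc ℂ) : Prop where
  fam : RatFam W f fun x ξ => f x * y x ξ
  exact : ∀ κ ∈ τ.places, ∃ o, ∀ x ∈ W, LExact o (expand (place x κ) (f x))
  ne_zero : ∀ x ∈ W, f x ≠ 0

namespace RatFam

variable {f g : τ.V → RatFunc ℂ} {f' g' : τ.V → τ.V → RatFunc ℂ}

theorem congr (hW : IsOpen W) (h : RatFam W f f') (hg : ∀ x ∈ W, g x = f x)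
    (hg' : ∀ x ∈ W, ∀ ξ, g' x ξ = f' x ξ) : RatFam W g g' := fun κ hκ =>
  (h κ hκ).congr hW (fun x hx => by rw [hg x hx]) fun x hx ξ => by rw [hg' x hx]

theorem C (c : ℂ) : RatFam W (fun _ => RatFunc.C c) fun _ _ => 0 := fun κ hκ => by
  simp only [expand_C, expand_zero]
  exact Fam.C c

theorem add (hW : IsOpen W) (h : RatFam W f f') (h' : RatFam W g g') :
    RatFam W (fun x => f x + g x) fun x ξ => f' x ξ + g' x ξ := fun κ hκ => by
  simpa only [expand_add] using (h κ hκ).add hW (h' κ hκ)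

theorem mul (hW : IsOpen W) (h : RatFam W f f') (h' : RatFam W g g') :
    RatFam W (fun x => f x * g x) fun x ξ => f' x ξ * g x + f x * g' x ξ := fun κ hκ => by
  simpa only [expand_add, expand_mul] using (h κ hκ).mul hW (h' κ hκ)

theorem sum (hW : IsOpen W) {ι : Type*} (s : Finset ι) {f : ι → τ.V → RatFunc ℂ}
    {f' : ι → τ.V → τ.V → RatFunc ℂ} (h : ∀ i ∈ s, RatFam W (f i) (f' i)) :
    RatFam W (fun x => ∑ i ∈ s, f i x) fun x ξ => ∑ i ∈ s, f' i x ξ := by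
  classical
  induction s using Finset.induction_on with
  | empty => simpa using C (W := W) 0
  | insert i s hi ih =>
    simp only [Finset.sum_insert hi]
    exact (h i (Finset.mem_insert_self i s)).add hW
      (ih fun j hj => h j (Finset.mem_insert_of_mem hj))

end RatFam

namespace RatUnit

variable {f g : τ.V → RatFunc ℂ} {y z : τ.V → τ.V → RatFunc ℂ}

theorem one : RatUnit W (fun _ => 1) fun _ _ => 0 where
  fam := by simpa using RatFam.C (W := W) 1
  exact κ _ := ⟨0, fun x _ => by rw [expand_one]; exact lExact_one⟩
  ne_zero _ _ := one_ne_zero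

theorem congr (hW : IsOpen W) (h : RatUnit W f y) (hg : ∀ x ∈ W, g x = f x)
    (hz : ∀ x ∈ W, ∀ ξ, z x ξ = y x ξ) : RatUnit W g z where
  fam := h.fam.congr hW hg fun x hx ξ => by rw [hg x hx, hz x hx]
  exact κ hκ := by
    obtain ⟨o, ho⟩ := h.exact κ hκ
    exact ⟨o, fun x hx => by rw [hg x hx]; exact ho x hx⟩
  ne_zero x hx := by rw [hg x hx]; exact h.ne_zero x hx

theorem mul (hW : IsOpen W) (h : RatUnit W f y) (h' : RatUnit W g z) :
    RatUnit W (fun x => f x * g x) fun x ξ => y x ξ + z x ξ where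
  fam := (h.fam.mul hW h'.fam).congr hW (fun _ _ => rfl) fun x _ ξ => by ring
  exact κ hκ := by
    obtain ⟨o, ho⟩ := h.exact κ hκ
    obtain ⟨o', ho'⟩ := h'.exact κ hκ
    exact ⟨o + o', fun x hx => by rw [expand_mul]; exact (ho x hx).mul (ho' x hx)⟩
  ne_zero x hx := mul_ne_zero (h.ne_zero x hx) (h'.ne_zero x hx)

theorem inv (hW : IsOpen W) (h : RatUnit W f y) : RatUnit W (fun x => (f x)⁻¹) fun x ξ => -y x ξ where
  fam κ hκ := by
    obtain ⟨o, ho⟩ := h.exact κ hκ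
    refine ((h.fam κ hκ).inv hW ho).congr hW (fun x _ => expand_inv _ _) fun x hx ξ => ?_
    have := (ho x hx).ne_zero
    rw [expand_mul, expand_mul, expand_inv, expand_neg]
    field_simp
  exact κ hκ := by
    obtain ⟨o, ho⟩ := h.exact κ hκ
    exact ⟨-o, fun x hx => by rw [expand_inv]; exact (ho x hx).inv⟩
  ne_zero x hx := inv_ne_zero (h.ne_zero x hx)

theorem zpow (hW : IsOpen W) (h : RatUnit W f y) (e : ℤ) :
    RatUnit W (fun x => f x ^ e) fun x ξ => RatFunc.C (e : ℂ) * y x ξ := by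
  induction e using Int.induction_on with
  | zero => simpa using one
  | succ k ih =>
    refine (ih.mul hW h).congr hW (fun x hx => zpow_add_one₀ (h.ne_zero x hx) _) fun x _ ξ => ?_
    push_cast; rw [map_add, map_one]; ring
  | pred k ih =>
    refine (ih.mul hW (h.inv hW)).congr hW (fun x hx => zpow_sub_one₀ (h.ne_zero x hx) _)
      fun x _ ξ => ?_
    push_cast; rw [map_sub, map_one]; ring

theorem prod (hW : IsOpen W) {ι : Type*} (s : Finset ι) {f : ι → τ.V → RatFunc ℂ}
    {y : ι → τ.V → τ.V → RatFunc ℂ} (h : ∀ i ∈ s, RatUnit W (f i) (y i)) :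
    RatUnit W (fun x => ∏ i ∈ s, f i x) fun x ξ => ∑ i ∈ s, y i x ξ := by
  classical
  induction s using Finset.induction_on with
  | empty => simpa using one
  | insert i s hi ih =>
    simp only [Finset.prod_insert hi, Finset.sum_insert hi]
    exact (h i (Finset.mem_insert_self i s)).mul hW
      (ih fun j hj => h j (Finset.mem_insert_of_mem hj))

end RatUnit

theorem ratFam_lin (hW : IsOpen W) (c : τ.Lab) :
    RatFam W (fun x => lin (spt x c)) fun _ ξ => -RatFunc.C (spt ξ c) := fun κ _ => by
  have hc : FamZ W (fun x => HahnSeries.C (spt x c)) fun x ξ => HahnSeries.C (spt ξ c) :=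
    (FamZ.C (smooth_spt c)).congr hW (fun _ _ => rfl) fun x _ ξ => by rw [fderiv_spt]
  have hd (x : τ.V) (μ : OnePoint ℂ) : der μ (expand μ (lin (spt x c))) = 1 := by
    rw [← expand_derivP, derivP_lin, expand_one]
  have hneg := (FamZ.const (W := W) (HahnSeries.C (-1))).mul hW hc
  cases κ with
  | none =>
    refine ((FamZ.const (HahnSeries.single (-1) 1)).add hW hneg).congr hW (fun x _ => ?_)
      fun x _ ξ => ?_
    · have h1 : (HahnSeries.C (-1) : LaurentSeries ℂ) = -1 := by rw [map_neg, map_one]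
      rw [place_none, expand_lin_infty, h1]; ring
    · simp only [vel, Option.elim_none, expand_neg, expand_C, map_zero, map_neg, map_one]; ring
  | some k =>
    have hk : FamZ W (fun x : τ.V => HahnSeries.C (pt x k)) fun x ξ => HahnSeries.C (pt ξ k) :=
      (FamZ.C (smooth_spt (Sum.inr k))).congr hW (fun _ _ => rfl)
        fun x _ ξ => by rw [fderiv_spt, spt_inr]
    refine ((hk.add hW hneg).add hW (FamZ.const (HahnSeries.single 1 1))).congr hW (fun x _ => ?_)
      fun x _ ξ => ?_
    · have h1 : (HahnSeries.C (-1) : LaurentSeries ℂ) = -1 := by rw [map_neg, map_one]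
      rw [place_some, expand_lin_coe, map_sub, h1]; ring
    · rw [hd]
      simp only [vel, Option.elim_some, expand_neg, expand_C, map_neg, map_one]; ring

theorem ratUnit_lin (hW : IsOpen W) (hWd : W ⊆ τ.domain) {c : τ.Lab} (hc : c ∈ τ.sidx) :
    RatUnit W (fun x => lin (spt x c)) fun x ξ => -RatFunc.C (spt ξ c) * (lin (spt x c))⁻¹ where
  fam := (ratFam_lin hW c).congr hW (fun _ _ => rfl) fun x _ ξ => by
    have := lin_ne_zero (spt x c); field_simp
  exact κ hκ := by
    classical
    cases κ with
    | none => exact ⟨-1, fun x _ => by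
      have h := lExact_lin (spt x c) ∞
      rwa [linOrd_infty] at h⟩
    | some k =>
      rw [places, Finset.some_mem_insertNone] at hκ
      refine ⟨if c = Sum.inr k then 1 else 0, fun x hx => ?_⟩
      have h := lExact_lin (spt x c) (pt x k : OnePoint ℂ)
      split_ifs with hck
      · subst hck; rwa [spt_inr, linOrd_self] at h
      · rwa [linOrd_of_ne] at h
        intro he
        rw [← spt_inr] at he
        exact hck (spt_injOn (hWd hx) hc (inr_mem_sidx.2 hκ) he.symm)
  ne_zero x _ := lin_ne_zero _

theorem ratUnit_ps (hW : IsOpen W) (hWd : W ⊆ τ.domain) : RatUnit W (fun _ => ps τ) fun _ _ => 0 := by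
  rcases τ.s_eq with hs | hs
  · have : ps τ = 1 := by rw [ps, hs, pow_zero]
    rw [this]; exact RatUnit.one
  · refine ((ratUnit_lin hW hWd (c := Sum.inr none)
      (inr_mem_sidx.2 (none_mem_marked.2 hs))).zpow hW (-(τ.s : ℤ))).congr hW (fun x _ => ?_)
        fun x _ ξ => ?_
    · rw [ps_eq, spt_inr_none]
    · simp [spt_inr_none]

theorem ratUnit_lam (hW : IsOpen W) (hWd : W ⊆ τ.domain) : RatUnit W (fun x => lam x) yy := by
  refine (RatUnit.prod hW τ.sidx fun c hc => (ratUnit_lin hW hWd hc).zpow hW (-τ.mult c)).congr hW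
    (fun x _ => lam_eq x) fun x _ ξ => ?_
  rw [yy, psum]
  refine Finset.sum_congr rfl fun c _ => ?_
  rw [map_mul]; push_cast; rw [map_neg, zpow_neg, zpow_one]; ring

theorem ratFam_lam (hW : IsOpen W) (hWd : W ⊆ τ.domain) : RatFam W (fun x => lam x) tangent :=
  (ratUnit_lam hW hWd).fam.congr hW (fun _ _ => rfl) fun x _ ξ => tangent_eq x ξ

theorem ratFam_tangent (hW : IsOpen W) (hWd : W ⊆ τ.domain) (ζ : τ.V) :
    RatFam W (fun x => tangent x ζ) fun x ξ => d2 x ξ ζ := by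
  have h1 : RatFam W (fun x => yy x ζ)
      fun x ξ => psum 2 x fun c => (τ.mult c : ℂ) * spt ξ c * spt ζ c := by
    refine (RatFam.sum hW τ.sidx fun c hc => (RatFam.C ((τ.mult c : ℂ) * spt ζ c)).mul hW
      ((ratUnit_lin hW hWd hc).inv hW).fam).congr hW (fun x _ => ?_) fun x _ ξ => ?_
    · rw [yy, psum]
      exact Finset.sum_congr rfl fun c _ => by rw [Nat.cast_one, zpow_neg, zpow_one]
    · rw [psum]
      refine Finset.sum_congr rfl fun c _ => ?_
      have := lin_ne_zero (spt x c)
      simp only [map_mul, zero_mul, zero_add, Nat.cast_ofNat, zpow_neg]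
      field_simp
  refine ((ratUnit_lam hW hWd).fam.mul hW h1).congr hW (fun x _ => tangent_eq x ζ) fun x _ ξ => ?_
  rw [d2]; ring

/-! ### Functionals given by residues at the marked points -/

theorem inR_lin_inv {x : τ.V} {k : Option (Fin τ.K)} (hk : k ∈ τ.marked) :
    InR x (lin (pt x k))⁻¹ := fun μ h => by
  rw [← zpow_neg_one]
  refine (lExact_lin_zpow (pt x k) μ (-1)).lOrd.mono ?_
  induction μ using OnePoint.rec with
  | infty => exact absurd (infty_mem_gam x) h
  | coe μ =>
    rw [linOrd_of_ne, mul_zero]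
    rintro rfl; exact h (pt_mem_gam x hk)

/-- The functional `∑ res (p ^ (-s) G f)`, the sum being over the marked points. -/
def Phi (G : Option (Option (Fin τ.K)) → LaurentSeries ℂ) (x : τ.V) (f : RatFunc ℂ) : ℂ :=
  ∑ κ ∈ τ.places, res (place x κ) (G κ * expand (place x κ) (ps τ * f))

theorem Phi_add (G : Option (Option (Fin τ.K)) → LaurentSeries ℂ) (x : τ.V) (f g : RatFunc ℂ) :
    Phi G x (f + g) = Phi G x f + Phi G x g := by
  simp only [Phi, mul_add, expand_add, map_add, Finset.sum_add_distrib]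

theorem Phi_zero (G : Option (Option (Fin τ.K)) → LaurentSeries ℂ) (x : τ.V) : Phi G x 0 = 0 := by
  simp [Phi, expand_zero]

/-- The families `G κ` have, up to multiples of `(p - v_k)⁻¹` that are independent of `κ`, the
derivatives `G₁ κ λ_p` and `G₁ κ X_ξ`. -/
structure Pot (W : Set τ.V) (k : Option (Fin τ.K)) (c : ℂ)
    (G G₁ : Option (Option (Fin τ.K)) → τ.V → LaurentSeries ℂ) : Prop where
  fam : ∀ κ ∈ τ.places, Fam W κ (G κ) fun x ξ => G₁ κ x * expand (place x κ) (tangent x ξ) -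
    HahnSeries.C (c * pt ξ k) * expand (place x κ) (lin (pt x k))⁻¹
  der : ∀ κ ∈ τ.places, ∀ x ∈ W, der (place x κ) (G κ x) =
    G₁ κ x * expand (place x κ) (derivP (lam x)) +
      HahnSeries.C c * expand (place x κ) (lin (pt x k))⁻¹
  mem : c ≠ 0 → k ∈ τ.marked

namespace Pot

variable {k : Option (Fin τ.K)} {c : ℂ}
  {G G₁ : Option (Option (Fin τ.K)) → τ.V → LaurentSeries ℂ}

/-- The correction c/(p - v_k) is one rational function, the same at all the places, so the residue
theorem removes it. This is why the logarithms at the different places have to be combined with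
exactly these weights. -/
theorem sum_res (h : Pot W k c G G₁) {x : τ.V} (hx : x ∈ τ.domain) {f : RatFunc ℂ} (hf : InR x f)
    (z : ℂ) : ∑ κ ∈ τ.places, res (place x κ) (HahnSeries.C (c * z) *
      expand (place x κ) (lin (pt x k))⁻¹ * expand (place x κ) f) = 0 := by
  by_cases hc : c = 0
  · simp [hc]
  · simp only [mul_assoc (HahnSeries.C (c * z)), ← expand_mul, res_C_mul]
    rw [← Finset.mul_sum, sum_places hx (fun μ => res μ (expand μ ((lin (pt x k))⁻¹ * f))),
      ((inR_lin_inv (h.mem hc)).mul hf).sum_res, mul_zero]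

theorem fderiv_Phi (h : Pot W k c G G₁) (hW : IsOpen W) (hWd : W ⊆ τ.domain)
    {f : τ.V → RatFunc ℂ} {f' : τ.V → τ.V → RatFunc ℂ} (hf : RatFam W f f')
    (hR : ∀ x ∈ W, InR x (f x)) :
    ContDiffOn ℂ (⊤ : ℕ∞) (fun x => Phi (G · x) x (f x)) W ∧ ∀ x ∈ W, ∀ ξ,
      fderiv ℂ (fun x => Phi (G · x) x (f x)) x ξ =
        Phi (G · x) x (f' x ξ) + Phi (G₁ · x) x (f x * tangent x ξ) := by
  have h1 : RatFam W (fun x => ps τ * f x) fun x ξ => ps τ * f' x ξ :=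
    ((ratUnit_ps hW hWd).fam.mul hW hf).congr hW (fun _ _ => rfl) fun x _ ξ => by ring
  have h2 (κ) (hκ : κ ∈ τ.places) := ((h.fam κ hκ).mul hW (h1 κ hκ)).res
  refine ⟨ContDiffOn.sum fun κ hκ => (h2 κ hκ).1, fun x hx ξ => ?_⟩
  have h3 := h.sum_res (hWd hx) ((inR_ps x).mul (hR x hx)) (pt ξ k)
  simp only [Phi]
  rw [fderiv_fun_sum fun κ hκ => smooth_diff hW (h2 κ hκ).1 hx, sum_apply,
    ← Finset.sum_add_distrib, ← sub_eq_zero, ← Finset.sum_sub_distrib, ← neg_eq_zero, ← h3,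
    ← Finset.sum_neg_distrib]
  refine Finset.sum_congr rfl fun κ hκ => ?_
  rw [(h2 κ hκ).2 x hx ξ, ← map_add, ← map_sub, ← map_neg]
  congr 1
  simp only [expand_mul]
  ring

/-- Integration by parts at each place; the corrections add up to zero. -/
theorem Phi_derivP (h : Pot W k c G G₁) (hWd : W ⊆ τ.domain) {x : τ.V} (hx : x ∈ W)
    {K : RatFunc ℂ} (hK : InR x K) :
    Phi (G · x) x (RatFunc.X ^ τ.s * derivP K) =
      -Phi (G₁ · x) x (RatFunc.X ^ τ.s * derivP (lam x) * K) := by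
  have h3 := h.sum_res (hWd hx) hK 1
  rw [← sub_eq_zero, sub_neg_eq_add, ← neg_eq_zero, ← h3, Phi, Phi, ← Finset.sum_add_distrib,
    ← Finset.sum_neg_distrib]
  refine Finset.sum_congr rfl fun κ hκ => ?_
  have h4 := res_der (place x κ) (G κ x * expand (place x κ) K)
  rw [der_mul, h.der κ hκ x hx, ← expand_derivP] at h4
  have h5 (f : RatFunc ℂ) : ps τ * (RatFunc.X ^ τ.s * f) = f := by
    rw [← mul_assoc, ps_mul_X_pow, one_mul]
  rw [mul_assoc (RatFunc.X ^ τ.s), h5, h5, ← map_add, ← map_neg, mul_one, ← sub_eq_zero, ← map_sub]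
  rw [← neg_eq_zero, ← map_neg] at h4
  rw [← h4]
  congr 1
  simp only [expand_mul]
  ring

/-- The derivative of the functional on X_ζ is the functional on the second derivative of λ plus
that of the derived family on X_ξ X_ζ. Inserting the decompositions of both through K, the terms
with K cancel after integration by parts, leaving the connection and the product. -/
theorem hess (h : Pot W k c G G₁) (hW : IsOpen W) (hWd : W ⊆ τ.domain) {f : τ.V → ℂ}
    (hfs : ContDiffOn ℂ (⊤ : ℕ∞) f W)
    (hf : ∀ x ∈ W, ∀ ξ, fderiv ℂ f x ξ = Phi (G · x) x (tangent x ξ)) {x : τ.V} (hx : x ∈ W)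
    (ξ ζ : τ.V) : dd f x ξ ζ =
      fderiv ℂ f x (connV x ξ ζ) + Phi (G₁ · x) x (tangent x (mulV x ξ ζ)) := by
  have h1 := (h.fderiv_Phi hW hWd (ratFam_tangent hW hWd ζ)
    fun x hx => inR_tangent (hWd hx) ζ).2 x hx ξ
  have hd := hWd hx
  rw [← fderiv_fderiv_const hW hfs hx, fderiv_congr_on hW (fun y hy => hf y hy ζ) hx, h1,
    connV_spec hd, Phi_add, h.Phi_derivP hWd hx (inR_kk hd ξ ζ), mul_comm (tangent x ζ), tangent_mul_tangent hd,
    Phi_add, hf x hx]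
  ring

end Pot

/-! ### Leading coefficients -/

/-- `F` has order `k` and leading coefficient `1`. -/
def Monic (k : ℤ) (F : LaurentSeries ℂ) : Prop := LExact k F ∧ F.coeff k = 1

theorem Monic.mul {k l : ℤ} {F G : LaurentSeries ℂ} (h : Monic k F) (h' : Monic l G) :
    Monic (k + l) (F * G) :=
  ⟨h.1.mul h'.1, by rw [h.1.lOrd.coeff_mul_add h'.1.lOrd, h.2, h'.2, one_mul]⟩

theorem Monic.inv {k : ℤ} {F : LaurentSeries ℂ} (h : Monic k F) : Monic (-k) F⁻¹ := by
  refine ⟨h.1.inv, ?_⟩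
  have h1 := h.1.lOrd.coeff_mul_add h.1.inv.lOrd
  rw [mul_inv_cancel₀ h.1.ne_zero, add_neg_cancel, h.2, one_mul] at h1
  rw [← h1]; simp

theorem monic_one : Monic 0 1 := ⟨lExact_one, by simp⟩

theorem Monic.zpow {k : ℤ} {F : LaurentSeries ℂ} (h : Monic k F) (e : ℤ) :
    Monic (e * k) (F ^ e) := by
  induction e using Int.induction_on with
  | zero => simpa using monic_one
  | succ i ih =>
    rw [zpow_add_one₀ h.1.ne_zero, add_mul, one_mul]; exact ih.mul h
  | pred i ih =>
    rw [zpow_sub_one₀ h.1.ne_zero, sub_mul, one_mul]; exact ih.mul h.inv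

theorem monic_lin_infty (c : ℂ) : Monic (-1) (expand ∞ (lin c)) := by
  refine ⟨by simpa using lExact_lin c ∞, ?_⟩
  rw [expand_lin_infty]; simp

theorem monic_lam_infty (x : τ.V) : Monic (-τ.n) (expand ∞ (lam x)) := by
  have key (S : Finset τ.Lab) : Monic (∑ c ∈ S, τ.mult c)
      (expand ∞ (∏ c ∈ S, lin (spt x c) ^ (-τ.mult c))) := by
    classical
    induction S using Finset.induction_on with
    | empty => simpa [expand_one] using monic_one
    | insert c S hc ih =>
      rw [Finset.sum_insert hc, Finset.prod_insert hc, expand_mul, expand_zpow]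
      have := (monic_lin_infty (spt x c)).zpow (-τ.mult c)
      rw [neg_mul_neg, mul_one] at this
      exact this.mul ih
  rw [lam_eq, ← sum_mult]; exact key _

/-! ### The pole orders and branches at all the marked points -/

variable (τ) in
/-- The order of the pole of `λ` at the marked point with label `κ`. -/
def ordOf (κ : Option (Option (Fin τ.K))) : ℤ := κ.elim τ.n τ.ord

theorem ordOf_ne_zero {κ : Option (Option (Fin τ.K))} (hκ : κ ∈ τ.places) : τ.ordOf κ ≠ 0 := by
  cases κ with
  | none => have := τ.n_pos'; change τ.n ≠ 0; omega
  | some k => exact ord_ne_zero (Finset.some_mem_insertNone.1 hκ)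

theorem lExact_lam_place {x : τ.V} (hx : x ∈ τ.domain) {κ : Option (Option (Fin τ.K))}
    (hκ : κ ∈ τ.places) : LExact (-τ.ordOf κ) (expand (place x κ) (lam x)) := by
  cases κ with
  | none => exact (monic_lam_infty x).1
  | some k => exact lOrd_lam_pt hx (Finset.some_mem_insertNone.1 hκ)

namespace Branch

variable (b : Branch τ W)

/-- The logarithm of the leading coefficient of `λ` at the marked point with label `κ`. -/
def lc (κ : Option (Option (Fin τ.K))) : τ.V → ℂ := κ.elim (fun _ => 0) b.logLead

theorem exp_lc {κ : Option (Option (Fin τ.K))} (hκ : κ ∈ τ.places) {x : τ.V} (hx : x ∈ W) :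
    Complex.exp (b.lc κ x) = (expand (place x κ) (lam x)).coeff (-τ.ordOf κ) := by
  cases κ with
  | none =>
    rw [place_none]
    exact Complex.exp_zero.trans (monic_lam_infty x).2.symm
  | some k => exact b.exp_logLead k (Finset.some_mem_insertNone.1 hκ) x hx

theorem smooth_lc (hW : IsOpen W) (hWd : W ⊆ τ.domain) {κ : Option (Option (Fin τ.K))}
    (hκ : κ ∈ τ.places) : ContDiffOn ℂ (⊤ : ℕ∞) (b.lc κ) W := by
  refine smooth_of_exp hW ?_ ((ratFam_lam hW hWd κ hκ).smooth (-τ.ordOf κ))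
    fun x hx => b.exp_lc hκ hx
  cases κ with
  | none => exact continuousOn_const
  | some k => exact b.continuous_logLead k (Finset.some_mem_insertNone.1 hκ)

theorem smooth_logDiff (hW : IsOpen W) {j k : Option (Fin τ.K)} (hj : j ∈ τ.marked)
    (hk : k ∈ τ.marked) (hjk : j ≠ k) : ContDiffOn ℂ (⊤ : ℕ∞) (b.logDiff j k) W :=
  smooth_of_exp hW (b.continuous_logDiff j hj k hk hjk)
    ((smooth_spt (Sum.inr j)).sub (smooth_spt (Sum.inr k)))
    fun x hx => b.exp_logDiff j hj k hk hjk x hx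

/-- The branch of `λ ^ (q / m)` at the marked point with label `κ`, where `m` is the order of the
pole. -/
def pw (κ : Option (Option (Fin τ.K))) (q : ℤ) (x : τ.V) : LaurentSeries ℂ :=
  fracPow (b.lc κ x) (τ.ordOf κ) q (expand (place x κ) (lam x))

theorem lExact_pw (κ : Option (Option (Fin τ.K))) (q : ℤ) (x : τ.V) :
    LExact (-q) (b.pw κ q x) := lExact_fracPow _ _ _ _

theorem pw_add {κ : Option (Option (Fin τ.K))} (hκ : κ ∈ τ.places) {x : τ.V} (hx : x ∈ W)
    (q r : ℤ) : b.pw κ (q + r) x = b.pw κ q x * b.pw κ r x :=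
  fracPow_add (b.exp_lc hκ hx) q r

theorem pw_zero {κ : Option (Option (Fin τ.K))} (hκ : κ ∈ τ.places) {x : τ.V} (hx : x ∈ W) :
    b.pw κ 0 x = 1 := fracPow_zero (b.exp_lc hκ hx)

theorem pw_self (hWd : W ⊆ τ.domain) {κ : Option (Option (Fin τ.K))} (hκ : κ ∈ τ.places) {x : τ.V}
    (hx : x ∈ W) : b.pw κ (τ.ordOf κ) x = expand (place x κ) (lam x) :=
  fracPow_self (ordOf_ne_zero hκ) (lExact_lam_place (hWd hx) hκ).lOrd (b.exp_lc hκ hx)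

theorem der_pw (hWd : W ⊆ τ.domain) {κ : Option (Option (Fin τ.K))} (hκ : κ ∈ τ.places) {x : τ.V}
    (hx : x ∈ W) (q : ℤ) : der (place x κ) (b.pw κ q x) =
      HahnSeries.C ((q : ℂ) / τ.ordOf κ) * b.pw κ (q - τ.ordOf κ) x *
        expand (place x κ) (derivP (lam x)) := by
  obtain ⟨D, hD⟩ := der_eq (place x κ)
  rw [expand_derivP, hD, hD, pw, theta_fracPow (ordOf_ne_zero hκ)
    (lExact_lam_place (hWd hx) hκ).lOrd (b.exp_lc hκ hx)]
  rw [pw]; ring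

theorem fam_pw (hW : IsOpen W) (hWd : W ⊆ τ.domain) {κ : Option (Option (Fin τ.K))}
    (hκ : κ ∈ τ.places) (q : ℤ) : Fam W κ (b.pw κ q) fun x ξ =>
      HahnSeries.C ((q : ℂ) / τ.ordOf κ) * b.pw κ (q - τ.ordOf κ) x *
        expand (place x κ) (tangent x ξ) :=
  (ratFam_lam hW hWd κ hκ).fracPow hW (ordOf_ne_zero hκ) (b.smooth_lc hW hWd hκ)
    (fun _ hx => (lExact_lam_place (hWd hx) hκ).lOrd) (fun _ hx => b.exp_lc hκ hx) q

open Classical in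
/-- The family of Laurent series `z λ ^ (q / m)` at the marked point `κ₀`. -/
def powG (κ₀ : Option (Option (Fin τ.K))) (z : ℂ) (q : ℤ) (κ : Option (Option (Fin τ.K)))
    (x : τ.V) : LaurentSeries ℂ := if κ = κ₀ then HahnSeries.C z * b.pw κ q x else 0

theorem Phi_powG {κ : Option (Option (Fin τ.K))} (hκ : κ ∈ τ.places) (z : ℂ) (q : ℤ) (x : τ.V)
    (f : RatFunc ℂ) : Phi (b.powG κ z q · x) x f =
      z * res (place x κ) (b.pw κ q x * expand (place x κ) (ps τ * f)) := by
  rw [Phi, Finset.sum_eq_single κ]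
  · rw [powG, if_pos rfl, mul_assoc, res_C_mul]
  · intro κ' _ h; rw [powG, if_neg h, zero_mul, map_zero]
  · intro h; exact absurd hκ h

theorem pot_powG (hW : IsOpen W) (hWd : W ⊆ τ.domain) {κ : Option (Option (Fin τ.K))}
    (z : ℂ) (q : ℤ) : Pot W none 0 (b.powG κ z q)
      (b.powG κ (z * (q / τ.ordOf κ)) (q - τ.ordOf κ)) where
  fam κ' hκ' := by
    by_cases h : κ' = κ
    · subst h
      refine ((b.fam_pw hW hWd hκ' q).C_mul hW z).congr hW (fun x _ => ?_) fun x _ ξ => ?_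
      · rw [powG, if_pos rfl]
      · rw [powG, if_pos rfl, zero_mul, map_zero, map_mul]; ring
    · refine (Fam.C 0).congr hW (fun x _ => ?_) fun x _ ξ => ?_
      · rw [powG, if_neg h, map_zero]
      · rw [powG, if_neg h]; simp
  der κ' hκ' x hx := by
    by_cases h : κ' = κ
    · subst h
      rw [powG, if_pos rfl, der_C_mul, b.der_pw hWd hκ' hx, powG, if_pos rfl, map_zero, map_mul]
      ring
    · rw [powG, if_neg h, powG, if_neg h, der_zero]; simp
  mem h := absurd rfl h

end Branch

/-- The family of Laurent series `w κ λ ^ e`. -/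
def ratG (w : Option (Option (Fin τ.K)) → ℂ) (e : ℤ) (κ : Option (Option (Fin τ.K))) (x : τ.V) :
    LaurentSeries ℂ := HahnSeries.C (w κ) * expand (place x κ) (lam x ^ e)

theorem derivP_lam_zpow (x : τ.V) (e : ℤ) :
    derivP (lam x ^ e) = RatFunc.C (e : ℂ) * lam x ^ (e - 1) * derivP (lam x) := by
  rw [derivP_zpow (lam_ne_zero x), zpow_sub_one₀ (lam_ne_zero x)]; ring

theorem pot_ratG (hW : IsOpen W) (hWd : W ⊆ τ.domain) (w : Option (Option (Fin τ.K)) → ℂ) (e : ℤ) :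
    Pot W none 0 (ratG w e) (ratG (fun κ => w κ * e) (e - 1)) where
  fam κ hκ := by
    refine ((((ratUnit_lam hW hWd).zpow hW e).fam κ hκ).C_mul hW (w κ)).congr hW (fun x _ => rfl)
      fun x _ ξ => ?_
    have := lam_ne_zero x
    rw [ratG, zero_mul, map_zero, zero_mul, sub_zero, tangent_eq, map_mul, zpow_sub_one₀ this]
    simp only [expand_mul, expand_C, expand_inv]
    have := expand_ne_zero (place x κ) this
    field_simp
  der κ hκ x hx := by
    rw [ratG, der_C_mul, ← expand_derivP, derivP_lam_zpow, ratG, map_zero, zero_mul, add_zero,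
      map_mul]
    simp only [expand_mul, expand_C]
    ring
  mem h := absurd rfl h

theorem Phi_ratG_lam (w : Option (Option (Fin τ.K)) → ℂ) (x : τ.V) (f : RatFunc ℂ) :
    Phi (ratG w (-1) · x) x (lam x * f) = Phi (ratG w 0 · x) x f := by
  have e (μ : OnePoint ℂ) : expand μ (lam x ^ (-1 : ℤ)) * expand μ (ps τ * (lam x * f)) =
      expand μ (lam x ^ (0 : ℤ)) * expand μ (ps τ * f) := by
    rw [← expand_mul, ← expand_mul]
    have := lam_ne_zero x
    congr 1
    rw [zpow_neg_one, zpow_zero]; field_simp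
  simp only [Phi, ratG]
  refine Finset.sum_congr rfl fun κ _ => ?_
  rw [mul_assoc, mul_assoc, e]

/-- The coefficients in `tr_{v_k} + (m_k / n) tr_∞`, written in terms of residues. -/
def wt (k : Option (Fin τ.K)) (κ : Option (Option (Fin τ.K))) : ℂ :=
  κ.elim (-((τ.ord k : ℂ) / τ.n)) fun j => by classical exact if j = k then 1 else 0

open Classical in
/-- The family of Laurent series that defines `regTrLog`. -/
def Branch.logG (b : Branch τ W) (k : Option (Fin τ.K)) (κ : Option (Option (Fin τ.K)))
    (x : τ.V) : LaurentSeries ℂ :=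
  κ.elim (HahnSeries.C (-((τ.ord k : ℂ) / τ.n)) *
      logReg 0 0 (expand ∞ (lin (pt x k) ^ (-τ.n) * lam x))) fun j =>
    if j = k then logReg (b.logLead k x) (τ.ord k) (expand (pt x k : OnePoint ℂ) (lam x))
    else HahnSeries.C (τ.ord k : ℂ) *
      logReg (b.logDiff j k x) 0 (expand (pt x j : OnePoint ℂ) (lin (pt x k)))

theorem Phi_logG (b : Branch τ W) {k : Option (Fin τ.K)} (hk : k ∈ τ.marked) (f : RatFunc ℂ)
    (x : τ.V) : regTrLog b k f x = Phi (b.logG k · x) x f := by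
  classical
  have h (ν : OnePoint ℂ) (F : LaurentSeries ℂ) :
      trSeries τ.s ν (expand ν f * F) = sgn ν * res ν (F * expand ν (ps τ * f)) := by
    rw [trSeries_eq, expand_mul]; congr 2; ring
  rw [Phi, places, Finset.sum_insertNone, ← Finset.add_sum_erase _ _ hk, regTrLog]
  simp only [h, sgn_infty, sgn_coe, one_mul]
  have h1 : ∑ j ∈ τ.marked.erase k, res (place x (some j)) (b.logG k (some j) x *
      expand (place x (some j)) (ps τ * f)) = (τ.ord k : ℂ) * ∑ j ∈ τ.marked.erase k,
        res (pt x j : OnePoint ℂ) (logReg (b.logDiff j k x) 0 (expand (pt x j : OnePoint ℂ)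
          (lin (pt x k))) * expand (pt x j : OnePoint ℂ) (ps τ * f)) := by
    rw [Finset.mul_sum]
    refine Finset.sum_congr rfl fun j hj => ?_
    rw [Branch.logG, Option.elim_some, if_neg (Finset.ne_of_mem_erase hj), mul_assoc, res_C_mul]
    rfl
  rw [h1, Branch.logG, Option.elim_none, mul_assoc, res_C_mul, Branch.logG, Option.elim_some,
    if_pos rfl, place_none, place_some]
  simp only [lin]
  ring

theorem der_logReg_zero (ν : OnePoint ℂ) {lc : ℂ} {F : LaurentSeries ℂ} (hF : LOrd 0 F)
    (hl : Complex.exp lc = F.coeff 0) : der ν (logReg lc 0 F) = der ν F / F := by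
  obtain ⟨D, hD⟩ := der_eq ν
  have h := theta_logReg (m := 0) (by simpa using hF) (by simpa using hl)
  rw [hD, hD, h, Int.cast_zero, map_zero, add_zero, mul_div_assoc]

theorem der_logReg_coe (ν : ℂ) {lc : ℂ} {m : ℤ} {F : LaurentSeries ℂ} (hF : LOrd (-m) F)
    (hl : Complex.exp lc = F.coeff (-m)) : der (ν : OnePoint ℂ) (logReg lc m F) =
      der (ν : OnePoint ℂ) F / F + HahnSeries.C (m : ℂ) * HahnSeries.single (-1) 1 := by
  rw [der_coe, der_coe, theta_logReg hF hl]; ring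

theorem expand_lin_inv_self (c : ℂ) :
    expand (c : OnePoint ℂ) (lin c)⁻¹ = HahnSeries.single (-1) 1 := by
  rw [← zpow_neg_one, expand_lin_zpow_self]

/-- The p-derivatives of the three kinds of logarithm are λ_p/λ + m_k/(p - v_k) at v_k,
-(m_k/n)(λ_p/λ - n/(p - v_k)) at ∞, and m_k/(p - v_k) at the remaining finite points. The correction
is the same everywhere, and what remains is the weight of the place divided by λ, times λ_p. -/
theorem pot_logG (hW : IsOpen W) (hWd : W ⊆ τ.domain) (b : Branch τ W) {k : Option (Fin τ.K)}
    (hk : k ∈ τ.marked) : Pot W k (τ.ord k) (b.logG k) (ratG (wt k) (-1)) := by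
  classical
  have hn : (τ.n : ℂ) ≠ 0 := by have := τ.n_pos'; exact_mod_cast (by omega : τ.n ≠ 0)
  have hk' := inr_mem_sidx.2 hk
  have hlin : RatUnit W (fun x => lin (pt x k)) fun x ξ => -RatFunc.C (pt ξ k) * (lin (pt x k))⁻¹ :=
    ratUnit_lin hW hWd hk'
  have hinf := (hlin.zpow hW (-τ.n)).mul hW (ratUnit_lam hW hWd)
  have m1 (x : τ.V) : Monic 0 (expand ∞ (lin (pt x k) ^ (-τ.n) * lam x)) := by
    have h := ((monic_lin_infty (pt x k)).zpow (-τ.n)).mul (monic_lam_infty x)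
    rw [neg_mul_neg, mul_one, add_neg_cancel] at h
    rwa [expand_mul, expand_zpow]
  have m2 (x : τ.V) (j : Option (Fin τ.K)) :
      LOrd 0 (expand (pt x j : OnePoint ℂ) (lin (pt x k))) ∧
        (expand (pt x j : OnePoint ℂ) (lin (pt x k))).coeff 0 = pt x j - pt x k := by
    rw [expand_lin_coe]
    exact ⟨(lOrd_C _).add ((lOrd_single 1 1).mono (by norm_num)), by simp⟩
  refine ⟨fun κ hκ => ?_, fun κ hκ x hx => ?_, fun _ => hk⟩
  · cases κ with
    | none =>
      refine (((hinf.fam none hκ).logReg hW (m := 0) (lc := fun _ => 0) contDiffOn_const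
        (fun x _ => by rw [neg_zero]; exact (m1 x).1.lOrd) (fun x _ => by
          rw [Complex.exp_zero]; exact (m1 x).2.symm) fun _ => rfl).C_mul hW _).congr hW
        (fun x _ => rfl) fun x hx ξ => ?_
      have h0 := expand_ne_zero ∞ (hinf.ne_zero x hx)
      have e : expand ∞ (tangent x ξ) = expand ∞ (lam x) * expand ∞ (yy x ξ) := by
        rw [tangent_eq, expand_mul]
      have h1 := expand_ne_zero ∞ (lam_ne_zero x)
      rw [place_none, expand_mul ∞ _ (_ + _), mul_div_cancel_left₀ _ h0, ratG, place_none, e,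
        zpow_neg_one, expand_inv, wt, Option.elim_none, Int.cast_zero, mul_zero, map_zero, sub_zero,
        mul_assoc (HahnSeries.C (-((τ.ord k : ℂ) / τ.n))), inv_mul_cancel_left₀ h1, expand_add,
        expand_mul, expand_mul, expand_neg, expand_C, expand_C]
      have e2 : (HahnSeries.C ((τ.ord k : ℂ) * pt ξ k) : LaurentSeries ℂ) =
          HahnSeries.C (-((τ.ord k : ℂ) / τ.n)) * HahnSeries.C ((-τ.n : ℤ) : ℂ) *
            HahnSeries.C (pt ξ k) := by
        rw [← map_mul, ← map_mul]; congr 1; push_cast; field_simp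
      rw [e2]; ring
    | some j =>
      by_cases hj : j = k
      · subst hj
        refine ((ratFam_lam hW hWd (some j) hκ).logReg hW (m := τ.ord j)
          (b.smooth_lc hW hWd hκ) (fun x hx => (lExact_lam_place (hWd hx) hκ).lOrd)
          (fun x hx => b.exp_lc hκ hx) (by simp)).congr hW (fun x _ => ?_) fun x _ ξ => ?_
        · rw [Branch.logG, Option.elim_some, if_pos rfl]; rfl
        · rw [ratG, wt, Option.elim_some, if_pos rfl, place_some, expand_lin_inv_self,
            zpow_neg_one, expand_inv, map_one, C_mul_single, mul_one, vel, Option.elim_some,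
            mul_comm (pt ξ j)]
          ring
      · refine (((hlin.fam (some j) hκ).logReg hW (m := 0)
          (b.smooth_logDiff hW (Finset.some_mem_insertNone.1 hκ) hk hj)
          (fun x _ => by rw [neg_zero]; exact (m2 x j).1) (fun x hx => by
            rw [b.exp_logDiff j (Finset.some_mem_insertNone.1 hκ) k hk hj x hx]
            exact (m2 x j).2.symm) (fun _ => rfl)).C_mul hW (τ.ord k : ℂ)).congr hW
          (fun x _ => ?_) fun x _ ξ => ?_
        · rw [Branch.logG, Option.elim_some, if_neg hj]; rfl
        · have h1 := expand_ne_zero (place x (some j)) (lin_ne_zero (pt x k))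
          have hs : (HahnSeries.single (-1) (0 : ℂ) : LaurentSeries ℂ) = 0 :=
            HahnSeries.single_eq_zero
          have h0 : HahnSeries.C (0 : ℂ) = (0 : LaurentSeries ℂ) := map_zero _
          beta_reduce
          rw [ratG, wt, Option.elim_some, if_neg hj, Int.cast_zero, mul_zero, hs, sub_zero,
            expand_mul _ (lin (pt x k)) _, mul_div_cancel_left₀ _ h1, expand_mul, expand_neg,
            expand_C, h0, map_mul]
          ring
  · cases κ with
    | none =>
      have h1 := lam_ne_zero x
      have h2 := lin_ne_zero (pt x k)
      have e : derivP (lin (pt x k) ^ (-τ.n) * lam x) = (lin (pt x k) ^ (-τ.n) * lam x) *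
          (RatFunc.C ((-τ.n : ℤ) : ℂ) * (lin (pt x k))⁻¹ + (lam x)⁻¹ * derivP (lam x)) := by
        rw [derivP_mul, derivP_zpow h2, derivP_lin]
        field_simp
      have h0 := expand_ne_zero ∞ (hinf.ne_zero x hx)
      have e2 : (HahnSeries.C (τ.ord k : ℂ) : LaurentSeries ℂ) =
          HahnSeries.C (-((τ.ord k : ℂ) / τ.n)) * HahnSeries.C ((-τ.n : ℤ) : ℂ) := by
        rw [← map_mul]; congr 1; push_cast; field_simp
      rw [Branch.logG, Option.elim_none, der_C_mul, place_none, der_logReg_zero ∞ (m1 x).1.lOrd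
        (by rw [Complex.exp_zero]; exact (m1 x).2.symm), ← expand_derivP, e, expand_mul ∞ _ (_ + _),
        mul_div_cancel_left₀ _ h0, ratG, wt, Option.elim_none, place_none, zpow_neg_one, e2,
        expand_add, expand_mul, expand_mul, expand_C]
      ring
    | some j =>
      by_cases hj : j = k
      · subst hj
        have h := der_logReg_coe (pt x j) (lExact_lam_place (hWd hx) hκ).lOrd (b.exp_lc hκ hx)
        rw [Branch.logG, Option.elim_some, if_pos rfl, ratG, wt, Option.elim_some, if_pos rfl,
          place_some, map_one, expand_lin_inv_self, zpow_neg_one, expand_inv, expand_derivP]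
        refine h.trans ?_
        rw [place_some, ordOf, Option.elim_some]; ring
      · have h1 := expand_ne_zero (place x (some j)) (lin_ne_zero (pt x k))
        have h := der_logReg_zero (pt x j) (m2 x j).1
          ((b.exp_logDiff j (Finset.some_mem_insertNone.1 hκ) k hk hj x hx).trans (m2 x j).2.symm)
        rw [Branch.logG, Option.elim_some, if_neg hj, der_C_mul, place_some, h, ← expand_derivP,
          derivP_lin, expand_one, expand_inv, ratG, wt, Option.elim_some, if_neg hj, map_zero]
        ring

/-! ### Potentials of the flat coordinates -/

theorem Phi_C_mul (G : Option (Option (Fin τ.K)) → LaurentSeries ℂ) (x : τ.V) (z : ℂ)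
    (f : RatFunc ℂ) : Phi G x (RatFunc.C z * f) = z * Phi G x f := by
  rw [Phi, Phi, Finset.mul_sum]
  refine Finset.sum_congr rfl fun κ _ => ?_
  rw [mul_left_comm (ps τ), expand_mul, expand_C, mul_left_comm, res_C_mul]

theorem Phi_sub (G : Option (Option (Fin τ.K)) → LaurentSeries ℂ) (x : τ.V) (f g : RatFunc ℂ) :
    Phi G x (f - g) = Phi G x f - Phi G x g := by
  have h : (RatFunc.C (-1) : RatFunc ℂ) = -1 := by rw [map_neg, map_one]
  rw [sub_eq_add_neg, neg_eq_neg_one_mul, ← h, Phi_add, Phi_C_mul]; ring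

theorem X_pow_mul_derivP (f : RatFunc ℂ) : RatFunc.X ^ τ.s * derivP (ps τ * RatFunc.X * f) =
    RatFunc.C (1 - (τ.s : ℂ)) * f + RatFunc.X * derivP f := by
  have h0 : (RatFunc.X : RatFunc ℂ) ≠ 0 := RatFunc.X_ne_zero
  have h1 : derivP (ps τ) * RatFunc.X = -RatFunc.C (τ.s : ℂ) * ps τ := by
    rw [ps_eq, derivP_zpow (lin_ne_zero 0), derivP_lin, lin_zero, Int.cast_neg, Int.cast_natCast,
      map_neg]
    field_simp
  rw [derivP_mul, derivP_mul, derivP_X, h1, map_sub, map_one]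
  have h2 := ps_mul_X_pow (τ := τ)
  linear_combination (f - RatFunc.C (τ.s : ℂ) * f + RatFunc.X * derivP f) * h2

/-- The function λ is homogeneous of degree n in p, the a_i and the v_j together, so the radial
field in the coordinates acts on it as n minus p∂_p. -/
theorem tangent_euler (x : τ.V) : tangent x ((1 / (τ.n : ℂ)) • x) = eulerFun x := by
  have hn : (τ.n : ℂ) ≠ 0 := by have := τ.n_pos'; exact_mod_cast (by omega : τ.n ≠ 0)
  have h1 : yy x ((1 / (τ.n : ℂ)) • x) = 1 - RatFunc.C (1 / (τ.n : ℂ)) * RatFunc.X * rho x := by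
    have h2 : ∑ c ∈ τ.sidx, RatFunc.C (1 / (τ.n : ℂ)) * RatFunc.C (τ.mult c : ℂ) = -1 := by
      rw [← Finset.mul_sum, ← map_sum, ← Int.cast_sum, sum_mult, ← map_mul, Int.cast_neg, mul_neg,
        one_div_mul_cancel hn, map_neg, map_one]
    have h3 : (1 : RatFunc ℂ) = -∑ c ∈ τ.sidx, RatFunc.C (1 / (τ.n : ℂ)) *
      RatFunc.C (τ.mult c : ℂ) := by rw [h2, neg_neg]
    rw [h3, yy, rho, psum, psum, Finset.mul_sum, ← Finset.sum_neg_distrib, ← Finset.sum_sub_distrib]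
    refine Finset.sum_congr rfl fun c _ => ?_
    have h4 : (RatFunc.X : RatFunc ℂ) = lin (spt x c) + RatFunc.C (spt x c) := by rw [lin]; ring
    have h5 := lin_ne_zero (spt x c)
    rw [spt_smul, h4]
    simp only [map_mul, map_neg, Nat.cast_one, zpow_neg_one]
    field_simp
    ring
  rw [tangent_eq, h1, eulerFun, derivP_lam]; ring

theorem Pot.Phi_X_mul_derivP {k : Option (Fin τ.K)} {c : ℂ}
    {G G₁ : Option (Option (Fin τ.K)) → τ.V → LaurentSeries ℂ} (h : Pot W k c G G₁)
    (hWd : W ⊆ τ.domain) {x : τ.V} (hx : x ∈ W) {f : RatFunc ℂ} (hf : InR x f) :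
    Phi (G₁ · x) x (derivP (lam x) * RatFunc.X * f) = -Phi (G · x) x
      (RatFunc.C (1 - (τ.s : ℂ)) * f + RatFunc.X * derivP f) := by
  rw [← X_pow_mul_derivP, h.Phi_derivP hWd hx (((inR_ps x).mul (inR_X x)).mul hf), neg_neg]
  congr 1
  have h2 := ps_mul_X_pow (τ := τ)
  linear_combination (-derivP (lam x) * RatFunc.X * f) * h2

/-- The sign of the residue at the marked point with label `κ` in the trace form. -/
def sg (κ : Option (Option (Fin τ.K))) : ℂ := κ.elim (-1) fun _ => 1

theorem sgn_place (x : τ.V) (κ : Option (Option (Fin τ.K))) : sgn (place x κ) = sg κ := by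
  cases κ <;> rfl

theorem sg_mul_self (κ : Option (Option (Fin τ.K))) : sg κ * sg κ = 1 := by
  cases κ <;> simp [sg]

/-- The covector `tr (λ ^ (-j / m) X)` at the marked point with label `κ`. -/
def Branch.cov (b : Branch τ W) (κ : Option (Option (Fin τ.K))) (j : ℤ) (x ξ : τ.V) : ℂ :=
  sg κ * res (place x κ) (b.pw κ (-j) x * expand (place x κ) (xt x ξ))

/-- The functions `t` and `H` are the residues of a primitive and of a second primitive of
`λ ^ (-j / m)`. -/
structure FlatPot (b : Branch τ W) (κ : Option (Option (Fin τ.K))) (j : ℤ)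
    (t H : τ.V → ℂ) (k : Option (Fin τ.K)) (c : ℂ)
    (G G₀ G₁ : Option (Option (Fin τ.K)) → τ.V → LaurentSeries ℂ) : Prop where
  pot : Pot W k c G G₀
  pot₀ : Pot W none 0 G₀ G₁
  t_eq : ∀ x ∈ W, t x = Phi (G · x) x 1
  smooth_H : ContDiffOn ℂ (⊤ : ℕ∞) H W
  fderiv_H : ∀ x ∈ W, ∀ ξ, fderiv ℂ H x ξ = Phi (G · x) x (tangent x ξ)
  cov : ∀ x ∈ W, ∀ ξ, Phi (G₀ · x) x (tangent x ξ) = b.cov κ j x ξ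
  vanish : ∀ x ∈ W, ∀ ξ, Phi (G₁ · x) x (tangent x ξ) = 0
  euler_t : ∃ r, ∀ x ∈ W, Phi (G₀ · x) x (lam x) = (1 - (j : ℂ) / τ.ordOf κ) * t x + r
  euler_H : ∃ g : τ.V → ℂ, ContDiffOn ℂ (⊤ : ℕ∞) g W ∧
    (∀ x ∈ W, ∀ X Y, dd g x X Y = fderiv ℂ g x (connV x X Y)) ∧
    ∀ x ∈ W, Phi (G · x) x (lam x) = (2 - (j : ℂ) / τ.ordOf κ) * H x + g x
  radial_H : ∀ x ∈ W, Phi (G · x) x (derivP (lam x) * RatFunc.X) = -(1 - (τ.s : ℂ)) * H x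

namespace FlatPot

variable {b : Branch τ W} {κ : Option (Option (Fin τ.K))} {j : ℤ} {t H : τ.V → ℂ}
  {k : Option (Fin τ.K)} {c : ℂ} {G G₀ G₁ : Option (Option (Fin τ.K)) → τ.V → LaurentSeries ℂ}

theorem smooth_and_fderiv_t (h : FlatPot b κ j t H k c G G₀ G₁) (hW : IsOpen W)
    (hWd : W ⊆ τ.domain) : ContDiffOn ℂ (⊤ : ℕ∞) t W ∧
      ∀ x ∈ W, ∀ ξ, fderiv ℂ t x ξ = Phi (G₀ · x) x (tangent x ξ) := by
  have h1 := h.pot.fderiv_Phi hW hWd (RatFam.C 1) fun x _ => inR_C x 1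
  rw [map_one] at h1
  refine ⟨h1.1.congr h.t_eq, fun x hx ξ => ?_⟩
  rw [fderiv_congr_on hW h.t_eq hx, h1.2 x hx, Phi_zero, zero_add, one_mul]

theorem fderiv_t (h : FlatPot b κ j t H k c G G₀ G₁) (hW : IsOpen W) (hWd : W ⊆ τ.domain)
    {x : τ.V} (hx : x ∈ W) (ξ : τ.V) : fderiv ℂ t x ξ = b.cov κ j x ξ := by
  rw [(h.smooth_and_fderiv_t hW hWd).2 x hx, h.cov x hx]

theorem hess_t (h : FlatPot b κ j t H k c G G₀ G₁) (hW : IsOpen W) (hWd : W ⊆ τ.domain)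
    {x : τ.V} (hx : x ∈ W) (ξ ζ : τ.V) : dd t x ξ ζ = fderiv ℂ t x (connV x ξ ζ) := by
  obtain ⟨h1, h2⟩ := h.smooth_and_fderiv_t hW hWd
  rw [h.pot₀.hess hW hWd h1 h2 hx, h.vanish x hx, add_zero]

theorem hess_H (h : FlatPot b κ j t H k c G G₀ G₁) (hW : IsOpen W) (hWd : W ⊆ τ.domain)
    {x : τ.V} (hx : x ∈ W) (ξ ζ : τ.V) :
    dd H x ξ ζ = fderiv ℂ H x (connV x ξ ζ) + fderiv ℂ t x (mulV x ξ ζ) := by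
  rw [h.pot.hess hW hWd h.smooth_H h.fderiv_H hx, (h.smooth_and_fderiv_t hW hWd).2 x hx]

/-- The Euler field is λ minus p λ_p/n. The first part raises the power of λ and reproduces t up to
a constant; the second is integrated by parts and contributes (1 - s)/n. -/
theorem fderiv_t_euler (h : FlatPot b κ j t H k c G G₀ G₁) (hW : IsOpen W) (hWd : W ⊆ τ.domain) :
    ∃ r, ∀ x ∈ W, fderiv ℂ t x ((1 / (τ.n : ℂ)) • x) =
      (1 - (j : ℂ) / τ.ordOf κ + (1 - (τ.s : ℂ)) / τ.n) * t x + r := by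
  obtain ⟨r, hr⟩ := h.euler_t
  refine ⟨r, fun x hx => ?_⟩
  have h1 := h.pot.Phi_X_mul_derivP hWd hx (inR_one x)
  rw [derivP_one, mul_zero, add_zero, Phi_C_mul, ← h.t_eq x hx, mul_one] at h1
  rw [(h.smooth_and_fderiv_t hW hWd).2 x hx, tangent_euler, eulerFun, Phi_sub, mul_assoc, Phi_C_mul,
    hr x hx, mul_comm RatFunc.X, h1]
  ring

theorem fderiv_H_euler (h : FlatPot b κ j t H k c G G₀ G₁) :
    ∃ g : τ.V → ℂ, ContDiffOn ℂ (⊤ : ℕ∞) g W ∧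
      (∀ x ∈ W, ∀ X Y, dd g x X Y = fderiv ℂ g x (connV x X Y)) ∧
      ∀ x ∈ W, fderiv ℂ H x ((1 / (τ.n : ℂ)) • x) =
        (1 - (j : ℂ) / τ.ordOf κ + (1 - (τ.s : ℂ)) / τ.n + 1) * H x + g x := by
  obtain ⟨g, hg, hg', hr⟩ := h.euler_H
  refine ⟨g, hg, hg', fun x hx => ?_⟩
  rw [h.fderiv_H x hx, tangent_euler, eulerFun, Phi_sub, mul_assoc, Phi_C_mul, hr x hx,
    mul_comm RatFunc.X, h.radial_H x hx]
  ring

end FlatPot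

theorem lb_place {x : τ.V} (hx : x ∈ τ.domain) {κ : Option (Option (Fin τ.K))}
    (hκ : κ ∈ τ.places) : lb x (place x κ) = -τ.ordOf κ - 1 + 2 * cut (place x κ) := by
  cases κ with
  | none =>
    rw [place_none, cut_infty]
    exact (lb_infty x).trans (by rw [ordOf, Option.elim_none]; ring)
  | some k =>
    rw [place_some, cut_coe]
    exact (lb_pt hx (Finset.some_mem_insertNone.1 hκ)).trans (by rw [ordOf, Option.elim_some]; ring)

theorem lOrd_xt_place {x : τ.V} (hx : x ∈ τ.domain) (ξ : τ.V) {κ : Option (Option (Fin τ.K))}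
    (hκ : κ ∈ τ.places) :
    LOrd (-τ.ordOf κ - 1 + 3 * cut (place x κ)) (expand (place x κ) (xt x ξ)) := by
  refine (inT_xt hx ξ (place x κ)).mono ?_
  rw [lb_place hx hκ]; omega

/-- The cut-off at the marked point with label `κ`. -/
def cutL (κ : Option (Option (Fin τ.K))) : ℤ := κ.elim 1 fun _ => 0

theorem cut_place (x : τ.V) (κ : Option (Option (Fin τ.K))) : cut (place x κ) = cutL κ := by
  cases κ <;> rfl

theorem cutL_cases (κ : Option (Option (Fin τ.K))) : cutL κ = 0 ∨ cutL κ = 1 := by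
  cases κ <;> simp [cutL]

section Power

variable (b : Branch τ W) {κ : Option (Option (Fin τ.K))} {j : ℤ}

theorem trSeries_pw (κ : Option (Option (Fin τ.K))) (q : ℤ) (x : τ.V) :
    trSeries τ.s (place x κ) (b.pw κ q x) =
      sg κ * res (place x κ) (b.pw κ q x * expand (place x κ) (ps τ * 1)) := by
  rw [trSeries_eq, sgn_place, mul_one, mul_comm (expand _ _)]

/-- The powers λ^(2 - j/m), λ^(1 - j/m), λ^(-j/m) are successive primitives with the stated
normalisations. The condition j < m keeps the denominators 1 - j/m and 2 - j/m away from zero. -/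
theorem flatPot_power (hW : IsOpen W) (hWd : W ⊆ τ.domain) (hκ : κ ∈ τ.places)
    (hj : cutL κ ≤ j) (hj' : j < τ.ordOf κ) {t H : τ.V → ℂ}
    (ht : ∀ x ∈ W, t x = 1 / (1 - (j : ℂ) / τ.ordOf κ) *
      trSeries τ.s (place x κ) (b.pw κ (τ.ordOf κ - j) x))
    (hH : ∀ x ∈ W, H x = 1 / (1 - (j : ℂ) / τ.ordOf κ) * (1 / (2 - (j : ℂ) / τ.ordOf κ)) *
      trSeries τ.s (place x κ) (b.pw κ (2 * τ.ordOf κ - j) x)) :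
    FlatPot b κ j t H none 0 (b.powG κ (sg κ / (1 - (j : ℂ) / τ.ordOf κ)) (τ.ordOf κ - j))
      (b.powG κ (sg κ) (-j)) (b.powG κ (sg κ * (((-j : ℤ) : ℂ) / τ.ordOf κ)) (-j - τ.ordOf κ)) := by
  have hc := cutL_cases κ
  have hm : (τ.ordOf κ : ℂ) ≠ 0 := by exact_mod_cast ordOf_ne_zero hκ
  have h1 : (τ.ordOf κ : ℂ) - j ≠ 0 := by
    have : (τ.ordOf κ - j : ℤ) ≠ 0 := by omega
    exact_mod_cast this
  have h2 : 2 * (τ.ordOf κ : ℂ) - j ≠ 0 := by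
    have : (2 * τ.ordOf κ - j : ℤ) ≠ 0 := by omega
    exact_mod_cast this
  have h1' : 1 - (j : ℂ) / τ.ordOf κ ≠ 0 := by
    rw [one_sub_div hm]; exact div_ne_zero h1 hm
  have h2' : 2 - (j : ℂ) / τ.ordOf κ ≠ 0 := by
    rw [sub_div' hm]; exact div_ne_zero h2 hm
  have p1 : Pot W none 0 (b.powG κ (sg κ / (1 - (j : ℂ) / τ.ordOf κ)) (τ.ordOf κ - j))
      (b.powG κ (sg κ) (-j)) := by
    have h := b.pot_powG hW hWd (κ := κ) (sg κ / (1 - (j : ℂ) / τ.ordOf κ)) (τ.ordOf κ - j)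
    have e1 : sg κ / (1 - (j : ℂ) / τ.ordOf κ) * (((τ.ordOf κ - j : ℤ) : ℂ) / τ.ordOf κ) = sg κ := by
      push_cast; field_simp
    rwa [e1, show τ.ordOf κ - j - τ.ordOf κ = -j by ring] at h
  have p2 : Pot W none 0
      (b.powG κ (sg κ / (1 - (j : ℂ) / τ.ordOf κ) / (2 - (j : ℂ) / τ.ordOf κ)) (2 * τ.ordOf κ - j))
      (b.powG κ (sg κ / (1 - (j : ℂ) / τ.ordOf κ)) (τ.ordOf κ - j)) := by
    have h := b.pot_powG hW hWd (κ := κ)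
      (sg κ / (1 - (j : ℂ) / τ.ordOf κ) / (2 - (j : ℂ) / τ.ordOf κ)) (2 * τ.ordOf κ - j)
    have e1 : sg κ / (1 - (j : ℂ) / τ.ordOf κ) / (2 - (j : ℂ) / τ.ordOf κ) *
        (((2 * τ.ordOf κ - j : ℤ) : ℂ) / τ.ordOf κ) = sg κ / (1 - (j : ℂ) / τ.ordOf κ) := by
      have e2 : ((2 * τ.ordOf κ - j : ℤ) : ℂ) / τ.ordOf κ = 2 - (j : ℂ) / τ.ordOf κ := by
        push_cast; rw [sub_div, mul_div_cancel_right₀ _ hm]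
      rw [e2, div_mul_cancel₀ _ h2']
    rwa [e1, show 2 * τ.ordOf κ - j - τ.ordOf κ = τ.ordOf κ - j by ring] at h
  have ht' : ∀ x ∈ W, t x = Phi (b.powG κ (sg κ / (1 - (j : ℂ) / τ.ordOf κ))
      (τ.ordOf κ - j) · x) x 1 := fun x hx => by
    rw [ht x hx, trSeries_pw, b.Phi_powG hκ]; ring
  have hH' : ∀ x ∈ W, H x = Phi (b.powG κ (sg κ / (1 - (j : ℂ) / τ.ordOf κ) /
      (2 - (j : ℂ) / τ.ordOf κ)) (2 * τ.ordOf κ - j) · x) x 1 := fun x hx => by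
    rw [hH x hx, trSeries_pw, b.Phi_powG hκ]; ring
  have hlam (z : ℂ) (q : ℤ) {x : τ.V} (hx : x ∈ W) : Phi (b.powG κ z q · x) x (lam x) =
      z * res (place x κ) (b.pw κ (q + τ.ordOf κ) x * expand (place x κ) (ps τ * 1)) := by
    rw [b.Phi_powG hκ, b.pw_add hκ hx, b.pw_self hWd hκ hx, mul_one, expand_mul]
    congr 2; ring
  have hd := p2.fderiv_Phi hW hWd (RatFam.C 1) fun x _ => inR_C x 1
  rw [map_one] at hd
  refine ⟨p1, b.pot_powG hW hWd _ _, ht', hd.1.congr hH', fun x hx ξ => ?_, fun x hx ξ => ?_,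
    fun x hx ξ => ?_, ⟨0, fun x hx => ?_⟩, ⟨fun _ => 0, contDiffOn_const, fun x hx X Y => ?_,
    fun x hx => ?_⟩, fun x hx => ?_⟩
  · rw [fderiv_congr_on hW hH' hx, hd.2 x hx, Phi_zero, zero_add, one_mul]
  · rw [b.Phi_powG hκ]; rfl
  · rw [b.Phi_powG hκ]
    -- For j = 0 the derived family has coefficient zero. Otherwise λ^(-j/m - 1) vanishes to order j
    -- + m, which beats the pole of a tangent vector, so there is no residue.
    by_cases h0 : j = 0
    · rw [h0]; simp
    · have h3 := ((b.lExact_pw κ (-j - τ.ordOf κ) x).lOrd.mul (lOrd_xt_place (hWd hx) ξ hκ)).mono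
        (l := 2 * cut (place x κ)) (by rw [cut_place]; omega)
      rw [xt] at h3
      rw [res_eq_zero h3, mul_zero]
  · rw [hlam _ _ hx, ht x hx, trSeries_pw, add_zero, neg_add_eq_sub]
    field_simp
  · simp [dd]
  · rw [hlam _ _ hx, hH x hx, trSeries_pw, add_zero,
      show τ.ordOf κ - j + τ.ordOf κ = 2 * τ.ordOf κ - j by ring]
    generalize res (place x κ) _ = R
    generalize (1 - (j : ℂ) / τ.ordOf κ) = A at *
    generalize (2 - (j : ℂ) / τ.ordOf κ) = B at *
    field_simp
  · have h3 := p2.Phi_X_mul_derivP hWd hx (inR_one x)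
    rw [derivP_one, mul_zero, add_zero, Phi_C_mul, ← hH' x hx, mul_one] at h3
    rw [h3, neg_mul]

end Power

theorem tr_add_tr_eq {k : Option (Fin τ.K)} (hk : k ∈ τ.marked) (x : τ.V) (f : RatFunc ℂ) :
    tr τ.s (pt x k : OnePoint ℂ) f + (τ.ord k : ℂ) / τ.n * tr τ.s ∞ f =
      Phi (ratG (wt k) 0 · x) x f := by
  classical
  have h (κ : Option (Option (Fin τ.K))) : ratG (wt k) 0 κ x = HahnSeries.C (wt k κ) := by
    rw [ratG, zpow_zero, expand_one, mul_one]
  rw [Phi, places, Finset.sum_insertNone]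
  simp only [h, res_C_mul]
  rw [Finset.sum_eq_single k, tr_eq, tr_eq, sgn_coe, sgn_infty, wt, wt, Option.elim_none,
    Option.elim_some, if_pos rfl, place_none, place_some]
  · ring
  · intro j _ hj; rw [wt, Option.elim_some, if_neg hj, zero_mul]
  · intro h; exact absurd hk h

/-- The residues of `p ^ (-s)` at the marked points do not depend on `λ`. -/
theorem res_ps_place {x y : τ.V} (hx : x ∈ τ.domain) (hy : y ∈ τ.domain)
    {κ : Option (Option (Fin τ.K))} (hκ : κ ∈ τ.places) :
    res (place x κ) (expand (place x κ) (ps τ)) = res (place y κ) (expand (place y κ) (ps τ)) := by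
  rcases κ with _ | _ | j
  · rfl
  · rfl
  · have h {x : τ.V} (hx : x ∈ τ.domain) : res (place x (some (some j)))
        (expand (place x (some (some j))) (ps τ)) = 0 := by
      refine res_eq_zero ?_
      have := lOrd_ps_coe (τ := τ) (μ := v x j) fun hs => (hx.2.2.2 hs).2 j
      simpa [place, pt] using this
    rw [h hx, h hy]

/-- Here the successive primitives are λ log λ - λ, log λ and 1/λ. Scaling the logarithm produces
the inhomogeneous terms: for t the weighted sum of residues of p^(-s), and for H the weighted trace
of λ. The latter has zero covariant Hessian, because its differential is given by constant weights,
whose derived family is zero. -/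
theorem flatPot_log (b : Branch τ W) (hW : IsOpen W) (hWd : W ⊆ τ.domain) {k : Option (Fin τ.K)}
    (hk : k ∈ τ.marked) (hk' : 0 ≤ τ.ord k) {t H : τ.V → ℂ} (ht : ∀ x ∈ W, t x = regTrLog b k 1 x)
    (hH : ∀ x ∈ W, H x = regTrLog b k (lam x) x - tr τ.s (pt x k : OnePoint ℂ) (lam x)
      - (τ.ord k : ℂ) / τ.n * tr τ.s ∞ (lam x)) :
    FlatPot b (some k) (τ.ord k) t H k (τ.ord k) (b.logG k) (ratG (wt k) (-1))
      (ratG (fun κ => wt k κ * ((-1 : ℤ) : ℂ)) (-1 - 1)) := by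
  classical
  have hκ : some k ∈ τ.places := Finset.some_mem_insertNone.2 hk
  have h0 := ord_ne_zero hk
  have hm : (τ.ord k : ℂ) ≠ 0 := by exact_mod_cast h0
  have p1 := pot_logG hW hWd b hk
  have p0 := pot_ratG hW hWd (wt k) 0
  have hz (x : τ.V) (f : RatFunc ℂ) :
      Phi (ratG (fun κ => wt k κ * ((0 : ℤ) : ℂ)) (0 - 1) · x) x f = 0 := by
    simp [Phi, ratG]
  have hH' : ∀ x ∈ W, H x = Phi (b.logG k · x) x (lam x) - Phi (ratG (wt k) 0 · x) x (lam x) :=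
    fun x hx => by rw [hH x hx, Phi_logG b hk, ← tr_add_tr_eq hk]; ring
  have hl := ratFam_lam hW hWd
  have hR : ∀ x ∈ W, InR x (lam x) := fun x hx => inR_lam (hWd hx)
  have d1 := p1.fderiv_Phi hW hWd hl hR
  have d0 := p0.fderiv_Phi hW hWd hl hR
  have d0' : ∀ x ∈ W, ∀ ξ, fderiv ℂ (fun x => Phi (ratG (wt k) 0 · x) x (lam x)) x ξ =
      Phi (ratG (wt k) 0 · x) x (tangent x ξ) := fun x hx ξ => by rw [d0.2 x hx, hz, add_zero]
  refine ⟨p1, pot_ratG hW hWd (wt k) (-1), fun x hx => ?_, (d1.1.sub d0.1).congr hH',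
    fun x hx ξ => ?_, fun x hx ξ => ?_, fun x hx ξ => ?_, ?_,
    ⟨fun x => Phi (ratG (wt k) 0 · x) x (lam x), d0.1, fun x hx X Y => ?_, fun x hx => ?_⟩,
    fun x hx => ?_⟩
  · rw [ht x hx, Phi_logG b hk]
  · rw [fderiv_congr_on hW hH' hx, fderiv_fun_sub (smooth_diff hW d1.1 hx)
      (smooth_diff hW d0.1 hx), sub_apply, d1.2 x hx, d0' x hx, Phi_ratG_lam]
    ring
  · rw [Phi, Finset.sum_eq_single (some k)]
    · have e : expand (place x (some k)) (lam x ^ (-1 : ℤ)) = b.pw (some k) (-τ.ord k) x := by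
        rw [zpow_neg_one, expand_inv, ← b.pw_self hWd hκ hx, inv_eq_iff_eq_inv]
        refine eq_inv_of_mul_eq_one_left ?_
        rw [← b.pw_add hκ hx, ordOf, Option.elim_some, add_neg_cancel, b.pw_zero hκ hx]
      rw [ratG, wt, Option.elim_some, if_pos rfl, map_one, one_mul, e, Branch.cov, sg,
        Option.elim_some, one_mul]
      rfl
    · rintro (_ | κ) hκ' hne
      · rw [ratG, mul_assoc, res_C_mul, res_eq_zero, mul_zero]
        -- At ∞ the inverse of λ has order n and a tangent vector divided by p^s has order at least
        -- 2 - n, so their product has no residue. Only the residue at v_k contributes to dt.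
        have h1 := (lExact_lam_place (hWd hx) hκ').zpow (-1)
        rw [← expand_zpow] at h1
        refine (h1.lOrd.mul (lOrd_xt_place (hWd hx) ξ hκ')).mono ?_
        rw [cut_place]; simp only [cutL, Option.elim_none]; omega
      · rw [ratG, wt, Option.elim_some, if_neg (by simpa using hne)]; simp
    · intro h; exact absurd hκ h
  · refine Finset.sum_eq_zero fun κ hκ' => ?_
    beta_reduce
    rw [ratG, mul_assoc, res_C_mul]
    have h1 := (lExact_lam_place (hWd hx) hκ').zpow (-1 - 1)
    rw [← expand_zpow] at h1
    have h2 := h1.lOrd.mul (lOrd_xt_place (hWd hx) ξ hκ')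
    rcases κ with _ | κ
    · rw [res_eq_zero, mul_zero]
      refine h2.mono ?_
      have := τ.n_pos'
      rw [cut_place]; simp only [cutL, ordOf, Option.elim_none]; omega
    · by_cases hkκ : κ = k
      · subst hkκ
        rw [res_eq_zero, mul_zero]
        refine h2.mono ?_
        rw [cut_place]; simp only [cutL, ordOf, Option.elim_some]; omega
      · rw [wt, Option.elim_some, if_neg hkκ, zero_mul, zero_mul]
  · by_cases hne : W.Nonempty
    · obtain ⟨y, hy⟩ := hne
      -- The constant is evaluated at one point of W: residues of p^(-s) can be nonzero only at 0
      -- and ∞, which do not move.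
      refine ⟨Phi (ratG (wt k) 0 · y) y 1, fun x hx => ?_⟩
      have h1 := Phi_ratG_lam (wt k) x 1
      rw [mul_one] at h1
      rw [h1, ordOf, Option.elim_some, div_self hm, sub_self, zero_mul, zero_add, Phi, Phi]
      refine Finset.sum_congr rfl fun κ hκ' => ?_
      simp only [ratG, zpow_zero, expand_one, mul_one, res_C_mul]
      rw [res_ps_place (hWd hx) (hWd hy) hκ']
    · exact ⟨0, fun x hx => absurd ⟨x, hx⟩ hne⟩
  · rw [p0.hess hW hWd d0.1 d0' hx, hz, add_zero]
  · rw [hH' x hx, ordOf, Option.elim_some, div_self hm]; ring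
  · have e1 := p1.Phi_X_mul_derivP hWd hx (hR x hx)
    have e0 := p0.Phi_X_mul_derivP hWd hx (hR x hx)
    rw [hz] at e0
    rw [mul_comm _ (lam x), Phi_ratG_lam] at e1
    rw [Phi_add, Phi_C_mul, mul_comm RatFunc.X] at e0 e1
    rw [hH' x hx]
    linear_combination e1 - e0

/-! ### The Gram matrix of the flat coordinates -/

/-- The exponents `j` for which `λ ^ (-j / m)` gives a flat coordinate at the marked point `κ`. -/
structure IsExp (τ : MeroType) (κ : Option (Option (Fin τ.K))) (j : ℤ) : Prop where
  mem : κ ∈ τ.places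
  le : cutL κ ≤ j
  ge : j ≤ τ.ordOf κ - cutL κ

namespace IsExp

variable {κ κ' : Option (Option (Fin τ.K))} {j j' : ℤ}

theorem ppart_eq_zero (h : IsExp τ κ j) (b : Branch τ W) (x : τ.V) :
    ppart (place x κ) (b.pw κ (-j) x) = 0 := by
  refine MeroFrob.ppart_eq_zero ((b.lExact_pw κ (-j) x).lOrd.mono ?_)
  rw [cut_place]; have := h.le; omega

theorem lift_eq (h : IsExp τ κ j) (b : Branch τ W) (x : τ.V) :
    lift x (place x κ) (b.pw κ (-j) x) = -(RatFunc.C (sgn (place x κ)) *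
      ppart (place x κ) (expand (place x κ) (derivP (lam x)) * b.pw κ (-j) x)) := by
  rw [lift, h.ppart_eq_zero b x]; ring

theorem metricV_eq (h : IsExp τ κ j) (b : Branch τ W) {x ξ : τ.V} (hx : x ∈ τ.domain)
    (hξ : xt x ξ = lift x (place x κ) (b.pw κ (-j) x)) (ζ : τ.V) :
    metricV x ξ ζ = b.cov κ j x ζ := by
  rw [metricV_lift hx (place_mem_gam x h.mem) hξ, sgn_place, Branch.cov]

theorem place_ne (h : IsExp τ κ j) (h' : IsExp τ κ' j') {x : τ.V} (hx : x ∈ τ.domain)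
    (hne : κ' ≠ κ) : place x κ' ≠ place x κ := by
  intro e
  refine hne ?_
  have hm := h.mem
  have hm' := h'.mem
  rcases κ with _ | k <;> rcases κ' with _ | k'
  · rfl
  · exact absurd e (OnePoint.coe_ne_infty _)
  · exact absurd e.symm (OnePoint.coe_ne_infty _)
  · exact congrArg some (pt_injOn hx (Finset.some_mem_insertNone.1 hm')
      (Finset.some_mem_insertNone.1 hm) (OnePoint.coe_injective e))

/-- For an admissible exponent λ^(-j/m) has no principal part, so its lift is, up to sign, a
principal part at κ alone. At any other place it has no residue against a power that has no
principal part there. -/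
theorem cov_lift_of_ne (h : IsExp τ κ j) (h' : IsExp τ κ' j') (b : Branch τ W) {x ξ : τ.V}
    (hx : x ∈ τ.domain) (hξ : xt x ξ = lift x (place x κ) (b.pw κ (-j) x)) (hne : κ' ≠ κ) :
    b.cov κ' j' x ξ = 0 := by
  have h1 : LOrd (cut (place x κ')) (b.pw κ' (-j') x) := by
    refine (b.lExact_pw κ' (-j') x).lOrd.mono ?_
    rw [cut_place]; have := h'.le; omega
  have h2 : LOrd (cut (place x κ')) (expand (place x κ') (xt x ξ)) := by
    rw [hξ, h.lift_eq b x, expand_neg]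
    exact (lOrd_C_mul _ (lOrd_ppart (h.place_ne h' hx hne) _)).neg
  rw [Branch.cov, res_mul_eq_zero h1 h2, mul_zero]

/-- The lift is minus the principal part of λ_p λ^(-j/m), up to the sign of the place. Against
λ^(-j'/m), which has no principal part, it may be replaced by the full series. -/
theorem cov_lift_self (h : IsExp τ κ j) (h' : IsExp τ κ j') (b : Branch τ W) {x ξ : τ.V} (hx : x ∈ W)
    (hξ : xt x ξ = lift x (place x κ) (b.pw κ (-j) x)) :
    b.cov κ j' x ξ = -res (place x κ) (b.pw κ (-(j + j')) x *
      expand (place x κ) (derivP (lam x))) := by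
  have h1 : LOrd (cut (place x κ)) (b.pw κ (-j') x) := by
    refine (b.lExact_pw κ (-j') x).lOrd.mono ?_
    rw [cut_place]; have := h'.le; omega
  have h2 := lOrd_sub_ppart (place x κ) (expand (place x κ) (derivP (lam x)) * b.pw κ (-j) x)
  have h3 := res_mul_eq_zero h1 h2
  rw [mul_sub, map_sub, sub_eq_zero] at h3
  have h4 : b.pw κ (-(j + j')) x = b.pw κ (-j') x * b.pw κ (-j) x := by
    rw [← b.pw_add h.mem hx]; congr 1; ring
  have h5 (z : ℂ) (F G : LaurentSeries ℂ) : F * -(HahnSeries.C z * G) =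
      -(HahnSeries.C z * (F * G)) := by ring
  rw [Branch.cov, hξ, h.lift_eq b x, expand_neg, expand_mul, expand_C, sgn_place, h5, map_neg,
    res_C_mul, mul_neg, ← mul_assoc, sg_mul_self, one_mul, ← h3, h4]
  congr 2; ring

/-- Unless j + j' = m the integrand is the derivative of a power of λ up to a nonzero factor. If j +
j' = m it is λ_p/λ, whose residue is minus the pole order of λ. -/
theorem res_pw_mul_derivP (h : IsExp τ κ j) (h' : IsExp τ κ j') (b : Branch τ W)
    (hWd : W ⊆ τ.domain) {x : τ.V} (hx : x ∈ W) : -res (place x κ) (b.pw κ (-(j + j')) x *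
      expand (place x κ) (derivP (lam x))) = if j + j' = τ.ordOf κ then (τ.ordOf κ : ℂ) else 0 := by
  have h0 := ordOf_ne_zero h.mem
  split_ifs with hj
  · have h1 : b.pw κ (-(j + j')) x * expand (place x κ) (derivP (lam x)) =
        expand (place x κ) (rho x) := by
      rw [derivP_lam, expand_mul, ← b.pw_self hWd h.mem hx, ← mul_assoc, ← b.pw_add h.mem hx, hj,
        neg_add_cancel, b.pw_zero h.mem hx, one_mul]
    rw [h1]
    have hm := h.mem
    rcases κ with _ | k
    · exact (congrArg Neg.neg (res_infty _)).trans ((neg_neg _).trans (coeff_rho_infty x))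
    · rw [place_some, res_coe, coeff_rho_pt (hWd hx) (Finset.some_mem_insertNone.1 hm), neg_neg]
      rfl
  · have h1 := res_der (place x κ) (b.pw κ (τ.ordOf κ - (j + j')) x)
    rw [b.der_pw hWd h.mem hx, mul_assoc, res_C_mul, mul_eq_zero,
      show τ.ordOf κ - (j + j') - τ.ordOf κ = -(j + j') by ring] at h1
    rw [h1.resolve_left, neg_zero]
    refine div_ne_zero ?_ (by exact_mod_cast h0)
    exact_mod_cast sub_ne_zero.2 (Ne.symm hj)

end IsExp

/-! ### Separation of tangent vectors -/

/-- The covectors are triangular with respect to the order at the place: once the lower coefficients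
of the tangent vector are known to vanish, pairing with the next power of λ extracts the next
coefficient. Starting from the pole bound, the order is raised one step at a time. -/
theorem lOrd_of_cov (b : Branch τ W) (hWd : W ⊆ τ.domain) {x ξ : τ.V} (hx : x ∈ W)
    {κ : Option (Option (Fin τ.K))} (hκ : κ ∈ τ.places)
    {j₀ : ℤ} (hj₀ : cutL κ ≤ j₀) (h : ∀ j, IsExp τ κ j → j₀ ≤ j → b.cov κ j x ξ = 0) :
    LOrd (2 * cutL κ - j₀) (expand (place x κ) (xt x ξ)) := by
  have hc := cutL_cases κ
  have key (i : ℕ) : LOrd (min (2 * cutL κ - j₀) (-τ.ordOf κ - 1 + 3 * cutL κ + i))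
      (expand (place x κ) (xt x ξ)) := by
    induction i with
    | zero =>
      refine (lOrd_xt_place (hWd hx) ξ hκ).mono ?_
      rw [cut_place]; push_cast; omega
    | succ i ih =>
      by_cases hi : 2 * cutL κ - j₀ ≤ -τ.ordOf κ - 1 + 3 * cutL κ + i
      · exact ih.mono (by push_cast; omega)
      -- With this exponent the leading coefficient of the power meets the first unknown coefficient
      -- of the tangent vector at the index of the residue.
      · have h1 := h (τ.ordOf κ - cutL κ - i) ⟨hκ, by omega, by omega⟩ (by omega)
        rw [min_eq_right (by omega)] at ih
        have h2 := (b.lExact_pw κ (-(τ.ordOf κ - cutL κ - i)) x)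
        have h3 := h2.lOrd.coeff_mul_add ih
        rw [Branch.cov, mul_eq_zero] at h1
        have h4 := h1.resolve_left fun e => by
          have := sg_mul_self κ; rw [e] at this; simp at this
        rw [res] at h4
        have h5 := (mul_eq_zero.1 h4).resolve_left fun e => by
          have := sgn_mul_self (place x κ); rw [e] at this; simp at this
        rw [cut_place, show 2 * cutL κ - 1 = -(-(τ.ordOf κ - cutL κ - i)) +
          (-τ.ordOf κ - 1 + 3 * cutL κ + i) by ring, h3] at h5
        have h6 := (mul_eq_zero.1 h5).resolve_left h2.coeff_ne_zero
        rw [lOrd_iff] at ih ⊢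
        intro d hd
        by_cases hd' : d < -τ.ordOf κ - 1 + 3 * cutL κ + i
        · exact ih d hd'
        · rw [← h6]; congr 1; push_cast at hd; omega
  -- After m + 1 steps the minimum is the desired bound. At a simple zero of λ, where m = -1, no
  -- step is needed, in accordance with the absence of flat coordinates there.
  exact (key (τ.ordOf κ + 1).toNat).mono (by omega)

/-- If all the covectors vanish, the tangent vector divided by p^s has no poles and vanishes at ∞.
-/
theorem eq_zero_of_cov (b : Branch τ W) (hWd : W ⊆ τ.domain) {x ξ : τ.V} (hx : x ∈ W)
    (h : ∀ κ j, IsExp τ κ j → b.cov κ j x ξ = 0) : ξ = 0 := by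
  refine eq_zero_of_xt_eq_zero (hWd hx) (eq_zero_of_forall_lOrd fun μ => ?_)
  by_cases hμ : μ ∈ gam x
  · rcases mem_gam.1 hμ with rfl | ⟨k, hk, rfl⟩
    · exact lOrd_of_cov b hWd hx (κ := none) Finset.none_mem_insertNone (j₀ := 1) le_rfl
        fun j hj _ => h _ j hj
    · exact lOrd_of_cov b hWd hx (κ := some k) (Finset.some_mem_insertNone.2 hk) (j₀ := 0) le_rfl
        fun j hj _ => h _ j hj
  · exact (inR_xt (hWd hx) ξ).lOrd_cut hμ

/-! ### The indices of the flat coordinates -/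

/-- The marked point of a flat coordinate. -/
def idxPlace : τ.FlatIdx → Option (Option (Fin τ.K))
  | Sum.inl _ => none
  | Sum.inr q => some q.1.1

/-- The exponent of a flat coordinate. -/
def idxExp : τ.FlatIdx → ℤ
  | Sum.inl i => i.1
  | Sum.inr q => q.1.2

/-- The index dual to that of a flat coordinate. -/
def idxDual : τ.FlatIdx → τ.FlatIdx
  | Sum.inl i => Sum.inl ⟨τ.n - i.1, by have := i.2; omega⟩
  | Sum.inr q => Sum.inr ⟨(q.1.1, τ.ord q.1.1 - q.1.2), q.2.1, by have := q.2; dsimp only; omega,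
      by have := q.2; dsimp only; omega⟩

theorem isExp_idx (A : τ.FlatIdx) : IsExp τ (idxPlace A) (idxExp A) := by
  rcases A with i | q
  · exact ⟨Finset.none_mem_insertNone, i.2.1, i.2.2⟩
  · exact ⟨Finset.some_mem_insertNone.2 q.2.1, q.2.2.1, by
      have := q.2.2.2; simpa [idxPlace, idxExp, ordOf, cutL] using this⟩

theorem exists_idx {κ : Option (Option (Fin τ.K))} {j : ℤ} (h : IsExp τ κ j) :
    ∃ A : τ.FlatIdx, idxPlace A = κ ∧ idxExp A = j := by
  rcases κ with _ | k
  · exact ⟨Sum.inl ⟨j, h.le, h.ge⟩, rfl, rfl⟩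
  · exact ⟨Sum.inr ⟨(k, j), Finset.some_mem_insertNone.1 h.mem, h.le, by
      have := h.ge; simpa [ordOf, cutL] using this⟩, rfl, rfl⟩

theorem idx_ext {A B : τ.FlatIdx} (h : idxPlace A = idxPlace B) (h' : idxExp A = idxExp B) :
    A = B := by
  rcases A with i | q <;> rcases B with i' | q'
  · exact congrArg Sum.inl (Subtype.ext h')
  · exact absurd h (by simp [idxPlace])
  · exact absurd h (by simp [idxPlace])
  · exact congrArg Sum.inr (Subtype.ext (Prod.ext (Option.some.inj h) h'))

theorem idxPlace_dual (A : τ.FlatIdx) : idxPlace (idxDual A) = idxPlace A := by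
  rcases A with i | q <;> rfl

theorem idxExp_dual (A : τ.FlatIdx) : idxExp (idxDual A) = τ.ordOf (idxPlace A) - idxExp A := by
  rcases A with i | q <;> rfl

theorem idxDual_dual (A : τ.FlatIdx) : idxDual (idxDual A) = A :=
  idx_ext (by rw [idxPlace_dual, idxPlace_dual]) (by
    rw [idxExp_dual, idxExp_dual, idxPlace_dual]; ring)

variable (τ) in
/-- The indices of the flat coordinates at the finite marked points. -/
def finIdx : Finset (Option (Fin τ.K) × ℤ) :=
  (τ.marked.sigma fun k => Finset.Icc 0 (τ.ord k)).map
    (Equiv.sigmaEquivProd (Option (Fin τ.K)) ℤ).toEmbedding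

theorem mem_finIdx {q : Option (Fin τ.K) × ℤ} :
    q ∈ τ.finIdx ↔ q.1 ∈ τ.marked ∧ 0 ≤ q.2 ∧ q.2 ≤ τ.ord q.1 := by
  rw [finIdx, Finset.mem_map_equiv, Finset.mem_sigma, Finset.mem_Icc]; rfl

instance : Fintype {q : Option (Fin τ.K) × ℤ // q.1 ∈ τ.marked ∧ 0 ≤ q.2 ∧ q.2 ≤ τ.ord q.1} :=
  Fintype.subtype τ.finIdx fun _ => mem_finIdx

instance : Fintype {i : ℤ // 1 ≤ i ∧ i ≤ τ.n - 1} :=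
  Fintype.subtype (Finset.Icc 1 (τ.n - 1)) fun _ => Finset.mem_Icc

theorem sum_flatIdx {M : Type*} [AddCommMonoid M] (f : ℤ → M) (g : Option (Fin τ.K) → ℤ → M) :
    ∑ A : τ.FlatIdx, Sum.elim (fun i => f i.1) (fun q => g q.1.1 q.1.2) A =
      ∑ i ∈ Finset.Icc 1 (τ.n - 1), f i + ∑ k ∈ τ.marked, ∑ j ∈ Finset.Icc 0 (τ.ord k), g k j := by
  rw [Fintype.sum_sum_type]
  simp only [Sum.elim_inl, Sum.elim_inr]
  rw [← Finset.sum_subtype (Finset.Icc 1 (τ.n - 1)) (fun _ => Finset.mem_Icc) f,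
    ← Finset.sum_subtype τ.finIdx (fun _ => mem_finIdx) fun q => g q.1 q.2, finIdx, Finset.sum_map,
    Finset.sum_sigma]
  rfl

end MeroType

end MeroFrob
end

/-! ### The unit field, assembly of the Frobenius structure, and flatness of the unit. -/

noncomputable section

namespace MeroFrob

open scoped OnePoint

set_option linter.unusedSectionVars false

/-! ### The unit field in flat coordinates -/

namespace FlatData

variable {V : Type*} [NormedAddCommGroup V] [NormedSpace ℂ V] [FiniteDimensional ℂ V]
  {D : FrobeniusData V} {W : Set V} {d κ : ℂ} {I : Type*} [Fintype I] {t H : I → V → ℂ}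
  {w dg : I → ℂ} {star : I → I}

theorem fderiv_nablaVec (h : FlatData D W d κ t H w dg star) {A : V → V}
    (hA : ContDiffOn ℂ (⊤ : ℕ∞) A W) {x : V} (hx : x ∈ W) (i : I) (X : V) :
    fderiv ℂ (t i) x (D.nablaVec A x X) = fderiv ℂ (fun y => fderiv ℂ (t i) y (A y)) x X := by
  rw [fderiv_fderiv_apply h.isOpen (h.smooth_t i) hx (smooth_diff h.isOpen hA hx), h.hess_t x hx,
    FrobeniusData.nablaVec, map_add, add_comm]

/-- This is [E, e] = -e, obtained by applying the weight-one property of the product to e * e and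
differentiating the unit law along E. -/
theorem fderiv_unit_euler (h : FlatData D W d κ t H w dg star)
    (he : ContDiffOn ℂ (⊤ : ℕ∞) D.e W) (hu : ∀ x ∈ W, ∀ X, D.mul x (D.e x) X = X) {x : V}
    (hx : x ∈ W) : fderiv ℂ D.e x (κ • x) = (κ - 1) • D.e x := by
  have hm : DifferentiableAt ℂ (fun y => D.mul y) x := smooth_diff h.isOpen h.smooth_mul hx
  have hd := smooth_diff h.isOpen he hx
  have h1 : fderiv ℂ (fun y => D.mul y) x (κ • x) (D.e x) (D.e x)
      + D.mul x (fderiv ℂ D.e x (κ • x)) (D.e x) = 0 := by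
    have h2 := DFunLike.congr_fun (fderiv_congr_on h.isOpen (fun y hy => hu y hy (D.e x)) hx) (κ • x)
    rw [fderiv_clm_apply (hm.clm_apply hd) (differentiableAt_const _), fderiv_clm_apply hm hd] at h2
    simpa [add_comm] using h2
  have h2 : fderiv ℂ (fun y => D.mul y (D.e x) (D.e x)) x (κ • x) =
      fderiv ℂ (fun y => D.mul y) x (κ • x) (D.e x) (D.e x) := by
    rw [fderiv_clm_apply (hm.clm_apply (differentiableAt_const _)) (differentiableAt_const _),
      fderiv_clm_apply hm (differentiableAt_const _)]
    simp
  have h3 := h.euler_mul hx (D.e x) (D.e x)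
  simp only [FrobeniusData.lieMul, h.fderiv_E, h.E_apply, map_smul (D.mul x), map_smul, smul_apply,
    hu x hx] at h3
  rw [← map_smul, h2] at h3
  rw [h.mul_comm x hx _ (D.e x), hu x hx] at h1
  linear_combination (norm := module) h1 - h3

/-- For flat e, comparing ∇_E e = 0 with [E, e] = -e in a flat coordinate shows that e has
components only in the coordinates of degree 1. -/
theorem unit_component (h : FlatData D W d κ t H w dg star)
    (he : ContDiffOn ℂ (⊤ : ℕ∞) D.e W) (hu : ∀ x ∈ W, ∀ X, D.mul x (D.e x) X = X)
    {x : V} (hx : x ∈ W) (hf : ∀ X, D.nablaVec D.e x X = 0) (i : I) :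
    (dg i - 1) * fderiv ℂ (t i) x (D.e x) = 0 := by
  have h1 := congrArg (fderiv ℂ (t i) x) (hf (κ • x))
  rw [FrobeniusData.nablaVec, h.fderiv_unit_euler he hu hx, map_add, ← h.hess_t x hx, h.dd_t_E hx,
    map_smul, map_zero, smul_eq_mul] at h1
  linear_combination h1

end FlatData

namespace MeroType

variable {τ : MeroType} {W : Set τ.V}

/-! ### The unit -/

open Classical in
/-- The coefficient of `λ_p` in the unit. -/
def unitCoeff (x : τ.V) : ℂ :=
  if τ.s = 0 ∧ τ.n = 1 then 1
  else if τ.Exceptional then ((expand ((0 : ℂ) : OnePoint ℂ) (lam x)).coeff 1)⁻¹ else 0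

theorem unitFun_eq (x : τ.V) : unitFun x = 1 - RatFunc.C (unitCoeff x) * derivP (lam x) := by
  rw [unitFun, unitCoeff]
  split_ifs
  · rw [map_one, one_mul]
  · rfl
  · rw [map_zero, zero_mul, sub_zero]

theorem lOrd_one_sub_of_coeff {F : LaurentSeries ℂ} (h : LOrd 0 F) (h' : F.coeff 0 = 1) :
    LOrd 1 (1 - F) := by
  have h1 := lOrd_iff.1 (lOrd_one.sub h)
  rw [lOrd_iff]
  intro d hd
  by_cases hd' : d < 0
  · exact h1 d hd'
  · obtain rfl : d = 0 := by omega
    simp [h']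

theorem coeff_derivP_lam_infty (x : τ.V) : (expand ∞ (derivP (lam x))).coeff (1 - τ.n) = τ.n := by
  rw [derivP_lam, expand_mul, show (1 - τ.n : ℤ) = -τ.n + 1 by ring,
    (monic_lam_infty x).1.lOrd.coeff_mul_add (lExact_rho_infty x).lOrd, (monic_lam_infty x).2,
    coeff_rho_infty, one_mul]

theorem lam_coeff_one_ne_zero (hτ : τ.Exceptional) {x : τ.V} (hx : x ∈ τ.domain) :
    (expand ((0 : ℂ) : OnePoint ℂ) (lam x)).coeff 1 ≠ 0 := by
  have h := (lOrd_lam_pt hx (none_mem_marked.2 hτ.1)).coeff_ne_zero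
  have e : -τ.ord none = 1 := by rw [ord, hτ.2]; rfl
  rwa [e] at h

/-- The function 1 meets the bounds except in two cases: at ∞ when s = 0 and n = 1, where vanishing
is required, and at 0 when s = 1 and m₀ = -1, where 1/p is not allowed. In each case λ_p is a unit
at that point, and subtracting 1 normalised by its value removes the constant term without spoiling
the bounds elsewhere. -/
theorem inT_unit {x : τ.V} (hx : x ∈ τ.domain) : InT x (ps τ * unitFun x) := by
  have hR : InR x (ps τ * unitFun x) := by
    rw [unitFun_eq]
    exact (inR_ps x).mul ((inR_one x).sub ((inR_C x _).mul (inR_lam hx).derivP))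
  have hn := τ.n_pos'
  intro μ
  by_cases hμ : μ ∈ gam x
  · have hl : LOrd (lb x μ) (expand μ (RatFunc.C (unitCoeff x) * derivP (lam x))) :=
      lOrd_C_mul _ (lOrd_derivP_lam hx μ)
    have h1 : LOrd 0 (expand μ 1) := by rw [expand_one]; exact lOrd_one
    rcases mem_gam.1 hμ with rfl | ⟨k, hk, rfl⟩
    · rw [lb_infty] at hl ⊢
      rw [expand_mul, unitFun_eq]
      rw [cut_infty]
      rcases τ.s_eq with hs | hs
      · by_cases hn1 : τ.n = 1
        · have e : unitCoeff x = 1 := by rw [unitCoeff, if_pos ⟨hs, hn1⟩]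
          rw [e, map_one, one_mul, expand_sub, expand_one]
          have h2 := coeff_derivP_lam_infty x
          have h3 := lOrd_derivP_lam hx ∞
          rw [lb_infty, hn1, sub_self] at h3
          rw [hn1, sub_self, Int.cast_one] at h2
          have h4 := (lOrd_ps_infty (τ := τ)).mul (lOrd_one_sub_of_coeff h3 h2)
          exact h4.mono (by rw [hs, hn1]; norm_num)
        · have e : unitCoeff x = 0 := by
            rw [unitCoeff, if_neg fun h => hn1 h.2, if_neg]
            rintro ⟨h, -⟩; omega
          rw [e, map_zero, zero_mul, sub_zero]
          exact (lOrd_ps_infty.mul h1).mono (by omega)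
      · rw [expand_sub]
        refine (lOrd_ps_infty.mul ((h1.mono ?_).sub hl)).mono ?_ <;> omega
    · have hlb := lb_pt hx hk
      have hord := neg_one_le_ord k
      rw [hlb] at hl ⊢
      rw [expand_mul, unitFun_eq, cut_coe, add_zero]
      rcases k with _ | k
      · have hs := none_mem_marked.1 hk
        have h2 := lOrd_ps_zero (τ := τ)
        by_cases hτ : τ.Exceptional
        · have e : unitCoeff x = ((expand ((0 : ℂ) : OnePoint ℂ) (lam x)).coeff 1)⁻¹ := by
            rw [unitCoeff, if_neg, if_pos hτ]
            rintro ⟨h, -⟩; omega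
          have e2 : τ.ord none = -1 := hτ.2
          have h3 : LOrd 0 (expand ((0 : ℂ) : OnePoint ℂ)
              (RatFunc.C (unitCoeff x) * derivP (lam x))) := hl.mono (by rw [e2]; norm_num)
          have h4 : (expand ((0 : ℂ) : OnePoint ℂ)
              (RatFunc.C (unitCoeff x) * derivP (lam x))).coeff 0 = 1 := by
            rw [expand_mul, expand_C, expand_derivP, HahnSeries.C_apply, coeff_single_mul',
              der_coe_coeff, e]
            simpa using inv_mul_cancel₀ (lam_coeff_one_ne_zero hτ hx)
          rw [expand_sub, expand_one]
          exact (h2.mul (lOrd_one_sub_of_coeff h3 h4)).mono (by rw [e2, hs]; norm_num)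
        · have e : unitCoeff x = 0 := by
            rw [unitCoeff, if_neg, if_neg hτ]
            rintro ⟨h, -⟩; omega
          have h0 : 0 ≤ τ.ord none := by
            rcases τ.s_cases with ⟨h, -⟩ | ⟨-, h | h⟩
            · omega
            · change 0 ≤ τ.m₀; omega
            · exact absurd ⟨hs, h⟩ hτ
          rw [e, map_zero, zero_mul, sub_zero]
          exact (h2.mul h1).mono (by rw [hs]; push_cast; omega)
      · have h2 : LOrd 0 (expand (pt x (some k) : OnePoint ℂ) (ps τ)) :=
          lOrd_ps_coe fun hs => (hx.2.2.2 hs).2 k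
        rw [expand_sub]
        refine (h2.mul ((h1.mono ?_).sub hl)).mono ?_ <;> omega
  · refine (hR μ hμ).mono ?_
    rw [lb_of_notMem hμ]
    induction μ using OnePoint.rec with
    | infty => exact absurd (infty_mem_gam x) hμ
    | coe μ => simp

open Classical in
/-- The unit vector field. -/
def unitV (x : τ.V) : τ.V := if hx : x ∈ τ.domain then (exists_xt_eq hx (inT_unit hx)).choose else 0

theorem xt_unitV {x : τ.V} (hx : x ∈ τ.domain) : xt x (unitV x) = ps τ * unitFun x := by
  rw [unitV, dif_pos hx]; exact (exists_xt_eq hx (inT_unit hx)).choose_spec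

theorem tangent_unitV {x : τ.V} (hx : x ∈ τ.domain) : tangent x (unitV x) = unitFun x := by
  rw [tangent_eq_xt, xt_unitV hx, ← mul_assoc, mul_comm (RatFunc.X ^ τ.s), ps_mul_X_pow, one_mul]

/-- The function differs from 1 by a constant multiple of λ_p, so it acts as 1 modulo λ_p R. -/
theorem unitV_mul {x : τ.V} (hx : x ∈ τ.domain) (ξ : τ.V) : mulV x (unitV x) ξ = ξ := by
  refine mulV_unique hx (((inR_C x (-unitCoeff x)).mul (inR_xt hx ξ))) ?_
  rw [← tangent_eq_xt, tangent_unitV hx, unitFun_eq, map_neg]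
  ring

/-- The Frobenius structure. -/
def frobData (τ : MeroType) : FrobeniusData τ.V where
  η := metricV
  mul := mulV
  e := unitV
  E := fun x => (1 / (τ.n : ℂ)) • x
  Γ := connV

/-! ### The flat coordinates of the Frobenius structure -/

/-- The second primitives `H_{(1)}`. -/
def hCoord (b : Branch τ W) : τ.FlatIdx → τ.V → ℂ
  | Sum.inl i => hInf i.1
  | Sum.inr q => hFin b q.1.1 q.1.2

theorem exists_flatPot (b : Branch τ W) (hW : IsOpen W) (hWd : W ⊆ τ.domain) (A : τ.FlatIdx) :
    ∃ k c G G₀ G₁, FlatPot b (idxPlace A) (idxExp A) (flatCoord b A) (hCoord b A) k c G G₀ G₁ := by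
  have h := isExp_idx A
  rcases A with i | ⟨⟨k, j⟩, hk, hj, hj'⟩
  · have hi := i.2
    exact ⟨_, _, _, _, _, flatPot_power b hW hWd h.mem h.le (by change i.1 < τ.n; omega)
      (fun x _ => rfl) fun x _ => rfl⟩
  · by_cases e : j = τ.ord k
    · subst e
      exact ⟨_, _, _, _, _, flatPot_log b hW hWd hk hj (fun x _ => if_pos rfl)
        fun x _ => if_pos rfl⟩
    · exact ⟨_, _, _, _, _, flatPot_power b hW hWd h.mem h.le
        (by change j < τ.ord k; dsimp only at hj'; omega) (fun x _ => if_neg e) fun x _ => if_neg e⟩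

variable (τ) in
theorem d_eq : 2 - τ.d = 1 + 2 * ((1 - (τ.s : ℂ)) / τ.n) := by rw [d]; ring

/-- The degree of a flat coordinate. -/
def degree (A : τ.FlatIdx) : ℂ :=
  1 - (idxExp A : ℂ) / τ.ordOf (idxPlace A) + (1 - (τ.s : ℂ)) / τ.n

theorem degree_add_degree (A : τ.FlatIdx) : degree A + degree (idxDual A) = 2 - τ.d := by
  have h : (τ.ordOf (idxPlace A) : ℂ) ≠ 0 := by exact_mod_cast ordOf_ne_zero (isExp_idx A).mem
  rw [d_eq, degree, degree, idxPlace_dual, idxExp_dual, Int.cast_sub, sub_div (τ.ordOf _ : ℂ),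
    div_self h]
  ring

theorem fderiv_flatCoord (b : Branch τ W) (hW : IsOpen W) (hWd : W ⊆ τ.domain) (A : τ.FlatIdx)
    {x : τ.V} (hx : x ∈ W) (ξ : τ.V) :
    fderiv ℂ (flatCoord b A) x ξ = b.cov (idxPlace A) (idxExp A) x ξ := by
  obtain ⟨k, c, G, G₀, G₁, h⟩ := exists_flatPot b hW hWd A
  exact h.fderiv_t hW hWd hx ξ

open Classical in
/-- The vectors dual to the differentials of the flat coordinates with respect to the metric form,
up to scaling, the dual basis. -/
theorem exists_dual (b : Branch τ W) (hW : IsOpen W) (hWd : W ⊆ τ.domain) (A : τ.FlatIdx)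
    {x : τ.V} (hx : x ∈ W) : ∃ v : τ.V, (∀ ζ, metricV x v ζ = fderiv ℂ (flatCoord b A) x ζ) ∧
      ∀ B, fderiv ℂ (flatCoord b B) x v =
        if B = idxDual A then (τ.ordOf (idxPlace A) : ℂ) else 0 := by
  have h := isExp_idx A
  obtain ⟨v, hv⟩ := exists_xt_eq (hWd hx)
    (inT_lift (hWd hx) (place x (idxPlace A)) (b.pw (idxPlace A) (-idxExp A) x))
  refine ⟨v, fun ζ => ?_, fun B => ?_⟩
  · rw [h.metricV_eq b (hWd hx) hv, fderiv_flatCoord b hW hWd A hx]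
  · have h' := isExp_idx B
    rw [fderiv_flatCoord b hW hWd B hx]
    by_cases hp : idxPlace B = idxPlace A
    · rw [hp] at h' ⊢
      rw [h.cov_lift_self h' b hx hv, h.res_pw_mul_derivP h' b hWd hx]
      refine if_congr ⟨fun e => ?_, ?_⟩ rfl rfl
      · exact idx_ext (by rw [hp, idxPlace_dual]) (by rw [idxExp_dual, ← e]; ring)
      · rintro rfl; rw [idxExp_dual]; ring
    · rw [h.cov_lift_of_ne h' b (hWd hx) hv hp, if_neg]
      rintro rfl; exact hp (idxPlace_dual A)

theorem flatCoord_separates (b : Branch τ W) (hW : IsOpen W) (hWd : W ⊆ τ.domain) {x : τ.V}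
    (hx : x ∈ W) {ξ : τ.V} (h : ∀ A, fderiv ℂ (flatCoord b A) x ξ = 0) : ξ = 0 :=
  eq_zero_of_cov b hWd hx fun κ j hj => by
    obtain ⟨A, rfl, rfl⟩ := exists_idx hj
    rw [← fderiv_flatCoord b hW hWd A hx, h A]

/-- The metric duals of the dt are, up to weights, the basis dual to the dt with indices exchanged
by duality; expanding the first vector in that basis gives the formula. -/
theorem metricV_eq_sum (b : Branch τ W) (hW : IsOpen W) (hWd : W ⊆ τ.domain) {x : τ.V}
    (hx : x ∈ W) (ξ ζ : τ.V) : metricV x ξ ζ = ∑ A, (τ.ordOf (idxPlace A) : ℂ)⁻¹ *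
      fderiv ℂ (flatCoord b A) x ξ * fderiv ℂ (flatCoord b (idxDual A)) x ζ := by
  classical
  choose v hv hv' using fun A => exists_dual b hW hWd A hx
  have h1 : ξ = ∑ A, ((τ.ordOf (idxPlace A) : ℂ)⁻¹ * fderiv ℂ (flatCoord b A) x ξ) •
      v (idxDual A) := by
    rw [← sub_eq_zero]
    refine flatCoord_separates b hW hWd hx fun B => ?_
    rw [map_sub, map_sum, Finset.sum_eq_single B]
    · have h : (τ.ordOf (idxPlace B) : ℂ) ≠ 0 := by
        exact_mod_cast ordOf_ne_zero (isExp_idx B).mem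
      rw [map_smul, hv', idxDual_dual, if_pos rfl, idxPlace_dual, smul_eq_mul]
      field_simp
      ring
    · intro A _ hA
      rw [map_smul, hv', idxDual_dual, if_neg hA.symm, smul_zero]
    · simp
  conv_lhs => rw [h1]
  rw [map_sum, sum_apply]
  refine Finset.sum_congr rfl fun A _ => ?_
  rw [map_smul, smul_apply, hv, smul_eq_mul]

/-- The Frobenius structure in its flat coordinates. -/
theorem flatData (b : Branch τ W) (hW : IsOpen W) (hWd : W ⊆ τ.domain) :
    FlatData (frobData τ) W τ.d (1 / (τ.n : ℂ)) (flatCoord b) (hCoord b)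
      (fun A => (τ.ordOf (idxPlace A) : ℂ)) degree idxDual := by
  classical
  have hw (A : τ.FlatIdx) : (τ.ordOf (idxPlace A) : ℂ) ≠ 0 := by
    exact_mod_cast ordOf_ne_zero (isExp_idx A).mem
  have hp := exists_flatPot b hW hWd
  refine
    { isOpen := hW
      smooth_t := fun A => ?_
      smooth_H := fun A => ?_
      star_star := idxDual_dual
      w_star := fun A => by rw [idxPlace_dual]
      exists_frame := fun x hx A => ?_
      separates := fun x hx X h => flatCoord_separates b hW hWd hx h
      metric := fun x hx X Y => metricV_eq_sum b hW hWd hx X Y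
      Γ_symm := fun x hx X Y => connV_symm (hWd hx) X Y
      hess_t := fun x hx A X Y => ?_
      hess_H := fun x hx A X Y => ?_
      mul_comm := fun x hx X Y => mulV_comm (hWd hx) X Y
      invariant := fun x hx X Y Z => metricV_invariant (hWd hx) X Y Z
      euler := rfl
      euler_t := fun A => ?_
      euler_H := fun A => ?_
      dg_star := degree_add_degree }
  · obtain ⟨k, c, G, G₀, G₁, h⟩ := hp A; exact (h.smooth_and_fderiv_t hW hWd).1
  · obtain ⟨k, c, G, G₀, G₁, h⟩ := hp A; exact h.smooth_H
  · obtain ⟨v, -, hv⟩ := exists_dual b hW hWd (idxDual A) hx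
    rw [idxDual_dual] at hv
    refine ⟨(τ.ordOf (idxPlace (idxDual A)) : ℂ)⁻¹ • v, ?_, fun B hB => ?_⟩
    · rw [map_smul, hv, if_pos rfl, smul_eq_mul, inv_mul_cancel₀ (hw _)]
    · rw [map_smul, hv, if_neg hB, smul_zero]
  · obtain ⟨k, c, G, G₀, G₁, h⟩ := hp A; exact h.hess_t hW hWd hx X Y
  · obtain ⟨k, c, G, G₀, G₁, h⟩ := hp A; exact h.hess_H hW hWd hx X Y
  · obtain ⟨k, c, G, G₀, G₁, h⟩ := hp A; exact h.fderiv_t_euler hW hWd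
  · obtain ⟨k, c, G, G₀, G₁, h⟩ := hp A; exact h.fderiv_H_euler

variable (τ) in
theorem three_sub_d_ne_zero : 3 - τ.d ≠ 0 := by
  have hn := τ.n_pos'
  have h0 : (τ.n : ℂ) ≠ 0 := by exact_mod_cast (by omega : τ.n ≠ 0)
  -- Both factors of the numerator 2(n + 1 - s) are positive, since n ≥ 1 and s ≤ 1.
  have e : 3 - τ.d = ((2 * (τ.n + (1 - τ.s)) : ℤ) : ℂ) / τ.n := by
    rw [d]; push_cast; field_simp; ring
  rw [e]
  refine div_ne_zero (Int.cast_ne_zero.2 ?_) h0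
  rcases τ.s_eq with h | h <;> rw [h] <;> push_cast <;> omega

theorem prepotential_eq (b : Branch τ W) (x : τ.V) : prepotential b (frobData τ).E x =
    1 / (3 - τ.d) * ∑ A, (τ.ordOf (idxPlace A) : ℂ)⁻¹ *
      (fderiv ℂ (flatCoord b A) x ((frobData τ).E x) * hCoord b (idxDual A) x) := by
  have h := sum_flatIdx (τ := τ)
    (fun i => (τ.n : ℂ)⁻¹ * (fderiv ℂ (tInf i) x ((frobData τ).E x) * hInf (τ.n - i) x))
    fun k j => (τ.ord k : ℂ)⁻¹ *
      (fderiv ℂ (tFin b k j) x ((frobData τ).E x) * hFin b k (τ.ord k - j) x)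
  rw [prepotential, one_div (τ.n : ℂ), Finset.mul_sum]
  simp only [one_div (τ.ord _ : ℂ), Finset.mul_sum (Finset.Icc _ _)]
  rw [← h]
  congr 1
  refine Finset.sum_congr rfl fun A _ => ?_
  rcases A with i | q <;> rfl

theorem isPrepotential (b : Branch τ W) (hW : IsOpen W) (hWd : W ⊆ τ.domain) :
    (frobData τ).IsPrepotential W (flatCoord b) (prepotential b (frobData τ).E) :=
  (flatData b hW hWd).isPrepotential (three_sub_d_ne_zero τ) fun x _ => prepotential_eq b x

/-! ### Branches -/

variable (τ) in
theorem isOpen_domain : IsOpen τ.domain := by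
  have ha (i : Fin τ.L) : Continuous fun x : τ.V => a x i :=
    (continuous_apply i).comp (continuous_fst.comp continuous_subtype_val)
  have hv (j : Fin τ.K) : Continuous fun x : τ.V => v x j :=
    (continuous_apply j).comp (continuous_snd.comp continuous_subtype_val)
  have e : τ.domain = (⋂ i, ⋂ j, {x | i ≠ j → a x i ≠ a x j}) ∩
      ((⋂ i, ⋂ j, {x | i ≠ j → v x i ≠ v x j}) ∩ ((⋂ i, ⋂ j, {x | a x i ≠ v x j}) ∩
        ((⋂ i, {x | τ.s = 1 → a x i ≠ 0}) ∩ ⋂ j, {x | τ.s = 1 → v x j ≠ 0}))) := by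
    ext x
    simp only [domain, Function.Injective, Set.mem_inter_iff, Set.mem_iInter, Set.mem_ofPred_eq]
    constructor
    · rintro ⟨h1, h2, h3, h4⟩
      exact ⟨fun i j h e => h (h1 e), fun i j h e => h (h2 e), h3, fun i h => (h4 h).1 i,
        fun j h => (h4 h).2 j⟩
    · rintro ⟨h1, h2, h3, h4, h5⟩
      exact ⟨fun i j e => by_contra fun h => h1 i j h e, fun i j e => by_contra fun h => h2 i j h e,
        h3, fun h => ⟨fun i => h4 i h, fun j => h5 j h⟩⟩
  have himp {p : Prop} {f g : τ.V → ℂ} (hf : Continuous f) (hg : Continuous g) :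
      IsOpen {x | p → f x ≠ g x} := by
    by_cases hp : p
    · simpa [hp] using isOpen_ne_fun hf hg
    · simp [hp]
  rw [e]
  refine IsOpen.inter ?_ (IsOpen.inter ?_ (IsOpen.inter ?_ (IsOpen.inter ?_ ?_)))
  · exact isOpen_iInter_of_finite fun i => isOpen_iInter_of_finite fun j => himp (ha i) (ha j)
  · exact isOpen_iInter_of_finite fun i => isOpen_iInter_of_finite fun j => himp (hv i) (hv j)
  · exact isOpen_iInter_of_finite fun i => isOpen_iInter_of_finite fun j =>
      isOpen_ne_fun (ha i) (hv j)
  · exact isOpen_iInter_of_finite fun i => himp (ha i) continuous_const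
  · exact isOpen_iInter_of_finite fun i => himp (hv i) continuous_const

/-- Near x the quotient f/f(x) stays in the slit plane, where the principal logarithm is continuous.
-/
theorem exists_log {X : Type*} [TopologicalSpace X] {f : X → ℂ} {x : X}
    (hf : ∀ᶠ y in nhds x, ContinuousAt f y) (h0 : f x ≠ 0) :
    ∃ g : X → ℂ, ∀ᶠ y in nhds x, ContinuousAt g y ∧ Complex.exp (g y) = f y := by
  refine ⟨fun y => Complex.log (f y / f x) + Complex.log (f x), ?_⟩
  have h1 : ContinuousAt (fun y => f y / f x) x := (hf.self_of_nhds).div_const _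
  have h2 : ∀ᶠ y in nhds x, f y / f x ∈ Complex.slitPlane := h1.eventually_mem
    (Complex.isOpen_slitPlane.mem_nhds (by simp [h0]))
  filter_upwards [hf, h2] with y hy hy'
  refine ⟨((hy.div_const _).clog hy').add continuousAt_const, ?_⟩
  rw [Complex.exp_add, Complex.exp_log (Complex.slitPlane_ne_zero hy'), Complex.exp_log h0,
    div_mul_cancel₀ _ h0]

theorem exists_branch {x : τ.V} (hx : x ∈ τ.domain) : ∃ W : Set τ.V, IsOpen W ∧ x ∈ W ∧
    W ⊆ τ.domain ∧ Nonempty (Branch τ W) := by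
  have ho := isOpen_domain τ
  have hd : ∀ᶠ y in nhds x, y ∈ τ.domain := ho.mem_nhds hx
  have h1 (k : Option (Fin τ.K)) : ∃ g : τ.V → ℂ, k ∈ τ.marked → ∀ᶠ y in nhds x,
      ContinuousAt g y ∧ Complex.exp (g y) = lead y k := by
    by_cases hk : k ∈ τ.marked
    · have hs := (ratFam_lam ho subset_rfl (some k) (Finset.some_mem_insertNone.2 hk)).smooth
        (-τ.ord k)
      obtain ⟨g, hg⟩ := exists_log (f := fun y => lead y k) (x := x)
        (hd.mono fun y hy => (smooth_at ho hs hy).continuousAt) (lOrd_lam_pt hx hk).coeff_ne_zero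
      exact ⟨g, fun _ => hg⟩
    · exact ⟨0, fun h => absurd h hk⟩
  have h2 (j k : Option (Fin τ.K)) : ∃ g : τ.V → ℂ, j ∈ τ.marked → k ∈ τ.marked → j ≠ k →
      ∀ᶠ y in nhds x, ContinuousAt g y ∧ Complex.exp (g y) = pt y j - pt y k := by
    by_cases h : j ∈ τ.marked ∧ k ∈ τ.marked ∧ j ≠ k
    · have hs : Continuous fun y : τ.V => pt y j - pt y k :=
        (sptL (Sum.inr j)).continuous.sub (sptL (Sum.inr k)).continuous
      obtain ⟨g, hg⟩ := exists_log (f := fun y : τ.V => pt y j - pt y k) (x := x)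
        (Filter.Eventually.of_forall fun y => hs.continuousAt)
        (sub_ne_zero.2 fun e => h.2.2 (pt_injOn hx h.1 h.2.1 e))
      exact ⟨g, fun _ _ _ => hg⟩
    · exact ⟨0, fun a b c => absurd ⟨a, b, c⟩ h⟩
  choose g1 hg1 using h1
  choose g2 hg2 using h2
  have h3 : ∀ᶠ y in nhds x, y ∈ τ.domain ∧
      (∀ k, k ∈ τ.marked → ContinuousAt (g1 k) y ∧ Complex.exp (g1 k y) = lead y k) ∧
      ∀ j k, j ∈ τ.marked → k ∈ τ.marked → j ≠ k →
        ContinuousAt (g2 j k) y ∧ Complex.exp (g2 j k y) = pt y j - pt y k := by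
    refine hd.and (.and ?_ ?_)
    · refine Filter.eventually_all.2 fun k => ?_
      by_cases hk : k ∈ τ.marked
      · exact (hg1 k hk).mono fun y hy _ => hy
      · exact Filter.Eventually.of_forall fun y h => absurd h hk
    · refine Filter.eventually_all.2 fun j => Filter.eventually_all.2 fun k => ?_
      by_cases h : j ∈ τ.marked ∧ k ∈ τ.marked ∧ j ≠ k
      · exact (hg2 j k h.1 h.2.1 h.2.2).mono fun y hy _ _ _ => hy
      · exact Filter.Eventually.of_forall fun y a b c => absurd ⟨a, b, c⟩ h
  obtain ⟨W, hW, hWo, hxW⟩ := eventually_nhds_iff.1 h3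
  exact ⟨W, hWo, hxW, fun y hy => (hW y hy).1, ⟨
    { logLead := g1
      logDiff := g2
      continuous_logLead := fun k hk y hy => ((hW y hy).2.1 k hk).1.continuousWithinAt
      exp_logLead := fun k hk y hy => ((hW y hy).2.1 k hk).2
      continuous_logDiff := fun j hj k hk h y hy =>
        ((hW y hy).2.2 j k hj hk h).1.continuousWithinAt
      exp_logDiff := fun j hj k hk h y hy => ((hW y hy).2.2 j k hj hk h).2 }⟩⟩

/-! ### Flatness of the unit -/

namespace FlatPot

variable {b : Branch τ W} {κ : Option (Option (Fin τ.K))} {j : ℤ} {t H : τ.V → ℂ}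
  {k : Option (Fin τ.K)} {c : ℂ} {G G₀ G₁ : Option (Option (Fin τ.K)) → τ.V → LaurentSeries ℂ}

theorem fderiv_t_unit (h : FlatPot b κ j t H k c G G₀ G₁) (hW : IsOpen W) (hWd : W ⊆ τ.domain)
    {x : τ.V} (hx : x ∈ W) : fderiv ℂ t x (unitV x) =
      Phi (G₀ · x) x 1 - unitCoeff x * Phi (G₀ · x) x (derivP (lam x)) := by
  rw [(h.smooth_and_fderiv_t hW hWd).2 x hx, tangent_unitV (hWd hx), unitFun_eq, Phi_sub, Phi_C_mul]

/-- The differential is the functional of the derived family, which vanishes on tangent vectors; so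
the pairing of dt with the function 1 is locally constant. This yields flatness of the unit. -/
theorem smooth_Phi_one (h : FlatPot b κ j t H k c G G₀ G₁) (hW : IsOpen W) (hWd : W ⊆ τ.domain) :
    ContDiffOn ℂ (⊤ : ℕ∞) (fun x => Phi (G₀ · x) x 1) W ∧
      ∀ x ∈ W, ∀ ξ, fderiv ℂ (fun x => Phi (G₀ · x) x 1) x ξ = 0 := by
  have h1 := h.pot₀.fderiv_Phi hW hWd (RatFam.C 1) fun x _ => inR_C x 1
  rw [map_one] at h1
  exact ⟨h1.1, fun x hx ξ => by rw [h1.2 x hx, Phi_zero, one_mul, h.vanish x hx, add_zero]⟩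

/-- When s = 0 and n = 1 the additional term with λ_p is, after integration by parts, a functional
of the derivative of 1, hence zero. -/
theorem fderiv_t_unit_of_not_exceptional (h : FlatPot b κ j t H k c G G₀ G₁) (hW : IsOpen W)
    (hWd : W ⊆ τ.domain) (hτ : ¬τ.Exceptional) {x : τ.V} (hx : x ∈ W) :
    fderiv ℂ t x (unitV x) = Phi (G₀ · x) x 1 := by
  rw [h.fderiv_t_unit hW hWd hx, unitCoeff, if_neg hτ]
  split_ifs with h1
  · have h2 := h.pot.Phi_derivP hWd hx (inR_one x)
    rw [derivP_one, mul_zero, Phi_zero, h1.1, pow_zero, one_mul, mul_one, eq_comm,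
      neg_eq_zero] at h2
    rw [h2]; ring
  · ring

/-- Integration by parts against p^(-1), with p∂_p p^(-1) = -p^(-1), trades λ_p for p^(-1) in the
correction. The resulting expression serves to show that the component is smooth. -/
theorem fderiv_t_unit_of_exceptional (h : FlatPot b κ j t H k c G G₀ G₁) (hW : IsOpen W)
    (hWd : W ⊆ τ.domain) (hτ : τ.Exceptional) {x : τ.V} (hx : x ∈ W) :
    fderiv ℂ t x (unitV x) = Phi (G₀ · x) x 1 -
      ((expand ((0 : ℂ) : OnePoint ℂ) (lam x)).coeff 1)⁻¹ * Phi (G · x) x (ps τ) := by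
  have hs := hτ.1
  have h0 : (RatFunc.X : RatFunc ℂ) ≠ 0 := RatFunc.X_ne_zero
  have h2 := h.pot.Phi_derivP hWd hx (inR_ps x)
  have e1 : RatFunc.X ^ τ.s * derivP (ps τ) = RatFunc.C (-1) * ps τ := by
    have h3 : (RatFunc.C (-1) : RatFunc ℂ) = -1 := by rw [map_neg, map_one]
    rw [ps, hs, pow_one, pow_one, derivP_inv h0, derivP_X, h3]
    field_simp
  have e2 : RatFunc.X ^ τ.s * derivP (lam x) * ps τ = derivP (lam x) := by
    rw [mul_comm, ← mul_assoc, ps_mul_X_pow, one_mul]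
  rw [e1, e2, Phi_C_mul] at h2
  rw [h.fderiv_t_unit hW hWd hx, unitCoeff, if_neg (by omega), if_pos hτ]
  linear_combination -((expand ((0 : ℂ) : OnePoint ℂ) (lam x)).coeff 1)⁻¹ * h2

theorem smooth_t_unit (h : FlatPot b κ j t H k c G G₀ G₁) (hW : IsOpen W) (hWd : W ⊆ τ.domain) :
    ContDiffOn ℂ (⊤ : ℕ∞) (fun x => fderiv ℂ t x (unitV x)) W := by
  by_cases hτ : τ.Exceptional
  · have h1 := (ratFam_lam hW hWd (some none)
      (Finset.some_mem_insertNone.2 (none_mem_marked.2 hτ.1))).smooth 1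
    have h2 := (h.pot.fderiv_Phi hW hWd (ratUnit_ps hW hWd).fam fun x _ => inR_ps x).1
    exact ((h.smooth_Phi_one hW hWd).1.sub
      ((h1.inv fun x hx => lam_coeff_one_ne_zero hτ (hWd hx)).mul h2)).congr
        fun x hx => h.fderiv_t_unit_of_exceptional hW hWd hτ hx
  · exact (h.smooth_Phi_one hW hWd).1.congr
      fun x hx => h.fderiv_t_unit_of_not_exceptional hW hWd hτ hx

end FlatPot

theorem smooth_unitV (b : Branch τ W) (hW : IsOpen W) (hWd : W ⊆ τ.domain) :
    ContDiffOn ℂ (⊤ : ℕ∞) unitV W :=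
  (flatData b hW hWd).smooth_vec fun A => by
    obtain ⟨k, c, G, G₀, G₁, h⟩ := exists_flatPot b hW hWd A
    exact h.smooth_t_unit hW hWd

theorem unitFlat_of_not_exceptional (b : Branch τ W) (hW : IsOpen W) (hWd : W ⊆ τ.domain)
    (hτ : ¬τ.Exceptional) : (frobData τ).UnitFlat W := fun x hx X => by
  refine (flatData b hW hWd).separates x hx _ fun A => ?_
  obtain ⟨k, c, G, G₀, G₁, h⟩ := exists_flatPot b hW hWd A
  refine ((flatData b hW hWd).fderiv_nablaVec (smooth_unitV b hW hWd) hx A X).trans ?_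
  rw [fderiv_congr_on hW (fun y hy => h.fderiv_t_unit_of_not_exceptional hW hWd hτ hy) hx,
    (h.smooth_Phi_one hW hWd).2 x hx]

variable (τ) in
theorem isFrobeniusUpToUnit : (frobData τ).IsFrobeniusUpToUnit τ.domain τ.d := by
  -- All the axioms are local, so they may be checked near each point on a set carrying branches,
  -- although the flat coordinates themselves need not exist globally.
  have hloc {P : τ.V → Prop} (h : ∀ (W : Set τ.V) (_ : Branch τ W), IsOpen W → W ⊆ τ.domain →
      ∀ x ∈ W, P x) : ∀ x ∈ τ.domain, P x := fun x hx => by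
    obtain ⟨W, hW, hxW, hWd, ⟨b⟩⟩ := exists_branch hx
    exact h W b hW hWd x hxW
  have hsm {F : Type} [NormedAddCommGroup F] [NormedSpace ℂ F] {f : τ.V → F}
      (h : ∀ (W : Set τ.V) (_ : Branch τ W), IsOpen W → W ⊆ τ.domain →
        ContDiffOn ℂ (⊤ : ℕ∞) f W) : ContDiffOn ℂ (⊤ : ℕ∞) f τ.domain := fun x hx => by
    obtain ⟨W, hW, hxW, hWd, ⟨b⟩⟩ := exists_branch hx
    exact (smooth_at hW (h W b hW hWd) hxW).contDiffWithinAt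
  exact
    { isOpen := isOpen_domain τ
      smooth_η := hsm fun W b hW hWd => (flatData b hW hWd).smooth_η
      smooth_mul := hsm fun W b hW hWd => (flatData b hW hWd).smooth_mul
      smooth_e := hsm fun W b hW hWd => smooth_unitV b hW hWd
      smooth_E := (contDiff_id.const_smul (1 / (τ.n : ℂ))).contDiffOn
      smooth_Γ := hsm fun W b hW hWd => (flatData b hW hWd).smooth_Γ
      η_symm := fun x _ => metricV_symm x
      η_nondegenerate := fun x hx X h => metricV_nondegenerate hx h
      mul_comm := fun x hx => mulV_comm hx
      mul_assoc := fun x hx => mulV_assoc hx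
      unit_mul := fun x hx => unitV_mul hx
      invariant := fun x hx => metricV_invariant hx
      torsion_free := fun x hx => connV_symm hx
      metric_compatible := hloc fun W b hW hWd x hx => (flatData b hW hWd).metric_compatible hx
      flat := hloc fun W b hW hWd x hx => (flatData b hW hWd).flat hx
      nablaC_symm := hloc fun W b hW hWd x hx => (flatData b hW hWd).nablaC_symm hx
      euler_affine := hloc fun W b hW hWd x hx => (flatData b hW hWd).euler_affine hx
      euler_mul := hloc fun W b hW hWd x hx => (flatData b hW hWd).euler_mul hx
      euler_metric := hloc fun W b hW hWd x hx => (flatData b hW hWd).euler_metric hx }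

theorem exists_mem_domain (hs : τ.s = 1) : ∃ x, x ∈ τ.domain := by
  -- The zeros are put at positive integers and the poles at negative ones; for s = 1 there is no
  -- linear relation to satisfy.
  refine ⟨⟨(fun i => (i : ℕ) + 1, fun j => -((j : ℕ) + 1)), fun h => by omega⟩,
    fun i j h => ?_, fun i j h => ?_, fun i j h => ?_, fun _ => ⟨fun i h => ?_, fun j h => ?_⟩⟩
  · have h : ((i : ℕ) : ℂ) + 1 = (j : ℕ) + 1 := h
    exact Fin.ext (by exact_mod_cast add_right_cancel h)
  · have h : -(((i : ℕ) : ℂ) + 1) = -((j : ℕ) + 1) := h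
    exact Fin.ext (by exact_mod_cast add_right_cancel (neg_injective h))
  · have h : ((i : ℕ) : ℂ) + 1 = -((j : ℕ) + 1) := h
    have h' : (((i : ℕ) + 1 + ((j : ℕ) + 1) : ℕ) : ℂ) = 0 := by push_cast; rw [h]; ring
    exact absurd (Nat.cast_eq_zero.1 h') (by omega)
  · have h : ((i : ℕ) : ℂ) + 1 = 0 := h
    exact Nat.cast_add_one_ne_zero _ h
  · have h : -(((j : ℕ) : ℂ) + 1) = 0 := h
    exact Nat.cast_add_one_ne_zero _ (neg_eq_zero.1 h)

/-- Here s = 1, so the coordinate with exponent j has degree 1 - j/m, and a flat unit has no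
component with j ≥ 1. That bounds the pole of e, and hence of uλ_p, at each place. The bound
contradicts the exact order of λ_p at any place whose pole order m exceeds the cut-off: a v_k, or ∞
if n > 1. -/
theorem not_unitFlat (hτ : τ.Exceptional) (hN : 1 ≤ τ.N) : ¬(frobData τ).UnitFlat τ.domain := by
  intro hf
  have hs := hτ.1
  obtain ⟨x, hx⟩ := exists_mem_domain hs
  obtain ⟨W, hW, hxW, hWd, ⟨b⟩⟩ := exists_branch hx
  have hcov (κ) (j) (hj : IsExp τ κ j) (hj1 : 1 ≤ j) : b.cov κ j x (unitV x) = 0 := by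
    obtain ⟨A, rfl, rfl⟩ := exists_idx hj
    have h1 := (flatData b hW hWd).unit_component (smooth_unitV b hW hWd)
      (fun y hy => unitV_mul (hWd hy)) hxW (hf x hx) A
    rw [← fderiv_flatCoord b hW hWd A hxW]
    refine (mul_eq_zero.1 h1).resolve_left ?_
    have h2 : (τ.ordOf (idxPlace A) : ℂ) ≠ 0 := by exact_mod_cast ordOf_ne_zero hj.mem
    have h3 : (idxExp A : ℂ) ≠ 0 := by exact_mod_cast (by omega : idxExp A ≠ 0)
    rw [degree, hs, Nat.cast_one, sub_self, zero_div, add_zero, sub_sub_cancel_left]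
    exact neg_ne_zero.2 (div_ne_zero h3 h2)
  set u := unitCoeff x with hu
  have hu0 : u ≠ 0 := by
    rw [hu, unitCoeff, if_neg (by omega), if_pos hτ]
    exact inv_ne_zero (lam_coeff_one_ne_zero hτ hx)
  have key (κ) (hκ : κ ∈ τ.places) (hc : cutL κ ≤ 1) (hm : cutL κ < τ.ordOf κ) : False := by
    have h1 := lOrd_of_cov b hWd hxW hκ hc fun j hj hj1 => hcov κ j hj hj1
    have h2 := (lOrd_X_pow (τ := τ) (place x κ)).mul h1
    rw [← expand_mul, ← tangent_eq_xt, tangent_unitV hx, unitFun_eq, cut_place] at h2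
    have h3 : LOrd (cutL κ - 1) (expand (place x κ) 1) := by
      rw [expand_one]; exact lOrd_one.mono (by omega)
    have h4 := h3.sub (h2.mono (by omega))
    rw [← expand_sub, sub_sub_cancel] at h4
    have h5 := lOrd_C_mul u⁻¹ h4
    rw [← mul_assoc, ← map_mul, inv_mul_cancel₀ hu0, map_one, one_mul] at h5
    have h6 := lExact_derivP_lam hx (place_mem_gam x hκ)
    rw [lb_place hx hκ, cut_place] at h6
    exact h6.coeff_ne_zero (h5.coeff (by omega))
  -- Without poles v_j the dimension is L, and n = L + 1 ≥ 2, so ∞ serves; otherwise the first v_j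
  -- does. This is where positive dimension is needed.
  rcases Nat.eq_zero_or_pos τ.K with hK | hK
  · refine key none Finset.none_mem_insertNone le_rfl ?_
    change 1 < τ.n
    have : IsEmpty (Fin τ.K) := by rw [hK]; infer_instance
    rw [N, hs, hK] at hN
    rw [n, hτ.2, Finset.univ_eq_empty, Finset.sum_empty]
    push_cast at hN
    omega
  · refine key (some (some ⟨0, hK⟩)) (Finset.some_mem_insertNone.2 (some_mem_marked _))
      zero_le_one ?_
    change (0 : ℤ) < τ.m ⟨0, hK⟩
    exact_mod_cast τ.m_pos ⟨0, hK⟩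

end MeroType

end MeroFrob

end

theorem mainTheorem5 (τ : MeroFrob.MeroType) :
    ∃ D : MeroFrob.FrobeniusData τ.V,
      (∀ x ∈ τ.domain, ∀ ν ∈ MeroFrob.MeroType.markedSet x,
        MeroFrob.MeroType.IsInducedAt D x ν) ∧
      (∀ x ∈ τ.domain,
        MeroFrob.MeroType.tangent x (D.e x) = MeroFrob.MeroType.unitFun x ∧
        MeroFrob.MeroType.tangent x (D.E x) = MeroFrob.MeroType.eulerFun x) ∧
      (¬ τ.Exceptional → D.IsFrobenius τ.domain τ.d) ∧
      (τ.Exceptional → D.IsFrobeniusUpToUnit τ.domain τ.d ∧ (1 ≤ τ.N → ¬ D.UnitFlat τ.domain)) ∧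
      (∀ x ∈ τ.domain, ∃ W : Set τ.V, IsOpen W ∧ x ∈ W ∧ W ⊆ τ.domain ∧
        Nonempty (MeroFrob.MeroType.Branch τ W)) ∧
      ∀ W : Set τ.V, IsOpen W → W ⊆ τ.domain → ∀ b : MeroFrob.MeroType.Branch τ W,
        D.IsFlatCoordinates W (MeroFrob.MeroType.flatCoord b) ∧
        D.IsPrepotential W (MeroFrob.MeroType.flatCoord b)
          (MeroFrob.MeroType.prepotential b D.E) := by
  refine ⟨MeroFrob.MeroType.frobData τ,
    fun x hx ν hν => MeroFrob.MeroType.isInducedAt hx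
      (MeroFrob.MeroType.mem_gam_iff_markedSet.2 hν) rfl rfl,
    fun x hx => ⟨MeroFrob.MeroType.tangent_unitV hx, MeroFrob.MeroType.tangent_euler x⟩,
    fun hτ => ⟨MeroFrob.MeroType.isFrobeniusUpToUnit τ, fun x hx X => ?_⟩,
    fun hτ => ⟨MeroFrob.MeroType.isFrobeniusUpToUnit τ, MeroFrob.MeroType.not_unitFlat hτ⟩,
    fun x hx => MeroFrob.MeroType.exists_branch hx,
    fun W hW hWd b => ⟨(MeroFrob.MeroType.flatData b hW hWd).isFlatCoordinates,
      MeroFrob.MeroType.isPrepotential b hW hWd⟩⟩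
  obtain ⟨W, hW, hxW, hWd, ⟨b⟩⟩ := MeroFrob.MeroType.exists_branch hx
  exact MeroFrob.MeroType.unitFlat_of_not_exceptional b hW hWd hτ x hxW X
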